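/- Let $G=(V,E)$ be a directed acyclic graph with $n=|V|$ vertices and $m=|E|$ edges, and let $d\ge 1$ be an integer. A $d$-dimensional weak dominance drawing $\Gamma$ of $G$ consists of $d$ topological orders of $G$; the coordinate $D(v)$ of a vertex $v$ in dimension $D$ is its position in the corresponding order, so that $D(u)<D(v)$ for every dimension $D$ whenever $G$ has a directed path from $u$ to $v$. A falsely implied path (fip) of $\Gamma$ is a pair $(u,v)$ of vertices such that $D(u)<D(v)$ for every dimension $D$, but $G$ has neither a path from $u$ to $v$ nor a path from $v$ to $u$. A path-based module of $G$ is a nonempty set $M\subseteq V$ such that, for all $v_1,v_2\in M$ and $u\in V\setminus M$, there is a path from $v_1$ to $u$ if and only if there is one from $v_2$ to $u$, and there is a path from $u$ to $v_1$ if and only if there is one from $u$ to $v_2$. The nodes of the path-based modular decomposition tree of $G$ are the strong modules, i.e. the path-based modules $M$ such that every path-based module $N$ satisfies $M\subseteq N$, $N\subseteq M$ or $M\cap N=\emptyset$; the children of a node are the maximal strong modules properly contained in it. Let $k$ be the maximum number of children of a node of this tree. Theorem. There is an algorithm that, given $d$ and $G$ (as a list of its edges), computes a $d$-dimensional weak dominance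 drawing of $G$ with the minimum number of fips among all $d$-dimensional weak dominance drawings of $G$. For $n\ge 2$ it takes $$O\bigl(nm+n\,d\,k^2\,(k!)^d\bigr)$$ time on a unit-cost random-access machine (with addition, truncated subtraction, multiplication and comparison with $0$) whose words have $O(\log(n+d))$ bits. The algorithm and the constants hidden in the $O$-notation do not depend on $d$ or $G$. -/

import Mathlib

/-!
A machine model with a step count, path-based modules of a directed graph and their modular
decomposition tree, weak dominance drawings and falsely implied paths.
-/

namespace WeakDominance

/-! ### The machine model

Structured programs over a random-access memory with unit-cost operations on words.  The memory
consists of arrays numbered `0, 1, 2, …`, each indexed by the natural numbers; a fixed program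
mentions only finitely many arrays (a scalar variable is an array of which only one cell is used).
-/

/-- The content of the memory: `σ a i` is the content of cell `i` of array `a`. -/
abbrev Store : Type := ℕ → ℕ → ℕ

/-- Arithmetic expressions: constants, random access to a cell of an array, sum,
truncated difference and product. -/
inductive Expr : Type
  | const (c : ℕ) : Expr
  | cell (a : ℕ) (i : Expr) : Expr
  | add (e f : Expr) : Expr
  | sub (e f : Expr) : Expr
  | mul (e f : Expr) : Expr

/-- The value of an expression. -/
def Expr.eval (σ : Store) : Expr → ℕ
  | .const c => c
  | .cell a i => σ a (i.eval σ)
  | .add e f => e.eval σ + f.eval σ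
  | .sub e f => e.eval σ - f.eval σ
  | .mul e f => e.eval σ * f.eval σ

/-- The number of elementary operations needed to evaluate an expression. -/
def Expr.cost : Expr → ℕ
  | .const _ => 1
  | .cell _ i => i.cost + 1
  | .add e f => e.cost + f.cost + 1
  | .sub e f => e.cost + f.cost + 1
  | .mul e f => e.cost + f.cost + 1

/-- Programs.  A test succeeds when its expression is nonzero. -/
inductive Prog : Type
  | skip : Prog
  | assign (a : ℕ) (i e : Expr) : Prog
  | seq (p q : Prog) : Prog
  | cond (e : Expr) (p q : Prog) : Prog
  | loop (e : Expr) (p : Prog) : Prog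

/-- Store the value `x` in cell `i` of array `a`. -/
def Store.write (σ : Store) (a i x : ℕ) : Store :=
  Function.update σ a (Function.update (σ a) i x)

/-- `Exec W p σ τ t`: on a machine whose words hold the numbers `0, …, W`, the program `p`,
started with memory content `σ`, halts with memory content `τ` after exactly `t` elementary steps.
Every number that is stored and every index that is written to has to fit into a word. -/
inductive Exec (W : ℕ) : Prog → Store → Store → ℕ → Prop
  | skip (σ : Store) : Exec W .skip σ σ 1
  | assign (a : ℕ) (i e : Expr) (σ : Store) (hi : i.eval σ ≤ W) (he : e.eval σ ≤ W) :
      Exec W (.assign a i e) σ (σ.write a (i.eval σ) (e.eval σ)) (i.cost + e.cost + 1)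
  | seq {p q : Prog} {σ τ υ : Store} {s t : ℕ} (hp : Exec W p σ τ s) (hq : Exec W q τ υ t) :
      Exec W (.seq p q) σ υ (s + t)
  | cond_true {e : Expr} {p q : Prog} {σ τ : Store} {t : ℕ} (he : e.eval σ ≠ 0)
      (hp : Exec W p σ τ t) : Exec W (.cond e p q) σ τ (e.cost + 1 + t)
  | cond_false {e : Expr} {p q : Prog} {σ τ : Store} {t : ℕ} (he : e.eval σ = 0)
      (hq : Exec W q σ τ t) : Exec W (.cond e p q) σ τ (e.cost + 1 + t)
  | loop_true {e : Expr} {p : Prog} {σ τ υ : Store} {s t : ℕ} (he : e.eval σ ≠ 0)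
      (hp : Exec W p σ τ s) (hl : Exec W (.loop e p) τ υ t) :
      Exec W (.loop e p) σ υ (e.cost + 1 + s + t)
  | loop_false {e : Expr} {p : Prog} {σ : Store} (he : e.eval σ = 0) :
      Exec W (.loop e p) σ σ (e.cost + 1)

/-- The initial memory content: array `0` holds the number `n` of vertices, the number of edges and
the number `d` of dimensions; arrays `1` and `2` hold the tails and the heads of the listed edges;
all other cells are `0`. -/
def inputStore (n d : ℕ) (es : List (Fin n × Fin n)) : Store := fun a i =>
  if a = 0 then (if i = 0 then n else if i = 1 then es.length else if i = 2 then d else 0)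
  else if a = 1 then (es[i]?.map fun e => (e.1 : ℕ)).getD 0
  else if a = 2 then (es[i]?.map fun e => (e.2 : ℕ)).getD 0
  else 0

/-! ### Directed acyclic graphs and path-based modules -/

/-- There is a (nonempty) directed path from `u` to `v`. -/
def HasPath {V : Type*} (G : Digraph V) (u v : V) : Prop :=
  Relation.TransGen G.Adj u v

/-- `G` has no directed cycle. -/
def IsDAG {V : Type*} (G : Digraph V) : Prop :=
  ∀ v, ¬ HasPath G v v

/-- A path-based module: a nonempty set of vertices whose members reach, and are reached from,
the same vertices outside the set. -/
def IsModule {V : Type*} (G : Digraph V) (M : Finset V) : Prop :=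
  M.Nonempty ∧ ∀ v₁ ∈ M, ∀ v₂ ∈ M, ∀ u ∉ M,
    (HasPath G v₁ u ↔ HasPath G v₂ u) ∧ (HasPath G u v₁ ↔ HasPath G u v₂)

/-- A strong module: a module that overlaps no other module.  The strong modules are the nodes of
the modular decomposition tree. -/
def IsStrongModule {V : Type*} (G : Digraph V) (M : Finset V) : Prop :=
  IsModule G M ∧ ∀ N, IsModule G N → M ⊆ N ∨ N ⊆ M ∨ Disjoint M N

/-- `N` is a child of `M` in the modular decomposition tree: a maximal strong module among those
strictly contained in `M`. -/
def IsChild {V : Type*} (G : Digraph V) (M N : Finset V) : Prop :=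
  IsStrongModule G N ∧ N ⊂ M ∧ ∀ L, IsStrongModule G L → N ⊂ L → ¬ L ⊂ M

open Classical in
/-- The maximum number of children of a node of the path-based modular decomposition tree. -/
noncomputable def treeDegree {V : Type*} [Fintype V] (G : Digraph V) : ℕ :=
  (Finset.univ.filter (IsStrongModule G)).sup fun M =>
    (Finset.univ.filter (IsChild G M)).card

/-! ### Weak dominance drawings -/

/-- A `d`-dimensional weak dominance drawing of a directed graph on `n` vertices: each of the `d`
dimensions is a topological order, giving the vertices the coordinates `0, …, n - 1`. -/
def IsWeakDominanceDrawing {d n : ℕ} (G : Digraph (Fin n)) (Γ : Fin d → Equiv.Perm (Fin n)) :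
    Prop :=
  ∀ u v, HasPath G u v → ∀ D, Γ D u < Γ D v

/-- The falsely implied paths of a drawing: pairs of incomparable vertices, the first of which has
the smaller coordinate in every dimension. -/
def fips {d n : ℕ} (G : Digraph (Fin n)) (Γ : Fin d → Equiv.Perm (Fin n)) :
    Set (Fin n × Fin n) :=
  {p | (∀ D, Γ D p.1 < Γ D p.2) ∧ ¬ HasPath G p.1 p.2 ∧ ¬ HasPath G p.2 p.1}

/-- A weak dominance drawing with the minimum number of falsely implied paths among all weak
dominance drawings of the same graph in the same number of dimensions. -/
def IsMinFipDrawing {d n : ℕ} (G : Digraph (Fin n)) (Γ : Fin d → Equiv.Perm (Fin n)) : Prop :=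
  IsWeakDominanceDrawing G Γ ∧
    ∀ Δ : Fin d → Equiv.Perm (Fin n), IsWeakDominanceDrawing G Δ →
      (fips G Γ).ncard ≤ (fips G Δ).ncard

end WeakDominance

open WeakDominance

namespace WeakDominance

/-! ### Notation for expressions and programs -/

/-! Suppose a module is partitioned into modules, the parts. Whether two vertices of different parts
are joined by a path depends only on their parts, so the fips of a drawing split into those inside a
part and those across two parts. Inside, every part costs at least its own optimum. Across, choose
one representative of each part independently and uniformly: if the pair (i, j) is weighted by the
product of the two sizes, the expected weighted number of fips among the representatives is exactly
the number of cross fips. Hence some choice is no worse than the average (`exists_representatives`),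
and the relative order of the chosen vertices is a drawing of the quotient (`exists_rank_le`).
Conversely, take an optimal weighted drawing of the quotient and give each part an interval of
consecutive coordinates in every dimension, filled by an optimal drawing of that part; both lower
bounds are then attained (`good_union`). A quotient with t parts is solved by trying all (t!)^d
tuples of permutations (`searchProg_ok`).

The hierarchy of partitions that is used need not be the modular decomposition tree. It suffices
that each partition has at most k parts and that there are O(n) of them. The first condition is
guaranteed by `card_le_treeDegree`: it holds as soon as every strong module inside the partitioned
module is either that whole module or contained in a part.

Such a hierarchy is found by partition refinement. A class is a module S with a distinguished
minimal vertex v; its children are {v} and the maximal modules inside S that avoid v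
(`PivotStep.inv`, `ClassStep.inv`). The unions of children that contain v and are modules correspond
to sets of children closed under forcing: if z belongs to the set and y distinguishes z from v, then
y belongs to it. A chain of closed sets is built from {0} up to the set of all children, each
generated from its predecessor A by one additional child x. This x is chosen such that every closed
set that properly contains A and lies in the closure of A and x contains x, and therefore is that
closure (`Pick`). Either some x can be added to A alone, or a minimal x above v will do; the reason
is `Kids.exists_twin`. Consequently a strong module inside the union of one closed set of the chain
is that union, or lies in the union of the preceding one, or lies in a single child
(`ChainInv.chain`). So the preceding union and the newly added children form a partition of the
required kind.

The hierarchy is traversed from the top, passing down only the first coordinate of each part in each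
dimension; optimality (`Good`) is then inferred from the single vertices upwards.

For the time: topological order and transitive closure take O(nm + n²), classes and chains O(n²),
and there are O(n) quotients, each costing O(d k² (k!)^d). The terms n² are absorbed because a graph
with m edges has at least n - m weakly connected components while k is at least their number, so
that n ≤ m + k (`card_le_length_add_treeDegree`) and n² ≤ nm + nk.

The programs are verified in a Hoare logic for total correctness with a step bound (`Ok`). Unchanged
arrays are tracked through the syntactic list of arrays a program writes to. -/

instance : Add Expr := ⟨.add⟩
instance : Sub Expr := ⟨.sub⟩
instance : Mul Expr := ⟨.mul⟩
instance (k : ℕ) : OfNat Expr k := ⟨.const k⟩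

@[simp] theorem Expr.eval_add (σ : Store) (e f : Expr) : (e + f).eval σ = e.eval σ + f.eval σ := rfl
@[simp] theorem Expr.eval_sub (σ : Store) (e f : Expr) : (e - f).eval σ = e.eval σ - f.eval σ := rfl
@[simp] theorem Expr.eval_mul (σ : Store) (e f : Expr) : (e * f).eval σ = e.eval σ * f.eval σ := rfl
@[simp] theorem Expr.eval_ofNat (σ : Store) (k : ℕ) :
    (no_index (OfNat.ofNat k : Expr)).eval σ = k := rfl
@[simp] theorem Expr.eval_cell (σ : Store) (a : ℕ) (i : Expr) :
    (Expr.cell a i).eval σ = σ a (i.eval σ) := rfl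

/-- The scalar variable kept in cell `0` of array `a`. -/
abbrev sv (a : ℕ) : Expr := .cell a 0

/-- An expression which is `1` if the values agree and `0` otherwise. -/
abbrev eqE (e f : Expr) : Expr := 1 - ((e - f) + (f - e))

theorem eqE_eval (σ : Store) (e f : Expr) :
    (eqE e f).eval σ = if e.eval σ = f.eval σ then 1 else 0 := by
  simp only [Expr.eval_sub, Expr.eval_add, Expr.eval_ofNat]
  split_ifs <;> omega

/-- Assignment to a scalar variable. -/
abbrev setv (a : ℕ) (e : Expr) : Prog := .assign a 0 e

infixr:60 " ;; " => Prog.seq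

/-- `for i := lo; i < hi; i++ { body }`. -/
def forLoop (i : ℕ) (lo hi : Expr) (body : Prog) : Prog :=
  setv i lo ;; .loop (hi - sv i) (body ;; setv i (sv i + 1))

@[simp] theorem Store.write_same (σ : Store) (a i x : ℕ) :
    σ.write a i x a = Function.update (σ a) i x := by
  simp [Store.write]

@[simp] theorem Store.write_ne (σ : Store) {a b : ℕ} (i x : ℕ) (h : b ≠ a) :
    σ.write a i x b = σ b := by
  simp [Store.write, h]

/-! ### Frames -/

/-- The arrays to which a program writes. -/
def Prog.writes : Prog → List ℕ
  | .skip => []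
  | .assign a _ _ => [a]
  | .seq p q => p.writes ++ q.writes
  | .cond _ p q => p.writes ++ q.writes
  | .loop _ p => p.writes

/-- The bound on what may change is syntactic and computable, so non-interference goals for concrete
programs can be closed by `decide`. -/
theorem Exec.frame {W : ℕ} {p : Prog} {σ τ : Store} {t : ℕ} (h : Exec W p σ τ t) :
    ∀ a ∉ p.writes, τ a = σ a := by
  induction h with
  | skip => simp
  | assign a i e σ hi he =>
    intro b hb
    simp only [Prog.writes, List.mem_singleton] at hb
    simp [hb]
  | seq _ _ ih1 ih2 =>
    intro b hb
    simp only [Prog.writes, List.mem_append, not_or] at hb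
    rw [ih2 b hb.2, ih1 b hb.1]
  | cond_true _ _ ih =>
    intro b hb
    simp only [Prog.writes, List.mem_append, not_or] at hb
    exact ih b hb.1
  | cond_false _ _ ih =>
    intro b hb
    simp only [Prog.writes, List.mem_append, not_or] at hb
    exact ih b hb.2
  | loop_true _ _ _ ih1 ih2 =>
    intro b hb
    rw [ih2 b hb, ih1 b hb]
  | loop_false => simp

/-- The store `τ` agrees with `σ` on the arrays to which `p` does not write. -/
def Same (p : Prog) (σ τ : Store) : Prop := ∀ a ∉ p.writes, τ a = σ a

/-! ### Total correctness with a time bound -/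

/-- `p` started in `σ` halts within `T` steps in a state satisfying `Q`. -/
def Ok (W : ℕ) (p : Prog) (σ : Store) (T : ℕ) (Q : Store → Prop) : Prop :=
  ∃ τ t, Exec W p σ τ t ∧ t ≤ T ∧ Q τ

section
variable {W : ℕ} {p q : Prog} {σ : Store} {T T' : ℕ} {Q Q' : Store → Prop}

theorem Ok.frame (h : Ok W p σ T Q) : Ok W p σ T fun τ => Q τ ∧ Same p σ τ := by
  obtain ⟨τ, t, h1, h2, h3⟩ := h
  exact ⟨τ, t, h1, h2, h3, h1.frame⟩

theorem Ok.mono (h : Ok W p σ T Q) (hT : T ≤ T') (hQ : ∀ τ, Same p σ τ → Q τ → Q' τ) :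
    Ok W p σ T' Q' := by
  obtain ⟨τ, t, h1, h2, h3⟩ := h
  exact ⟨τ, t, h1, h2.trans hT, hQ τ h1.frame h3⟩

theorem Ok.time (h : Ok W p σ T Q) (hT : T ≤ T') : Ok W p σ T' Q :=
  h.mono hT fun _ _ h => h

theorem Ok.seq (h : Ok W p σ T Q) (h' : ∀ τ, Same p σ τ → Q τ → Ok W q τ T' Q') :
    Ok W (p ;; q) σ (T + T') Q' := by
  obtain ⟨τ, t, h1, h2, h3⟩ := h
  obtain ⟨υ, s, k1, k2, k3⟩ := h' τ h1.frame h3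
  exact ⟨υ, t + s, .seq h1 k1, by omega, k3⟩

theorem Ok.assign {a : ℕ} {i e : Expr} (hi : i.eval σ ≤ W) (he : e.eval σ ≤ W)
    (hQ : Q (σ.write a (i.eval σ) (e.eval σ))) :
    Ok W (.assign a i e) σ (i.cost + e.cost + 1) Q :=
  ⟨_, _, .assign a i e σ hi he, le_rfl, hQ⟩

theorem Ok.cond {e : Expr} (h1 : e.eval σ ≠ 0 → Ok W p σ T Q)
    (h2 : e.eval σ = 0 → Ok W q σ T Q) (hT : e.cost + 1 + T ≤ T') :
    Ok W (.cond e p q) σ T' Q := by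
  refine Ok.time ?_ hT
  by_cases he : e.eval σ = 0
  · obtain ⟨τ, t, k1, k2, k3⟩ := h2 he
    exact ⟨τ, _, .cond_false he k1, by omega, k3⟩
  · obtain ⟨τ, t, k1, k2, k3⟩ := h1 he
    exact ⟨τ, _, .cond_true he k1, by omega, k3⟩

/-- A loop whose iterations are paid for by a potential. -/
theorem Ok.loop {e : Expr} (Inv : Store → Prop) (Φ : Store → ℕ)
    (h : ∀ τ, Same (.loop e p) σ τ → Inv τ → e.eval τ ≠ 0 →
      ∃ s, Ok W p τ s fun υ => Inv υ ∧ Φ υ + s + e.cost + 1 ≤ Φ τ)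
    (h0 : Inv σ) (hT : Φ σ + e.cost + 1 ≤ T)
    (hQ : ∀ τ, Same (.loop e p) σ τ → Inv τ → e.eval τ = 0 → Q τ) :
    Ok W (.loop e p) σ T Q := by
  -- Induction on a bound for the potential. Every round lowers it by at least the cost of the test
  -- and the body, which gives termination and the time bound together; the summand `e.cost + 1`
  -- outside pays for the last, failing test.
  have key : ∀ N, ∀ τ, Φ τ ≤ N → Same (.loop e p) σ τ → Inv τ →
      Ok W (.loop e p) τ (Φ τ + e.cost + 1) Q := by
    intro N
    induction N with
    | zero =>
      intro τ hN hs hi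
      by_cases he : e.eval τ = 0
      · exact ⟨τ, _, .loop_false he, by omega, hQ τ hs hi he⟩
      · obtain ⟨s, υ, t, k1, k2, k3, k4⟩ := h τ hs hi he
        omega
    | succ N ih =>
      intro τ hN hs hi
      by_cases he : e.eval τ = 0
      · exact ⟨τ, _, .loop_false he, by omega, hQ τ hs hi he⟩
      · obtain ⟨s, υ, t, k1, k2, k3, k4⟩ := h τ hs hi he
        have hs' : Same (.loop e p) σ υ := fun a ha => by
          rw [k1.frame a ha, hs a ha]
        obtain ⟨ω, r, m1, m2, m3⟩ := ih υ (by omega) hs' k3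
        exact ⟨ω, _, .loop_true he k1 m1, by omega, m3⟩
  exact (key _ σ le_rfl (fun _ _ => rfl) h0).time hT

/-- A `for` loop; the iteration with index `k` takes at most `c k` steps. -/
theorem Ok.for {i : ℕ} {lo hi : Expr} {body : Prog} (L N : ℕ) (c : ℕ → ℕ)
    (Inv : ℕ → Store → Prop)
    (hlo : lo.eval σ = L) (hLN : L ≤ N) (hNW : N ≤ W)
    (hi_body : i ∉ body.writes)
    (hhi : ∀ τ, Same (forLoop i lo hi body) σ τ → hi.eval τ = N)
    (h0 : Inv L (σ.write i 0 L))
    (h : ∀ k τ, L ≤ k → k < N → τ i 0 = k → Same (forLoop i lo hi body) σ τ → Inv k τ →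
      Ok W body τ (c k) fun υ => Inv (k + 1) (υ.write i 0 (k + 1)))
    (hT : ∑ k ∈ Finset.Ico L N, (c k + hi.cost + 11) + (lo.cost + hi.cost + 6) ≤ T)
    (hQ : ∀ τ, Same (forLoop i lo hi body) σ τ → τ i 0 = N → Inv N τ → Q τ) :
    Ok W (forLoop i lo hi body) σ T Q := by
  have hs0 : Same (forLoop i lo hi body) σ (σ.write i 0 L) := by
    intro a ha
    simp only [forLoop, setv, Prog.writes, List.mem_append, List.mem_singleton, not_or] at ha
    simp [ha.1]
  -- A round pays `hi.cost + 4` for the test and 6 steps, rounded up to 7, for the increment; hence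
  -- the 11 in the time bound.
  have hcost : (hi - sv i : Expr).cost = hi.cost + 3 := rfl
  have h1 : Ok W (.loop (hi - sv i) (body ;; setv i (sv i + 1))) (σ.write i 0 L)
      (∑ k ∈ Finset.Ico L N, (c k + hi.cost + 11) + (hi.cost + 3) + 1) Q := by
    refine Ok.loop
      (fun τ => ∃ k, L ≤ k ∧ k ≤ N ∧ τ i 0 = k ∧ Inv k τ)
      (fun τ => ∑ k ∈ Finset.Ico (τ i 0) N, (c k + hi.cost + 11)) ?_ ?_ ?_ ?_
    · rintro τ hs ⟨k, hk1, hk2, hk3, hk4⟩ he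
      have hs' : Same (forLoop i lo hi body) σ τ := by
        intro a ha
        rw [hs a, hs0 a ha]
        intro h'
        apply ha
        simp only [forLoop, Prog.writes, List.mem_append] at h' ⊢
        tauto
      have hkN : k < N := by
        simp only [Expr.eval_sub, Expr.eval_cell, Expr.eval_ofNat, hhi τ hs', hk3] at he
        omega
      refine ⟨c k + 7, ?_⟩
      refine Ok.time (T := c k + 7) (Ok.seq (T' := 7) (h k τ hk1 hkN hk3 hs' hk4).frame ?_) le_rfl
      rintro υ hυ ⟨hυ1, hυ2⟩
      have hi' : υ i 0 = k := by rw [hυ2 i hi_body, hk3]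
      have : (sv i + 1 : Expr).eval υ = k + 1 := by simp [hi']
      refine (Ok.assign (by simp) (by rw [this]; omega) ?_).time
        (show 6 ≤ 7 by omega)
      rw [this]
      simp only [Expr.eval_ofNat]
      refine ⟨⟨k + 1, by omega, by omega, by simp, hυ1⟩, ?_⟩
      rw [Finset.sum_eq_sum_Ico_succ_bot (show τ i 0 < N by omega)]
      simp only [Store.write_same, Function.update_self, hk3, hcost]
      omega
    · exact ⟨L, le_rfl, hLN, by simp, h0⟩
    · simp [hcost]
    · rintro τ hs ⟨k, hk1, hk2, hk3, hk4⟩ he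
      have hs' : Same (forLoop i lo hi body) σ τ := by
        intro a ha
        rw [hs a, hs0 a ha]
        intro h'
        apply ha
        simp only [forLoop, Prog.writes, List.mem_append] at h' ⊢
        tauto
      have hkN : k = N := by
        simp only [Expr.eval_sub, Expr.eval_cell, Expr.eval_ofNat, hhi τ hs', hk3] at he
        omega
      subst hkN
      exact hQ τ hs' hk3 hk4
  have h2 : Ok W (setv i lo) σ (1 + lo.cost + 1) fun τ => τ = σ.write i 0 L := by
    have := @Ok.assign W σ (fun τ => τ = σ.write i 0 L) i 0 lo (by simp) (by omega) (by simp [hlo])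
    exact this
  refine (Ok.seq h2 (T' := _) (Q' := Q) fun τ _ hτ => by rw [hτ]; exact h1).time ?_
  omega

/-- A `for` loop whose iterations take at most `c` steps each. -/
theorem Ok.for_const {i : ℕ} {lo hi : Expr} {body : Prog} (L N : ℕ) (c : ℕ)
    (Inv : ℕ → Store → Prop)
    (hlo : lo.eval σ = L) (hLN : L ≤ N) (hNW : N ≤ W)
    (hi_body : i ∉ body.writes)
    (hhi : ∀ τ, Same (forLoop i lo hi body) σ τ → hi.eval τ = N)
    (h0 : Inv L (σ.write i 0 L))
    (h : ∀ k τ, L ≤ k → k < N → τ i 0 = k → Same (forLoop i lo hi body) σ τ → Inv k τ →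
      Ok W body τ c fun υ => Inv (k + 1) (υ.write i 0 (k + 1)))
    (hT : (N - L) * (c + hi.cost + 11) + (lo.cost + hi.cost + 6) ≤ T)
    (hQ : ∀ τ, Same (forLoop i lo hi body) σ τ → τ i 0 = N → Inv N τ → Q τ) :
    Ok W (forLoop i lo hi body) σ T Q :=
  Ok.for L N (fun _ => c) Inv hlo hLN hNW hi_body hhi h0 h (by simpa using hT) hQ

end

/-! ### Weakest preconditions of loop-free programs -/

/-- The weakest precondition of a loop-free program. -/
def Prog.wp (W : ℕ) : Prog → (Store → Prop) → Store → Prop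
  | .skip, Q, σ => Q σ
  | .assign a i e, Q, σ => i.eval σ ≤ W ∧ e.eval σ ≤ W ∧ Q (σ.write a (i.eval σ) (e.eval σ))
  | .seq p q, Q, σ => p.wp W (q.wp W Q) σ
  | .cond e p q, Q, σ => (e.eval σ ≠ 0 → p.wp W Q σ) ∧ (e.eval σ = 0 → q.wp W Q σ)
  | .loop _ _, _, _ => False

/-- An upper bound for the number of steps of a loop-free program. -/
def Prog.steps : Prog → ℕ
  | .skip => 1
  | .assign _ i e => i.cost + e.cost + 1
  | .seq p q => p.steps + q.steps
  | .cond e p q => e.cost + 1 + (p.steps + q.steps)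
  | .loop _ _ => 0

/-- Code without loops thus reduces to one simplification and one computation of a numeral. The
value 0 of `steps` at loops does no harm because the precondition there is `False`. -/
theorem Ok.of_wp {W : ℕ} {p : Prog} {σ : Store} {Q : Store → Prop} {T : ℕ}
    (h : p.wp W Q σ) (hT : p.steps ≤ T) : Ok W p σ T Q := by
  refine Ok.time (T := p.steps) ?_ hT
  clear hT
  induction p generalizing σ Q with
  | skip => exact ⟨σ, 1, .skip σ, le_rfl, h⟩
  | assign a i e => exact Ok.assign h.1 h.2.1 h.2.2
  | seq p q ihp ihq => exact Ok.seq (ihp h) fun τ _ hτ => ihq hτ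
  | cond e p q ihp ihq =>
    refine Ok.cond (fun he => ?_) (fun he => ?_) le_rfl
    · exact (ihp (h.1 he)).time (by omega)
    · exact (ihq (h.2 he)).time (by omega)
  | loop => exact h.elim

/-! ### Topological sorting and the transitive closure -/

notation "vN" => Expr.cell 0 0
notation "vM" => Expr.cell 0 1
notation "vD" => Expr.cell 0 2
notation "aDone" => (4 : ℕ)
notation "aFlag" => (5 : ℕ)
notation "aPerm" => (6 : ℕ)
notation "aMtx" => (7 : ℕ)
notation "xS" => (10 : ℕ)
notation "xI" => (11 : ℕ)
notation "xJ" => (12 : ℕ)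
notation "xX" => (13 : ℕ)

/-- Lists the vertices in a topological order. -/
def topoProg : Prog :=
  forLoop xS 0 vN
    (forLoop xI 0 vN (.assign aFlag (sv xI) (.cell aDone (sv xI))) ;;
     forLoop xI 0 vM
      (.cond (.cell aDone (.cell 2 (sv xI))) .skip (.assign aFlag (.cell 1 (sv xI)) 1)) ;;
     forLoop xI 0 vN (.cond (.cell aFlag (sv xI)) .skip (setv xX (sv xI))) ;;
     .assign aDone (sv xX) 1 ;;
     .assign aPerm (vN - 1 - sv xS) (sv xX))

/-- Computes the matrix of the transitive closure from a topological order. -/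
def closureProg : Prog :=
  forLoop xS 0 vN
    (setv xX (.cell aPerm (vN - 1 - sv xS)) ;;
     forLoop xI 0 vM
      (.cond (eqE (.cell 1 (sv xI)) (sv xX))
        (.assign aMtx (sv xX * vN + .cell 2 (sv xI)) 1 ;;
         forLoop xJ 0 vN
          (.cond (.cell aMtx (.cell 2 (sv xI) * vN + sv xJ))
            (.assign aMtx (sv xX * vN + sv xJ) 1) .skip))
        .skip))

/-- Among the numbers outside `P`, one with the fewest descendants works: a successor outside `P`
would have strictly fewer, since acyclicity excludes it from its own descendants. -/
theorem exists_sink {n : ℕ} {E : ℕ → ℕ → Prop} (hE : ∀ x y, E x y → x < n ∧ y < n)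
    (hac : ∀ x, ¬ Relation.TransGen E x x) (P : ℕ → Prop) (hP : ∃ x < n, ¬ P x) :
    ∃ x < n, ¬ P x ∧ ∀ y, E x y → P y := by
  classical
  let S := (Finset.range n).filter fun x => ¬ P x
  have hS : S.Nonempty := by
    obtain ⟨x, h1, h2⟩ := hP
    exact ⟨x, by simp [S, h1, h2]⟩
  obtain ⟨x, hx, hmin⟩ := S.exists_min_image
    (fun x => ((Finset.range n).filter fun y => Relation.TransGen E x y).card) hS
  simp only [S, Finset.mem_filter, Finset.mem_range] at hx
  refine ⟨x, hx.1, hx.2, fun y hxy => ?_⟩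
  by_contra hy
  have hyS : y ∈ S := by simp [S, hy, (hE x y hxy).2]
  have := hmin y hyS
  refine absurd this (not_le.2 (Finset.card_lt_card ⟨fun w => ?_, fun hsub => ?_⟩))
  · simp only [Finset.mem_filter, Finset.mem_range]
    rintro ⟨h1, h2⟩
    exact ⟨h1, h2.head hxy⟩
  · have : y ∈ (Finset.range n).filter fun y' => Relation.TransGen E x y' := by
      simp [(hE x y hxy).2, Relation.TransGen.single hxy]
    exact hac y (by simpa using (Finset.mem_filter.1 (hsub this)).2)

/-- The relation given by a list of `m` pairs. -/
def EdgeRel (m : ℕ) (tl hd : ℕ → ℕ) (x y : ℕ) : Prop := ∃ e < m, tl e = x ∧ hd e = y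

/-- `f` lists the numbers below `n` in such a way that later ones are not related to earlier
ones. -/
structure TopoList (n : ℕ) (R : ℕ → ℕ → Prop) (f : ℕ → ℕ) : Prop where
  lt : ∀ i < n, f i < n
  inj : ∀ i < n, ∀ j < n, f i = f j → i = j
  surj : ∀ x < n, ∃ i < n, f i = x
  sorted : ∀ i j, i ≤ j → j < n → ¬ R (f j) (f i)

theorem surj_of_inj {n : ℕ} {f : ℕ → ℕ} (lt : ∀ i < n, f i < n)
    (inj : ∀ i < n, ∀ j < n, f i = f j → i = j) : ∀ x < n, ∃ i < n, f i = x := by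
  intro x hx
  have := Finset.surj_on_of_inj_on_of_card_le (s := Finset.range n) (t := Finset.range n)
    (fun i _ => f i) (by simpa using lt)
    (by intro a b ha hb; exact inj a (by simpa using ha) b (by simpa using hb)) le_rfl x
    (by simpa using hx)
  obtain ⟨i, hi, h⟩ := this
  exact ⟨i, by simpa using hi, h.symm⟩

theorem topoProg_ok {W n m : ℕ} {σ : Store} (hn : σ 0 0 = n) (hm : σ 0 1 = m)
    (hE : ∀ e < m, σ 1 e < n ∧ σ 2 e < n)
    (hac : ∀ x, ¬ Relation.TransGen (EdgeRel m (σ 1) (σ 2)) x x)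
    (hd : ∀ i, σ aDone i = 0) (hnW : n + 1 ≤ W) (hmW : m ≤ W) :
    Ok W topoProg σ (n * (60 * n + 30 * m + 120) + 10) fun τ =>
      TopoList n (Relation.TransGen (EdgeRel m (σ 1) (σ 2))) (τ aPerm) := by
  set E := EdgeRel m (σ 1) (σ 2) with hEdef
  have hE' : ∀ x y, E x y → x < n ∧ y < n := by
    rintro x y ⟨e, he, rfl, rfl⟩
    exact hE e he
  -- The order is filled from its end: round `s` writes position `n - 1 - s` with a vertex all of
  -- whose successors are already placed, that is, stand at larger positions.
  refine Ok.for_const 0 n (60 * n + 30 * m + 100)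
    (fun s τ => (∀ x, τ aDone x ≤ 1) ∧
      (∀ x, τ aDone x ≠ 0 ↔ ∃ s' < s, τ aPerm (n - 1 - s') = x) ∧
      (∀ s' < s, τ aPerm (n - 1 - s') < n ∧ ∀ s'' < s', τ aPerm (n - 1 - s'') ≠
        τ aPerm (n - 1 - s')) ∧
      ∀ s' < s, ∀ y, E (τ aPerm (n - 1 - s')) y → ∃ s'' < s', τ aPerm (n - 1 - s'') = y)
    rfl (Nat.zero_le _) (by omega) (by decide) ?_ ?_ ?_ ?_ ?_
  · intro τ hs
    simp [hs 0 (by decide), hn]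
  · simp [hd]
  · intro s τ _ hsn hτs hs ⟨h0, h1, h2, h3⟩
    have e0 : τ 0 = σ 0 := hs 0 (by decide)
    have e1 : τ 1 = σ 1 := hs 1 (by decide)
    have e2 : τ 2 = σ 2 := hs 2 (by decide)
    refine Ok.time (T := (n * 20 + 10) + ((m * 30 + 10) + ((n * 30 + 10) + 40))) ?_ ?_
    rotate_left
    · nlinarith
    refine Ok.seq (Q := fun υ => ∀ x < n, υ aFlag x = τ aDone x) ?_ ?_
    · refine Ok.for_const 0 n 6 (fun k υ => ∀ x < k, υ aFlag x = τ aDone x)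
        rfl (Nat.zero_le _) (by omega) (by decide) ?_ ?_ ?_ ?_ ?_
      · intro υ hυ
        simp [hυ 0 (by decide), e0, hn]
      · simp
      · intro k υ _ hk hυk hυ hI
        refine Ok.of_wp ?_ (by decide)
        have f4 : υ aDone = τ aDone := hυ aDone (by decide)
        simp only [Prog.wp, Expr.eval_cell, Expr.eval_ofNat, hυk, f4]
        refine ⟨by omega, (h0 k).trans (by omega), ?_⟩
        intro x hx
        rcases Nat.lt_succ_iff_lt_or_eq.1 hx with hx | rfl
        · simp [hx.ne, hI x hx]
        · simp
      · simp [Expr.cost]; omega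
      · intro υ _ _ h; exact h
    intro υ hυ hf
    have f4 : υ aDone = τ aDone := hυ aDone (by decide)
    have f0 : υ 0 = σ 0 := (hυ 0 (by decide)).trans e0
    have f1 : υ 1 = σ 1 := (hυ 1 (by decide)).trans e1
    have f2 : υ 2 = σ 2 := (hυ 2 (by decide)).trans e2
    have f6 : υ aPerm = τ aPerm := hυ aPerm (by decide)
    have f10 : υ xS = τ xS := hυ xS (by decide)
    clear hυ
    refine Ok.seq (Q := fun ω => ∀ x < n, ω aFlag x ≠ 0 ↔ τ aDone x ≠ 0 ∨
      ∃ y, E x y ∧ τ aDone y = 0) ?_ ?_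
    · refine Ok.for_const 0 m 17 (fun k ω => ∀ x < n, ω aFlag x ≠ 0 ↔ τ aDone x ≠ 0 ∨
        ∃ e < k, σ 1 e = x ∧ τ aDone (σ 2 e) = 0)
        rfl (Nat.zero_le _) (by omega) (by decide) ?_ ?_ ?_ ?_ ?_
      · intro ω hω
        simp [hω 0 (by decide), f0, hm]
      · intro x hx
        simp [hf x hx]
      · intro k ω _ hk hωk hω hI
        refine Ok.of_wp ?_ (by decide)
        have g4 : ω aDone = τ aDone := (hω aDone (by decide)).trans f4
        have g1 : ω 1 = σ 1 := (hω 1 (by decide)).trans f1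
        have g2 : ω 2 = σ 2 := (hω 2 (by decide)).trans f2
        simp only [Prog.wp, Expr.eval_cell, Expr.eval_ofNat, hωk, g4, g1, g2]
        refine ⟨fun hne x hx => ?_, fun heq => ⟨?_, ?_, fun x hx => ?_⟩⟩
        · rw [Store.write_ne _ _ _ (by decide), hI x hx]
          refine or_congr_right ⟨?_, ?_⟩
          · rintro ⟨e, he, h⟩
            exact ⟨e, by omega, h⟩
          · rintro ⟨e, he, h⟩
            refine ⟨e, ?_, h⟩
            rcases Nat.lt_succ_iff_lt_or_eq.1 he with he | rfl
            · exact he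
            · exact absurd h.2 hne
        · have := (hE k hk).1; omega
        · show 1 ≤ W
          omega
        · rw [Store.write_ne _ _ _ (by decide), Store.write_same, Function.update_apply]
          split_ifs with hxk
          · simp only [ne_eq, one_ne_zero, not_false_eq_true, true_iff]
            exact Or.inr ⟨k, by omega, hxk.symm, heq⟩
          · rw [hI x hx]
            refine or_congr_right ⟨?_, ?_⟩
            · rintro ⟨e, he, h⟩
              exact ⟨e, by omega, h⟩
            · rintro ⟨e, he, h⟩
              refine ⟨e, ?_, h⟩
              rcases Nat.lt_succ_iff_lt_or_eq.1 he with he | rfl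
              · exact he
              · exact absurd h.1.symm hxk
      · simp [Expr.cost]
        try omega
      · intro ω _ _ hI x hx
        rw [hI x hx]
        refine or_congr_right ⟨?_, ?_⟩
        · rintro ⟨e, he, rfl, h⟩
          exact ⟨_, ⟨e, he, rfl, rfl⟩, h⟩
        · rintro ⟨y, ⟨e, he, rfl, rfl⟩, h⟩
          exact ⟨e, he, rfl, h⟩
    intro ω hω hg
    have g4 : ω aDone = τ aDone := (hω aDone (by decide)).trans f4
    have g0 : ω 0 = σ 0 := (hω 0 (by decide)).trans f0
    have g6 : ω aPerm = τ aPerm := (hω aPerm (by decide)).trans f6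
    have g10 : ω xS = τ xS := (hω xS (by decide)).trans f10
    clear hω hf
    -- Only `s < n` vertices are placed so far, so some vertex is left, and among the remaining ones
    -- there is a sink.
    have hex : ∃ x < n, ω aFlag x = 0 := by
      obtain ⟨x, hx, hx1, hx2⟩ := exists_sink hE' hac (fun x => τ aDone x ≠ 0) (by
        by_contra hcon
        push Not at hcon
        have : ∀ x ∈ Finset.range n, ∃ s' ∈ Finset.range s, τ aPerm (n - 1 - s') = x := by
          intro x hx
          simpa using (h1 x).1 (hcon x (by simpa using hx))
        have := Finset.card_le_card_of_surjOn (s := Finset.range s) (t := Finset.range n)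
          (fun s' => τ aPerm (n - 1 - s')) (by
            intro x hx
            obtain ⟨s', hs', h⟩ := this x hx
            exact ⟨s', hs', h⟩)
        simp at this
        omega)
      refine ⟨x, hx, ?_⟩
      by_contra hne
      rcases (hg x hx).1 hne with h | ⟨y, hy, hy'⟩
      · exact hx1 h
      · exact hx2 y hy hy'
    refine Ok.seq (Q := fun π => π xX 0 < n ∧ π aFlag (π xX 0) = 0) ?_ ?_
    · refine Ok.for_const 0 n 16 (fun k π => (∃ x < k, ω aFlag x = 0) →
        π xX 0 < n ∧ ω aFlag (π xX 0) = 0)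
        rfl (Nat.zero_le _) (by omega) (by decide) ?_ ?_ ?_ ?_ ?_
      · intro π hπ
        simp [hπ 0 (by decide), g0, hn]
      · simp
      · intro k π _ hk hπk hπ hI
        refine Ok.of_wp ?_ (by decide)
        have p5 : π aFlag = ω aFlag := hπ aFlag (by decide)
        simp only [Prog.wp, Expr.eval_cell, Expr.eval_ofNat, hπk, p5]
        refine ⟨fun hne => ?_, fun heq => ⟨by omega, by omega, ?_⟩⟩
        · rintro ⟨x, hx, hx'⟩
          rw [Store.write_ne _ _ _ (by decide)]
          refine hI ⟨x, ?_, hx'⟩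
          rcases Nat.lt_succ_iff_lt_or_eq.1 hx with hx | rfl
          · exact hx
          · exact absurd hx' hne
        · intro _
          simpa using ⟨hk, heq⟩
      · simp [Expr.cost]; omega
      · intro π hπ _ hI
        have p5 : π aFlag = ω aFlag := hπ aFlag (by decide)
        rw [p5]
        exact hI hex
    intro π hπ ⟨hx, hx'⟩
    have p4 : π aDone = τ aDone := (hπ aDone (by decide)).trans g4
    have p0 : π 0 = σ 0 := (hπ 0 (by decide)).trans g0
    have p5 : π aFlag = ω aFlag := hπ aFlag (by decide)
    have p6 : π aPerm = τ aPerm := (hπ aPerm (by decide)).trans g6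
    have p10 : π xS = τ xS := (hπ xS (by decide)).trans g10
    rw [p5] at hx'
    have hnot : ¬ (τ aDone (π xX 0) ≠ 0 ∨ ∃ y, E (π xX 0) y ∧ τ aDone y = 0) := by
      rw [← hg _ hx]; simpa using hx'
    push Not at hnot
    clear hπ hg
    refine Ok.of_wp ?_ (by decide)
    simp only [Prog.wp, Expr.eval_cell, Expr.eval_ofNat, Expr.eval_sub]
    simp only [ne_eq, Nat.reduceEqDiff, not_false_eq_true, Store.write_ne,
      Store.write_same, p0, p10, hτs, hn, p4, p6]
    set x := π xX 0
    refine ⟨by omega, by omega, by omega, by omega, ?_, ?_, ?_, ?_⟩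
    · intro y
      rw [Function.update_apply]
      split_ifs
      · rfl
      · exact h0 y
    · intro y
      rw [Function.update_apply]
      have : ∀ s' < s, Function.update (τ aPerm) (n - 1 - s) x (n - 1 - s') =
          τ aPerm (n - 1 - s') := fun s' hs' =>
        Function.update_of_ne (by omega) _ _
      constructor
      · split_ifs with hyx
        · intro _
          exact ⟨s, by omega, by simp [hyx]⟩
        · intro hy
          obtain ⟨s', hs', h⟩ := (h1 y).1 hy
          exact ⟨s', by omega, by rw [this s' hs', h]⟩
      · rintro ⟨s', hs', h⟩
        rcases Nat.lt_succ_iff_lt_or_eq.1 hs' with hs' | rfl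
        · rw [this s' hs'] at h
          split_ifs
          · simp
          · exact (h1 y).2 ⟨s', hs', h⟩
        · simp only [Function.update_self] at h
          simp [h]
    · have upd : ∀ s' < s, Function.update (τ aPerm) (n - 1 - s) x (n - 1 - s') =
          τ aPerm (n - 1 - s') := fun s' hs' =>
        Function.update_of_ne (by omega) _ _
      intro s' hs'
      rcases Nat.lt_succ_iff_lt_or_eq.1 hs' with hs' | rfl
      · rw [upd s' hs']
        refine ⟨(h2 s' hs').1, fun s'' hs'' => ?_⟩
        rw [upd s'' (by omega)]
        exact (h2 s' hs').2 s'' hs''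
      · simp only [Function.update_self]
        refine ⟨hx, fun s'' hs'' => ?_⟩
        rw [upd s'' (by omega)]
        intro h
        exact (h1 x).2 ⟨s'', hs'', h⟩ hnot.1
    · have upd : ∀ s' < s, Function.update (τ aPerm) (n - 1 - s) x (n - 1 - s') =
          τ aPerm (n - 1 - s') := fun s' hs' =>
        Function.update_of_ne (by omega) _ _
      intro s' hs'
      rcases Nat.lt_succ_iff_lt_or_eq.1 hs' with hs' | rfl
      · rw [upd s' hs']
        intro y hy
        obtain ⟨s'', hs'', h⟩ := h3 s' hs' y hy
        exact ⟨s'', hs'', by rw [upd s'' (by omega), h]⟩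
      · simp only [Function.update_self]
        intro y hy
        obtain ⟨s'', hs'', h⟩ := (h1 y).1 (hnot.2 y hy)
        exact ⟨s'', hs'', by rw [upd s'' hs'', h]⟩
  · have : Expr.cost vN + 11 = 13 := rfl
    have h2 : Expr.cost 0 + Expr.cost vN + 6 = 9 := rfl
    rw [h2, add_assoc (60 * n + 30 * m + 100), this, Nat.sub_zero]
    nlinarith
  · rintro τ - - ⟨-, -, h2, h3⟩
    have hlt : ∀ i < n, τ aPerm i < n := fun i hi => by
      have := (h2 (n - 1 - i) (by omega)).1
      rwa [show n - 1 - (n - 1 - i) = i by omega] at this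
    have hinj : ∀ i < n, ∀ j < n, τ aPerm i = τ aPerm j → i = j := by
      have key : ∀ i j, i < j → j < n → τ aPerm i ≠ τ aPerm j := by
        intro i j hij hj h
        have := (h2 (n - 1 - i) (by omega)).2 (n - 1 - j) (by omega)
        rw [show n - 1 - (n - 1 - i) = i by omega, show n - 1 - (n - 1 - j) = j by omega] at this
        exact this h.symm
      intro i hi j hj h
      rcases lt_trichotomy i j with hij | hij | hij
      · exact absurd h (key i j hij hj)
      · exact hij
      · exact absurd h.symm (key j i hij hi)
    refine ⟨hlt, hinj, surj_of_inj hlt hinj, ?_⟩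
    have hstep : ∀ i < n, ∀ y, E (τ aPerm i) y → ∃ j < n, i < j ∧ τ aPerm j = y := by
      intro i hi y hy
      obtain ⟨s'', hs'', h⟩ := h3 (n - 1 - i) (by omega) y (by
        rwa [show n - 1 - (n - 1 - i) = i by omega])
      exact ⟨n - 1 - s'', by omega, by omega, h⟩
    have hpath : ∀ i < n, ∀ y, Relation.TransGen E (τ aPerm i) y →
        ∃ j < n, i < j ∧ τ aPerm j = y := by
      intro i hi y hy
      induction hy with
      | single h => exact hstep i hi _ h
      | tail _ h ih =>
        obtain ⟨j, hj, hij, rfl⟩ := ih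
        obtain ⟨l, hl, hjl, h⟩ := hstep j hj _ h
        exact ⟨l, hl, by omega, h⟩
    intro i j hij hj h
    obtain ⟨l, hl, hjl, h'⟩ := hpath j hj _ h
    have := hinj l hl i (by omega) h'
    omega

theorem idx_inj {n x y x' y' : ℕ} (hy : y < n) (hy' : y' < n) (h : x * n + y = x' * n + y') :
    x = x' ∧ y = y' := by
  have h1 : (x * n + y) / n = x := by
    rw [Nat.mul_comm, Nat.mul_add_div (by omega), Nat.div_eq_of_lt hy, Nat.add_zero]
  have h2 : (x' * n + y') / n = x' := by
    rw [Nat.mul_comm, Nat.mul_add_div (by omega), Nat.div_eq_of_lt hy', Nat.add_zero]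
  have : x = x' := by rw [← h1, ← h2, h]
  subst this
  exact ⟨rfl, by omega⟩

theorem idx_lt {n m x y : ℕ} (hx : x < m) (hy : y < n) : x * n + y < m * n := by
  calc x * n + y < (x + 1) * n := by rw [add_mul]; omega
    _ ≤ m * n := Nat.mul_le_mul_right _ hx

-- Vertices are treated in reverse topological order, so the rows of all successors of `x` are final
-- when row `x` is assembled. The inner loop of length `n` runs only when the tail of the scanned
-- edge is the current vertex, hence once per edge overall. This keeps the total at O(nm + n)
-- instead of O(n²m).
set_option maxHeartbeats 800000 in
open Classical in
theorem closureProg_ok {W n m : ℕ} {σ : Store} (hn : σ 0 0 = n) (hm : σ 0 1 = m)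
    (hE : ∀ e < m, σ 1 e < n ∧ σ 2 e < n)
    (hp : TopoList n (Relation.TransGen (EdgeRel m (σ 1) (σ 2))) (σ aPerm))
    (h0 : ∀ i, σ aMtx i = 0) (hnW : n * n + n + 1 ≤ W) (hmW : m ≤ W) :
    Ok W closureProg σ (n * (60 * m + 60) + m * (60 * n + 60) + 10) fun τ =>
      ∀ x < n, ∀ y < n, τ aMtx (x * n + y) =
        if Relation.TransGen (EdgeRel m (σ 1) (σ 2)) x y then 1 else 0 := by
  set E := EdgeRel m (σ 1) (σ 2) with hEdef
  set R := Relation.TransGen E with hR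
  have hRE : ∀ x y, R x y ↔ ∃ e < m, σ 1 e = x ∧ (σ 2 e = y ∨ R (σ 2 e) y) := by
    intro x y
    constructor
    · intro h
      rcases Relation.TransGen.head'_iff.1 h with ⟨z, ⟨e, he, h1, rfl⟩, h2⟩
      rcases Relation.reflTransGen_iff_eq_or_transGen.1 h2 with h2 | h2
      · exact ⟨e, he, h1, Or.inl h2.symm⟩
      · exact ⟨e, he, h1, Or.inr h2⟩
    · rintro ⟨e, he, rfl, rfl | h⟩
      · exact .single ⟨e, he, rfl, rfl⟩
      · exact .head ⟨e, he, rfl, rfl⟩ h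
  have idxW : ∀ x < n, ∀ y < n, x * n + y ≤ W := fun x hx y hy => by
    have := idx_lt hx hy; omega
  refine Ok.for 0 n (fun s => m * 40 + (∑ e ∈ Finset.range m,
      if σ 1 e = σ aPerm (n - 1 - s) then 50 * n + 40 else 0) + 40)
    (fun s τ => ∀ x < n, ∀ y < n, τ aMtx (x * n + y) =
        if (∃ s' < s, σ aPerm (n - 1 - s') = x) ∧ R x y then 1 else 0)
    rfl (Nat.zero_le _) (by omega) (by decide) ?_ ?_ ?_ ?_ ?_
  · intro τ hs
    simp [hs 0 (by decide), hn]
  · simp [h0]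
  · intro s τ _ hsn hτs hs hI
    have e0 : τ 0 = σ 0 := hs 0 (by decide)
    have e1 : τ 1 = σ 1 := hs 1 (by decide)
    have e2 : τ 2 = σ 2 := hs 2 (by decide)
    have e6 : τ aPerm = σ aPerm := hs aPerm (by decide)
    set x := σ aPerm (n - 1 - s) with hx
    have hxn : x < n := hp.lt _ (by omega)
    have hfresh : ¬ ∃ s' < s, σ aPerm (n - 1 - s') = x := by
      rintro ⟨s', hs', h⟩
      have := hp.inj _ (by omega) _ (by omega) h
      omega
    have hdone : ∀ e < m, σ 1 e = x → ∃ s' < s, σ aPerm (n - 1 - s') = σ 2 e := by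
      intro e he hex
      obtain ⟨j, hj, hj'⟩ := hp.surj (σ 2 e) (hE e he).2
      have h1 : R x (σ 2 e) := .single ⟨e, he, hex, rfl⟩
      by_cases h : j ≤ n - 1 - s
      · exact absurd (by rw [hj']; exact h1) (hp.sorted _ _ h (by omega))
      · exact ⟨n - 1 - j, by omega, by rw [show n - 1 - (n - 1 - j) = j by omega, hj']⟩
    refine Ok.time (T := 10 + ((∑ e ∈ Finset.Ico 0 m, ((20 +
      if σ 1 e = x then 50 * n + 40 else 0) + 2 + 11)) + 10)) ?_ ?_
    rotate_left
    · rw [Finset.sum_add_distrib, Finset.sum_add_distrib, Finset.sum_add_distrib]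
      simp only [Nat.Ico_zero_eq_range, Finset.sum_const, Finset.card_range, smul_eq_mul]
      omega
    refine Ok.seq (Q := fun υ => υ = τ.write xX 0 x) (Ok.of_wp ?_ (by decide)) ?_
    · simp only [Prog.wp, Expr.eval_cell, Expr.eval_ofNat, Expr.eval_sub, e0, hn, hτs, e6, ← hx]
      exact ⟨by omega, by omega, trivial⟩
    rintro υ - rfl
    refine Ok.for 0 m (fun e => 20 + if σ 1 e = x then 50 * n + 40 else 0) (fun k υ =>
      ∀ a < n, ∀ y < n, υ aMtx (a * n + y) =
      if (∃ s' < s, σ aPerm (n - 1 - s') = a) ∧ R a y ∨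
        a = x ∧ (∃ e < k, σ 1 e = x ∧ (σ 2 e = y ∨ R (σ 2 e) y)) then 1 else 0)
      rfl (Nat.zero_le _) (by omega) (by decide) ?_ ?_ ?_
      (Nat.add_le_add_left (show 9 ≤ 10 by omega) _) ?_
    · intro υ hυ
      rw [Expr.eval_cell, Expr.eval_ofNat, hυ 0 (by decide), Store.write_ne _ _ _ (by decide), e0, hm]
    · intro a ha y hy
      simp [hI a ha y hy]
    · intro k υ _ hk hυk hυ hJ
      have f0 : υ 0 = σ 0 := (hυ 0 (by decide)).trans e0
      have f1 : υ 1 = σ 1 := (hυ 1 (by decide)).trans e1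
      have f2 : υ 2 = σ 2 := (hυ 2 (by decide)).trans e2
      have f13 : υ xX 0 = x := by
        rw [hυ xX (by decide)]; simp
      have hext : ∀ y, (∃ e < k + 1, σ 1 e = x ∧ (σ 2 e = y ∨ R (σ 2 e) y)) ↔
          (∃ e < k, σ 1 e = x ∧ (σ 2 e = y ∨ R (σ 2 e) y)) ∨
            (σ 1 k = x ∧ (σ 2 k = y ∨ R (σ 2 k) y)) := by
        intro y
        constructor
        · rintro ⟨e, he, h⟩
          rcases Nat.lt_succ_iff_lt_or_eq.1 he with he | rfl
          · exact Or.inl ⟨e, he, h⟩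
          · exact Or.inr h
        · rintro (⟨e, he, h⟩ | h)
          · exact ⟨e, by omega, h⟩
          · exact ⟨k, by omega, h⟩
      have hval : (eqE (.cell 1 (sv xI)) (sv xX)).eval υ = if σ 1 k = x then 1 else 0 := by
        rw [eqE_eval]; simp [hυk, f1, f13]
      refine Ok.cond (T := (if σ 1 k = x then 50 * n + 40 else 0) + 1)
        (fun he => ?_) (fun he => ?_)
        (show 15 + 1 + ((if σ 1 k = x then 50 * n + 40 else 0) + 1) ≤ _ by omega)
      · have hkx : σ 1 k = x := by
          by_contra h
          simp [hval, h] at he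
        rw [if_pos hkx]
        have hh := (hE k hk).2
        obtain ⟨s₁, hs₁, hs₂⟩ := hdone k hk hkx
        -- The row that is read differs from the row that is written, so the reads below still see
        -- the final entries.
        have hhx : σ 2 k ≠ x := fun h => hfresh ⟨s₁, hs₁, hs₂.trans h⟩
        refine Ok.time (T := 20 + (50 * n + 10)) ?_ (by omega)
        refine Ok.seq (Q := fun ω => ∀ a < n, ∀ y < n, ω aMtx (a * n + y) =
          if (∃ s' < s, σ aPerm (n - 1 - s') = a) ∧ R a y ∨
          a = x ∧ ((∃ e < k, σ 1 e = x ∧ (σ 2 e = y ∨ R (σ 2 e) y)) ∨ σ 2 k = y)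
          then 1 else 0) (Ok.of_wp ?_ (by decide)) ?_
        · simp only [Prog.wp, Expr.eval_cell, Expr.eval_ofNat, Expr.eval_add, Expr.eval_mul,
            f0, hn, f13, f2, hυk]
          refine ⟨idxW x hxn _ hh, by omega, fun a ha y hy => ?_⟩
          rw [Store.write_same, Function.update_apply, hJ a ha y hy]
          by_cases hc : a = x ∧ σ 2 k = y
          · rw [if_pos (by rw [hc.1, hc.2]), if_pos (Or.inr ⟨hc.1, Or.inr hc.2⟩)]
          · rw [if_neg (fun h => hc (by
              obtain ⟨h1, h2⟩ := idx_inj hy hh h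
              exact ⟨h1, h2.symm⟩))]
            congr 1
            exact propext (or_congr_right ⟨fun h => ⟨h.1, Or.inl h.2⟩,
              fun h => ⟨h.1, h.2.resolve_right fun h' => hc ⟨h.1, h'⟩⟩⟩)
        intro ω hω hK
        have g0 : ω 0 = σ 0 := (hω 0 (by decide)).trans f0
        have g2 : ω 2 = σ 2 := (hω 2 (by decide)).trans f2
        have g13 : ω xX 0 = x := by rw [hω xX (by decide), f13]
        have g11 : ω xI 0 = k := by rw [hω xI (by decide), hυk]
        refine Ok.for_const 0 n 30 (fun l π => ∀ a < n, ∀ y < n, π aMtx (a * n + y) =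
          if (∃ s' < s, σ aPerm (n - 1 - s') = a) ∧ R a y ∨
          a = x ∧ ((∃ e < k, σ 1 e = x ∧ (σ 2 e = y ∨ R (σ 2 e) y)) ∨ σ 2 k = y ∨
            y < l ∧ R (σ 2 k) y)
          then 1 else 0) rfl (Nat.zero_le _) (by omega) (by decide) ?_ ?_ ?_ ?_ ?_
        · intro π hπ
          simp [hπ 0 (by decide), g0, hn]
        · intro a ha y hy
          rw [Store.write_ne _ _ _ (by decide), hK a ha y hy]
          simp
        · intro l π _ hl hπl hπ hL
          have p0 : π 0 = σ 0 := (hπ 0 (by decide)).trans g0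
          have p2 : π 2 = σ 2 := (hπ 2 (by decide)).trans g2
          have p13 : π xX 0 = x := by rw [hπ xX (by decide), g13]
          have p11 : π xI 0 = k := by rw [hπ xI (by decide), g11]
          have hread : π aMtx (σ 2 k * n + l) = if R (σ 2 k) l then 1 else 0 := by
            rw [hL _ hh l hl]
            congr 1
            simp only [hhx, false_and, or_false, eq_iff_iff, and_iff_right_iff_imp]
            exact fun _ => ⟨s₁, hs₁, hs₂⟩
          refine Ok.of_wp ?_ (by decide)
          simp only [Prog.wp, Expr.eval_cell, Expr.eval_ofNat, Expr.eval_add, Expr.eval_mul,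
            p0, hn, p13, p2, p11, hπl, hread]
          refine ⟨fun hne => ⟨idxW x hxn l hl, by omega, fun a ha y hy => ?_⟩,
            fun heq a ha y hy => ?_⟩
          · have hRl : R (σ 2 k) l := by
              by_contra h
              simp [h] at hne
            rw [Store.write_ne _ _ _ (by decide), Store.write_same, Function.update_apply,
              hL a ha y hy]
            by_cases hc : a = x ∧ y = l
            · rw [if_pos (by rw [hc.1, hc.2]), if_pos]
              exact Or.inr ⟨hc.1, Or.inr (Or.inr ⟨by omega, by rw [hc.2]; exact hRl⟩)⟩
            · rw [if_neg (fun h => hc (idx_inj hy hl h))]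
              congr 1
              have : a = x → (y < l ↔ y < l + 1) := fun h => by
                have : y ≠ l := fun h' => hc ⟨h, h'⟩
                omega
              simp only [eq_iff_iff]
              refine or_congr_right (and_congr_right fun h => ?_)
              rw [this h]
          · have hRl : ¬ R (σ 2 k) l := by
              intro h
              simp [h] at heq
            rw [Store.write_ne _ _ _ (by decide), hL a ha y hy]
            congr 1
            have : y < l ∧ R (σ 2 k) y ↔ y < l + 1 ∧ R (σ 2 k) y := by
              refine and_congr_left fun h => ?_
              have : y ≠ l := by rintro rfl; exact hRl h
              omega
            rw [this]
        · have h1 : Expr.cost vN = 2 := rfl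
          have h2 : Expr.cost 0 = 1 := rfl
          rw [h1, h2]; omega
        · intro π _ _ hL a ha y hy
          rw [Store.write_ne _ _ _ (by decide), hL a ha y hy]
          congr 1
          simp only [hy, true_and, hext, hkx]
      · have hkx : σ 1 k ≠ x := by
          intro h
          simp [hval, h] at he
        refine Ok.of_wp ?_ (show 1 ≤ _ by omega)
        intro a ha y hy
        rw [Store.write_ne _ _ _ (by decide), hJ a ha y hy]
        simp only [hext, hkx, false_and, or_false]
    · intro υ hυ _ hJ a ha y hy
      rw [Store.write_ne _ _ _ (by decide), hJ a ha y hy]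
      congr 1
      simp only [eq_iff_iff, ← hRE]
      constructor
      · rintro (⟨⟨s', h1, h2⟩, h3⟩ | ⟨rfl, h⟩)
        · exact ⟨⟨s', by omega, h2⟩, h3⟩
        · exact ⟨⟨s, by omega, rfl⟩, h⟩
      · rintro ⟨⟨s', h1, h2⟩, h3⟩
        rcases Nat.lt_succ_iff_lt_or_eq.1 h1 with h1 | rfl
        · exact Or.inl ⟨⟨s', h1, h2⟩, h3⟩
        · exact Or.inr ⟨h2.symm, by rw [hx, h2]; exact h3⟩
  · have h1 : Expr.cost vN = 2 := rfl
    have h2 : Expr.cost 0 = 1 := rfl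
    rw [h1, h2]
    simp only [Finset.sum_add_distrib, Nat.Ico_zero_eq_range, Finset.sum_const, Finset.card_range,
      smul_eq_mul]
    -- Charge the expensive rounds to edges instead of vertices: a fixed edge is expensive in at
    -- most one round, because its tail occurs at one position only.
    rw [Finset.sum_comm]
    have : ∀ e ∈ Finset.range m, (∑ s ∈ Finset.range n,
        if σ 1 e = σ aPerm (n - 1 - s) then 50 * n + 40 else 0) ≤ 50 * n + 40 := by
      intro e _
      rw [← Finset.sum_filter, Finset.sum_const, smul_eq_mul]
      have : ((Finset.range n).filter fun s => σ 1 e = σ aPerm (n - 1 - s)).card ≤ 1 := by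
        rw [Finset.card_le_one]
        intro s hs s' hs'
        simp only [Finset.mem_filter, Finset.mem_range] at hs hs'
        have := hp.inj _ (by omega) _ (by omega) (hs.2.symm.trans hs'.2)
        omega
      nlinarith
    have := Finset.sum_le_sum this
    simp only [Finset.sum_const, Finset.card_range, smul_eq_mul] at this
    nlinarith
  · intro τ _ _ hI x hx y hy
    rw [hI x hx y hy]
    congr 1
    simp only [eq_iff_iff, and_iff_right_iff_imp]
    intro _
    obtain ⟨j, hj, h⟩ := hp.surj x hx
    exact ⟨n - 1 - j, by omega, by rw [show n - 1 - (n - 1 - j) = j by omega, h]⟩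

/-! ### Lower bounds for the degree of the decomposition tree -/

section
variable {V : Type*} [Fintype V] [DecidableEq V] {G : Digraph V}

theorem isStrongModule_singleton (G : Digraph V) (x : V) : IsStrongModule G {x} := by
  refine ⟨⟨⟨x, by simp⟩, ?_⟩, fun N _ => ?_⟩
  · intro v₁ h₁ v₂ h₂ u _
    rw [Finset.mem_singleton.1 h₁, Finset.mem_singleton.1 h₂]
    exact ⟨Iff.rfl, Iff.rfl⟩
  · by_cases h : x ∈ N
    · exact Or.inl (by simpa using h)
    · exact Or.inr (Or.inr (by simpa using h))

theorem isStrongModule_univ (G : Digraph V) [Nonempty V] : IsStrongModule G Finset.univ :=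
  ⟨⟨Finset.univ_nonempty, fun _ _ _ _ u hu => absurd (Finset.mem_univ u) hu⟩,
    fun N _ => Or.inr (Or.inl (Finset.subset_univ N))⟩

theorem exists_child {N : Finset V} (hN : 2 ≤ N.card) {x : V} (hx : x ∈ N) :
    ∃ C, IsChild G N C ∧ x ∈ C := by
  classical
  let S := Finset.univ.filter fun C : Finset V => IsStrongModule G C ∧ x ∈ C ∧ C ⊂ N
  have hS : S.Nonempty := by
    refine ⟨{x}, ?_⟩
    simp only [S, Finset.mem_filter, Finset.mem_univ, true_and]
    refine ⟨isStrongModule_singleton G x, by simp, Finset.ssubset_iff_subset_ne.2 ⟨by simpa, ?_⟩⟩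
    rintro rfl
    simp at hN
  obtain ⟨C, hC, hmax⟩ := S.exists_max_image Finset.card hS
  simp only [S, Finset.mem_filter, Finset.mem_univ, true_and] at hC hmax
  refine ⟨C, ⟨hC.1, hC.2.2, fun L hL hCL hLN => ?_⟩, hC.2.1⟩
  have := hmax L ⟨hL, hCL.1 hC.2.1, hLN⟩
  have := Finset.card_lt_card hCL
  omega

theorem card_children_le {N : Finset V} (hN : IsStrongModule G N) (S : Finset (Finset V))
    (hS : ∀ C ∈ S, IsChild G N C) : S.card ≤ treeDegree G := by
  classical
  unfold treeDegree
  refine le_trans (Finset.card_le_card fun C hC => ?_)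
    (Finset.le_sup (f := fun M => (Finset.univ.filter (IsChild G M)).card)
      (Finset.mem_filter.2 ⟨Finset.mem_univ N, hN⟩))
  simpa using hS C hC

/-- A partition of a module into parts none of which can be merged without merging all of them has
at most as many parts as some node of the decomposition tree has children. -/
theorem card_le_treeDegree {M : Finset V} (hM : IsModule G M) {t : ℕ} (ht : 2 ≤ t)
    (C : ℕ → Finset V) (hne : ∀ i < t, (C i).Nonempty)
    (hdis : ∀ i < t, ∀ j < t, i ≠ j → Disjoint (C i) (C j)) (hsub : ∀ i < t, C i ⊆ M)
    (H : ∀ N, IsStrongModule G N → N ⊆ M → N = M ∨ ∃ i < t, N ⊆ C i) :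
    t ≤ treeDegree G := by
  classical
  obtain ⟨x₀, hx₀⟩ := hne 0 (by omega)
  obtain ⟨x₁, hx₁⟩ := hne 1 (by omega)
  have : Nonempty V := ⟨x₀⟩
  -- The required node is a smallest strong module that meets `M` and lies in no part. It contains
  -- `M`. By minimality each of its children that meets `M` lies in a part, so different parts are
  -- met by different children.
  let S := Finset.univ.filter fun N : Finset V =>
    IsStrongModule G N ∧ (∃ x ∈ N, x ∈ M) ∧ ¬ ∃ i < t, N ⊆ C i
  have hS : S.Nonempty := by
    refine ⟨Finset.univ, ?_⟩
    simp only [S, Finset.mem_filter, Finset.mem_univ, true_and]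
    refine ⟨isStrongModule_univ G, ⟨x₀, hsub 0 (by omega) hx₀⟩, ?_⟩
    rintro ⟨i, hi, h⟩
    have h0 : i = 0 := by
      by_contra hne
      exact Finset.disjoint_left.1 (hdis i hi 0 (by omega) hne) (h (Finset.mem_univ x₀)) hx₀
    have h1 : i = 1 := by
      by_contra hne
      exact Finset.disjoint_left.1 (hdis i hi 1 (by omega) hne) (h (Finset.mem_univ x₁)) hx₁
    omega
  obtain ⟨N, hN, hmin⟩ := S.exists_min_image Finset.card hS
  simp only [S, Finset.mem_filter, Finset.mem_univ, true_and] at hN hmin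
  obtain ⟨hN1, ⟨y, hyN, hyM⟩, hN2⟩ := hN
  have hMN : M ⊆ N := by
    rcases hN1.2 M hM with h | h | h
    · rcases H N hN1 h with h | h
      · exact h.ge
      · exact absurd h hN2
    · exact h
    · exact absurd hyM (Finset.disjoint_left.1 h hyN)
  have hcard : 2 ≤ N.card := by
    have h01 : x₀ ≠ x₁ := fun h =>
      Finset.disjoint_left.1 (hdis 0 (by omega) 1 (by omega) (by omega)) hx₀ (h ▸ hx₁)
    refine (Finset.one_lt_card.2 ⟨x₀, ?_, x₁, ?_, h01⟩)
    · exact hMN (hsub 0 (by omega) hx₀)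
    · exact hMN (hsub 1 (by omega) hx₁)
  have hch : ∀ i : Fin t, ∃ K, IsChild G N K ∧ K.Nonempty ∧ K ⊆ C i := by
    intro i
    obtain ⟨x, hx⟩ := hne i i.2
    obtain ⟨K, hK, hxK⟩ := exists_child (G := G) hcard (hMN (hsub i i.2 hx))
    refine ⟨K, hK, ⟨x, hxK⟩, ?_⟩
    have : ∃ j < t, K ⊆ C j := by
      by_contra hcon
      have := hmin K ⟨hK.1, ⟨x, hxK, hsub i i.2 hx⟩, hcon⟩
      have := Finset.card_lt_card hK.2.1
      omega
    obtain ⟨j, hj, hKj⟩ := this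
    have : j = i := by
      by_contra hne
      exact Finset.disjoint_left.1 (hdis j hj i i.2 hne) (hKj hxK) hx
    rwa [← this]
  choose K hK1 hK2 hK3 using hch
  have hinj : Function.Injective K := by
    intro i j hij
    by_contra hne
    obtain ⟨x, hx⟩ := hK2 i
    exact Finset.disjoint_left.1 (hdis i i.2 j j.2 (fun h => hne (Fin.ext h))) (hK3 i hx)
      (hK3 j (hij ▸ hx))
  have := card_children_le hN1 (Finset.univ.image K) (by simpa using hK1)
  rwa [Finset.card_image_of_injective _ hinj, Finset.card_univ, Fintype.card_fin] at this

/-- A smallest strong module with at least two elements has nothing but singletons strictly below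
it, so its elements are its children. -/
theorem two_le_treeDegree (G : Digraph V) (hV : 2 ≤ Fintype.card V) : 2 ≤ treeDegree G := by
  classical
  have : Nonempty V := Fintype.card_pos_iff.1 (by omega)
  let S := Finset.univ.filter fun N : Finset V => IsStrongModule G N ∧ 2 ≤ N.card
  have hS : S.Nonempty :=
    ⟨Finset.univ, by simpa [S] using ⟨isStrongModule_univ G, hV⟩⟩
  obtain ⟨N, hN, hmin⟩ := S.exists_min_image Finset.card hS
  simp only [S, Finset.mem_filter, Finset.mem_univ, true_and] at hN hmin
  have : ∀ x ∈ N, IsChild G N {x} := by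
    intro x hx
    refine ⟨isStrongModule_singleton G x,
      Finset.ssubset_iff_subset_ne.2 ⟨by simpa, ?_⟩, fun L hL hxL hLN => ?_⟩
    · intro h
      rw [← h] at hN
      simp at hN
    · have h1 := Finset.card_lt_card hxL
      have h2 := Finset.card_lt_card hLN
      have := hmin L ⟨hL, by simp at h1; omega⟩
      omega
  have := card_children_le hN.1 (N.image fun x => {x}) (by simpa using this)
  rw [Finset.card_image_of_injective _ (Finset.singleton_injective)] at this
  omega

/-! ### Weakly connected components and the bound n ≤ m + k -/

theorem isModule_of_closed {S : Finset V} (hne : S.Nonempty)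
    (h : ∀ x y, G.Adj x y → (x ∈ S ↔ y ∈ S)) : IsModule G S := by
  have key : ∀ x y, HasPath G x y → (x ∈ S ↔ y ∈ S) := by
    intro x y hxy
    induction hxy with
    | single h' => exact h _ _ h'
    | tail _ h' ih => exact ih.trans (h _ _ h')
  refine ⟨hne, fun v₁ h₁ v₂ h₂ u hu => ⟨?_, ?_⟩⟩
  · exact iff_of_false (fun hp => hu ((key _ _ hp).1 h₁)) fun hp => hu ((key _ _ hp).1 h₂)
  · exact iff_of_false (fun hp => hu ((key _ _ hp).2 h₁)) fun hp => hu ((key _ _ hp).2 h₂)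

/-- Treating one more edge identifies at most two values of `f`, so each edge costs at most one
value. The fibres serve as unions of weakly connected components. -/
theorem exists_component_map (es : List (V × V)) :
    ∃ f : V → V, (∀ e ∈ es, f e.1 = f e.2) ∧
      Fintype.card V ≤ es.length + (Finset.univ.image f).card := by
  induction es with
  | nil => exact ⟨id, by simp, by simp⟩
  | cons e es ih =>
    obtain ⟨f, h1, h2⟩ := ih
    refine ⟨fun x => if f x = f e.1 then f e.2 else f x, ?_, ?_⟩
    · intro e' he'
      rcases List.mem_cons.1 he' with rfl | he'
      · by_cases h : f e'.2 = f e'.1 <;> simp [h]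
      · simp [h1 e' he']
    · have : (Finset.univ.image f).erase (f e.1) ⊆
          Finset.univ.image fun x => if f x = f e.1 then f e.2 else f x := by
        intro y hy
        simp only [Finset.mem_erase, Finset.mem_image, Finset.mem_univ, true_and] at hy ⊢
        obtain ⟨hy, x, rfl⟩ := hy
        exact ⟨x, by simp [hy]⟩
      have h3 := Finset.card_le_card this
      have h4 := Finset.pred_card_le_card_erase (a := f e.1) (s := Finset.univ.image f)
      simp only [List.length_cons]
      omega

/-- There are at least `n - m` fibres without edges between them, and any union of fibres is a
module. If there are at least two fibres, they meet the criterion of `card_le_treeDegree` for the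
whole vertex set; otherwise `two_le_treeDegree` is enough. -/
theorem card_le_length_add_treeDegree (es : List (V × V)) (hes : ∀ u v, G.Adj u v → (u, v) ∈ es)
    (hV : 2 ≤ Fintype.card V) : Fintype.card V ≤ es.length + treeDegree G := by
  classical
  obtain ⟨f, h1, h2⟩ := exists_component_map es
  refine h2.trans (Nat.add_le_add_left ?_ _)
  set I := Finset.univ.image f with hI
  by_cases hI2 : I.card < 2
  · have := two_le_treeDegree G hV
    omega
  have : Nonempty V := Fintype.card_pos_iff.1 (by omega)
  let K : V → Finset V := fun x => Finset.univ.filter fun y => f y = f x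
  have hKmod : ∀ x, IsModule G (K x) := fun x => by
    refine isModule_of_closed ⟨x, by simp [K]⟩ fun a b hab => ?_
    simp [K, h1 (a, b) (hes a b hab)]
  let e := I.equivFin.symm
  let C : ℕ → Finset V := fun i =>
    if h : i < I.card then Finset.univ.filter fun y => f y = e ⟨i, h⟩ else ∅
  have hC : ∀ i (h : i < I.card), C i = Finset.univ.filter fun y => f y = e ⟨i, h⟩ := fun i h => by
    simp [C, h]
  have hKC : ∀ x, ∃ i < I.card, K x = C i := by
    intro x
    have hx : f x ∈ I := by simp [hI]
    refine ⟨e.symm ⟨f x, hx⟩, Fin.is_lt _, ?_⟩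
    rw [hC _ (Fin.is_lt _)]
    simp [K]
  refine card_le_treeDegree (isStrongModule_univ G).1 (not_lt.1 hI2) C ?_ ?_ (by simp) ?_
  · intro i hi
    rw [hC i hi]
    obtain ⟨x, -, hx⟩ := Finset.mem_image.1 (e ⟨i, hi⟩).2
    exact ⟨x, by simp [hx]⟩
  · intro i hi j hj hij
    rw [hC i hi, hC j hj, Finset.disjoint_left]
    intro x hx hx'
    simp only [Finset.mem_filter, Finset.mem_univ, true_and] at hx hx'
    have := e.injective (Subtype.ext (hx.symm.trans hx'))
    exact hij (by simpa using this)
  · intro N hN _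
    by_contra hcon
    push Not at hcon
    obtain ⟨hN1, hN2⟩ := hcon
    have hKN : ∀ x ∈ N, K x ⊆ N := by
      intro x hx
      rcases hN.2 (K x) (hKmod x) with h | h | h
      · obtain ⟨i, hi, hi'⟩ := hKC x
        exact absurd (hi' ▸ h) (hN2 i hi)
      · exact h
      · exact absurd (by simp [K]) (Finset.disjoint_left.1 h hx)
    obtain ⟨y, hy⟩ : ∃ y, y ∉ N := by
      by_contra h
      push Not at h
      exact hN1 (Finset.eq_univ_iff_forall.2 h)
    obtain ⟨x, hx⟩ := hN.1.1
    obtain ⟨x', hx', hx'x⟩ : ∃ x' ∈ N, x' ∉ K x := by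
      by_contra h
      push Not at h
      obtain ⟨i, hi, hi'⟩ := hKC x
      exact hN2 i hi (hi' ▸ h)
    -- This module overlaps `N`: it contains `x` in `N` and `y` outside `N`, and it misses `x'` in
    -- `N`. Strongness of `N` forbids that.
    have hmod : IsModule G (K x ∪ K y) := by
      refine isModule_of_closed ⟨x, by simp [K]⟩ fun a b hab => ?_
      simp [K, h1 (a, b) (hes a b hab)]
    rcases hN.2 _ hmod with h | h | h
    · rcases Finset.mem_union.1 (h hx') with h | h
      · exact hx'x h
      · refine hy (hKN x' hx' ?_)
        simp only [K, Finset.mem_filter, Finset.mem_univ, true_and] at h ⊢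
        exact h.symm
    · exact hy (h (by simp [K]))
    · exact Finset.disjoint_left.1 h hx (by simp [K])

end

/-! ### Choosing representatives -/

-- Independence of two coordinates of a uniformly random choice, with denominators cleared: every
-- pair of values is attained by the same share of all choices.
open Classical in
theorem card_fiber_piFinset {t : ℕ} (C : Fin t → Finset ℕ) {i j : Fin t} (hij : i ≠ j) {a b : ℕ}
    (ha : a ∈ C i) (hb : b ∈ C j) :
    ((Fintype.piFinset C).filter fun x => (x i, x j) = (a, b)).card * ((C i).card * (C j).card) =
      ∏ l, (C l).card := by
  have h1 : ((Fintype.piFinset C).filter fun x => (x i, x j) = (a, b)) =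
      Fintype.piFinset fun l => if l = i then {a} else if l = j then {b} else C l := by
    ext x
    simp only [Finset.mem_filter, Fintype.mem_piFinset, Prod.mk.injEq]
    constructor
    · rintro ⟨h, rfl, rfl⟩ l
      split_ifs with h1 h2
      · simp [h1]
      · simp [h2]
      · exact h l
    · intro h
      have hi := h i
      have hj := h j
      rw [if_pos rfl, Finset.mem_singleton] at hi
      rw [if_neg hij.symm, if_pos rfl, Finset.mem_singleton] at hj
      refine ⟨fun l => ?_, hi, hj⟩
      have hl := h l
      split_ifs at hl with h1 h2
      · rw [h1, hi]; exact ha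
      · rw [h2, hj]; exact hb
      · exact hl
  have h2 : (C i).card = ∏ l, if l = i then (C l).card else 1 := by simp
  have h3 : (C j).card = ∏ l, if l = j then (C l).card else 1 := by simp
  rw [h1, Fintype.card_piFinset, h2, h3, ← Finset.prod_mul_distrib, ← Finset.prod_mul_distrib]
  refine Finset.prod_congr rfl fun l _ => ?_
  by_cases hl : l = i
  · subst hl; simp [hij]
  · by_cases hl' : l = j
    · subst hl'; simp [hl]
    · simp [hl, hl']

-- The expectation identity behind the averaging argument, multiplied by the number of choices. A
-- given pair is chosen with probability one over the product of the two sizes, and this product is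
-- the weight.
open Classical in
theorem sum_piFinset_pair {t : ℕ} (C : Fin t → Finset ℕ) {i j : Fin t} (hij : i ≠ j)
    (φ : ℕ → ℕ → Prop) :
    (∑ x ∈ Fintype.piFinset C, (if φ (x i) (x j) then (C i).card * (C j).card else 0 : ℕ)) =
      (∏ l, (C l).card) * ((C i ×ˢ C j).filter fun p => φ p.1 p.2).card := by
  rw [← Finset.sum_fiberwise_of_maps_to (s := Fintype.piFinset C) (t := C i ×ˢ C j)
    (g := fun x => (x i, x j))]
  · rw [Finset.card_filter, Finset.mul_sum]
    refine Finset.sum_congr rfl fun p hp => ?_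
    obtain ⟨a, b⟩ := p
    rw [Finset.mem_product] at hp
    rw [← card_fiber_piFinset C hij hp.1 hp.2]
    by_cases h : φ a b
    · rw [if_pos h, mul_one]
      refine (Finset.sum_congr rfl fun x hx => ?_).trans (Finset.sum_const_nat fun _ _ => rfl)
      have := (Finset.mem_filter.1 hx).2
      simp only [Prod.mk.injEq] at this
      rw [this.1, this.2, if_pos h]
    · rw [if_neg h, mul_zero]
      refine Finset.sum_eq_zero fun x hx => ?_
      have := (Finset.mem_filter.1 hx).2
      simp only [Prod.mk.injEq] at this
      rw [this.1, this.2, if_neg h]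
  · intro x hx
    rw [Fintype.mem_piFinset] at hx
    exact Finset.mem_product.2 ⟨hx i, hx j⟩

open Classical in
/-- Some choice of representatives costs no more than the average choice. -/
theorem exists_representatives {t : ℕ} (C : ℕ → Finset ℕ) (hne : ∀ i < t, (C i).Nonempty)
    (φ : ℕ → ℕ → Prop) :
    ∃ x : ℕ → ℕ, (∀ i < t, x i ∈ C i) ∧
      (∑ i ∈ Finset.range t, ∑ j ∈ Finset.range t,
        if i ≠ j ∧ φ (x i) (x j) then (C i).card * (C j).card else 0) ≤
      ∑ i ∈ Finset.range t, ∑ j ∈ Finset.range t,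
        if i ≠ j then ((C i ×ˢ C j).filter fun p => φ p.1 p.2).card else 0 := by
  let C' : Fin t → Finset ℕ := fun i => C i
  have hP : (Fintype.piFinset C').Nonempty := by
    rw [Fintype.piFinset_nonempty]
    exact fun i => hne i i.2
  obtain ⟨x, hx, hle⟩ := Finset.exists_le_of_sum_le (s := Fintype.piFinset C')
    (f := fun x => ∑ i : Fin t, ∑ j : Fin t,
        if i ≠ j ∧ φ (x i) (x j) then (C i).card * (C j).card else 0)
    (g := fun _ => ∑ i : Fin t, ∑ j : Fin t,
        if i ≠ j then ((C i ×ˢ C j).filter fun p => φ p.1 p.2).card else 0) hP (by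
      rw [Finset.sum_const, smul_eq_mul, Fintype.card_piFinset, Finset.sum_comm, Finset.mul_sum]
      refine (Finset.sum_congr rfl fun i _ => ?_).le
      rw [Finset.sum_comm, Finset.mul_sum]
      refine Finset.sum_congr rfl fun j _ => ?_
      by_cases hij : i = j
      · simp [hij]
      · simp only [ne_eq, hij, not_false_eq_true, true_and, if_true]
        exact sum_piFinset_pair C' hij φ)
  refine ⟨fun i => if h : i < t then x ⟨i, h⟩ else 0, fun i hi => ?_, ?_⟩
  · simp only [hi, dif_pos]
    exact Fintype.mem_piFinset.1 hx ⟨i, hi⟩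
  · rw [Finset.sum_range, Finset.sum_range]
    simp only [Finset.sum_range]
    simpa [Fin.ext_iff] using hle

/-! ### Optimal drawings of a module from optimal drawings of its parts -/

section
variable (d : ℕ) (R : ℕ → ℕ → Prop)

/-- `(x, y)` is a falsely implied path for the coordinates `f`. -/
def Fip (f : ℕ → ℕ → ℕ) (x y : ℕ) : Prop := (∀ D < d, f D x < f D y) ∧ ¬ R x y ∧ ¬ R y x

open Classical in
/-- The number of falsely implied paths from `A` to `B`. -/
noncomputable def crossFips (f : ℕ → ℕ → ℕ) (A B : Finset ℕ) : ℕ :=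
  ((A ×ˢ B).filter fun p => Fip d R f p.1 p.2).card

/-- Coordinates respecting `R` on the numbers below `n`. -/
def IsDraw (n : ℕ) (f : ℕ → ℕ → ℕ) : Prop :=
  ∀ D < d, (∀ x < n, ∀ y < n, f D x = f D y → x = y) ∧ ∀ x < n, ∀ y < n, R x y → f D x < f D y

/-- `f` draws `S` with the minimum number of fips, using the coordinates from `b D` on in
dimension `D`. -/
structure Good (n : ℕ) (f : ℕ → ℕ → ℕ) (S : Finset ℕ) (b : ℕ → ℕ) : Prop where
  range : ∀ D < d, ∀ x ∈ S, b D ≤ f D x ∧ f D x < b D + S.card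
  inj : ∀ D < d, ∀ x ∈ S, ∀ y ∈ S, f D x = f D y → x = y
  mono : ∀ D < d, ∀ x ∈ S, ∀ y ∈ S, R x y → f D x < f D y
  min : ∀ g, IsDraw d R n g → crossFips d R f S S ≤ crossFips d R g S S

/-- Each `p D` is a permutation of the numbers below `t`. -/
def IsRank (t : ℕ) (p : ℕ → ℕ → ℕ) : Prop :=
  ∀ D < d, (∀ i < t, p D i < t) ∧ ∀ i < t, ∀ j < t, p D i = p D j → i = j

open Classical in
/-- The cost of a pair of parts in a drawing of a quotient. -/
noncomputable def pairCost (B : ℕ) (r w : ℕ → ℕ) (p : ℕ → ℕ → ℕ) (i j : ℕ) : ℕ :=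
  if R (r i) (r j) then (if ∀ D < d, p D i < p D j then 0 else B)
  else if R (r j) (r i) then 0 else if ∀ D < d, p D i < p D j then w i * w j else 0

/-- The cost of a drawing of a quotient with representatives `r` and weights `w`: the weighted
number of fips, and `B` for each violated constraint. -/
noncomputable def quotCost (B t : ℕ) (r w : ℕ → ℕ) (p : ℕ → ℕ → ℕ) : ℕ :=
  ∑ i ∈ Finset.range t, ∑ j ∈ Finset.range t, pairCost d R B r w p i j

variable {d R}

theorem crossFips_self_eq_sum {t : ℕ} {C : ℕ → Finset ℕ} {M : Finset ℕ}
    (hM : ∀ x, x ∈ M ↔ ∃ i < t, x ∈ C i)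
    (hdis : ∀ i < t, ∀ j < t, i ≠ j → Disjoint (C i) (C j)) (f : ℕ → ℕ → ℕ) :
    crossFips d R f M M = ∑ i ∈ Finset.range t, crossFips d R f (C i) (C i) +
      ∑ i ∈ Finset.range t, ∑ j ∈ Finset.range t,
        if i ≠ j then crossFips d R f (C i) (C j) else 0 := by
  classical
  have h1 : crossFips d R f M M = ∑ i ∈ Finset.range t, ∑ j ∈ Finset.range t,
      crossFips d R f (C i) (C j) := by
    rw [← Finset.sum_product']
    unfold crossFips
    rw [← Finset.card_biUnion]
    · congr 1
      ext ⟨x, y⟩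
      simp only [Finset.mem_filter, Finset.mem_product, Finset.mem_biUnion, Finset.mem_range,
        Prod.exists, hM]
      constructor
      · rintro ⟨⟨⟨i, hi, hx⟩, j, hj, hy⟩, h⟩
        exact ⟨i, j, ⟨hi, hj⟩, ⟨hx, hy⟩, h⟩
      · rintro ⟨i, j, ⟨hi, hj⟩, ⟨hx, hy⟩, h⟩
        exact ⟨⟨⟨i, hi, hx⟩, j, hj, hy⟩, h⟩
    · rintro ⟨i, j⟩ hij ⟨i', j'⟩ hij' hne
      simp only [Finset.mem_coe, Finset.mem_product, Finset.mem_range] at hij hij'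
      rw [Function.onFun, Finset.disjoint_left]
      rintro ⟨x, y⟩ h h'
      simp only [Finset.mem_filter, Finset.mem_product] at h h'
      apply hne
      rw [Prod.mk.injEq]
      constructor
      · by_contra hc
        exact Finset.disjoint_left.1 (hdis i hij.1 i' hij'.1 hc) h.1.1 h'.1.1
      · by_contra hc
        exact Finset.disjoint_left.1 (hdis j hij.2 j' hij'.2 hc) h.1.2 h'.1.2
  rw [h1, ← Finset.sum_add_distrib]
  refine Finset.sum_congr rfl fun i hi => ?_
  rw [← Finset.add_sum_erase _ _ hi, ← Finset.add_sum_erase (Finset.range t) (fun j => ite _ _ _) hi]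
  simp only [ne_eq, not_true_eq_false, if_false, zero_add]
  congr 1
  refine Finset.sum_congr rfl fun j hj => ?_
  rw [if_pos (Finset.ne_of_mem_erase hj).symm]

/-- Every drawing yields a drawing of the quotient which is at least as good. -/
theorem exists_rank_le {n t B : ℕ} (hd : 1 ≤ d) {C : ℕ → Finset ℕ} {r : ℕ → ℕ}
    (hne : ∀ i < t, (C i).Nonempty) (hn : ∀ i < t, ∀ x ∈ C i, x < n)
    (hdis : ∀ i < t, ∀ j < t, i ≠ j → Disjoint (C i) (C j))
    (hR : ∀ i < t, ∀ j < t, i ≠ j → ∀ x ∈ C i, ∀ y ∈ C j, (R x y ↔ R (r i) (r j)))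
    (hirr : ∀ x, ¬ R x x) {g : ℕ → ℕ → ℕ} (hg : IsDraw d R n g) :
    ∃ p, IsRank d t p ∧ quotCost d R B t r (fun i => (C i).card) p ≤
      ∑ i ∈ Finset.range t, ∑ j ∈ Finset.range t,
        if i ≠ j then crossFips d R g (C i) (C j) else 0 := by
  classical
  obtain ⟨x, hx, hle⟩ := exists_representatives C hne (Fip d R g)
  have hxinj : ∀ i < t, ∀ j < t, x i = x j → i = j := by
    intro i hi j hj h
    by_contra hc
    exact Finset.disjoint_left.1 (hdis i hi j hj hc) (hx i hi) (h ▸ hx j hj)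
  -- The rank of each representative among all representatives, separately in each dimension.
  let p : ℕ → ℕ → ℕ := fun D i => ((Finset.range t).filter fun l => g D (x l) < g D (x i)).card
  have hp : ∀ D, ∀ i < t, ∀ j < t, p D i < p D j ↔ g D (x i) < g D (x j) := by
    intro D i hi j hj
    have key : ∀ i < t, ∀ j < t, g D (x i) < g D (x j) → p D i < p D j := by
      intro i hi j hj h
      refine Finset.card_lt_card ⟨fun l => ?_, fun hsub => ?_⟩
      · simp only [Finset.mem_filter]
        exact fun hl => ⟨hl.1, hl.2.trans h⟩
      · have := hsub (Finset.mem_filter.2 ⟨Finset.mem_range.2 hi, h⟩)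
        exact lt_irrefl _ (Finset.mem_filter.1 this).2
    constructor
    · intro h
      by_contra hc
      rcases (not_lt.1 hc).lt_or_eq with hc | hc
      · exact absurd (key j hj i hi hc) (by omega)
      · have : p D i = p D j := by simp only [p, hc]
        omega
    · exact key i hi j hj
  refine ⟨p, fun D hD => ⟨fun i hi => ?_, fun i hi j hj h => ?_⟩, ?_⟩
  · have : p D i < (Finset.range t).card := by
      refine Finset.card_lt_card ⟨Finset.filter_subset _ _, fun hsub => ?_⟩
      exact lt_irrefl _ (Finset.mem_filter.1 (hsub (Finset.mem_range.2 hi))).2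
    simpa using this
  · have h1 := hp D i hi j hj
    have h2 := hp D j hj i hi
    have : g D (x i) = g D (x j) := by omega
    exact hxinj i hi j hj ((hg D hD).1 _ (hn i hi _ (hx i hi)) _ (hn j hj _ (hx j hj)) this)
  -- The comparison holds term by term. The penalty `B` is never charged because `g` respects `R`,
  -- so its size does not matter here. Diagonal terms vanish because `1 ≤ d`: no part precedes
  -- itself.
  · refine le_trans (Finset.sum_le_sum fun i hi => Finset.sum_le_sum fun j hj => ?_) hle
    rw [Finset.mem_range] at hi hj
    have hb : (∀ D < d, p D i < p D j) ↔ ∀ D < d, g D (x i) < g D (x j) :=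
      forall₂_congr fun D _ => hp D i hi j hj
    unfold pairCost
    by_cases hij : i = j
    · subst hij
      have : ¬ ∀ D < d, p D i < p D i := fun h => lt_irrefl _ (h 0 (by omega))
      rw [if_neg (hirr _), if_neg (hirr _), if_neg this]
      exact Nat.zero_le _
    · have h1 := hR i hi j hj hij (x i) (hx i hi) (x j) (hx j hj)
      have h2 := hR j hj i hi (Ne.symm hij) (x j) (hx j hj) (x i) (hx i hi)
      simp only [hb]
      split_ifs with h3 h4 h5 h6 h7 h8 h9
      · exact Nat.zero_le _
      · exact Nat.zero_le _
      · exact absurd (fun D hD => (hg D hD).2 _ (hn i hi _ (hx i hi)) _ (hn j hj _ (hx j hj))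
          (h1.2 h3)) h4
      · exact absurd (fun D hD => (hg D hD).2 _ (hn i hi _ (hx i hi)) _ (hn j hj _ (hx j hj))
          (h1.2 h3)) h4
      · exact Nat.zero_le _
      · exact Nat.zero_le _
      · exact le_rfl
      · rename_i hc
        exact absurd ⟨hij, ‹∀ D < d, g D (x i) < g D (x j)›, fun h => ‹¬ R (r i) (r j)› (h1.1 h),
          fun h => ‹¬ R (r j) (r i)› (h2.1 h)⟩ hc
      · exact Nat.zero_le _
      · exact Nat.zero_le _

/-- With weights as lengths, the interval of part `i` ends before that of any later part `j` begins.
-/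
theorem sum_weight_le {t : ℕ} {p w : ℕ → ℕ} {i j : ℕ} (hi : i < t) (h : p i < p j) :
    (∑ l ∈ Finset.range t, if p l < p i then w l else 0) + w i ≤
      ∑ l ∈ Finset.range t, if p l < p j then w l else 0 := by
  rw [← Finset.sum_filter, ← Finset.sum_filter]
  have h1 : i ∉ (Finset.range t).filter fun l => p l < p i := by simp
  rw [add_comm, ← Finset.sum_insert h1]
  refine Finset.sum_le_sum_of_subset fun l hl => ?_
  simp only [Finset.mem_insert, Finset.mem_filter, Finset.mem_range] at hl ⊢
  rcases hl with rfl | hl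
  · exact ⟨hi, h⟩
  · exact ⟨hl.1, hl.2.trans h⟩

/-- Consecutive intervals make all pairs between two parts behave alike, so the cross fips of `f`
are exactly the cost of the optimal quotient drawing `p`, which bounds the cross fips of every
competitor from below; the parts are optimal by assumption. Competitors are drawings of all numbers
below `n`, restricted to the set in question, which lets the same competitor be used for every part.
-/
theorem good_union {n t : ℕ} (hd : 1 ≤ d) {C : ℕ → Finset ℕ} {M : Finset ℕ} {r : ℕ → ℕ}
    (hne : ∀ i < t, (C i).Nonempty) (hn : ∀ i < t, ∀ x ∈ C i, x < n)
    (hM : ∀ x, x ∈ M ↔ ∃ i < t, x ∈ C i)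
    (hdis : ∀ i < t, ∀ j < t, i ≠ j → Disjoint (C i) (C j))
    (hR : ∀ i < t, ∀ j < t, i ≠ j → ∀ x ∈ C i, ∀ y ∈ C j, (R x y ↔ R (r i) (r j)))
    (hirr : ∀ x, ¬ R x x) (hex : ∃ g, IsDraw d R n g) {p : ℕ → ℕ → ℕ} (hp : IsRank d t p)
    (hmin : ∀ q, IsRank d t q → quotCost d R (n * n + 1) t r (fun i => (C i).card) p ≤
      quotCost d R (n * n + 1) t r (fun i => (C i).card) q)
    {f : ℕ → ℕ → ℕ} {b : ℕ → ℕ}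
    (hf : ∀ i < t, Good d R n f (C i) fun D => b D +
      ∑ l ∈ Finset.range t, if p D l < p D i then (C l).card else 0) :
    Good d R n f M b := by
  classical
  have hlow : ∀ g, IsDraw d R n g → quotCost d R (n * n + 1) t r (fun i => (C i).card) p ≤
      ∑ i ∈ Finset.range t, ∑ j ∈ Finset.range t,
        if i ≠ j then crossFips d R g (C i) (C j) else 0 := by
    intro g hg
    obtain ⟨q, hq, hle⟩ := exists_rank_le (B := n * n + 1) hd hne hn hdis hR hirr hg
    exact (hmin q hq).trans hle
  -- A genuine drawing exists and has at most `n * n` fips, so the optimum cannot afford even one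
  -- penalty of `n * n + 1`. Therefore `p` respects all constraints of the quotient.
  have hsmall : quotCost d R (n * n + 1) t r (fun i => (C i).card) p ≤ n * n := by
    obtain ⟨g, hg⟩ := hex
    have h1 := crossFips_self_eq_sum (d := d) (R := R) hM hdis g
    have h2 : crossFips d R g M M ≤ n * n := by
      have h3 : M ⊆ Finset.range n := fun x hx => by
        obtain ⟨i, hi, hx⟩ := (hM x).1 hx
        exact Finset.mem_range.2 (hn i hi x hx)
      calc crossFips d R g M M ≤ (M ×ˢ M).card := Finset.card_filter_le _ _
        _ ≤ (Finset.range n ×ˢ Finset.range n).card :=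
          Finset.card_le_card (Finset.product_subset_product h3 h3)
        _ = n * n := by simp
    have := hlow g hg
    omega
  have hvalid : ∀ i < t, ∀ j < t, R (r i) (r j) → ∀ D < d, p D i < p D j := by
    intro i hi j hj h
    by_contra hc
    have h1 : pairCost d R (n * n + 1) r (fun i => (C i).card) p i j = n * n + 1 := by
      rw [pairCost, if_pos h, if_neg hc]
    have h2 := Finset.single_le_sum (f := fun j => pairCost d R (n * n + 1) r
      (fun i => (C i).card) p i j) (fun _ _ => Nat.zero_le _) (Finset.mem_range.2 hj)
    have h3 := Finset.single_le_sum (f := fun i => ∑ j ∈ Finset.range t,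
      pairCost d R (n * n + 1) r (fun i => (C i).card) p i j)
      (fun _ _ => Nat.zero_le _) (Finset.mem_range.2 hi)
    simp only [quotCost] at hsmall
    omega
  have hlt : ∀ D < d, ∀ i < t, ∀ j < t, p D i < p D j → ∀ x ∈ C i, ∀ y ∈ C j, f D x < f D y := by
    intro D hD i hi j hj h x hx y hy
    have h1 := ((hf i hi).range D hD x hx).2
    have h2 := ((hf j hj).range D hD y hy).1
    have h3 := sum_weight_le (w := fun l => (C l).card) hi h
    omega
  have hlt_iff : ∀ D < d, ∀ i < t, ∀ j < t, i ≠ j → ∀ x ∈ C i, ∀ y ∈ C j,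
      (f D x < f D y ↔ p D i < p D j) := by
    intro D hD i hi j hj hij x hx y hy
    refine ⟨fun h => ?_, fun h => hlt D hD i hi j hj h x hx y hy⟩
    by_contra hc
    rcases (not_lt.1 hc).lt_or_eq with hc | hc
    · exact absurd (hlt D hD j hj i hi hc y hy x hx) (by omega)
    · exact hij ((hp D hD).2 i hi j hj hc.symm)
  have hcross : ∀ i < t, ∀ j < t, i ≠ j → crossFips d R f (C i) (C j) =
      pairCost d R (n * n + 1) r (fun i => (C i).card) p i j := by
    intro i hi j hj hij
    unfold pairCost
    by_cases hb : (∀ D < d, p D i < p D j) ∧ ¬ R (r i) (r j) ∧ ¬ R (r j) (r i)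
    · rw [if_neg hb.2.1, if_neg hb.2.2, if_pos hb.1, ← Finset.card_product]
      unfold crossFips
      rw [Finset.filter_true_of_mem]
      rintro ⟨x, y⟩ hxy
      rw [Finset.mem_product] at hxy
      refine ⟨fun D hD => (hlt_iff D hD i hi j hj hij x hxy.1 y hxy.2).2 (hb.1 D hD), ?_, ?_⟩
      · rw [hR i hi j hj hij x hxy.1 y hxy.2]; exact hb.2.1
      · rw [hR j hj i hi hij.symm y hxy.2 x hxy.1]; exact hb.2.2
    · have h0 : crossFips d R f (C i) (C j) = 0 := by
        unfold crossFips
        rw [Finset.card_eq_zero, Finset.filter_eq_empty_iff]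
        rintro ⟨x, y⟩ hxy h
        rw [Finset.mem_product] at hxy
        refine hb ⟨fun D hD => (hlt_iff D hD i hi j hj hij x hxy.1 y hxy.2).1 (h.1 D hD), ?_, ?_⟩
        · rw [← hR i hi j hj hij x hxy.1 y hxy.2]; exact h.2.1
        · rw [← hR j hj i hi hij.symm y hxy.2 x hxy.1]; exact h.2.2
      rw [h0]
      split_ifs with h1 h2 h3 h4
      · rfl
      · exact absurd (hvalid i hi j hj h1) h2
      · rfl
      · exact absurd ⟨h4, h1, h3⟩ hb
      · rfl
  refine ⟨?_, ?_, ?_, ?_⟩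
  · intro D hD x hx
    obtain ⟨i, hi, hx⟩ := (hM x).1 hx
    have h1 := (hf i hi).range D hD x hx
    have h2 : (∑ l ∈ Finset.range t, if p D l < p D i then (C l).card else 0) + (C i).card ≤
        M.card := by
      have hMc : M = (Finset.range t).biUnion C := by
        ext y; simp [hM]
      rw [hMc, Finset.card_biUnion (fun i hi j hj hij => hdis i (Finset.mem_range.1 hi) j
        (Finset.mem_range.1 hj) hij), ← Finset.sum_filter]
      have h1 : i ∉ (Finset.range t).filter fun l => p D l < p D i := by simp
      rw [add_comm, ← Finset.sum_insert (f := fun l => (C l).card) h1]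
      refine Finset.sum_le_sum_of_subset fun l hl => ?_
      simp only [Finset.mem_insert, Finset.mem_filter, Finset.mem_range] at hl ⊢
      rcases hl with rfl | hl
      · exact hi
      · exact hl.1
    omega
  · intro D hD x hx y hy h
    obtain ⟨i, hi, hx⟩ := (hM x).1 hx
    obtain ⟨j, hj, hy⟩ := (hM y).1 hy
    by_cases hij : i = j
    · subst hij
      exact (hf i hi).inj D hD x hx y hy h
    · have h1 := hlt_iff D hD i hi j hj hij x hx y hy
      have h2 := hlt_iff D hD j hj i hi (Ne.symm hij) y hy x hx
      have : p D i = p D j := by omega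
      exact absurd ((hp D hD).2 i hi j hj this) hij
  · intro D hD x hx y hy h
    obtain ⟨i, hi, hx⟩ := (hM x).1 hx
    obtain ⟨j, hj, hy⟩ := (hM y).1 hy
    by_cases hij : i = j
    · subst hij
      exact (hf i hi).mono D hD x hx y hy h
    · exact hlt D hD i hi j hj (hvalid i hi j hj ((hR i hi j hj hij x hx y hy).1 h) D hD) x hx y hy
  · intro g hg
    rw [crossFips_self_eq_sum hM hdis f, crossFips_self_eq_sum hM hdis g]
    refine add_le_add (Finset.sum_le_sum fun i hi => (hf i (Finset.mem_range.1 hi)).min g hg)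
      (le_trans (Finset.sum_le_sum fun i hi => Finset.sum_le_sum fun j hj => ?_) (hlow g hg))
    split_ifs with hij
    · exact (hcross i (Finset.mem_range.1 hi) j (Finset.mem_range.1 hj) hij).le
    · exact Nat.zero_le _

end

/-! ### Mixed radix numbers -/

/-- The number with digits `c 0, …, c (L - 1)` in the mixed radix `ρ`. -/
def radixVal (ρ c : ℕ → ℕ) (L : ℕ) : ℕ := ∑ l ∈ Finset.range L, c l * ∏ m ∈ Finset.range l, ρ m

theorem radixVal_lt {ρ c : ℕ → ℕ} {L : ℕ} (hc : ∀ l < L, c l < ρ l) :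
    radixVal ρ c L < ∏ m ∈ Finset.range L, ρ m := by
  induction L with
  | zero => simp [radixVal]
  | succ L ih =>
    have h1 := ih fun l hl => hc l (by omega)
    have h2 := hc L (by omega)
    rw [radixVal, Finset.sum_range_succ, Finset.prod_range_succ]
    rw [radixVal] at h1
    have h3 := Nat.mul_le_mul_right (∏ m ∈ Finset.range L, ρ m) h2
    rw [Nat.succ_mul] at h3
    rw [mul_comm _ (ρ L)]
    omega

theorem radixVal_inj {ρ c c' : ℕ → ℕ} {L : ℕ} (hc : ∀ l < L, c l < ρ l)
    (hc' : ∀ l < L, c' l < ρ l) (h : radixVal ρ c L = radixVal ρ c' L) : ∀ l < L, c l = c' l := by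
  induction L with
  | zero => simp
  | succ L ih =>
    have h1 := radixVal_lt (L := L) fun l hl => hc l (by omega)
    have h2 := radixVal_lt (L := L) fun l hl => hc' l (by omega)
    rw [radixVal, radixVal, Finset.sum_range_succ, Finset.sum_range_succ] at h
    rw [radixVal] at h1 h2
    rw [add_comm, add_comm (∑ l ∈ Finset.range L, c' l * _)] at h
    obtain ⟨h3, h4⟩ := idx_inj h1 h2 h
    intro l hl
    rcases Nat.lt_succ_iff_lt_or_eq.1 hl with hl | rfl
    · exact ih (fun l hl => hc l (by omega)) (fun l hl => hc' l (by omega)) h4 l hl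
    · exact h3

theorem radixVal_max {ρ c : ℕ → ℕ} {L : ℕ} (hc : ∀ l < L, c l + 1 = ρ l) :
    radixVal ρ c L + 1 = ∏ m ∈ Finset.range L, ρ m := by
  induction L with
  | zero => simp [radixVal]
  | succ L ih =>
    have h1 := ih fun l hl => hc l (by omega)
    rw [radixVal] at h1
    rw [radixVal, Finset.sum_range_succ, Finset.prod_range_succ, ← hc L (by omega), mul_add,
      mul_comm (c L)]
    omega

theorem radixVal_incr {ρ c c' : ℕ → ℕ} {i L : ℕ} (hi : i < L) (h1 : ∀ l < i, c l + 1 = ρ l)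
    (h2 : ∀ l < i, c' l = 0) (h3 : c' i = c i + 1) (h4 : ∀ l < L, i < l → c' l = c l) :
    radixVal ρ c' L = radixVal ρ c L + 1 := by
  induction L with
  | zero => omega
  | succ L ih =>
    by_cases hL : i < L
    · have := ih hL fun l hl => h4 l (by omega)
      rw [radixVal, radixVal] at this ⊢
      rw [Finset.sum_range_succ, Finset.sum_range_succ, this, h4 L (by omega) hL]
      omega
    · have : i = L := by omega
      subst this
      have h5 := radixVal_max h1
      rw [radixVal] at h5
      rw [radixVal, radixVal, Finset.sum_range_succ, Finset.sum_range_succ, h3, add_mul,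
        Finset.sum_eq_zero fun l hl => by rw [h2 l (Finset.mem_range.1 hl), zero_mul]]
      omega

/-- Each block of `t` digits is a factorial number system with radices 1, …, t, and there is one
block per dimension. This is where the number of search rounds comes from. -/
theorem prod_radix (d t : ℕ) :
    ∏ m ∈ Finset.range (d * t), (m % t + 1) = t.factorial ^ d := by
  induction d with
  | zero => simp
  | succ d ih =>
    rw [add_mul, one_mul, Finset.prod_range_add, ih, pow_succ, ← Finset.prod_range_add_one_eq_factorial]
    congr 1
    refine Finset.prod_congr rfl fun x hx => ?_
    rw [Finset.mem_range] at hx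
    rw [mul_comm, Nat.mul_add_mod, Nat.mod_eq_of_lt hx]

/-! ### Decoding permutations -/

/-- The positions of the items `0, …, s - 1` after they have been inserted one after the other,
item `i` at position `c i`. -/
def insertPos (c : ℕ → ℕ) : ℕ → ℕ → ℕ
  | 0, _ => 0
  | s + 1, l => if l = s then c s else insertPos c s l + if c s ≤ insertPos c s l then 1 else 0

theorem insertPos_lt {c : ℕ → ℕ} {s : ℕ} (hc : ∀ i < s, c i ≤ i) : ∀ l < s, insertPos c s l < s := by
  induction s with
  | zero => simp
  | succ s ih =>
    intro l hl
    have h1 := hc s (by omega)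
    rw [insertPos]
    split_ifs with h2 h3
    · omega
    all_goals
      have := ih (fun i hi => hc i (by omega)) l (by omega)
      omega

theorem insertPos_inj {c : ℕ → ℕ} {s : ℕ} :
    ∀ l < s, ∀ m < s, insertPos c s l = insertPos c s m → l = m := by
  induction s with
  | zero => simp
  | succ s ih =>
    intro l hl m hm h
    rw [insertPos, insertPos] at h
    by_cases h1 : l = s <;> by_cases h2 : m = s
    · omega
    · rw [if_pos h1, if_neg h2] at h
      split_ifs at h <;> omega
    · rw [if_neg h1, if_pos h2] at h
      split_ifs at h <;> omega
    · rw [if_neg h1, if_neg h2] at h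
      refine ih l (by omega) m (by omega) ?_
      split_ifs at h <;> omega

/-- Inserting item `s` shifts exactly the earlier items at or behind its position. If the code of an
item counts the earlier items that should precede it, then after `s` insertions every item stands at
its rank among the first `s`. -/
theorem insertPos_code {q : ℕ → ℕ} {t : ℕ} (hq : ∀ i < t, ∀ j < t, q i = q j → i = j) :
    ∀ s ≤ t, ∀ l < s,
      insertPos (fun i => ((Finset.range i).filter fun m => q m < q i).card) s l =
        ((Finset.range s).filter fun m => q m < q l).card := by
  intro s
  induction s with
  | zero => simp
  | succ s ih =>
    intro hs l hl
    rw [insertPos]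
    split_ifs with h1 h2
    · subst h1
      rw [Finset.range_add_one, Finset.filter_insert, if_neg (lt_irrefl _)]
    · have h3 := ih (by omega) l (by omega)
      rw [h3] at h2 ⊢
      have h4 : q s < q l := by
        by_contra hc
        have h5 : q l ≠ q s := fun h => h1 (hq l (by omega) s (by omega) h)
        refine absurd (Finset.card_lt_card ⟨?_, ?_⟩) (not_lt.2 h2)
        · intro m
          simp only [Finset.mem_filter]
          exact fun hm => ⟨hm.1, by omega⟩
        · intro hsub
          have := Finset.mem_filter.1 (hsub (Finset.mem_filter.2
            ⟨Finset.mem_range.2 (show l < s by omega), show q l < q s by omega⟩))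
          exact lt_irrefl _ this.2
      rw [Finset.range_add_one, Finset.filter_insert, if_pos h4, Finset.card_insert_of_notMem]
      simp
    · have h3 := ih (by omega) l (by omega)
      rw [h3] at h2 ⊢
      have h4 : ¬ q s < q l := by
        intro hc
        refine h2 (Finset.card_le_card fun m => ?_)
        simp only [Finset.mem_filter]
        exact fun hm => ⟨hm.1, by omega⟩
      rw [Finset.range_add_one, Finset.filter_insert, if_neg h4, add_zero]

theorem card_filter_lt_eq {q : ℕ → ℕ} {t : ℕ} (hlt : ∀ i < t, q i < t)
    (hq : ∀ i < t, ∀ j < t, q i = q j → i = j) {l : ℕ} (hl : l < t) :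
    ((Finset.range t).filter fun m => q m < q l).card = q l := by
  have h1 : (((Finset.range t).filter fun m => q m < q l).image q) = Finset.range (q l) := by
    ext x
    simp only [Finset.mem_image, Finset.mem_filter, Finset.mem_range]
    constructor
    · rintro ⟨m, ⟨_, h⟩, rfl⟩
      exact h
    · intro hx
      obtain ⟨i, hi, h⟩ := surj_of_inj hlt hq x (hx.trans (hlt l hl))
      exact ⟨i, ⟨hi, by omega⟩, h⟩
  rw [← Finset.card_image_of_injOn (f := q), h1, Finset.card_range]
  intro i hi j hj h
  simp only [Finset.coe_filter, Finset.mem_range, Set.mem_ofPred_eq] at hi hj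
  exact hq i hi.1 j hj.1 h

/-- The drawing of a quotient with `t` parts given by a list of digits. -/
def decode (t : ℕ) (c : ℕ → ℕ) (D i : ℕ) : ℕ := insertPos (fun i => c (D * t + i)) t i

theorem decode_isRank {d t : ℕ} {c : ℕ → ℕ} (hc : ∀ l < d * t, c l < l % t + 1) :
    IsRank d t (decode t c) := by
  intro D hD
  refine ⟨fun i hi => insertPos_lt (fun j hj => ?_) i hi, insertPos_inj⟩
  have := hc (D * t + j) (idx_lt hD hj)
  rw [mul_comm, Nat.mul_add_mod, Nat.mod_eq_of_lt hj] at this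
  rw [mul_comm]; omega

/-- Surjectivity of the decoding, which makes the search exhaustive. Injectivity is not needed. -/
theorem exists_code {d t : ℕ} {q : ℕ → ℕ → ℕ} (hq : IsRank d t q) :
    ∃ c : ℕ → ℕ, (∀ l < d * t, c l < l % t + 1) ∧ ∀ D < d, ∀ i < t, decode t c D i = q D i := by
  refine ⟨fun l => ((Finset.range (l % t)).filter fun m => q (l / t) m < q (l / t) (l % t)).card,
    ?_, ?_⟩
  · intro l _
    have := Finset.card_filter_le (Finset.range (l % t)) fun m => q (l / t) m < q (l / t) (l % t)
    rw [Finset.card_range] at this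
    exact Nat.lt_succ_of_le this
  · intro D hD i hi
    have h1 : ∀ s ≤ t, ∀ i < s, insertPos (fun i => ((Finset.range ((D * t + i) % t)).filter
        fun m => q ((D * t + i) / t) m < q ((D * t + i) / t) ((D * t + i) % t)).card) s i =
        insertPos (fun i => ((Finset.range i).filter fun m => q D m < q D i).card) s i := by
      intro s
      induction s with
      | zero => simp
      | succ s ih =>
        intro hs i hi
        have h2 : (D * t + s) % t = s := by
          rw [mul_comm, Nat.mul_add_mod, Nat.mod_eq_of_lt (by omega)]
        have h3 : (D * t + s) / t = D := by
          rw [mul_comm, Nat.mul_add_div (by omega), Nat.div_eq_of_lt (by omega), add_zero]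
        rw [insertPos, insertPos, h2, h3]
        by_cases hi' : i = s
        · simp [hi']
        · rw [if_neg hi', if_neg hi', ih (by omega) i (by omega)]
    rw [decode, h1 t le_rfl i hi, insertPos_code (hq D hD).2 t le_rfl i hi,
      card_filter_lt_eq (hq D hD).1 (hq D hD).2 hi]

/-! ### Exhaustive search for the best drawing of a quotient -/

notation "aRep" => (50 : ℕ)
notation "aWgt" => (51 : ℕ)
notation "xT" => (52 : ℕ)
notation "aDig" => (53 : ℕ)
notation "aPos" => (54 : ℕ)
notation "aBest" => (55 : ℕ)
notation "xBest" => (56 : ℕ)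
notation "xGo" => (57 : ℕ)
notation "xCost" => (58 : ℕ)
notation "xB" => (59 : ℕ)
notation "xK" => (60 : ℕ)
notation "xP" => (61 : ℕ)
notation "xQ" => (62 : ℕ)

/-- Turns the digits into positions. -/
def decodeProg : Prog :=
  forLoop xK 0 vD (forLoop xP 0 (sv xT)
    (.assign aPos (sv xK * sv xT + sv xP) (.cell aDig (sv xK * sv xT + sv xP)) ;;
     forLoop xQ 0 (sv xP)
      (.assign aPos (sv xK * sv xT + sv xQ) (.cell aPos (sv xK * sv xT + sv xQ) +
        (1 - (.cell aPos (sv xK * sv xT + sv xP) - .cell aPos (sv xK * sv xT + sv xQ)))))))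

theorem decodeProg_ok {W d t : ℕ} {σ : Store} (hd : σ 0 2 = d) (ht : σ xT 0 = t)
    (hdig : ∀ l < d * t, σ aDig l < l % t + 1) (h1d : 1 ≤ d) (h1t : 1 ≤ t)
    (hW : d * t + d + t + 1 ≤ W) :
    Ok W decodeProg σ (d * (t * (t * 60 + 40) + 30) + 10) fun τ =>
      ∀ D < d, ∀ i < t, τ aPos (D * t + i) = decode t (σ aDig) D i := by
  have hdig' : ∀ D < d, ∀ i < t, σ aDig (D * t + i) ≤ i := by
    intro D hD j hj
    have := hdig (D * t + j) (idx_lt hD hj)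
    rw [mul_comm, Nat.mul_add_mod, Nat.mod_eq_of_lt hj] at this
    rw [mul_comm]; omega
  refine Ok.for_const 0 d (t * (t * 60 + 40) + 10)
    (fun k τ => ∀ D < k, ∀ i < t, τ aPos (D * t + i) = decode t (σ aDig) D i)
    rfl (Nat.zero_le _) (by omega) (by decide) ?_ ?_ ?_ ?_ ?_
  · intro τ hs
    simp [hs 0 (by decide), hd]
  · simp
  · intro D τ _ hD hτD hs hI
    have e0 : τ 0 = σ 0 := hs 0 (by decide)
    have eT : τ xT = σ xT := hs xT (by decide)
    have eG : τ aDig = σ aDig := hs aDig (by decide)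
    refine Ok.for_const 0 t (t * 60 + 25)
      (fun s υ => (∀ D' < D, ∀ i < t, υ aPos (D' * t + i) = decode t (σ aDig) D' i) ∧
        ∀ i < s, υ aPos (D * t + i) = insertPos (fun i => σ aDig (D * t + i)) s i)
      rfl (Nat.zero_le _) (by omega) (by decide) ?_ ?_ ?_ ?_ ?_
    · intro υ hυ
      simp [hυ xT (by decide), eT, ht]
    · simpa using hI
    · intro s υ _ hst hυs hυ ⟨hJ1, hJ2⟩
      have fT : υ xT = σ xT := (hυ xT (by decide)).trans eT
      have fG : υ aDig = σ aDig := (hυ aDig (by decide)).trans eG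
      have fK : υ xK 0 = D := by rw [hυ xK (by decide), hτD]
      have hc := hdig' D hD s hst
      have hidx := idx_lt hD hst
      refine Ok.time (T := 20 + (s * 55 + 10)) ?_ (by nlinarith)
      refine Ok.seq (Q := fun ω => ω = υ.write aPos (D * t + s) (σ aDig (D * t + s)))
        (Ok.of_wp ?_ (by decide)) ?_
      · simp only [Prog.wp, Expr.eval_cell, Expr.eval_ofNat, Expr.eval_add, Expr.eval_mul,
          fT, ht, fK, hυs, fG]
        exact ⟨by omega, by omega, trivial⟩
      rintro ω - rfl
      refine Ok.for_const 0 s 40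
        (fun k ω => (∀ D' < D, ∀ i < t, ω aPos (D' * t + i) = decode t (σ aDig) D' i) ∧
          ω aPos (D * t + s) = σ aDig (D * t + s) ∧
          ∀ i < s, ω aPos (D * t + i) = if i < k then
            insertPos (fun i => σ aDig (D * t + i)) (s + 1) i else
            insertPos (fun i => σ aDig (D * t + i)) s i)
        rfl (Nat.zero_le _) (by omega) (by decide) ?_ ?_ ?_ ?_ ?_
      · intro ω hω
        simp [hω xP (by decide), hυs]
      · refine ⟨fun D' hD' i hi => ?_, by simp, fun i hi => ?_⟩
        · rw [Store.write_ne _ _ _ (by decide), Store.write_same, Function.update_of_ne,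
            hJ1 D' hD' i hi]
          intro h
          have := (idx_inj hi hst h).1
          omega
        · rw [Store.write_ne _ _ _ (by decide), Store.write_same, Function.update_of_ne
            (by omega), if_neg (by omega), hJ2 i hi]
      · intro k ω _ hk hωk hω ⟨hL1, hL2, hL3⟩
        have gT : ω xT 0 = t := by
          rw [hω xT (by decide), Store.write_ne _ _ _ (by decide), fT, ht]
        have gK : ω xK 0 = D := by
          rw [hω xK (by decide), Store.write_ne _ _ _ (by decide), fK]
        have gP : ω xP 0 = s := by
          rw [hω xP (by decide), Store.write_ne _ _ _ (by decide), hυs]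
        have hidx' := idx_lt hD (show k < t by omega)
        have hval := insertPos_lt (c := fun i => σ aDig (D * t + i)) (s := s)
          (fun i hi => hdig' D hD i (by omega)) k hk
        have hk1 : ω aPos (D * t + k) = insertPos (fun i => σ aDig (D * t + i)) s k := by
          rw [hL3 k hk, if_neg (lt_irrefl _)]
        refine Ok.of_wp ?_ (by decide)
        simp only [Prog.wp, Expr.eval_cell, Expr.eval_ofNat, Expr.eval_add, Expr.eval_mul,
          Expr.eval_sub, gT, gK, gP, hωk, hk1, hL2]
        refine ⟨by omega, by omega, ?_, ?_, ?_⟩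
        · intro D' hD' i hi
          rw [Store.write_ne _ _ _ (by decide), Store.write_same, Function.update_of_ne,
            hL1 D' hD' i hi]
          intro h
          have := (idx_inj hi (show k < t by omega) h).1
          omega
        · rw [Store.write_ne _ _ _ (by decide), Store.write_same, Function.update_of_ne
            (by omega), hL2]
        · intro i hi
          rw [Store.write_ne _ _ _ (by decide), Store.write_same, Function.update_apply]
          by_cases hik : i = k
          · subst hik
            rw [if_pos rfl, if_pos (by omega), insertPos, if_neg (by omega)]
            -- With truncated subtraction, `1 - (c - x)` equals 1 exactly if `c ≤ x`, which is the
            -- shift caused by inserting at position `c`.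
            congr 1
            split_ifs with h <;> omega
          · rw [if_neg (by omega), hL3 i hi]
            by_cases h : i < k
            · rw [if_pos h, if_pos (by omega)]
            · rw [if_neg h, if_neg (by omega)]
      · simp only [Expr.cost]
        show (s - 0) * (40 + 2 + 11) + (1 + 2 + 6) ≤ _
        omega
      · intro ω _ _ ⟨hL1, hL2, hL3⟩
        refine ⟨fun D' hD' i hi => ?_, fun i hi => ?_⟩
        · rw [Store.write_ne _ _ _ (by decide), hL1 D' hD' i hi]
        · rw [Store.write_ne _ _ _ (by decide)]
          rcases Nat.lt_succ_iff_lt_or_eq.1 hi with hi | rfl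
          · rw [hL3 i hi, if_pos hi]
          · rw [hL2, insertPos, if_pos rfl]
    · show (t - 0) * (t * 60 + 25 + 2 + 11) + (1 + 2 + 6) ≤ _
      rw [Nat.sub_zero]; nlinarith
    · intro υ _ _ ⟨hJ1, hJ2⟩ D' hD' i hi
      rw [Store.write_ne _ _ _ (by decide)]
      rcases Nat.lt_succ_iff_lt_or_eq.1 hD' with hD' | rfl
      · exact hJ1 D' hD' i hi
      · exact hJ2 i hi
  · show (d - 0) * (t * (t * 60 + 40) + 10 + 2 + 11) + (1 + 2 + 6) ≤ _
    rw [Nat.sub_zero]; nlinarith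
  · intro τ _ _ h
    exact h

/-- Computes the cost of a drawing of the quotient. -/
def costProg : Prog :=
  setv xCost 0 ;;
  forLoop xP 0 (sv xT) (forLoop xQ 0 (sv xT)
    (setv xB 1 ;;
     forLoop xK 0 vD
      (.cond (.cell aPos (sv xK * sv xT + sv xQ) - .cell aPos (sv xK * sv xT + sv xP)) .skip
        (setv xB 0)) ;;
     .cond (.cell aMtx (.cell aRep (sv xP) * vN + .cell aRep (sv xQ)))
      (setv xCost (sv xCost + (1 - sv xB) * (vN * vN + 1)))
      (.cond (.cell aMtx (.cell aRep (sv xQ) * vN + .cell aRep (sv xP))) .skip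
        (setv xCost (sv xCost + sv xB * (.cell aWgt (sv xP) * .cell aWgt (sv xQ)))))))

theorem pairCost_le {d n : ℕ} {R : ℕ → ℕ → Prop} {r w : ℕ → ℕ} {p : ℕ → ℕ → ℕ} {i j : ℕ}
    (hi : w i ≤ n) (hj : w j ≤ n) : pairCost d R (n * n + 1) r w p i j ≤ n * n + 1 := by
  have := Nat.mul_le_mul hi hj
  unfold pairCost
  split_ifs <;> omega

theorem quotCost_le {d n t : ℕ} {R : ℕ → ℕ → Prop} {r w : ℕ → ℕ} {p : ℕ → ℕ → ℕ}
    (hw : ∀ i < t, w i ≤ n) : quotCost d R (n * n + 1) t r w p ≤ t * (t * (n * n + 1)) := by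
  unfold quotCost
  refine (Finset.sum_le_card_nsmul _ _ (t * (n * n + 1)) fun i hi => ?_).trans (by simp)
  refine (Finset.sum_le_card_nsmul _ _ (n * n + 1) fun j hj => ?_).trans (by simp)
  exact pairCost_le (hw i (Finset.mem_range.1 hi)) (hw j (Finset.mem_range.1 hj))

theorem costProg_ok {W n d t : ℕ} {σ : Store} {R : ℕ → ℕ → Prop}
    (hn : σ 0 0 = n) (hd : σ 0 2 = d) (ht : σ xT 0 = t)
    (hR : ∀ x < n, ∀ y < n, (σ aMtx (x * n + y) ≠ 0 ↔ R x y))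
    (hr : ∀ i < t, σ aRep i < n) (hw : ∀ i < t, σ aWgt i ≤ n) (h1d : 1 ≤ d)
    (hW : t * (t * (n * n + 1)) + d + t + 1 ≤ W) :
    Ok W costProg σ (t * (t * (d * 60 + 120) + 30) + 20) fun τ =>
      τ xCost 0 = quotCost d R (n * n + 1) t (σ aRep) (σ aWgt) fun D i => σ aPos (D * t + i) := by
  classical
  set p : ℕ → ℕ → ℕ := fun D i => σ aPos (D * t + i) with hp
  set c : ℕ → ℕ → ℕ := fun i j => pairCost d R (n * n + 1) (σ aRep) (σ aWgt) p i j with hc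
  have hcle : ∀ i < t, ∀ j < t, c i j ≤ n * n + 1 := fun i hi j hj =>
    pairCost_le (hw i hi) (hw j hj)
  have hrow : ∀ i < t, ∀ s ≤ t, ∑ j ∈ Finset.range s, c i j ≤ s * (n * n + 1) := by
    intro i hi s hs
    refine (Finset.sum_le_card_nsmul _ _ (n * n + 1) fun j hj => ?_).trans (by simp)
    exact hcle i hi j (by have := Finset.mem_range.1 hj; omega)
  have htot : ∀ s ≤ t, ∑ i ∈ Finset.range s, ∑ j ∈ Finset.range t, c i j ≤
      s * (t * (n * n + 1)) := by
    intro s hs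
    refine (Finset.sum_le_card_nsmul _ _ (t * (n * n + 1)) fun i hi => ?_).trans (by simp)
    exact hrow i (by have := Finset.mem_range.1 hi; omega) t le_rfl
  refine Ok.time (T := 5 + (t * (t * (d * 60 + 120) + 30) + 10)) ?_ (by omega)
  refine Ok.seq (Q := fun τ => τ = σ.write xCost 0 0) (Ok.of_wp ?_ (by decide)) ?_
  · simp only [Prog.wp, Expr.eval_ofNat]
    exact ⟨by omega, by omega, trivial⟩
  rintro σ' - rfl
  refine Ok.for_const 0 t (t * (d * 60 + 120) + 10)
    (fun s τ => τ xCost 0 = ∑ i ∈ Finset.range s, ∑ j ∈ Finset.range t, c i j)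
    rfl (Nat.zero_le _) (by omega) (by decide) ?_ ?_ ?_ ?_ ?_
  · intro τ hs
    simp [hs xT (by decide), ht]
  · simp
  · intro i τ _ hi hτi hs hI
    have e0 : τ 0 = σ 0 := hs 0 (by decide)
    have eT : τ xT = σ xT := hs xT (by decide)
    have eM : τ aMtx = σ aMtx := hs aMtx (by decide)
    have eR : τ aRep = σ aRep := hs aRep (by decide)
    have eW : τ aWgt = σ aWgt := hs aWgt (by decide)
    have eP : τ aPos = σ aPos := hs aPos (by decide)
    refine Ok.for_const 0 t (d * 60 + 100)
      (fun s τ => τ xCost 0 = ∑ i ∈ Finset.range i, ∑ j ∈ Finset.range t, c i j +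
        ∑ j ∈ Finset.range s, c i j)
      rfl (Nat.zero_le _) (by omega) (by decide) ?_ ?_ ?_ ?_ ?_
    · intro υ hυ
      simp [hυ xT (by decide), eT, ht]
    · simpa using hI
    · intro j υ _ hj hυj hυ hJ
      have f0 : υ 0 = σ 0 := (hυ 0 (by decide)).trans e0
      have fT : υ xT = σ xT := (hυ xT (by decide)).trans eT
      have fM : υ aMtx = σ aMtx := (hυ aMtx (by decide)).trans eM
      have fR : υ aRep = σ aRep := (hυ aRep (by decide)).trans eR
      have fW : υ aWgt = σ aWgt := (hυ aWgt (by decide)).trans eW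
      have fP : υ aPos = σ aPos := (hυ aPos (by decide)).trans eP
      have fi : υ xP 0 = i := by rw [hυ xP (by decide), hτi]
      refine Ok.time (T := 5 + ((d * 50 + 10) + 80)) ?_ (by omega)
      refine Ok.seq (Q := fun ω => ω = υ.write xB 0 1) (Ok.of_wp ?_ (by decide)) ?_
      · simp only [Prog.wp, Expr.eval_ofNat]
        exact ⟨by omega, by omega, trivial⟩
      rintro ω - rfl
      refine Ok.seq (Q := fun ω => ω xB 0 = if ∀ D < d, p D i < p D j then 1 else 0) ?_ ?_
      · refine Ok.for_const 0 d 26 (fun s ω => ω xB 0 = if ∀ D < s, p D i < p D j then 1 else 0)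
          rfl (Nat.zero_le _) (by omega) (by decide) ?_ ?_ ?_ ?_ ?_
        · intro ω hω
          simp [hω 0 (by decide), f0, hd]
        · simp
        · intro D ω _ hD hωD hω hK
          have gT : ω xT 0 = t := by
            rw [hω xT (by decide), Store.write_ne _ _ _ (by decide), fT, ht]
          have gP : ω aPos = σ aPos := by
            rw [hω aPos (by decide), Store.write_ne _ _ _ (by decide), fP]
          have gi : ω xP 0 = i := by
            rw [hω xP (by decide), Store.write_ne _ _ _ (by decide), fi]
          have gj : ω xQ 0 = j := by
            rw [hω xQ (by decide), Store.write_ne _ _ _ (by decide), hυj]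
          refine Ok.of_wp ?_ (by decide)
          simp only [Prog.wp, Expr.eval_cell, Expr.eval_ofNat, Expr.eval_add, Expr.eval_mul,
            Expr.eval_sub, gT, gi, gj, hωD, gP]
          refine ⟨fun hne => ?_, fun heq => ⟨by omega, by omega, ?_⟩⟩
          · rw [Store.write_ne _ _ _ (by decide), hK]
            congr 1
            refine propext ⟨fun h D' hD' => ?_, fun h D' hD' => h D' (by omega)⟩
            rcases Nat.lt_succ_iff_lt_or_eq.1 hD' with hD' | rfl
            · exact h D' hD'
            · simp only [hp]; omega
          · rw [Store.write_ne _ _ _ (by decide), Store.write_same, Function.update_self, if_neg]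
            intro h
            have := h D (by omega)
            simp only [hp] at this
            omega
        · show (d - 0) * (26 + 2 + 11) + (1 + 2 + 6) ≤ _
          omega
        · intro ω _ _ h
          exact h
      intro ω hω hb
      have g0 : ω 0 = σ 0 := by rw [hω 0 (by decide), Store.write_ne _ _ _ (by decide), f0]
      have gM : ω aMtx = σ aMtx := by
        rw [hω aMtx (by decide), Store.write_ne _ _ _ (by decide), fM]
      have gR : ω aRep = σ aRep := by
        rw [hω aRep (by decide), Store.write_ne _ _ _ (by decide), fR]
      have gW : ω aWgt = σ aWgt := by
        rw [hω aWgt (by decide), Store.write_ne _ _ _ (by decide), fW]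
      have gi : ω xP 0 = i := by
        rw [hω xP (by decide), Store.write_ne _ _ _ (by decide), fi]
      have gj : ω xQ 0 = j := by
        rw [hω xQ (by decide), Store.write_ne _ _ _ (by decide), hυj]
      have gC : ω xCost = υ xCost := by
        rw [hω xCost (by decide), Store.write_ne _ _ _ (by decide)]
      -- Every partial sum is bounded by the maximal conceivable total cost, so the accumulator
      -- always fits into a word.
      have hsum : ∑ i ∈ Finset.range i, ∑ j ∈ Finset.range t, c i j +
          ∑ j ∈ Finset.range j, c i j + c i j ≤ W := by
        have h1 := htot i hi.le
        have h2 := hrow i hi (j + 1) hj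
        rw [Finset.sum_range_succ] at h2
        have h3 : (j + 1) * (n * n + 1) ≤ t * (n * n + 1) := Nat.mul_le_mul_right _ hj
        have h4 : (i + 1) * (t * (n * n + 1)) ≤ t * (t * (n * n + 1)) :=
          Nat.mul_le_mul_right _ hi
        rw [add_mul, one_mul] at h4
        omega
      have hcost : υ xCost 0 + c i j ≤ W := by rw [hJ]; exact hsum
      have h1 := hR _ (hr i hi) _ (hr j hj)
      have h2 := hR _ (hr j hj) _ (hr i hi)
      refine Ok.of_wp ?_ (by decide)
      simp only [Prog.wp, Expr.eval_cell, Expr.eval_ofNat, Expr.eval_add, Expr.eval_mul,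
        Expr.eval_sub, gM, gi, gj, gR, gW, g0, hn, hb, gC]
      rw [Finset.sum_range_succ, ← add_assoc, ← hJ]
      refine ⟨fun h3 => ?_, fun h3 => ⟨fun h4 => ?_, fun h4 => ?_⟩⟩
      · have hcij : c i j = (1 - if ∀ D < d, p D i < p D j then 1 else 0) * (n * n + 1) := by
          simp only [hc, pairCost]
          rw [if_pos (h1.1 h3)]
          split_ifs <;> simp
        rw [← hcij]
        exact ⟨by omega, hcost, by simp⟩
      · have hcij : c i j = 0 := by
          simp only [hc, pairCost]
          rw [if_neg fun h => h1.2 h h3, if_pos (h2.1 h4)]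
        rw [Store.write_ne _ _ _ (by decide), gC, hcij, add_zero]
      · have hcij : c i j = (if ∀ D < d, p D i < p D j then 1 else 0) *
            (σ aWgt i * σ aWgt j) := by
          simp only [hc, pairCost]
          rw [if_neg fun h => h1.2 h h3, if_neg fun h => h2.2 h h4]
          split_ifs <;> simp
        rw [← hcij]
        exact ⟨by omega, hcost, by simp⟩
    · show (t - 0) * (d * 60 + 100 + 2 + 11) + (1 + 2 + 6) ≤ _
      rw [Nat.sub_zero]; nlinarith
    · intro υ _ _ h
      rw [Store.write_ne _ _ _ (by decide), h, Finset.sum_range_succ]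
  · show (t - 0) * (t * (d * 60 + 120) + 10 + 2 + 11) + (1 + 2 + 6) ≤ _
    rw [Nat.sub_zero]; nlinarith
  · intro τ _ _ h
    exact h

/-- Replaces the digits by those of the next number, if there is one, and tells whether there is. -/
def nextProg : Prog :=
  setv xGo 0 ;;
  forLoop xK 0 vD (forLoop xP 0 (sv xT)
    (.cond (sv xGo) .skip
      (.cond (sv xP - .cell aDig (sv xK * sv xT + sv xP))
        (.assign aDig (sv xK * sv xT + sv xP) (.cell aDig (sv xK * sv xT + sv xP) + 1) ;;
          setv xGo 1)
        (.assign aDig (sv xK * sv xT + sv xP) 0))))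

/-- The state of the digits `g` (originally `c`) and of the flag `go` after the first `L` digits
have been treated. -/
def NextInv (ρ c : ℕ → ℕ) (N L : ℕ) (go : ℕ) (g : ℕ → ℕ) : Prop :=
  (go = 0 ∧ (∀ l < L, c l + 1 = ρ l ∧ g l = 0) ∧ ∀ l < N, L ≤ l → g l = c l) ∨
  (go = 1 ∧ ∃ i < L, (∀ l < i, c l + 1 = ρ l ∧ g l = 0) ∧ c i + 1 < ρ i ∧ g i = c i + 1 ∧
    ∀ l < N, i < l → g l = c l)

/-- Increment with carry, digit 0 being the least significant. Maximal digits are reset to 0 until a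
digit can be raised; the flag stays 0 only if all digits were maximal, that is, if the last code has
been reached. -/
theorem nextProg_ok {W d t : ℕ} {σ : Store} (hd : σ 0 2 = d) (ht : σ xT 0 = t)
    (hdig : ∀ l < d * t, σ aDig l < l % t + 1) (h1t : 1 ≤ t) (hW : d * t + d + t + 1 ≤ W) :
    Ok W nextProg σ (d * (t * 80 + 30) + 20) fun τ =>
      (τ xGo 0 = 0 ∧ ∀ l < d * t, σ aDig l + 1 = l % t + 1) ∨
      (τ xGo 0 = 1 ∧ (∀ l < d * t, τ aDig l < l % t + 1) ∧
        radixVal (fun l => l % t + 1) (τ aDig) (d * t) =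
          radixVal (fun l => l % t + 1) (σ aDig) (d * t) + 1) := by
  set ρ : ℕ → ℕ := fun l => l % t + 1 with hρ
  refine Ok.time (T := 5 + (d * (t * 80 + 30) + 10)) ?_ (by omega)
  refine Ok.seq (Q := fun τ => τ = σ.write xGo 0 0) (Ok.of_wp ?_ (by decide)) ?_
  · simp only [Prog.wp, Expr.eval_ofNat]
    exact ⟨by omega, by omega, trivial⟩
  rintro σ' - rfl
  refine Ok.for_const 0 d (t * 80 + 10)
    (fun D τ => NextInv ρ (σ aDig) (d * t) (D * t) (τ xGo 0) (τ aDig))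
    rfl (Nat.zero_le _) (by omega) (by decide) ?_ ?_ ?_ ?_ ?_
  · intro τ hs
    simp [hs 0 (by decide), hd]
  · simp [NextInv]
  · intro D τ _ hD hτD hs hI
    have eT : τ xT 0 = t := by
      rw [hs xT (by decide), Store.write_ne _ _ _ (by decide), ht]
    refine Ok.for_const 0 t 60
      (fun i τ => NextInv ρ (σ aDig) (d * t) (D * t + i) (τ xGo 0) (τ aDig))
      rfl (Nat.zero_le _) (by omega) (by decide) ?_ ?_ ?_ ?_ ?_
    · intro υ hυ
      simp [hυ xT (by decide), eT]
    · simpa using hI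
    · intro i υ _ hi hυi hυ hJ
      have fT : υ xT 0 = t := by rw [hυ xT (by decide), eT]
      have fD : υ xK 0 = D := by rw [hυ xK (by decide), hτD]
      have hidx := idx_lt hD hi
      have hρi : ρ (D * t + i) = i + 1 := by
        simp only [hρ]
        rw [mul_comm, Nat.mul_add_mod, Nat.mod_eq_of_lt hi]
      have hci := hdig _ hidx
      change _ < ρ _ at hci
      rw [hρi] at hci
      refine Ok.of_wp ?_ (by decide)
      simp only [Prog.wp, Expr.eval_cell, Expr.eval_ofNat, Expr.eval_add, Expr.eval_mul,
        Expr.eval_sub, fT, fD, hυi]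
      refine ⟨fun h1 => ?_, fun h1 => ⟨fun h2 => ?_, fun h2 => ?_⟩⟩
      · rw [Store.write_ne _ _ _ (by decide), Store.write_ne _ _ _ (by decide)]
        rcases hJ with hJ | ⟨h3, j, hj, h4⟩
        · exact absurd hJ.1 h1
        · exact Or.inr ⟨h3, j, by omega, h4⟩
      · obtain ⟨h3, h4, h5⟩ : υ xGo 0 = 0 ∧ _ := by
          rcases hJ with hJ | hJ
          · exact hJ
          · exact absurd hJ.1 (by omega)
        have h6 := h5 _ hidx le_rfl
        rw [h6] at h2 ⊢
        refine ⟨by omega, by omega, by omega, by omega, Or.inr ⟨by simp, D * t + i, by omega, ?_⟩⟩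
        simp only [ne_eq, Nat.reduceEqDiff, not_false_eq_true, Store.write_ne, Store.write_same]
        refine ⟨fun l hl => ⟨(h4 l hl).1, ?_⟩, by omega, by simp, fun l hl hl' => ?_⟩
        · rw [Function.update_of_ne (by omega), (h4 l hl).2]
        · rw [Function.update_of_ne (by omega), h5 l hl (by omega)]
      · obtain ⟨h3, h4, h5⟩ : υ xGo 0 = 0 ∧ _ := by
          rcases hJ with hJ | hJ
          · exact hJ
          · exact absurd hJ.1 (by omega)
        have h6 := h5 _ hidx le_rfl
        rw [h6] at h2
        refine ⟨by omega, by omega, Or.inl ⟨by simpa using h3, ?_⟩⟩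
        simp only [ne_eq, Nat.reduceEqDiff, not_false_eq_true, Store.write_ne, Store.write_same]
        refine ⟨fun l hl => ?_, fun l hl hl' => ?_⟩
        · rcases Nat.lt_succ_iff_lt_or_eq.1 (show l < (D * t + i) + 1 by omega) with hl | rfl
          · rw [Function.update_of_ne (by omega)]
            exact h4 l hl
          · exact ⟨by omega, by simp⟩
        · rw [Function.update_of_ne (by omega), h5 l hl (by omega)]
    · show (t - 0) * (60 + 2 + 11) + (1 + 2 + 6) ≤ _
      omega
    · intro υ _ _ h
      rw [Store.write_ne _ _ _ (by decide), Store.write_ne _ _ _ (by decide), add_mul, one_mul]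
      exact h
  · show (d - 0) * (t * 80 + 10 + 2 + 11) + (1 + 2 + 6) ≤ _
    rw [Nat.sub_zero]; nlinarith
  · intro τ _ _ h
    rcases h with ⟨h1, h2, h3⟩ | ⟨h1, i, hi, h2, h3, h4, h5⟩
    · exact Or.inl ⟨h1, fun l hl => (h2 l hl).1⟩
    · refine Or.inr ⟨h1, fun l hl => ?_, radixVal_incr hi (fun l hl => (h2 l hl).1)
        (fun l hl => (h2 l hl).2) h4 h5⟩
      rcases lt_trichotomy l i with h | h | h
      · rw [(h2 l h).2]; omega
      · rw [h, h4]; exact h3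
      · rw [h5 l hl h]; exact hdig l hl

/-- Records a drawing which is better than those seen before. -/
def recordProg : Prog :=
  .cond (sv xBest - sv xCost)
    (setv xBest (sv xCost) ;;
     forLoop xK 0 (vD * sv xT) (.assign aBest (sv xK) (.cell aPos (sv xK))))
    .skip

theorem recordProg_ok {W d t : ℕ} {σ : Store} (hd : σ 0 2 = d) (ht : σ xT 0 = t)
    (hpos : ∀ l < d * t, σ aPos l ≤ W) (hW : d * t + 1 ≤ W) (hcost : σ xBest 0 ≤ W) :
    Ok W recordProg σ (d * (t * 25) + 35) fun τ =>
      τ xBest 0 = min (σ xBest 0) (σ xCost 0) ∧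
      (σ xCost 0 < σ xBest 0 → ∀ l < d * t, τ aBest l = σ aPos l) ∧
      (σ xBest 0 ≤ σ xCost 0 → τ aBest = σ aBest) := by
  refine Ok.cond (T := d * (t * 25) + 27) (fun h => ?_) (fun h => ?_)
    (show 5 + 1 + (d * (t * 25) + 27) ≤ _ by omega)
  · simp only [Expr.eval_cell, Expr.eval_sub, Expr.eval_ofNat] at h
    refine Ok.time (T := 7 + (d * (t * 25) + 12)) ?_ (by omega)
    refine Ok.seq (Q := fun τ => τ = σ.write xBest 0 (σ xCost 0)) (Ok.of_wp ?_ (by decide)) ?_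
    · simp only [Prog.wp, Expr.eval_ofNat, Expr.eval_cell]
      exact ⟨by omega, by omega, trivial⟩
    rintro σ' - rfl
    refine Ok.for_const 0 (d * t) 6
      (fun L τ => ∀ l < L, τ aBest l = σ aPos l)
      rfl (Nat.zero_le _) (by omega) (by decide) ?_ ?_ ?_ ?_ ?_
    · intro τ hs
      simp [hs 0 (by decide), hs xT (by decide), hd, ht]
    · simp
    · intro l τ _ hl hτl hs hI
      have eP : τ aPos = σ aPos := by
        rw [hs aPos (by decide), Store.write_ne _ _ _ (by decide)]
      refine Ok.of_wp ?_ (by decide)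
      simp only [Prog.wp, Expr.eval_ofNat, Expr.eval_cell, hτl, eP]
      refine ⟨by omega, hpos l hl, fun l' hl' => ?_⟩
      simp only [ne_eq, Nat.reduceEqDiff, not_false_eq_true, Store.write_ne, Store.write_same]
      rcases Nat.lt_succ_iff_lt_or_eq.1 hl' with hl' | rfl
      · rw [Function.update_of_ne (by omega), hI l' hl']
      · simp
    · show (d * t - 0) * (6 + 5 + 11) + (1 + 5 + 6) ≤ _
      rw [Nat.sub_zero]; nlinarith
    · intro τ hs _ hI
      refine ⟨?_, fun _ => hI, fun h' => absurd h' (by omega)⟩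
      rw [hs xBest (by decide)]
      simp; omega
  · simp only [Expr.eval_cell, Expr.eval_sub, Expr.eval_ofNat] at h
    refine Ok.of_wp ?_ (show 1 ≤ _ by omega)
    exact ⟨by omega, fun h' => absurd h' (by omega), fun _ => rfl⟩

/-- Finds the best drawing of a quotient by exhaustive search. -/
def searchProg : Prog :=
  forLoop xK 0 (vD * sv xT) (.assign aDig (sv xK) 0) ;;
  setv xBest (vN * vN * (vN * vN + 1) + 1) ;;
  setv xGo 1 ;;
  .loop (sv xGo) (decodeProg ;; costProg ;; recordProg ;; nextProg)

theorem quotCost_congr {d B t : ℕ} {R : ℕ → ℕ → Prop} {r w : ℕ → ℕ} {p q : ℕ → ℕ → ℕ}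
    (h : ∀ D < d, ∀ i < t, p D i = q D i) : quotCost d R B t r w p = quotCost d R B t r w q := by
  classical
  unfold quotCost
  refine Finset.sum_congr rfl fun i hi => Finset.sum_congr rfl fun j hj => ?_
  have : (∀ D < d, p D i < p D j) ↔ ∀ D < d, q D i < q D j :=
    forall₂_congr fun D hD => by
      rw [h D hD i (Finset.mem_range.1 hi), h D hD j (Finset.mem_range.1 hj)]
  simp only [pairCost, this]

theorem IsRank.congr {d t : ℕ} {p q : ℕ → ℕ → ℕ} (hp : IsRank d t p)
    (h : ∀ D < d, ∀ i < t, p D i = q D i) : IsRank d t q := by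
  intro D hD
  refine ⟨fun i hi => h D hD i hi ▸ (hp D hD).1 i hi, fun i hi j hj hij => ?_⟩
  rw [← h D hD i hi, ← h D hD j hj] at hij
  exact (hp D hD).2 i hi j hj hij

/-- The digits run through all `t.factorial ^ d` codes. The recorded cost is at most that of every
code with a smaller number, so when no next code exists it is minimal over all codes, and by
`exists_code` over all drawings of the quotient. -/
theorem searchProg_ok {W n d t : ℕ} {σ : Store} {R : ℕ → ℕ → Prop}
    (hn : σ 0 0 = n) (hd : σ 0 2 = d) (ht : σ xT 0 = t)
    (hR : ∀ x < n, ∀ y < n, (σ aMtx (x * n + y) ≠ 0 ↔ R x y))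
    (hr : ∀ i < t, σ aRep i < n) (hw : ∀ i < t, σ aWgt i ≤ n) (h1d : 1 ≤ d) (h1t : 1 ≤ t)
    (htn : t ≤ n) (hW : n * n * (n * n + 1) + d * t + d + t + 2 ≤ W) :
    Ok W searchProg σ (700 * (d * t ^ 2 * t.factorial ^ d)) fun τ =>
      IsRank d t (fun D i => τ aBest (D * t + i)) ∧
      ∀ q, IsRank d t q →
        quotCost d R (n * n + 1) t (σ aRep) (σ aWgt) (fun D i => τ aBest (D * t + i)) ≤
          quotCost d R (n * n + 1) t (σ aRep) (σ aWgt) q := by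
  set ρ : ℕ → ℕ := fun l => l % t + 1 with hρ
  set c : (ℕ → ℕ → ℕ) → ℕ := quotCost d R (n * n + 1) t (σ aRep) (σ aWgt) with hc
  have htt : t * (t * (n * n + 1)) ≤ n * n * (n * n + 1) := by
    rw [← mul_assoc]
    exact Nat.mul_le_mul_right _ (Nat.mul_le_mul htn htn)
  have hcle : ∀ p, c p < n * n * (n * n + 1) + 1 := fun p =>
    Nat.lt_succ_of_le ((quotCost_le hw).trans htt)
  have hpos : 1 ≤ d * t ^ 2 * t.factorial ^ d := Nat.mul_pos (Nat.mul_pos (by omega)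
    (pow_pos (by omega) 2)) (pow_pos (Nat.factorial_pos t) d)
  have hfac : 1 ≤ t.factorial ^ d := pow_pos (Nat.factorial_pos t) d
  have hdt : d * t ≤ d * t ^ 2 := Nat.mul_le_mul_left _ (by nlinarith)
  have hdt1 : 1 ≤ d * t := Nat.mul_pos h1d h1t
  have hd2 : d ≤ d * t := Nat.le_mul_of_pos_right _ h1t
  have ht2 : t ^ 2 ≤ d * t ^ 2 := Nat.le_mul_of_pos_left _ h1d
  have ht3 : t ≤ d * t ^ 2 := by nlinarith
  have hdt2 : d * t ^ 2 ≤ d * t ^ 2 * t.factorial ^ d := Nat.le_mul_of_pos_right _ hfac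
  refine Ok.time (T := (d * t * 25 + 20) + (30 + (5 + (t.factorial ^ d * (570 * (d * t ^ 2)) + 5))))
    ?_ (by nlinarith)
  refine Ok.seq (Q := fun τ => ∀ l < d * t, τ aDig l = 0) ?_ ?_
  · refine Ok.for_const 0 (d * t) 4 (fun L τ => ∀ l < L, τ aDig l = 0)
      rfl (Nat.zero_le _) (by omega) (by decide) ?_ ?_ ?_ ?_ ?_
    · intro τ hs
      simp [hs 0 (by decide), hs xT (by decide), hd, ht]
    · simp
    · intro l τ _ hl hτl hs hI
      refine Ok.of_wp ?_ (by decide)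
      simp only [Prog.wp, Expr.eval_ofNat, Expr.eval_cell, hτl]
      refine ⟨by omega, by omega, fun l' hl' => ?_⟩
      simp only [ne_eq, Nat.reduceEqDiff, not_false_eq_true, Store.write_ne, Store.write_same]
      rcases Nat.lt_succ_iff_lt_or_eq.1 hl' with hl' | rfl
      · rw [Function.update_of_ne (by omega), hI l' hl']
      · simp
    · show (d * t - 0) * (4 + 5 + 11) + (1 + 5 + 6) ≤ _
      rw [Nat.sub_zero]; nlinarith
    · intro τ _ _ h
      exact h
  intro τ hs hz
  have e0 : τ 0 = σ 0 := hs 0 (by decide)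
  refine Ok.seq (Q := fun υ => υ = τ.write xBest 0 (n * n * (n * n + 1) + 1))
    (Ok.of_wp ?_ (by decide)) ?_
  · simp only [Prog.wp, Expr.eval_ofNat, Expr.eval_cell, Expr.eval_add, Expr.eval_mul, e0, hn]
    exact ⟨by omega, by omega, trivial⟩
  rintro υ - rfl
  refine Ok.seq (Q := fun υ => υ = (τ.write xBest 0 (n * n * (n * n + 1) + 1)).write xGo 0 1)
    (Ok.of_wp ?_ (by decide)) ?_
  · simp only [Prog.wp, Expr.eval_ofNat]
    exact ⟨by omega, by omega, trivial⟩
  rintro υ - rfl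
  -- The initial value of the record exceeds every possible cost, so the first drawing is always
  -- stored; this explains the first alternative in the invariant. The potential is the number of
  -- codes not yet treated times a bound for one round.
  refine Ok.loop
    (fun υ => υ xGo 0 ≤ 1 ∧ υ xBest 0 ≤ n * n * (n * n + 1) + 1 ∧
      (υ xBest 0 = n * n * (n * n + 1) + 1 ∨
        IsRank d t (fun D i => υ aBest (D * t + i)) ∧
          υ xBest 0 = c fun D i => υ aBest (D * t + i)) ∧
      (υ xGo 0 ≠ 0 → (∀ l < d * t, υ aDig l < ρ l) ∧
        ∀ g : ℕ → ℕ, (∀ l < d * t, g l < ρ l) →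
          radixVal ρ g (d * t) < radixVal ρ (υ aDig) (d * t) → υ xBest 0 ≤ c (decode t g)) ∧
      (υ xGo 0 = 0 → ∀ g : ℕ → ℕ, (∀ l < d * t, g l < ρ l) → υ xBest 0 ≤ c (decode t g)))
    (fun υ => if υ xGo 0 = 0 then 0 else
      (t.factorial ^ d - radixVal ρ (υ aDig) (d * t)) * (570 * (d * t ^ 2))) ?_ ?_ ?_ ?_
  · rintro υ hυ ⟨h1, h2, h3, h4, -⟩ hgo
    simp only [Expr.eval_cell, Expr.eval_ofNat] at hgo
    obtain ⟨h4, h5⟩ := h4 hgo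
    have f0 : υ 0 = σ 0 := by
      rw [hυ 0 (by decide), Store.write_ne _ _ _ (by decide), Store.write_ne _ _ _ (by decide), e0]
    have fT : υ xT = σ xT := by
      rw [hυ xT (by decide), Store.write_ne _ _ _ (by decide), Store.write_ne _ _ _ (by decide),
        hs xT (by decide)]
    have fM : υ aMtx = σ aMtx := by
      rw [hυ aMtx (by decide), Store.write_ne _ _ _ (by decide), Store.write_ne _ _ _ (by decide),
        hs aMtx (by decide)]
    have fR : υ aRep = σ aRep := by
      rw [hυ aRep (by decide), Store.write_ne _ _ _ (by decide), Store.write_ne _ _ _ (by decide),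
        hs aRep (by decide)]
    have fW : υ aWgt = σ aWgt := by
      rw [hυ aWgt (by decide), Store.write_ne _ _ _ (by decide), Store.write_ne _ _ _ (by decide),
        hs aWgt (by decide)]
    have hvlt : radixVal ρ (υ aDig) (d * t) < t.factorial ^ d := by
      rw [← prod_radix]; exact radixVal_lt h4
    refine ⟨(d * (t * (t * 60 + 40) + 30) + 10) + ((t * (t * (d * 60 + 120) + 30) + 20) +
      ((d * (t * 25) + 35) + (d * (t * 80 + 30) + 20))), ?_⟩
    refine Ok.seq (decodeProg_ok (f0 ▸ hd) (fT ▸ ht) h4 h1d h1t (by omega)) fun ω hω hdec => ?_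
    have g0 : ω 0 = σ 0 := (hω 0 (by decide)).trans f0
    have gT : ω xT = σ xT := (hω xT (by decide)).trans fT
    have gM : ω aMtx = σ aMtx := (hω aMtx (by decide)).trans fM
    have gR : ω aRep = σ aRep := (hω aRep (by decide)).trans fR
    have gW : ω aWgt = σ aWgt := (hω aWgt (by decide)).trans fW
    have gG : ω aDig = υ aDig := hω aDig (by decide)
    have gB : ω aBest = υ aBest := hω aBest (by decide)
    have gX : ω xBest = υ xBest := hω xBest (by decide)
    refine Ok.seq (costProg_ok (R := R) (g0 ▸ hn) (g0 ▸ hd) (gT ▸ ht) (gM ▸ hR) (gR ▸ hr) (gW ▸ hw)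
      h1d (by omega)) fun π hπ hcost => ?_
    rw [gR, gW] at hcost
    have p0 : π 0 = σ 0 := (hπ 0 (by decide)).trans g0
    have pT : π xT = σ xT := (hπ xT (by decide)).trans gT
    have pG : π aDig = υ aDig := (hπ aDig (by decide)).trans gG
    have pB : π aBest = υ aBest := (hπ aBest (by decide)).trans gB
    have pX : π xBest = υ xBest := (hπ xBest (by decide)).trans gX
    have pP : π aPos = ω aPos := hπ aPos (by decide)
    have hrank := decode_isRank h4
    have hPle : ∀ l < d * t, π aPos l ≤ W := by
      intro l hl
      have h6 : l / t < d := Nat.div_lt_of_lt_mul (by rw [mul_comm]; exact hl)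
      have h7 := hdec (l / t) h6 (l % t) (Nat.mod_lt _ (by omega))
      rw [mul_comm, Nat.div_add_mod] at h7
      rw [pP, h7]
      have := (hrank (l / t) h6).1 (l % t) (Nat.mod_lt _ (by omega))
      omega
    have hcdec : π xCost 0 = c (decode t (υ aDig)) := by
      rw [hcost]
      exact quotCost_congr fun D hD i hi => hdec D hD i hi
    refine Ok.seq (recordProg_ok (p0 ▸ hd) (pT ▸ ht) hPle (by omega) (by rw [pX]; omega))
      fun α hα ⟨hr1, hr2, hr3⟩ => ?_
    have a0 : α 0 = σ 0 := (hα 0 (by decide)).trans p0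
    have aT : α xT = σ xT := (hα xT (by decide)).trans pT
    have aG : α aDig = υ aDig := (hα aDig (by decide)).trans pG
    rw [pX, hcdec] at hr1 hr2 hr3
    refine (nextProg_ok (a0 ▸ hd) (aT ▸ ht) (aG ▸ h4) h1t (by omega)).mono le_rfl fun β hβ hnext => ?_
    have bX : β xBest 0 = min (υ xBest 0) (c (decode t (υ aDig))) := by
      rw [hβ xBest (by decide), hr1]
    have bB : β aBest = α aBest := hβ aBest (by decide)
    rw [aG] at hnext
    have hK : (d * (t * (t * 60 + 40) + 30) + 10) + ((t * (t * (d * 60 + 120) + 30) + 20) +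
      ((d * (t * 25) + 35) + (d * (t * 80 + 30) + 20))) + 3 ≤ 570 * (d * t ^ 2) := by
      nlinarith
    have hbest : β xBest 0 = n * n * (n * n + 1) + 1 ∨
        IsRank d t (fun D i => β aBest (D * t + i)) ∧
          β xBest 0 = c fun D i => β aBest (D * t + i) := by
      right
      rw [bB, bX]
      rcases lt_or_ge (c (decode t (υ aDig))) (υ xBest 0) with h6 | h6
      · have h7 : ∀ D < d, ∀ i < t, decode t (υ aDig) D i = α aBest (D * t + i) := by
          intro D hD i hi
          rw [hr2 h6 _ (idx_lt hD hi), pP, hdec D hD i hi]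
        exact ⟨hrank.congr h7, by rw [min_eq_right h6.le]; exact quotCost_congr h7⟩
      · rw [hr3 h6, pB, min_eq_left h6]
        rcases h3 with h3 | h3
        · have := hcle (decode t (υ aDig))
          omega
        · exact h3
    have hle : ∀ g : ℕ → ℕ, (∀ l < d * t, g l < ρ l) →
        radixVal ρ g (d * t) < radixVal ρ (υ aDig) (d * t) + 1 → β xBest 0 ≤ c (decode t g) := by
      intro g hg hlt
      rw [bX]
      rcases Nat.lt_succ_iff_lt_or_eq.1 hlt with hlt | heq
      · exact (min_le_left _ _).trans (h5 g hg hlt)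
      · have h6 := radixVal_inj hg h4 heq
        refine (min_le_right _ _).trans (quotCost_congr fun D hD i hi => ?_).le
        have h7 : ∀ s ≤ t, ∀ i < s, insertPos (fun i => υ aDig (D * t + i)) s i =
            insertPos (fun i => g (D * t + i)) s i := by
          intro s
          induction s with
          | zero => simp
          | succ s ih =>
            intro hs i hi
            rw [insertPos, insertPos, h6 _ (idx_lt hD (show s < t by omega))]
            by_cases h : i = s
            · simp [h]
            · rw [if_neg h, if_neg h, ih (by omega) i (by omega)]
        exact h7 t le_rfl i hi
    rcases hnext with ⟨hn1, hn2⟩ | ⟨hn1, hn2, hn3⟩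
    · refine ⟨⟨by omega, by rw [bX]; omega, hbest, fun h => absurd hn1 h, fun _ g hg => ?_⟩, ?_⟩
      · refine hle g hg ?_
        rw [radixVal_max hn2]
        exact radixVal_lt hg
      · rw [if_pos hn1, if_neg hgo]
        have h6 : 1 * (570 * (d * t ^ 2)) ≤
            (t.factorial ^ d - radixVal ρ (υ aDig) (d * t)) * (570 * (d * t ^ 2)) :=
          Nat.mul_le_mul_right _ (by omega)
        have h7 : (sv xGo).cost + 1 = 3 := rfl
        omega
    · refine ⟨⟨by omega, by rw [bX]; omega, hbest, fun _ => ⟨hn2, ?_⟩, fun h => by omega⟩, ?_⟩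
      · rw [hn3]
        exact hle
      · change radixVal ρ (β aDig) (d * t) = radixVal ρ (υ aDig) (d * t) + 1 at hn3
        rw [if_neg (by omega), if_neg hgo, hn3]
        have h6 : t.factorial ^ d - radixVal ρ (υ aDig) (d * t) =
            (t.factorial ^ d - (radixVal ρ (υ aDig) (d * t) + 1)) + 1 := by omega
        rw [h6, add_mul _ 1]
        have h7 : (sv xGo).cost + 1 = 3 := rfl
        omega
  · simp only [ne_eq, Nat.reduceEqDiff, not_false_eq_true, Store.write_ne, Store.write_same,
      Function.update_self]
    refine ⟨le_rfl, le_rfl, Or.inl trivial, fun _ => ⟨fun l hl => ?_, fun g _ h => ?_⟩,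
      fun h => by simp at h⟩
    · rw [hz l hl]; exact Nat.succ_pos _
    · have : radixVal ρ (τ aDig) (d * t) = 0 :=
        Finset.sum_eq_zero fun l hl => by rw [hz l (Finset.mem_range.1 hl), zero_mul]
      omega
  · rw [if_neg (by simp)]
    have h7 : (sv xGo).cost + 1 = 3 := rfl
    have := Nat.mul_le_mul_right (570 * (d * t ^ 2)) (Nat.sub_le (t.factorial ^ d)
      (radixVal ρ (((τ.write xBest 0 (n * n * (n * n + 1) + 1)).write xGo 0 1) aDig) (d * t)))
    omega
  · rintro υ - ⟨-, -, h3, -, h5⟩ hgo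
    have h5 := h5 hgo
    have hall : ∀ q, IsRank d t q → υ xBest 0 ≤ c q := by
      intro q hq
      obtain ⟨g, hg, h⟩ := exists_code hq
      exact (h5 g hg).trans (quotCost_congr h).le
    rcases h3 with h3 | ⟨h3, h4⟩
    · have h6 := h5 (fun _ => 0) fun l _ => Nat.succ_pos _
      have := hcle (decode t fun _ => 0)
      omega
    · exact ⟨h3, fun q hq => h4 ▸ hall q hq⟩

/-! ### Modules of a relation -/

open Classical in
/-- How `u` is related to `x`. -/
noncomputable def rl (R : ℕ → ℕ → Prop) (u x : ℕ) : ℕ :=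
  (if R u x then 1 else 0) + 2 * (if R x u then 1 else 0)

/-- No number outside `S` distinguishes two members of `S`. -/
def IsMod (R : ℕ → ℕ → Prop) (S : Finset ℕ) : Prop :=
  ∀ u ∉ S, ∀ x ∈ S, ∀ y ∈ S, rl R u x = rl R u y

theorem rl_eq_iff {R : ℕ → ℕ → Prop} {u x y : ℕ} :
    rl R u x = rl R u y ↔ (R u x ↔ R u y) ∧ (R x u ↔ R y u) := by
  unfold rl
  by_cases h1 : R u x <;> by_cases h2 : R u y <;> by_cases h3 : R x u <;> by_cases h4 : R y u <;>
    simp [h1, h2, h3, h4]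

/-- The value 3 would require a cycle of length two. A pivot therefore splits a task into at most
three pieces, which is why the distribution loop makes three rounds. -/
theorem rl_lt {R : ℕ → ℕ → Prop} (h : ∀ x y, R x y → ¬ R y x) (u x : ℕ) : rl R u x < 3 := by
  unfold rl
  have := h u x
  split_ifs <;> simp_all

/-- The values of `f` on `c, …, e - 1`. -/
def tset (f : ℕ → ℕ) (c e : ℕ) : Finset ℕ := (Finset.Ico c e).image f

theorem mem_tset {f : ℕ → ℕ} {c e x : ℕ} : x ∈ tset f c e ↔ ∃ t, c ≤ t ∧ t < e ∧ f t = x := by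
  simp [tset, and_assoc]

theorem tset_mono {f : ℕ → ℕ} {c e c' e' : ℕ} (h1 : c' ≤ c) (h2 : e ≤ e') :
    tset f c e ⊆ tset f c' e' := by
  intro x
  rw [mem_tset, mem_tset]
  rintro ⟨t, h3, h4, h5⟩
  exact ⟨t, by omega, by omega, h5⟩

theorem tset_congr {f g : ℕ → ℕ} {c e : ℕ} (h : ∀ t, c ≤ t → t < e → f t = g t) :
    tset f c e = tset g c e := by
  refine Finset.image_congr fun t ht => ?_
  simp only [Finset.coe_Ico, Set.mem_Ico] at ht
  exact h t ht.1 ht.2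

/-! ### The state of the refinement algorithm -/

/-- A list of vertices, a stack of tasks and a list of classes.  Task `i` asks for the refinement of
the vertices number `C i, …, E i - 1` by those with numbers in `[A i, B i)` outside this interval;
its result becomes part of class `P i`. -/
structure SplitState where
  perm : ℕ → ℕ
  sp : ℕ
  A : ℕ → ℕ
  B : ℕ → ℕ
  C : ℕ → ℕ
  E : ℕ → ℕ
  P : ℕ → ℕ
  N : ℕ
  rep : ℕ → ℕ
  par : ℕ → ℕ
  siz : ℕ → ℕ

/-- The vertices of task `i`. -/
def SplitState.ts (s : SplitState) (i : ℕ) : Finset ℕ := tset s.perm (s.C i) (s.E i)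

/-- The invariant of the refinement algorithm; `cs j` is the set of vertices of class `j`. -/
structure SplitInv (n : ℕ) (R : ℕ → ℕ → Prop) (s : SplitState) (cs : ℕ → Finset ℕ) : Prop where
  lt : ∀ i < n, s.perm i < n
  inj : ∀ i < n, ∀ j < n, s.perm i = s.perm j → i = j
  task : ∀ i < s.sp, s.A i ≤ s.C i ∧ s.C i < s.E i ∧ s.E i ≤ s.B i ∧ s.B i ≤ n
  sorted : ∀ i < s.sp, ∀ t u, s.C i ≤ t → t ≤ u → u < s.E i → ¬ R (s.perm u) (s.perm t)
  indist : ∀ i < s.sp, ∀ u, u ∉ tset s.perm (s.A i) (s.B i) → ∀ x ∈ s.ts i, ∀ y ∈ s.ts i,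
    rl R u x = rl R u y
  nest : ∀ i j, i < j → j < s.sp →
    (s.A i ≤ s.C j ∧ s.E j ≤ s.B i) ∨ s.E j ≤ s.A i ∨ s.B i ≤ s.C j
  disj : ∀ i j, i < j → j < s.sp → s.E j ≤ s.C i ∨ s.E i ≤ s.C j
  parent : ∀ i < s.sp, s.P i < s.N ∧ s.siz (s.P i) ≠ 1 ∧ s.ts i ⊆ cs (s.P i)
  pos : 1 ≤ s.N
  cs_zero : cs 0 = Finset.range n
  rep_zero : s.rep 0 = n
  siz_zero : s.siz 0 = 0
  par_lt : ∀ j, 1 ≤ j → j < s.N → s.par j < j ∧ s.siz (s.par j) ≠ 1 ∧ cs j ⊆ cs (s.par j)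
  cls : ∀ j, 1 ≤ j → j < s.N → cs j ⊆ Finset.range n ∧ IsMod R (cs j) ∧ (cs j).card = s.siz j ∧
    s.rep j ∈ cs j ∧ ∀ x ∈ cs j, ¬ R x (s.rep j)
  vclass : ∀ j, 1 ≤ j → j < s.N → s.siz j ≠ 1 →
    j + 1 < s.N ∧ s.par (j + 1) = j ∧ cs (j + 1) = {s.rep j}
  cover : ∀ p < s.N, s.siz p ≠ 1 → ∀ x ∈ cs p,
    (∃ j, 1 ≤ j ∧ j < s.N ∧ s.par j = p ∧ x ∈ cs j) ∨ ∃ i < s.sp, s.P i = p ∧ x ∈ s.ts i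
  maxi : ∀ p < s.N, s.siz p ≠ 1 → ∀ M, M.Nonempty → IsMod R M → M ⊆ cs p → s.rep p ∉ M →
    (∃ j, 1 ≤ j ∧ j < s.N ∧ s.par j = p ∧ M ⊆ cs j) ∨ ∃ i < s.sp, s.P i = p ∧ M ⊆ s.ts i
  disjC : ∀ i j, 1 ≤ i → i < s.N → 1 ≤ j → j < s.N → i ≠ j → s.par i = s.par j →
    Disjoint (cs i) (cs j)
  disjT : ∀ j, 1 ≤ j → j < s.N → ∀ i < s.sp, s.par j = s.P i → Disjoint (cs j) (s.ts i)
  count : s.N + ∑ i ∈ Finset.range s.sp, (2 * (s.E i - s.C i) - 1) ≤ 2 * n + 1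

/-- What remains to be done. -/
def SplitState.pot (s : SplitState) : ℕ :=
  ∑ i ∈ Finset.range s.sp, (s.E i - s.C i) * (s.B i - s.A i - 1)

/-- The number of classes which may still be created. -/
def SplitState.rest (s : SplitState) : ℕ :=
  ∑ i ∈ Finset.range s.sp, (2 * (s.E i - s.C i) - 1)

/-- The top task of `s` has been replaced by its refinement by the vertex `z`. -/
structure PivotStep (n : ℕ) (R : ℕ → ℕ → Prop) (s s' : SplitState) (k z a' b' : ℕ) : Prop where
  sp : s.sp = k + 1
  piv : (s.A k < s.C k ∧ z = s.perm (s.A k) ∧ a' = s.A k + 1 ∧ b' = s.B k) ∨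
    (s.E k < s.B k ∧ z = s.perm (s.B k - 1) ∧ a' = s.A k ∧ b' = s.B k - 1)
  perm_out : ∀ t, ¬ (s.C k ≤ t ∧ t < s.E k) → s'.perm t = s.perm t
  perm_in : tset s'.perm (s.C k) (s.E k) = s.ts k
  perm_inj : ∀ t, s.C k ≤ t → t < s.E k → ∀ u, s.C k ≤ u → u < s.E k →
    s'.perm t = s'.perm u → t = u
  le_sp : k ≤ s'.sp
  old : ∀ i < k, s'.A i = s.A i ∧ s'.B i = s.B i ∧ s'.C i = s.C i ∧ s'.E i = s.E i ∧
    s'.P i = s.P i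
  new : ∀ i, k ≤ i → i < s'.sp → s'.A i = a' ∧ s'.B i = b' ∧ s'.P i = s.P k ∧
    s.C k ≤ s'.C i ∧ s'.C i < s'.E i ∧ s'.E i ≤ s.E k ∧
    ∃ r, s'.ts i = (s.ts k).filter fun x => rl R z x = r
  new_sorted : ∀ i, k ≤ i → i < s'.sp → ∀ t u, s'.C i ≤ t → t ≤ u → u < s'.E i →
    ¬ R (s'.perm u) (s'.perm t)
  new_disj : ∀ i j, k ≤ i → i < j → j < s'.sp → s'.E i ≤ s'.C j
  new_cover : ∀ x ∈ s.ts k, ∃ i, k ≤ i ∧ i < s'.sp ∧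
    s'.ts i = (s.ts k).filter fun y => rl R z y = rl R z x
  sum : ∑ i ∈ Finset.Ico k s'.sp, (s'.E i - s'.C i) = s.E k - s.C k
  N : s'.N = s.N
  rep : s'.rep = s.rep
  par : s'.par = s.par
  siz : s'.siz = s.siz

section
variable {n k z a' b' : ℕ} {R : ℕ → ℕ → Prop} {s s' : SplitState} {cs : ℕ → Finset ℕ}

theorem PivotStep.nonempty (h : PivotStep n R s s' k z a' b') (inv : SplitInv n R s cs) :
    k < s'.sp := by
  by_contra hc
  have h1 := h.sum
  rw [Finset.Ico_eq_empty (by omega), Finset.sum_empty] at h1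
  have := inv.task k (by rw [h.sp]; omega)
  omega

theorem sum_range_split {k m : ℕ} (h : k ≤ m) (f : ℕ → ℕ) :
    ∑ i ∈ Finset.range m, f i = ∑ i ∈ Finset.range k, f i + ∑ i ∈ Finset.Ico k m, f i :=
  (Finset.sum_range_add_sum_Ico f h).symm

/-- The lengths of the pieces add up to the length of the task, and there is at least one piece to
subtract 1 for. -/
theorem PivotStep.rest_le (h : PivotStep n R s s' k z a' b') (inv : SplitInv n R s cs) :
    s'.rest ≤ s.rest := by
  have hne := h.nonempty inv
  unfold SplitState.rest
  rw [h.sp, Finset.sum_range_succ, sum_range_split h.le_sp]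
  refine add_le_add (Finset.sum_le_sum fun i hi => ?_) ?_
  · obtain ⟨_, _, h3, h4, _⟩ := h.old i (Finset.mem_range.1 hi)
    rw [h3, h4]
  · have h1 : ∑ i ∈ Finset.Ico k s'.sp, (2 * (s'.E i - s'.C i) - 1) + (s'.sp - k) =
        2 * ∑ i ∈ Finset.Ico k s'.sp, (s'.E i - s'.C i) := by
      rw [Finset.mul_sum]
      have : s'.sp - k = ∑ i ∈ Finset.Ico k s'.sp, 1 := by simp
      rw [this, ← Finset.sum_add_distrib]
      refine Finset.sum_congr rfl fun i hi => ?_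
      rw [Finset.mem_Ico] at hi
      have := h.new i hi.1 hi.2
      omega
    rw [h.sum] at h1
    omega

/-- The total length is preserved while the interval of pivots loses one vertex. The gain is the
length of the task, which pays for distributing its vertices. -/
theorem PivotStep.pot_le (h : PivotStep n R s s' k z a' b') (inv : SplitInv n R s cs) :
    s'.pot + (s.E k - s.C k) ≤ s.pot := by
  unfold SplitState.pot
  have ht := inv.task k (by rw [h.sp]; omega)
  have hab : b' - a' = s.B k - s.A k - 1 := by
    rcases h.piv with ⟨h1, h2, h3, h4⟩ | ⟨h1, h2, h3, h4⟩ <;> omega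
  have hlen : 2 ≤ s.B k - s.A k := by
    rcases h.piv with ⟨h1, h2, h3, h4⟩ | ⟨h1, h2, h3, h4⟩ <;> omega
  rw [h.sp, Finset.sum_range_succ, sum_range_split h.le_sp, add_assoc]
  refine add_le_add (Finset.sum_le_sum fun i hi => ?_) ?_
  · obtain ⟨h1, h2, h3, h4, _⟩ := h.old i (Finset.mem_range.1 hi)
    rw [h1, h2, h3, h4]
  · have h1 : ∑ i ∈ Finset.Ico k s'.sp, (s'.E i - s'.C i) * (s'.B i - s'.A i - 1) =
        (s.E k - s.C k) * (s.B k - s.A k - 2) := by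
      rw [← h.sum, Finset.sum_mul]
      refine Finset.sum_congr rfl fun i hi => ?_
      rw [Finset.mem_Ico] at hi
      obtain ⟨h1, h2, _⟩ := h.new i hi.1 hi.2
      rw [h1, h2, hab]
      congr 1
    rw [h1, show s.B k - s.A k - 1 = (s.B k - s.A k - 2) + 1 by omega, mul_add, mul_one]

theorem PivotStep.tset_eq (h : PivotStep n R s s' k z a' b') {a b : ℕ}
    (hab : (a ≤ s.C k ∧ s.E k ≤ b) ∨ s.E k ≤ a ∨ b ≤ s.C k) :
    tset s'.perm a b = tset s.perm a b := by
  rcases hab with hab | hab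
  · have key : ∀ f : ℕ → ℕ, s.C k ≤ s.E k → ∀ x, x ∈ tset f a b ↔
        x ∈ tset f (s.C k) (s.E k) ∨ ∃ t, (a ≤ t ∧ t < b) ∧ ¬ (s.C k ≤ t ∧ t < s.E k) ∧ f t = x := by
      intro f _ x
      rw [mem_tset, mem_tset]
      constructor
      · rintro ⟨t, h1, h2, h3⟩
        by_cases hc : s.C k ≤ t ∧ t < s.E k
        · exact Or.inl ⟨t, hc.1, hc.2, h3⟩
        · exact Or.inr ⟨t, ⟨h1, h2⟩, hc, h3⟩
      · rintro (⟨t, h1, h2, h3⟩ | ⟨t, h1, _, h3⟩)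
        · exact ⟨t, by omega, by omega, h3⟩
        · exact ⟨t, h1.1, h1.2, h3⟩
    by_cases hce : s.C k ≤ s.E k
    · ext x
      rw [key _ hce, key _ hce, h.perm_in]
      refine or_congr Iff.rfl (exists_congr fun t => and_congr_right fun _ =>
        and_congr_right fun hc => ?_)
      rw [h.perm_out t hc]
    · exact tset_congr fun t h1 h2 => h.perm_out t (by omega)
  · exact tset_congr fun t h1 h2 => h.perm_out t (by omega)

theorem PivotStep.ts_old (h : PivotStep n R s s' k z a' b') (inv : SplitInv n R s cs) {i : ℕ}
    (hi : i < k) : s'.ts i = s.ts i := by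
  obtain ⟨_, _, h3, h4, _⟩ := h.old i hi
  unfold SplitState.ts
  rw [h3, h4]
  refine h.tset_eq (Or.inr ?_)
  exact inv.disj i k hi (by rw [h.sp]; omega)

/-- Reordering the interval of the task changes no set of pivots of another task, because by `nest`
each of these either contains the interval or avoids it. Within a piece all vertices have the same
relation to `z`, so `z` may be dropped from the pivots. Finally, `z` lies outside the task and
cannot distinguish the members of a module inside the task, so such a module lies in one piece; this
preserves `maxi`. -/
theorem PivotStep.inv (h : PivotStep n R s s' k z a' b') (inv : SplitInv n R s cs) :
    SplitInv n R s' cs := by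
  have hk : k < s.sp := by rw [h.sp]; omega
  have htk := inv.task k hk
  have hz_out : z ∉ s.ts k := by
    unfold SplitState.ts
    rw [mem_tset]
    rintro ⟨t, h1, h2, h3⟩
    rcases h.piv with ⟨h4, h5, _⟩ | ⟨h4, h5, _⟩
    · have := inv.inj t (by omega) (s.A k) (by omega) (h3.trans h5)
      omega
    · have := inv.inj t (by omega) (s.B k - 1) (by omega) (h3.trans h5)
      omega
  have hab : s.A k ≤ a' ∧ b' ≤ s.B k ∧ a' ≤ s.C k ∧ s.E k ≤ b' := by
    rcases h.piv with ⟨h1, h2, h3, h4⟩ | ⟨h1, h2, h3, h4⟩ <;> omega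
  have hsub : ∀ i, k ≤ i → i < s'.sp → s'.ts i ⊆ s.ts k := by
    intro i h1 h2
    obtain ⟨_, _, _, _, _, _, r, hr⟩ := h.new i h1 h2
    rw [hr]
    exact Finset.filter_subset _ _
  refine ⟨?_, ?_, ?_, ?_, ?_, ?_, ?_, ?_, ?_, inv.cs_zero, ?_, ?_, ?_, ?_, ?_, ?_, ?_, ?_, ?_, ?_⟩
  · intro i hi
    by_cases hc : s.C k ≤ i ∧ i < s.E k
    · have : s'.perm i ∈ tset s'.perm (s.C k) (s.E k) := mem_tset.2 ⟨i, hc.1, hc.2, rfl⟩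
      rw [h.perm_in] at this
      obtain ⟨t, h1, h2, h3⟩ := mem_tset.1 this
      rw [← h3]
      exact inv.lt t (by omega)
    · rw [h.perm_out i hc]
      exact inv.lt i hi
  · have key : ∀ i < n, ∀ j < n, (s.C k ≤ i ∧ i < s.E k) → ¬ (s.C k ≤ j ∧ j < s.E k) →
        s'.perm i ≠ s'.perm j := by
      intro i hi j hj hci hcj hij
      have : s'.perm i ∈ tset s'.perm (s.C k) (s.E k) := mem_tset.2 ⟨i, hci.1, hci.2, rfl⟩
      rw [h.perm_in] at this
      obtain ⟨t, h1, h2, h3⟩ := mem_tset.1 this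
      rw [hij, h.perm_out j hcj] at h3
      have := inv.inj t (by omega) j hj h3
      omega
    intro i hi j hj hij
    by_cases hci : s.C k ≤ i ∧ i < s.E k <;> by_cases hcj : s.C k ≤ j ∧ j < s.E k
    · exact h.perm_inj i hci.1 hci.2 j hcj.1 hcj.2 hij
    · exact absurd hij (key i hi j hj hci hcj)
    · exact absurd hij.symm (key j hj i hi hcj hci)
    · rw [h.perm_out i hci, h.perm_out j hcj] at hij
      exact inv.inj i hi j hj hij
  · intro i hi
    by_cases hik : i < k
    · obtain ⟨h1, h2, h3, h4, _⟩ := h.old i hik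
      rw [h1, h2, h3, h4]
      exact inv.task i (by omega)
    · obtain ⟨h1, h2, _, h3, h4, h5, _⟩ := h.new i (by omega) hi
      rw [h1, h2]
      omega
  · intro i hi
    by_cases hik : i < k
    · obtain ⟨h1, h2, h3, h4, _⟩ := h.old i hik
      rw [h3, h4]
      intro t u h5 h6 h7
      have h8 := inv.disj i k hik hk
      rw [h.perm_out t (by omega), h.perm_out u (by omega)]
      exact inv.sorted i (by omega) t u h5 h6 h7
    · exact h.new_sorted i (by omega) hi
  · intro i hi u hu
    by_cases hik : i < k
    · obtain ⟨h1, h2, h3, h4, _⟩ := h.old i hik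
      rw [h.ts_old inv hik]
      rw [h1, h2, h.tset_eq (inv.nest i k hik hk)] at hu
      exact inv.indist i (by omega) u hu
    · obtain ⟨h1, h2, _, _, _, _, r, hr⟩ := h.new i (by omega) hi
      rw [h1, h2, h.tset_eq (Or.inl ⟨hab.2.2.1, hab.2.2.2⟩)] at hu
      rw [hr]
      intro x hx y hy
      rw [Finset.mem_filter] at hx hy
      by_cases huz : u = z
      · rw [huz, hx.2, hy.2]
      · refine inv.indist k hk u (fun hu' => ?_) x hx.1 y hy.1
        obtain ⟨t, h3, h4, h5⟩ := mem_tset.1 hu'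
        refine hu (mem_tset.2 ⟨t, ?_, ?_, h5⟩)
        · rcases h.piv with ⟨h6, h7, h8, h9⟩ | ⟨h6, h7, h8, h9⟩
          · have : t ≠ s.A k := by
              rintro rfl
              exact huz (h5.symm.trans h7.symm)
            omega
          · omega
        · rcases h.piv with ⟨h6, h7, h8, h9⟩ | ⟨h6, h7, h8, h9⟩
          · omega
          · have : t ≠ s.B k - 1 := by
              rintro rfl
              exact huz (h5.symm.trans h7.symm)
            omega
  · intro i j hij hj
    by_cases hjk : j < k
    · obtain ⟨h1, h2, h3, h4, _⟩ := h.old i (by omega)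
      obtain ⟨h1', h2', h3', h4', _⟩ := h.old j hjk
      rw [h1, h2, h3', h4']
      exact inv.nest i j hij (by omega)
    · obtain ⟨_, _, _, h3, h4, h5, _⟩ := h.new j (by omega) hj
      by_cases hik : i < k
      · obtain ⟨h1, h2, _⟩ := h.old i hik
        rw [h1, h2]
        have := inv.nest i k hik hk
        omega
      · obtain ⟨h1, h2, _⟩ := h.new i (by omega) (by omega)
        rw [h1, h2]
        omega
  · intro i j hij hj
    by_cases hjk : j < k
    · obtain ⟨h1, h2, h3, h4, _⟩ := h.old i (by omega)
      obtain ⟨h1', h2', h3', h4', _⟩ := h.old j hjk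
      rw [h3, h4, h3', h4']
      exact inv.disj i j hij (by omega)
    · obtain ⟨_, _, _, h3, h4, h5, _⟩ := h.new j (by omega) hj
      by_cases hik : i < k
      · obtain ⟨_, _, h1, h2, _⟩ := h.old i hik
        rw [h1, h2]
        have := inv.disj i k hik hk
        omega
      · exact Or.inr (h.new_disj i j (by omega) hij hj)
  · intro i hi
    rw [h.N, h.siz]
    by_cases hik : i < k
    · obtain ⟨_, _, _, _, h5⟩ := h.old i hik
      rw [h5, h.ts_old inv hik]
      exact inv.parent i (by omega)
    · obtain ⟨_, _, h3, _⟩ := h.new i (by omega) hi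
      rw [h3]
      obtain ⟨h4, h5, h6⟩ := inv.parent k hk
      exact ⟨h4, h5, (hsub i (by omega) hi).trans h6⟩
  · rw [h.N]; exact inv.pos
  · rw [h.rep]; exact inv.rep_zero
  · rw [h.siz]; exact inv.siz_zero
  · rw [h.N, h.par, h.siz]; exact inv.par_lt
  · rw [h.N, h.rep, h.siz]; exact inv.cls
  · rw [h.N, h.rep, h.siz, h.par]; exact inv.vclass
  · rw [h.N, h.siz, h.par]
    intro p hp hp1 x hx
    rcases inv.cover p hp hp1 x hx with h1 | ⟨i, hi, hip, hxi⟩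
    · exact Or.inl h1
    · right
      by_cases hik : i < k
      · refine ⟨i, by have := h.le_sp; omega, ?_, ?_⟩
        · rw [(h.old i hik).2.2.2.2, hip]
        · rw [h.ts_old inv hik]; exact hxi
      · have : i = k := by have := h.sp; omega
        subst this
        obtain ⟨j, h1, h2, h3⟩ := h.new_cover x hxi
        refine ⟨j, h2, (h.new j h1 h2).2.2.1.trans hip, ?_⟩
        rw [h3]
        exact Finset.mem_filter.2 ⟨hxi, rfl⟩
  · rw [h.N, h.siz, h.par, h.rep]
    intro p hp hp1 M hM1 hM2 hM3 hM4
    rcases inv.maxi p hp hp1 M hM1 hM2 hM3 hM4 with h1 | ⟨i, hi, hip, hMi⟩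
    · exact Or.inl h1
    · right
      by_cases hik : i < k
      · refine ⟨i, by have := h.le_sp; omega, ?_, ?_⟩
        · rw [(h.old i hik).2.2.2.2, hip]
        · rw [h.ts_old inv hik]; exact hMi
      · have : i = k := by have := h.sp; omega
        subst this
        obtain ⟨x, hx⟩ := hM1
        obtain ⟨j, h1, h2, h3⟩ := h.new_cover x (hMi hx)
        refine ⟨j, h2, (h.new j h1 h2).2.2.1.trans hip, ?_⟩
        rw [h3]
        intro y hy
        exact Finset.mem_filter.2 ⟨hMi hy, hM2 z (fun hz => hz_out (hMi hz)) y hy x hx⟩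
  · rw [h.N, h.par]; exact inv.disjC
  · rw [h.N, h.par]
    intro j hj1 hj2 i hi hji
    by_cases hik : i < k
    · rw [(h.old i hik).2.2.2.2] at hji
      rw [h.ts_old inv hik]
      exact inv.disjT j hj1 hj2 i (by omega) hji
    · rw [(h.new i (by omega) hi).2.2.1] at hji
      exact (inv.disjT j hj1 hj2 k hk hji).mono_right (hsub i (by omega) hi)
  · have h1 := h.rest_le inv
    have h2 := inv.count
    unfold SplitState.rest at h1
    rw [h.N]
    omega

end

/-- The top task of `s` has been replaced by a class, and by the task to refine this class without
its first vertex if there are other vertices. -/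
structure ClassStep (s s' : SplitState) (k : ℕ) : Prop where
  sp : s.sp = k + 1
  full : s.A k = s.C k ∧ s.E k = s.B k
  perm : s'.perm = s.perm
  old : ∀ i < k, s'.A i = s.A i ∧ s'.B i = s.B i ∧ s'.C i = s.C i ∧ s'.E i = s.E i ∧
    s'.P i = s.P i
  cls : ∀ j < s.N, s'.rep j = s.rep j ∧ s'.par j = s.par j ∧ s'.siz j = s.siz j
  head : s'.rep s.N = s.perm (s.C k) ∧ s'.par s.N = s.P k ∧ s'.siz s.N = s.E k - s.C k
  tail : (s.E k = s.C k + 1 ∧ s'.sp = k ∧ s'.N = s.N + 1) ∨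
    (s.C k + 2 ≤ s.E k ∧ s'.sp = k + 1 ∧ s'.N = s.N + 2 ∧ s'.rep (s.N + 1) = s.perm (s.C k) ∧
      s'.par (s.N + 1) = s.N ∧ s'.siz (s.N + 1) = 1 ∧ s'.A k = s.C k ∧ s'.B k = s.E k ∧
      s'.C k = s.C k + 1 ∧ s'.E k = s.E k ∧ s'.P k = s.N)

/-- The sets of vertices of the classes after the creation of a class. -/
def newSets (s : SplitState) (k : ℕ) (cs : ℕ → Finset ℕ) (j : ℕ) : Finset ℕ :=
  if j = s.N then s.ts k else if j = s.N + 1 then {s.perm (s.C k)} else cs j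

section
variable {n k : ℕ} {R : ℕ → ℕ → Prop} {s s' : SplitState} {cs : ℕ → Finset ℕ}

theorem card_tset {f : ℕ → ℕ} {c e : ℕ}
    (h : ∀ i < e, ∀ j < e, f i = f j → i = j) : (tset f c e).card = e - c := by
  rw [tset, Finset.card_image_of_injOn, Nat.card_Ico]
  intro i hi j hj hij
  simp only [Finset.coe_Ico, Set.mem_Ico] at hi hj
  exact h i hi.2 j hj.2 hij

theorem tset_disjoint {f : ℕ → ℕ} {c e c' e' : ℕ} (h : ∀ i < n, ∀ j < n, f i = f j → i = j)
    (he : e ≤ n) (he' : e' ≤ n) (hd : e ≤ c' ∨ e' ≤ c) :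
    Disjoint (tset f c e) (tset f c' e') := by
  rw [Finset.disjoint_left]
  intro x hx hx'
  obtain ⟨t, h1, h2, h3⟩ := mem_tset.1 hx
  obtain ⟨u, h4, h5, h6⟩ := mem_tset.1 hx'
  have := h t (by omega) u (by omega) (h3.trans h6.symm)
  omega

theorem ClassStep.ts_old (h : ClassStep s s' k) {i : ℕ} (hi : i < k) : s'.ts i = s.ts i := by
  obtain ⟨_, _, h3, h4, _⟩ := h.old i hi
  unfold SplitState.ts
  rw [h3, h4, h.perm]

/-- A task of length l can lead to at most 2l - 1 classes: one for itself and, if l ≥ 2, one for its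
representative and 2(l - 1) - 1 from the task for the rest. -/
theorem ClassStep.rest_lt (h : ClassStep s s' k) (inv : SplitInv n R s cs) :
    s'.rest + (s'.N - s.N) ≤ s.rest ∧ s.N < s'.N := by
  have ht := inv.task k (by rw [h.sp]; omega)
  have h0 : ∑ i ∈ Finset.range k, (2 * (s'.E i - s'.C i) - 1) =
      ∑ i ∈ Finset.range k, (2 * (s.E i - s.C i) - 1) :=
    Finset.sum_congr rfl fun i hi => by
      obtain ⟨_, _, h3, h4, _⟩ := h.old i (Finset.mem_range.1 hi)
      rw [h3, h4]
  unfold SplitState.rest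
  rw [h.sp, Finset.sum_range_succ]
  rcases h.tail with ⟨h1, h2, h3⟩ | ⟨h1, h2, h3, _, _, _, _, _, h4, h5, _⟩
  · rw [h2, h0, h3]
    omega
  · rw [h2, Finset.sum_range_succ, h0, h3, h4, h5]
    omega

theorem ClassStep.pot_le (h : ClassStep s s' k) (inv : SplitInv n R s cs) : s'.pot ≤ s.pot := by
  have ht := inv.task k (by rw [h.sp]; omega)
  have h0 : ∑ i ∈ Finset.range k, (s'.E i - s'.C i) * (s'.B i - s'.A i - 1) =
      ∑ i ∈ Finset.range k, (s.E i - s.C i) * (s.B i - s.A i - 1) :=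
    Finset.sum_congr rfl fun i hi => by
      obtain ⟨h1, h2, h3, h4, _⟩ := h.old i (Finset.mem_range.1 hi)
      rw [h1, h2, h3, h4]
  unfold SplitState.pot
  rw [h.sp, Finset.sum_range_succ]
  rcases h.tail with ⟨h1, h2, h3⟩ | ⟨h1, h2, h3, _, _, _, h6, h7, h4, h5, _⟩
  · rw [h2, h0]
    omega
  · rw [h2, Finset.sum_range_succ, h0, h4, h5, h6, h7, h.full.1, h.full.2]
    refine Nat.add_le_add_left (Nat.mul_le_mul ?_ le_rfl) _
    omega

theorem newSets_of_lt {j : ℕ} (h : j < s.N) : newSets s k cs j = cs j := by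
  unfold newSets
  rw [if_neg (by omega), if_neg (by omega)]

theorem newSets_N : newSets s k cs s.N = s.ts k := if_pos rfl

theorem newSets_succ : newSets s k cs (s.N + 1) = {s.perm (s.C k)} := by
  unfold newSets
  rw [if_neg (by omega), if_pos rfl]

/-- No pivots are left outside the task, so nothing distinguishes its vertices and it is a module.
Its first vertex is minimal because the list is sorted topologically. A module inside the new class
that avoids the representative lies in the task for the remaining vertices, which is how `maxi`
starts for this class. The representative becomes a class of its own under the next number. -/
theorem ClassStep.inv (h : ClassStep s s' k) (inv : SplitInv n R s cs) :
    SplitInv n R s' (newSets s k cs) := by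
  have hk : k < s.sp := by rw [h.sp]; omega
  have ht := inv.task k hk
  obtain ⟨hp1, hp2, hp3⟩ := inv.parent k hk
  obtain ⟨hh1, hh2, hh3⟩ := h.head
  have hmod : IsMod R (s.ts k) := by
    intro u hu
    refine inv.indist k hk u ?_
    rw [h.full.1, ← h.full.2]
    exact hu
  have hts : s.ts k ⊆ Finset.range n := by
    intro x hx
    obtain ⟨t, h1, h2, rfl⟩ := mem_tset.1 hx
    exact Finset.mem_range.2 (inv.lt t (by omega))
  have hcard : (s.ts k).card = s.E k - s.C k :=
    card_tset fun i hi j hj => inv.inj i (by omega) j (by omega)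
  have hmem : s.perm (s.C k) ∈ s.ts k := mem_tset.2 ⟨s.C k, le_rfl, ht.2.1, rfl⟩
  have hmin : ∀ x ∈ s.ts k, ¬ R x (s.perm (s.C k)) := by
    intro x hx
    obtain ⟨t, h1, h2, rfl⟩ := mem_tset.1 hx
    exact inv.sorted k hk _ _ le_rfl h1 h2
  have hNN := (h.rest_lt inv).2
  have hk' : k ≤ s'.sp ∧ s'.sp ≤ k + 1 ∧ s'.N ≤ s.N + 2 := by
    rcases h.tail with ⟨_, h2, h3⟩ | ⟨_, h2, h3, _⟩ <;> omega
  have hiN : ∀ j, j < s'.N → j < s.N ∨ j = s.N ∨ (j = s.N + 1 ∧ s'.sp = k + 1 ∧ s'.siz j = 1 ∧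
      s'.par j = s.N ∧ s'.rep j = s.perm (s.C k)) := by
    intro j hj
    rcases h.tail with ⟨_, h2, h3⟩ | ⟨_, h2, h3, h4, h5, h6, _⟩
    · omega
    · rcases Nat.lt_trichotomy j s.N with hc | hc | hc
      · exact Or.inl hc
      · exact Or.inr (Or.inl hc)
      · have : j = s.N + 1 := by omega
        subst this
        exact Or.inr (Or.inr ⟨rfl, h2, h6, h5, h4⟩)
  have htk : s'.sp = k + 1 → s.C k + 2 ≤ s.E k ∧ s'.N = s.N + 2 ∧ s'.par (s.N + 1) = s.N ∧
      s'.A k = s.C k ∧ s'.B k = s.E k ∧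
      s'.C k = s.C k + 1 ∧ s'.E k = s.E k ∧ s'.P k = s.N ∧
      s'.ts k = tset s.perm (s.C k + 1) (s.E k) := by
    intro hsp
    rcases h.tail with ⟨_, h2, h3⟩ | ⟨h1, h2, h3, h4, h5, h6, h7, h8, h9, h10, h11⟩
    · omega
    · refine ⟨h1, h3, h5, h7, h8, h9, h10, h11, ?_⟩
      unfold SplitState.ts
      rw [h.perm, h9, h10]
  have hsN : s'.siz s.N ≠ 1 → s'.sp = k + 1 := by
    intro hne
    rcases h.tail with ⟨h1, h2, h3⟩ | ⟨h1, h2, h3, h4, h5, h6, h7, h8, h9, h10, h11⟩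
    · omega
    · exact h2
  have hsN' : s'.sp = k + 1 → s'.siz s.N ≠ 1 := by
    intro hsp
    have := htk hsp
    omega
  have hik : ∀ i, i < s'.sp → i < k ∨ (i = k ∧ s'.sp = k + 1) := by
    intro i hi; omega
  refine ⟨?_, ?_, ?_, ?_, ?_, ?_, ?_, ?_, ?_, ?_, ?_, ?_, ?_, ?_, ?_, ?_, ?_, ?_, ?_, ?_⟩
  · rw [h.perm]; exact inv.lt
  · rw [h.perm]; exact inv.inj
  · intro i hi
    rcases hik i hi with hi | ⟨rfl, hsp⟩
    · obtain ⟨h1, h2, h3, h4, _⟩ := h.old i hi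
      rw [h1, h2, h3, h4]
      exact inv.task i (by omega)
    · obtain ⟨h1, h2, h3, h4, h5, h6, h7, h8, h9⟩ := htk hsp
      omega
  · intro i hi
    rw [h.perm]
    rcases hik i hi with hi | ⟨rfl, hsp⟩
    · obtain ⟨h1, h2, h3, h4, _⟩ := h.old i hi
      rw [h3, h4]
      exact inv.sorted i (by omega)
    · obtain ⟨h1, h2, h3, h4, h5, h6, h7, h8, h9⟩ := htk hsp
      rw [h6, h7]
      intro t u htt
      exact inv.sorted i hk t u (by omega)
  · intro i hi u hu
    rw [h.perm] at hu
    rcases hik i hi with hi | ⟨rfl, hsp⟩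
    · obtain ⟨h1, h2, h3, h4, _⟩ := h.old i hi
      rw [h1, h2] at hu
      rw [h.ts_old hi]
      exact inv.indist i (by omega) u hu
    · obtain ⟨h1, h2, h3, h4, h5, h6, h7, h8, h9⟩ := htk hsp
      rw [h4, h5] at hu
      rw [h9]
      intro x hx y hy
      exact hmod u hu x (tset_mono (by omega) le_rfl hx) y (tset_mono (by omega) le_rfl hy)
  · intro i j hij hj
    rcases hik j hj with hj | ⟨rfl, hsp⟩
    · obtain ⟨h1, h2, h3, h4, _⟩ := h.old i (by omega)
      obtain ⟨h1', h2', h3', h4', _⟩ := h.old j hj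
      rw [h1, h2, h3', h4']
      exact inv.nest i j hij (by omega)
    · obtain ⟨h1, h2, h3, h4, h5, h6, h7, h8, h9⟩ := htk hsp
      obtain ⟨h1', h2', h3', h4', _⟩ := h.old i hij
      rw [h1', h2', h6, h7]
      have := inv.nest i j hij hk
      omega
  · intro i j hij hj
    rcases hik j hj with hj | ⟨rfl, hsp⟩
    · obtain ⟨h1, h2, h3, h4, _⟩ := h.old i (by omega)
      obtain ⟨h1', h2', h3', h4', _⟩ := h.old j hj
      rw [h3, h4, h3', h4']
      exact inv.disj i j hij (by omega)
    · obtain ⟨h1, h2, h3, h4, h5, h6, h7, h8, h9⟩ := htk hsp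
      obtain ⟨h1', h2', h3', h4', _⟩ := h.old i hij
      rw [h3', h4', h6, h7]
      have := inv.disj i j hij hk
      omega
  · intro i hi
    rcases hik i hi with hi | ⟨rfl, hsp⟩
    · obtain ⟨_, _, _, _, h5⟩ := h.old i hi
      obtain ⟨h6, h7, h8⟩ := inv.parent i (by omega)
      rw [h5, h.ts_old hi, newSets_of_lt h6, (h.cls _ h6).2.2]
      exact ⟨by omega, h7, h8⟩
    · obtain ⟨h1, h2, h3, h4, h5, h6, h7, h8, h9⟩ := htk hsp
      rw [h8, newSets_N, h9]
      exact ⟨by omega, hsN' hsp, tset_mono (by omega) le_rfl⟩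
  · omega
  · rw [newSets_of_lt inv.pos]; exact inv.cs_zero
  · rw [(h.cls 0 inv.pos).1]; exact inv.rep_zero
  · rw [(h.cls 0 inv.pos).2.2]; exact inv.siz_zero
  · intro j hj1 hj2
    rcases hiN j hj2 with hj | rfl | ⟨rfl, hsp, h1, h2, h3⟩
    · obtain ⟨h1, h2, h3⟩ := inv.par_lt j hj1 hj
      rw [(h.cls j hj).2.1, (h.cls _ (by omega)).2.2, newSets_of_lt hj, newSets_of_lt (by omega)]
      exact ⟨h1, h2, h3⟩
    · rw [hh2, (h.cls _ hp1).2.2, newSets_N, newSets_of_lt hp1]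
      exact ⟨hp1, hp2, hp3⟩
    · rw [h2, newSets_N, newSets_succ]
      exact ⟨by omega, hsN' hsp, Finset.singleton_subset_iff.2 hmem⟩
  · intro j hj1 hj2
    rcases hiN j hj2 with hj | rfl | ⟨rfl, hsp, h1, h2, h3⟩
    · rw [(h.cls j hj).1, (h.cls j hj).2.2, newSets_of_lt hj]
      exact inv.cls j hj1 hj
    · rw [hh1, hh3, newSets_N]
      exact ⟨hts, hmod, hcard, hmem, hmin⟩
    · rw [h1, h3, newSets_succ]
      refine ⟨Finset.singleton_subset_iff.2 (hts hmem), ?_, Finset.card_singleton _,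
        Finset.mem_singleton_self _, ?_⟩
      · intro u _ x hx y hy
        rw [Finset.mem_singleton.1 hx, Finset.mem_singleton.1 hy]
      · intro x hx
        rw [Finset.mem_singleton.1 hx]
        exact hmin _ hmem
  · intro j hj1 hj2 hj3
    rcases hiN j hj2 with hj | rfl | ⟨rfl, hsp, h1, h2, h3⟩
    · rw [(h.cls j hj).2.2] at hj3
      obtain ⟨h1, h2, h3⟩ := inv.vclass j hj1 hj hj3
      rw [(h.cls _ h1).2.1, newSets_of_lt h1, (h.cls j hj).1]
      exact ⟨by omega, h2, h3⟩
    · obtain ⟨h1, h2, h3, _⟩ := htk (hsN hj3)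
      rw [h3, newSets_succ, hh1]
      exact ⟨by omega, rfl, rfl⟩
    · exact absurd h1 hj3
  · intro p hp hps x hx
    rcases hiN p hp with hj | rfl | ⟨rfl, hsp, h1, h2, h3⟩
    · rw [(h.cls p hj).2.2] at hps
      rw [newSets_of_lt hj] at hx
      rcases inv.cover p hj hps x hx with ⟨j, h1, h2, h3, h4⟩ | ⟨i, h1, h2, h3⟩
      · refine Or.inl ⟨j, h1, by omega, ?_, ?_⟩
        · rw [(h.cls j h2).2.1, h3]
        · rw [newSets_of_lt h2]; exact h4
      · by_cases hi : i < k
        · refine Or.inr ⟨i, by omega, ?_, ?_⟩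
          · rw [(h.old i hi).2.2.2.2, h2]
          · rw [h.ts_old hi]; exact h3
        · have : i = k := by have := h.sp; omega
          subst this
          refine Or.inl ⟨s.N, inv.pos, by omega, hh2.trans h2, ?_⟩
          rw [newSets_N]; exact h3
    · have hsp := hsN hps
      obtain ⟨h1, h2, h3, h4, h5, h6, h7, h8, h9⟩ := htk hsp
      rw [newSets_N] at hx
      obtain ⟨t, k1, k2, k3⟩ := mem_tset.1 hx
      by_cases htc : t = s.C k
      · refine Or.inl ⟨s.N + 1, by omega, by omega, h3, ?_⟩
        rw [newSets_succ, ← k3, htc]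
        exact Finset.mem_singleton_self _
      · refine Or.inr ⟨k, by omega, h8, ?_⟩
        rw [h9]
        exact mem_tset.2 ⟨t, by omega, k2, k3⟩
    · exact absurd h1 hps
  · intro p hp hps M hM1 hM2 hM3 hM4
    rcases hiN p hp with hj | rfl | ⟨rfl, hsp, h1, h2, h3⟩
    · rw [(h.cls p hj).2.2] at hps
      rw [newSets_of_lt hj] at hM3
      rw [(h.cls p hj).1] at hM4
      rcases inv.maxi p hj hps M hM1 hM2 hM3 hM4 with ⟨j, h1, h2, h3, h4⟩ | ⟨i, h1, h2, h3⟩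
      · refine Or.inl ⟨j, h1, by omega, ?_, ?_⟩
        · rw [(h.cls j h2).2.1, h3]
        · rw [newSets_of_lt h2]; exact h4
      · by_cases hi : i < k
        · refine Or.inr ⟨i, by omega, ?_, ?_⟩
          · rw [(h.old i hi).2.2.2.2, h2]
          · rw [h.ts_old hi]; exact h3
        · have : i = k := by have := h.sp; omega
          subst this
          refine Or.inl ⟨s.N, inv.pos, by omega, hh2.trans h2, ?_⟩
          rw [newSets_N]; exact h3
    · have hsp := hsN hps
      obtain ⟨h1, h2, h3, h4, h5, h6, h7, h8, h9⟩ := htk hsp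
      rw [newSets_N] at hM3
      rw [hh1] at hM4
      refine Or.inr ⟨k, by omega, h8, ?_⟩
      rw [h9]
      intro x hx
      obtain ⟨t, k1, k2, k3⟩ := mem_tset.1 (hM3 hx)
      have : t ≠ s.C k := by
        rintro rfl
        exact hM4 (k3 ▸ hx)
      exact mem_tset.2 ⟨t, by omega, k2, k3⟩
    · exact absurd h1 hps
  · have key : ∀ i j, 1 ≤ i → i < s'.N → 1 ≤ j → j < s'.N → i < j → s'.par i = s'.par j →
        Disjoint (newSets s k cs i) (newSets s k cs j) := by
      intro i j hi1 hi2 hj1 hj2 hij hp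
      rcases hiN j hj2 with hj | rfl | ⟨rfl, hsp, h1, h2, h3⟩
      · rw [newSets_of_lt hj, newSets_of_lt (by omega)]
        rw [(h.cls i (by omega)).2.1, (h.cls j hj).2.1] at hp
        exact inv.disjC i j hi1 (by omega) hj1 hj (by omega) hp
      · rw [newSets_N, newSets_of_lt hij]
        rw [(h.cls i hij).2.1, hh2] at hp
        exact inv.disjT i hi1 hij k hk hp
      · rw [h2] at hp
        exfalso
        by_cases hi : i < s.N
        · rw [(h.cls i hi).2.1] at hp
          have := (inv.par_lt i hi1 hi).1
          omega
        · have : i = s.N := by omega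
          rw [this, hh2] at hp
          omega
    intro i j hi1 hi2 hj1 hj2 hij hp
    rcases Nat.lt_or_gt_of_ne hij with hlt | hlt
    · exact key i j hi1 hi2 hj1 hj2 hlt hp
    · exact (key j i hj1 hj2 hi1 hi2 hlt hp.symm).symm
  · intro j hj1 hj2 i hi hp
    rcases hik i hi with hi | ⟨rfl, hsp⟩
    · rw [(h.old i hi).2.2.2.2] at hp
      rw [h.ts_old hi]
      have hpi := (inv.parent i (by omega)).1
      have hti := inv.task i (by omega)
      rcases hiN j hj2 with hj | rfl | ⟨rfl, hsp, h1, h2, h3⟩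
      · rw [newSets_of_lt hj]
        rw [(h.cls j hj).2.1] at hp
        exact inv.disjT j hj1 hj i (by omega) hp
      · rw [newSets_N]
        have := inv.disj i k hi hk
        exact tset_disjoint inv.inj (by omega) (by omega) (by omega)
      · omega
    · obtain ⟨h1, h2, h3, h4, h5, h6, h7, h8, h9⟩ := htk hsp
      rw [h8] at hp
      rcases hiN j hj2 with hj | rfl | ⟨rfl, -, -⟩
      · rw [(h.cls j hj).2.1] at hp
        have := (inv.par_lt j hj1 hj).1
        omega
      · omega
      · rw [newSets_succ, h9, Finset.disjoint_singleton_left]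
        intro hx
        obtain ⟨t, k1, k2, k3⟩ := mem_tset.1 hx
        have := inv.inj t (by omega) _ (by omega) k3
        omega
  · have h1 := (h.rest_lt inv).1
    have h2 := inv.count
    unfold SplitState.rest at h1
    omega

/-- The final result of the refinement algorithm. -/
structure ClassTree (n : ℕ) (R : ℕ → ℕ → Prop) (N : ℕ) (rep par siz : ℕ → ℕ)
    (cs : ℕ → Finset ℕ) : Prop where
  par_lt : ∀ j, 1 ≤ j → j < N → par j < j ∧ siz (par j) ≠ 1 ∧ cs j ⊆ cs (par j)
  cls : ∀ j, 1 ≤ j → j < N → cs j ⊆ Finset.range n ∧ IsMod R (cs j) ∧ (cs j).card = siz j ∧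
    rep j ∈ cs j ∧ ∀ x ∈ cs j, ¬ R x (rep j)
  vclass : ∀ j, 1 ≤ j → j < N → siz j ≠ 1 → j + 1 < N ∧ par (j + 1) = j ∧ cs (j + 1) = {rep j}
  cover : ∀ p, 1 ≤ p → p < N → siz p ≠ 1 → ∀ x ∈ cs p, ∃ j, 1 ≤ j ∧ j < N ∧ par j = p ∧ x ∈ cs j
  maxi : ∀ p, 1 ≤ p → p < N → siz p ≠ 1 → ∀ M, M.Nonempty → IsMod R M → M ⊆ cs p → rep p ∉ M →
    ∃ j, 1 ≤ j ∧ j < N ∧ par j = p ∧ M ⊆ cs j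
  disj : ∀ i j, 1 ≤ i → i < N → 1 ≤ j → j < N → i ≠ j → par i = par j → Disjoint (cs i) (cs j)
  count : N ≤ 2 * n + 1
  root : 1 ≤ n → 1 < N ∧ cs 1 = Finset.range n

/-- The initial state of the refinement algorithm. -/
structure SplitInit (n : ℕ) (s : SplitState) : Prop where
  sp : s.sp = 1
  task : s.A 0 = 0 ∧ s.B 0 = n ∧ s.C 0 = 0 ∧ s.E 0 = n ∧ s.P 0 = 0
  N : s.N = 1
  rep : s.rep 0 = n
  siz : s.siz 0 = 0

/-- Class 0 is a virtual parent of the whole vertex set. Its representative `n` is not a vertex, so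
every module of vertices avoids it, and its size is set to 0 since size 1 marks the leaves. -/
theorem SplitInit.inv (h : SplitInit n s) (hn : 1 ≤ n) (hp : TopoList n R s.perm)
    (hR : ∀ x y, R x y → x < n ∧ y < n) :
    SplitInv n R s (fun _ => Finset.range n) := by
  obtain ⟨h1, ⟨h2, h3, h4, h5, h6⟩, h7, h8, h9⟩ := h
  have hi0 : ∀ i, i < s.sp → i = 0 := by omega
  have hts : s.ts 0 = Finset.range n := by
    unfold SplitState.ts
    rw [h4, h5]
    ext x
    rw [mem_tset, Finset.mem_range]
    constructor
    · rintro ⟨t, _, k1, rfl⟩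
      exact hp.lt t k1
    · intro hx
      obtain ⟨t, k1, k2⟩ := hp.surj x hx
      exact ⟨t, by omega, k1, k2⟩
  refine ⟨hp.lt, hp.inj, ?_, ?_, ?_, ?_, ?_, ?_, ?_, rfl, h8, h9, ?_, ?_, ?_, ?_, ?_, ?_, ?_, ?_⟩
  · intro i hi
    rw [hi0 i hi, h2, h3, h4, h5]
    omega
  · intro i hi
    rw [hi0 i hi, h4, h5]
    intro t u _ k2 k3
    exact hp.sorted t u k2 k3
  · intro i hi u hu
    rw [hi0 i hi] at hu ⊢
    have hu' : ¬ u < n := by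
      have : u ∉ s.ts 0 := by
        unfold SplitState.ts
        rw [h4, h5]
        rwa [h2, h3] at hu
      rw [hts] at this
      simpa using this
    intro x _ y _
    rw [rl_eq_iff]
    have k1 : ∀ w, ¬ R u w := fun w hw => hu' (hR _ _ hw).1
    have k2 : ∀ w, ¬ R w u := fun w hw => hu' (hR _ _ hw).2
    simp [k1, k2]
  · omega
  · omega
  · intro i hi
    rw [hi0 i hi, h6, h9, h7, hts]
    exact ⟨by omega, by omega, subset_rfl⟩
  · omega
  · omega
  · omega
  · omega
  · intro p hp1 _ x hx
    exact Or.inr ⟨0, by omega, by omega, by rw [hts]; exact hx⟩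
  · intro p hp1 _ M _ _ hM _
    exact Or.inr ⟨0, by omega, by omega, by rw [hts]; exact hM⟩
  · omega
  · omega
  · rw [h1, Finset.sum_range_one, h4, h5, h7]
    omega

theorem SplitInv.classTree (inv : SplitInv n R s cs) (h0 : s.sp = 0)
    (hR : ∀ x y, R x y → x < n ∧ y < n) :
    ClassTree n R s.N s.rep s.par s.siz cs := by
  have hmaxi : ∀ p < s.N, s.siz p ≠ 1 → ∀ M, M.Nonempty → IsMod R M → M ⊆ cs p → s.rep p ∉ M →
      ∃ j, 1 ≤ j ∧ j < s.N ∧ s.par j = p ∧ M ⊆ cs j := by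
    intro p hp hp1 M hM1 hM2 hM3 hM4
    rcases inv.maxi p hp hp1 M hM1 hM2 hM3 hM4 with h | ⟨i, hi, _⟩
    · exact h
    · omega
  refine ⟨inv.par_lt, inv.cls, inv.vclass, ?_, fun p _ => hmaxi p, inv.disjC, ?_, ?_⟩
  · intro p _ hp hp1 x hx
    rcases inv.cover p hp hp1 x hx with h | ⟨i, hi, _⟩
    · exact h
    · omega
  · have := inv.count
    omega
  · intro hn
    have hmod : IsMod R (Finset.range n) := by
      intro u hu x _ y _
      have hu' : ¬ u < n := by simpa using hu
      have k1 : ∀ w, ¬ R u w := fun w hw => hu' (hR _ _ hw).1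
      have k2 : ∀ w, ¬ R w u := fun w hw => hu' (hR _ _ hw).2
      rw [rl_eq_iff]
      simp [k1, k2]
    -- The whole vertex set is a module avoiding the virtual representative, so it lies in a child
    -- of class 0. Class 1 is also a child of class 0, and children are disjoint, so this child is
    -- class 1.
    obtain ⟨j, h1, h2, h3, h4⟩ := hmaxi 0 inv.pos (by rw [inv.siz_zero]; omega)
      (Finset.range n) ⟨0, Finset.mem_range.2 hn⟩ hmod (by rw [inv.cs_zero])
      (by rw [inv.rep_zero]; simp)
    have hsub := (inv.cls j h1 h2).1
    have hcj : cs j = Finset.range n := hsub.antisymm h4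
    refine ⟨by omega, ?_⟩
    by_cases hj : j = 1
    · rw [← hj]; exact hcj
    · obtain ⟨k1, k2, k3, k4, _⟩ := inv.cls 1 le_rfl (by omega)
      have hp1 : s.par 1 = 0 := by have := (inv.par_lt 1 le_rfl (by omega)).1; omega
      have := inv.disjC 1 j le_rfl (by omega) h1 h2 (by omega) (by omega)
      rw [hcj] at this
      exact absurd (k1 k4) (Finset.disjoint_left.1 this k4)

end

/-! ### Distribution of a list according to the relation to a pivot -/

theorem card_tset_of_injOn {f : ℕ → ℕ} {c e : ℕ}
    (h : ∀ t, c ≤ t → t < e → ∀ u, c ≤ u → u < e → f t = f u → t = u) :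
    (tset f c e).card = e - c := by
  rw [tset, Finset.card_image_of_injOn, Nat.card_Ico]
  intro i hi j hj hij
  simp only [Finset.coe_Ico, Set.mem_Ico] at hi hj
  exact h i hi.1 hi.2 j hj.1 hj.2 hij

theorem mem_tset_update {g : ℕ → ℕ} {s c x y : ℕ} (h : s ≤ c) :
    x ∈ tset (Function.update g c y) s (c + 1) ↔ x ∈ tset g s c ∨ x = y := by
  rw [mem_tset, mem_tset]
  constructor
  · rintro ⟨t, h1, h2, h3⟩
    rcases Nat.lt_succ_iff_lt_or_eq.1 h2 with h2 | rfl
    · rw [Function.update_of_ne (by omega)] at h3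
      exact Or.inl ⟨t, h1, h2, h3⟩
    · rw [Function.update_self] at h3
      exact Or.inr h3.symm
  · rintro (⟨t, h1, h2, h3⟩ | rfl)
    · exact ⟨t, h1, by omega, by rw [Function.update_of_ne (by omega), h3]⟩
    · exact ⟨c, h, by omega, Function.update_self ..⟩

theorem mem_tset_succ {g : ℕ → ℕ} {s c x : ℕ} (h : s ≤ c) :
    x ∈ tset g s (c + 1) ↔ x ∈ tset g s c ∨ x = g c := by
  rw [← mem_tset_update h, Function.update_eq_self]

/-- `tmp` lists, from number `s` up to number `c' - 1`, those vertices of the list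
`perm c, …, perm (i - 1)` whose relation to `z` is `r`. -/
structure Filtered (R : ℕ → ℕ → Prop) (perm : ℕ → ℕ) (z c i : ℕ) (tmp : ℕ → ℕ) (s cnt r : ℕ) :
    Prop where
  le : s ≤ cnt ∧ cnt ≤ s + (i - c)
  mem : ∀ x, x ∈ tset tmp s cnt ↔ x ∈ tset perm c i ∧ rl R z x = r
  inj : ∀ t, s ≤ t → t < cnt → ∀ u, s ≤ u → u < cnt → tmp t = tmp u → t = u
  sorted : ∀ t u, s ≤ t → t ≤ u → u < cnt → ¬ R (tmp u) (tmp t)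

section
variable {R : ℕ → ℕ → Prop} {perm tmp tmp' : ℕ → ℕ} {z c e i s cnt r n : ℕ}

theorem Filtered.init : Filtered R perm z c c tmp s s r := by
  refine ⟨by omega, fun x => ?_, by omega, by omega⟩
  simp [mem_tset]
  omega

theorem Filtered.skip (h : Filtered R perm z c i tmp s cnt r) (hc : c ≤ i)
    (hr : rl R z (perm i) ≠ r) : Filtered R perm z c (i + 1) tmp s cnt r := by
  refine ⟨by have := h.le; omega, fun x => ?_, h.inj, h.sorted⟩
  rw [h.mem, mem_tset_succ hc]
  constructor
  · exact fun hx => ⟨Or.inl hx.1, hx.2⟩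
  · rintro ⟨hx | rfl, h2⟩
    · exact ⟨hx, h2⟩
    · exact absurd h2 hr

/-- Vertices are appended in the order of the original list, so the filtered list inherits its
topological order. -/
theorem Filtered.push (h : Filtered R perm z c i tmp s cnt r) (hc : c ≤ i)
    (hr : rl R z (perm i) = r) (hinj : ∀ t, c ≤ t → t < i → perm t ≠ perm i)
    (hs : ∀ t, c ≤ t → t ≤ i → ¬ R (perm i) (perm t)) :
    Filtered R perm z c (i + 1) (Function.update tmp cnt (perm i)) s (cnt + 1) r := by
  have hle := h.le
  have hmem : ∀ t, s ≤ t → t < cnt → ∃ u, c ≤ u ∧ u < i ∧ perm u = tmp t := fun t h1 h2 =>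
    mem_tset.1 ((h.mem (tmp t)).1 (mem_tset.2 ⟨t, h1, h2, rfl⟩)).1
  refine ⟨by omega, fun x => ?_, ?_, ?_⟩
  · rw [mem_tset_update hle.1, h.mem, mem_tset_succ hc]
    constructor
    · rintro (hx | rfl)
      · exact ⟨Or.inl hx.1, hx.2⟩
      · exact ⟨Or.inr rfl, hr⟩
    · rintro ⟨hx | rfl, h2⟩
      · exact Or.inl ⟨hx, h2⟩
      · exact Or.inr rfl
  · intro t h1 h2 u h3 h4 h5
    rcases Nat.lt_succ_iff_lt_or_eq.1 h2 with h2 | rfl <;>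
      rcases Nat.lt_succ_iff_lt_or_eq.1 h4 with h4 | rfl
    · rw [Function.update_of_ne (by omega), Function.update_of_ne (by omega)] at h5
      exact h.inj t h1 h2 u h3 h4 h5
    · rw [Function.update_of_ne (by omega), Function.update_self] at h5
      obtain ⟨w, k1, k2, k3⟩ := hmem t h1 h2
      exact absurd (k3.trans h5) (hinj w k1 k2)
    · rw [Function.update_self, Function.update_of_ne (by omega)] at h5
      obtain ⟨w, k1, k2, k3⟩ := hmem u h3 h4
      exact absurd (k3.trans h5.symm) (hinj w k1 k2)
    · rfl
  · intro t u h1 h2 h3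
    rcases Nat.lt_succ_iff_lt_or_eq.1 h3 with h3 | rfl
    · rw [Function.update_of_ne (by omega), Function.update_of_ne (by omega)]
      exact h.sorted t u h1 h2 h3
    · rw [Function.update_self]
      rcases Nat.lt_or_ge t u with h4 | h4
      · rw [Function.update_of_ne (by omega)]
        obtain ⟨w, k1, k2, k3⟩ := hmem t h1 h4
        rw [← k3]
        exact hs w k1 k2.le
      · have : t = u := by omega
        rw [this, Function.update_self]
        exact hs i hc le_rfl

/-- The vertices `perm c, …, perm (e - 1)` whose relation to `z` is less than `r` have been
listed in `tmp` from number `c` up to number `cnt - 1`, and tasks with numbers from `k` on have been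
set up for them. -/
structure Parted (R : ℕ → ℕ → Prop) (perm : ℕ → ℕ) (z c e k a b p : ℕ) (tmp : ℕ → ℕ) (cnt r : ℕ)
    (s : SplitState) : Prop where
  le : c ≤ cnt
  mem : ∀ x, x ∈ tset tmp c cnt ↔ x ∈ tset perm c e ∧ rl R z x < r
  inj : ∀ t, c ≤ t → t < cnt → ∀ u, c ≤ u → u < cnt → tmp t = tmp u → t = u
  sp : k ≤ s.sp ∧ s.sp ≤ k + r
  new : ∀ i, k ≤ i → i < s.sp → s.A i = a ∧ s.B i = b ∧ s.P i = p ∧ c ≤ s.C i ∧ s.C i < s.E i ∧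
    s.E i ≤ cnt ∧ (∃ r', ∀ x, x ∈ tset tmp (s.C i) (s.E i) ↔ x ∈ tset perm c e ∧ rl R z x = r') ∧
    ∀ t u, s.C i ≤ t → t ≤ u → u < s.E i → ¬ R (tmp u) (tmp t)
  disj : ∀ i j, k ≤ i → i < j → j < s.sp → s.E i ≤ s.C j
  cover : ∀ x ∈ tset perm c e, rl R z x < r →
    ∃ i, k ≤ i ∧ i < s.sp ∧ x ∈ tset tmp (s.C i) (s.E i)
  sum : ∑ i ∈ Finset.Ico k s.sp, (s.E i - s.C i) = cnt - c

variable {k a b p : ℕ} {S S' : SplitState}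

theorem Parted.cnt_le (h : Parted R perm z c e k a b p tmp cnt r S) : cnt ≤ c + (e - c) := by
  have h1 := card_tset_of_injOn h.inj
  have h2 : tset tmp c cnt ⊆ tset perm c e := fun x hx => ((h.mem x).1 hx).1
  have h3 := Finset.card_le_card h2
  have h4 : (tset perm c e).card ≤ e - c := by
    rw [← Nat.card_Ico]
    exact Finset.card_image_le
  have := h.le
  omega

theorem Parted.step (h : Parted R perm z c e k a b p tmp s r S)
    (hf : Filtered R perm z c e tmp' s cnt r) (htmp : ∀ t < s, tmp' t = tmp t)
    (hold : ∀ i < S.sp, S'.A i = S.A i ∧ S'.B i = S.B i ∧ S'.C i = S.C i ∧ S'.E i = S.E i ∧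
      S'.P i = S.P i)
    (hsp : (s = cnt ∧ S'.sp = S.sp) ∨ (s < cnt ∧ S'.sp = S.sp + 1 ∧ S'.A S.sp = a ∧
      S'.B S.sp = b ∧ S'.C S.sp = s ∧ S'.E S.sp = cnt ∧ S'.P S.sp = p)) :
    Parted R perm z c e k a b p tmp' cnt (r + 1) S' := by
  have hle := hf.le
  have hcs := h.le
  have hpre : ∀ c' e', e' ≤ s → tset tmp' c' e' = tset tmp c' e' := fun c' e' he' =>
    tset_congr fun t _ ht => htmp t (by omega)
  have hsplit : ∀ x, x ∈ tset tmp' c cnt ↔ x ∈ tset tmp c s ∨ x ∈ tset tmp' s cnt := by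
    intro x
    rw [← hpre c s le_rfl, mem_tset, mem_tset, mem_tset]
    constructor
    · rintro ⟨t, h1, h2, h3⟩
      rcases Nat.lt_or_ge t s with h4 | h4
      · exact Or.inl ⟨t, h1, h4, h3⟩
      · exact Or.inr ⟨t, h4, h2, h3⟩
    · rintro (⟨t, h1, h2, h3⟩ | ⟨t, h1, h2, h3⟩)
      · exact ⟨t, h1, by omega, h3⟩
      · exact ⟨t, by omega, h2, h3⟩
  have hcross : ∀ t u, c ≤ t → t < s → s ≤ u → u < cnt → tmp' t ≠ tmp' u := by
    intro t u h1 h2 h3 h4 h5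
    have h6 := (h.mem (tmp' t)).1 (by rw [← hpre c s le_rfl]; exact mem_tset.2 ⟨t, h1, h2, rfl⟩)
    have h7 := (hf.mem (tmp' u)).1 (mem_tset.2 ⟨u, h3, h4, rfl⟩)
    rw [h5] at h6
    omega
  have hi : ∀ i, i < S'.sp → i < S.sp ∨ i = S.sp ∧ s < cnt := by omega
  have hsp' := h.sp
  refine ⟨by omega, fun x => ?_, ?_, by omega, ?_, ?_, ?_, ?_⟩
  · rw [hsplit, h.mem, hf.mem]
    constructor
    · rintro (⟨h1, h2⟩ | ⟨h1, h2⟩)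
      · exact ⟨h1, by omega⟩
      · exact ⟨h1, by omega⟩
    · rintro ⟨h1, h2⟩
      rcases Nat.lt_succ_iff_lt_or_eq.1 h2 with h2 | h2
      · exact Or.inl ⟨h1, h2⟩
      · exact Or.inr ⟨h1, h2⟩
  · intro t h1 h2 u h3 h4 h5
    rcases Nat.lt_or_ge t s with h6 | h6 <;> rcases Nat.lt_or_ge u s with h7 | h7
    · rw [htmp t h6, htmp u h7] at h5
      exact h.inj t h1 h6 u h3 h7 h5
    · exact absurd h5 (hcross t u h1 h6 h7 h4)
    · exact absurd h5.symm (hcross u t h3 h7 h6 h2)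
    · exact hf.inj t h6 h2 u h7 h4 h5
  · intro i h1 h2
    rcases hi i h2 with h3 | ⟨rfl, h3⟩
    · obtain ⟨k1, k2, k3, k4, k5⟩ := hold i h3
      obtain ⟨m1, m2, m3, m4, m5, m6, m7, m8⟩ := h.new i h1 h3
      rw [k1, k2, k3, k4, k5, hpre _ _ m6]
      refine ⟨m1, m2, m3, m4, m5, by omega, m7, fun t u n1 n2 n3 => ?_⟩
      rw [htmp t (by omega), htmp u (by omega)]
      exact m8 t u n1 n2 n3
    · rcases hsp with hsp | ⟨_, _, k1, k2, k3, k4, k5⟩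
      · omega
      · rw [k1, k2, k3, k4, k5]
        exact ⟨rfl, rfl, rfl, hcs, h3, le_rfl, ⟨r, hf.mem⟩, hf.sorted⟩
  · intro i j h1 h2 h3
    obtain ⟨k1, k2, k3, k4, k5⟩ := hold i (by omega)
    rcases hi j h3 with h4 | ⟨rfl, h4⟩
    · obtain ⟨_, _, k3', _⟩ := hold j h4
      rw [k4, k3']
      exact h.disj i j h1 h2 h4
    · have := (h.new i h1 h2).2.2.2.2.2.1
      omega
  · intro x hx hr
    by_cases hr' : rl R z x = r
    · have hxt : x ∈ tset tmp' s cnt := (hf.mem x).2 ⟨hx, hr'⟩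
      obtain ⟨t, h1, h2, _⟩ := mem_tset.1 hxt
      refine ⟨S.sp, by omega, by omega, ?_⟩
      rcases hsp with hsp | ⟨_, _, k1, k2, k3, k4, k5⟩
      · omega
      · rw [k3, k4]; exact hxt
    · obtain ⟨i, h1, h2, h3⟩ := h.cover x hx (by omega)
      obtain ⟨k1, k2, k3, k4, k5⟩ := hold i h2
      refine ⟨i, h1, by omega, ?_⟩
      rw [k3, k4, hpre _ _ (h.new i h1 h2).2.2.2.2.2.1]
      exact h3
  · have h0 : ∑ i ∈ Finset.Ico k S.sp, (S'.E i - S'.C i) = s - c := by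
      rw [← h.sum]
      refine Finset.sum_congr rfl fun i hi => ?_
      rw [Finset.mem_Ico] at hi
      obtain ⟨_, _, k3, k4, _⟩ := hold i hi.2
      rw [k3, k4]
    rcases hsp with ⟨h1, h2⟩ | ⟨h1, h2, _, _, h3, h4, _⟩
    · rw [h2, h0, h1]
    · rw [h2, Finset.sum_Ico_succ_top hsp'.1, h0, h3, h4]
      omega

/-- After three rounds every vertex of the task has been listed, since the relation to the pivot
takes three values only. Counting shows that the lists fill exactly the interval of the task, so
they can be copied back in place. -/
theorem Parted.pivotStep {s s' : SplitState}
    (inv : SplitInv n R s cs) (hsp : s.sp = k + 1)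
    (h : Parted R s.perm z (s.C k) (s.E k) k a b (s.P k) tmp cnt 3 s')
    (has : ∀ x y, R x y → ¬ R y x)
    (hz : (s.A k < s.C k ∧ z = s.perm (s.A k) ∧ a = s.A k + 1 ∧ b = s.B k) ∨
      (s.E k < s.B k ∧ z = s.perm (s.B k - 1) ∧ a = s.A k ∧ b = s.B k - 1))
    (hin : ∀ t, s.C k ≤ t → t < s.E k → s'.perm t = tmp t)
    (hout : ∀ t, ¬ (s.C k ≤ t ∧ t < s.E k) → s'.perm t = s.perm t)
    (hold : ∀ i < k, s'.A i = s.A i ∧ s'.B i = s.B i ∧ s'.C i = s.C i ∧ s'.E i = s.E i ∧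
      s'.P i = s.P i)
    (hN : s'.N = s.N) (hrep : s'.rep = s.rep) (hpar : s'.par = s.par) (hsiz : s'.siz = s.siz) :
    PivotStep n R s s' k z a b := by
  have ht := inv.task k (by omega)
  have hle := h.cnt_le
  have hset : tset tmp (s.C k) cnt = s.ts k := by
    ext x
    rw [h.mem]
    exact ⟨fun hx => hx.1, fun hx => ⟨hx, rl_lt has z x⟩⟩
  have hcnt : cnt = s.E k := by
    have h1 := card_tset_of_injOn h.inj
    have h2 : (s.ts k).card = s.E k - s.C k :=
      card_tset fun i hi j hj => inv.inj i (by omega) j (by omega)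
    rw [hset, h2] at h1
    have := h.le
    omega
  have hpre : ∀ c' e', s.C k ≤ c' → e' ≤ s.E k → tset s'.perm c' e' = tset tmp c' e' :=
    fun c' e' hc' he' => tset_congr fun t h1 h2 => hin t (by omega) (by omega)
  subst hcnt
  refine ⟨hsp, hz, hout, ?_, ?_, h.sp.1, hold, ?_, ?_, h.disj, ?_, ?_, hN, hrep, hpar, hsiz⟩
  · rw [hpre _ _ le_rfl le_rfl, hset]
  · intro t h1 h2 u h3 h4 h5
    rw [hin t h1 h2, hin u h3 h4] at h5
    exact h.inj t h1 h2 u h3 h4 h5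
  · intro i h1 h2
    obtain ⟨m1, m2, m3, m4, m5, m6, ⟨r, m7⟩, m8⟩ := h.new i h1 h2
    refine ⟨m1, m2, m3, m4, m5, m6, r, ?_⟩
    ext x
    rw [SplitState.ts, hpre _ _ m4 m6, m7, Finset.mem_filter]
    rfl
  · intro i h1 h2 t u h3 h4 h5
    obtain ⟨m1, m2, m3, m4, m5, m6, ⟨r, m7⟩, m8⟩ := h.new i h1 h2
    rw [hin t (by omega) (by omega), hin u (by omega) (by omega)]
    exact m8 t u h3 h4 h5
  · intro x hx
    obtain ⟨i, h1, h2, h3⟩ := h.cover x hx (rl_lt has z x)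
    obtain ⟨m1, m2, m3, m4, m5, m6, ⟨r, m7⟩, m8⟩ := h.new i h1 h2
    refine ⟨i, h1, h2, ?_⟩
    ext y
    rw [SplitState.ts, hpre _ _ m4 m6, m7, Finset.mem_filter, ((m7 x).1 h3).2]
    rfl
  · exact h.sum

end

/-! ### The refinement program -/

notation "aSA" => (100 : ℕ)
notation "aSB" => (101 : ℕ)
notation "aSC" => (102 : ℕ)
notation "aSE" => (103 : ℕ)
notation "aSP" => (104 : ℕ)
notation "xSp" => (105 : ℕ)
notation "xLo" => (106 : ℕ)
notation "xHi" => (107 : ℕ)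
notation "xCl" => (108 : ℕ)
notation "xCh" => (109 : ℕ)
notation "xPr" => (110 : ℕ)
notation "xPiv" => (111 : ℕ)
notation "xCnt" => (112 : ℕ)
notation "xSt" => (113 : ℕ)
notation "xRv" => (114 : ℕ)
notation "xE" => (115 : ℕ)
notation "aTmp" => (116 : ℕ)
notation "aRp" => (117 : ℕ)
notation "aPa" => (118 : ℕ)
notation "aSz" => (119 : ℕ)
notation "xNc" => (120 : ℕ)

/-- The entries of the matrix which describe the relation of two vertices. -/
abbrev relE (z y : Expr) : Expr := .cell aMtx (z * vN + y) + 2 * .cell aMtx (y * vN + z)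

/-- Appends to the list `aTmp` the vertices which are related to the pivot in a given way. -/
def filterProg : Prog :=
  forLoop xE (sv xCl) (sv xCh)
    (.cond (eqE (relE (sv xPiv) (.cell aPerm (sv xE))) (sv xRv))
      (.assign aTmp (sv xCnt) (.cell aPerm (sv xE)) ;; setv xCnt (sv xCnt + 1)) .skip)

/-- Puts a task on the stack. -/
def pushProg : Prog :=
  .assign aSA (sv xSp) (sv xLo) ;; .assign aSB (sv xSp) (sv xHi) ;;
  .assign aSC (sv xSp) (sv xSt) ;; .assign aSE (sv xSp) (sv xCnt) ;;
  .assign aSP (sv xSp) (sv xPr) ;; setv xSp (sv xSp + 1)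

/-- Distributes the vertices of the current task according to their relation to the pivot. -/
def distributeProg : Prog :=
  setv xCnt (sv xCl) ;;
  forLoop xRv 0 3 (setv xSt (sv xCnt) ;; filterProg ;; .cond (sv xCnt - sv xSt) pushProg .skip)

/-- Takes a task from the stack. -/
def popProg : Prog :=
  setv xSp (sv xSp - 1) ;; setv xLo (.cell aSA (sv xSp)) ;; setv xHi (.cell aSB (sv xSp)) ;;
  setv xCl (.cell aSC (sv xSp)) ;; setv xCh (.cell aSE (sv xSp)) ;; setv xPr (.cell aSP (sv xSp))

/-- Chooses a pivot for the current task. -/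
def choosePivotProg : Prog :=
  .cond (sv xCl - sv xLo)
    (setv xPiv (.cell aPerm (sv xLo)) ;; setv xLo (sv xLo + 1))
    (setv xPiv (.cell aPerm (sv xHi - 1)) ;; setv xHi (sv xHi - 1))

/-- Refines the current task by a pivot. -/
def pivotProg : Prog :=
  choosePivotProg ;; distributeProg ;;
  forLoop xE (sv xCl) (sv xCh) (.assign aPerm (sv xE) (.cell aTmp (sv xE)))

/-- Makes a class of the current task. -/
def newClassProg : Prog :=
  .assign aRp (sv xNc) (.cell aPerm (sv xCl)) ;; .assign aPa (sv xNc) (sv xPr) ;;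
  .assign aSz (sv xNc) (sv xCh - sv xCl) ;; setv xNc (sv xNc + 1) ;;
  .cond (sv xCh - (sv xCl + 1))
    (.assign aRp (sv xNc) (.cell aPerm (sv xCl)) ;; .assign aPa (sv xNc) (sv xNc - 1) ;;
     .assign aSz (sv xNc) 1 ;;
     .assign aSA (sv xSp) (sv xCl) ;; .assign aSB (sv xSp) (sv xCh) ;;
     .assign aSC (sv xSp) (sv xCl + 1) ;; .assign aSE (sv xSp) (sv xCh) ;;
     .assign aSP (sv xSp) (sv xNc - 1) ;;
     setv xNc (sv xNc + 1) ;; setv xSp (sv xSp + 1)) .skip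

/-- Computes the classes. -/
def splitProg : Prog :=
  .assign aRp 0 vN ;; setv xNc 1 ;; setv xSp 1 ;; .assign aSA 0 0 ;; .assign aSB 0 vN ;;
  .assign aSC 0 0 ;; .assign aSE 0 vN ;; .assign aSP 0 0 ;; .assign aSz 0 0 ;;
  .loop (sv xSp) (popProg ;;
    .cond ((sv xCl - sv xLo) + (sv xHi - sv xCh)) pivotProg newClassProg)

/-- The state of the refinement algorithm in the memory. -/
def splitView (τ : Store) : SplitState :=
  ⟨τ aPerm, τ xSp 0, τ aSA, τ aSB, τ aSC, τ aSE, τ aSP, τ xNc 0, τ aRp, τ aPa, τ aSz⟩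

/-- The matrix of a relation. -/
def IsMatrix (n : ℕ) (R : ℕ → ℕ → Prop) (f : ℕ → ℕ) : Prop :=
  open Classical in ∀ x < n, ∀ y < n, f (x * n + y) = if R x y then 1 else 0

theorem IsMatrix.rl_eq {n : ℕ} {R : ℕ → ℕ → Prop} {f : ℕ → ℕ} (h : IsMatrix n R f) {x y : ℕ}
    (hx : x < n) (hy : y < n) : f (x * n + y) + 2 * f (y * n + x) = rl R x y := by
  rw [h x hx y hy, h y hy x hx]
  rfl

section
variable {W n : ℕ} {R : ℕ → ℕ → Prop} {σ : Store}

theorem filterProg_ok {z c e r s : ℕ} (hn : σ 0 0 = n) (hM : IsMatrix n R (σ aMtx))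
    (hz : σ xPiv 0 = z) (hc : σ xCl 0 = c) (he : σ xCh 0 = e) (hr : σ xRv 0 = r)
    (hs : σ xCnt 0 = s) (hzn : z < n) (hce : c ≤ e) (hen : e ≤ n) (hsn : s ≤ n)
    (hlt : ∀ i < n, σ aPerm i < n) (hinj : ∀ i < n, ∀ j < n, σ aPerm i = σ aPerm j → i = j)
    (hsort : ∀ t u, c ≤ t → t ≤ u → u < e → ¬ R (σ aPerm u) (σ aPerm t))
    (hW : 4 * n + 10 ≤ W) :
    Ok W filterProg σ ((e - c) * 83 + 10) fun τ =>
      Filtered R (σ aPerm) z c e (τ aTmp) s (τ xCnt 0) r ∧ ∀ t < s, τ aTmp t = σ aTmp t := by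
  refine Ok.for_const c e 70
    (fun i τ => Filtered R (σ aPerm) z c i (τ aTmp) s (τ xCnt 0) r ∧
      ∀ t < s, τ aTmp t = σ aTmp t) hc hce (by omega) (by decide) ?_ ?_ ?_ ?_ ?_
  · intro τ hτ
    simp only [Expr.eval_cell, Expr.eval_ofNat, hτ xCh (by decide), he]
  · simp only [ne_eq, Nat.reduceEqDiff, not_false_eq_true, Store.write_ne, hs]
    exact ⟨Filtered.init, fun _ _ => by simp⟩
  · rintro i τ hci hie hτi hτ ⟨hf, ht⟩
    have e0 : τ 0 = σ 0 := hτ 0 (by decide)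
    have eM : τ aMtx = σ aMtx := hτ aMtx (by decide)
    have eP : τ aPerm = σ aPerm := hτ aPerm (by decide)
    have eV : τ xPiv = σ xPiv := hτ xPiv (by decide)
    have eR : τ xRv = σ xRv := hτ xRv (by decide)
    have hle := hf.le
    have hil := hlt i (by omega)
    refine Ok.of_wp ?_ (by decide)
    simp only [Prog.wp, eqE_eval, Expr.eval_cell, Expr.eval_ofNat, Expr.eval_add, Expr.eval_mul,
      e0, hn, eM, eP, eV, eR, hz, hr, hτi, hM.rl_eq hzn hil]
    refine ⟨fun h => ?_, fun h => ?_⟩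
    · have hrl : rl R z (σ aPerm i) = r := by
        by_contra hne
        exact h (if_neg hne)
      simp only [ne_eq, Nat.reduceEqDiff, not_false_eq_true, Store.write_ne, Store.write_same,
        Function.update_self]
      refine ⟨by omega, by omega, by omega, by omega, ?_, ?_⟩
      · exact hf.push hci hrl
          (fun t h1 h2 h3 => by have := hinj t (by omega) i (by omega) h3; omega)
          (fun t h1 h2 => hsort t i h1 h2 hie)
      · intro t hts
        rw [Function.update_of_ne (by omega)]
        exact ht t hts
    · have hrl : rl R z (σ aPerm i) ≠ r := by
        intro heq
        rw [if_pos heq] at h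
        omega
      simp only [ne_eq, Nat.reduceEqDiff, not_false_eq_true, Store.write_ne]
      exact ⟨hf.skip hci hrl, ht⟩
  · exact le_rfl
  · intro τ _ _ h
    exact h

theorem distributeProg_ok {z c e k a b p : ℕ} (hn : σ 0 0 = n) (hM : IsMatrix n R (σ aMtx))
    (hz : σ xPiv 0 = z) (hc : σ xCl 0 = c) (he : σ xCh 0 = e) (hk : σ xSp 0 = k)
    (ha : σ xLo 0 = a) (hb : σ xHi 0 = b) (hp : σ xPr 0 = p)
    (hzn : z < n) (hce : c ≤ e) (hen : e ≤ n)
    (hlt : ∀ i < n, σ aPerm i < n) (hinj : ∀ i < n, ∀ j < n, σ aPerm i = σ aPerm j → i = j)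
    (hsort : ∀ t u, c ≤ t → t ≤ u → u < e → ¬ R (σ aPerm u) (σ aPerm t))
    (hW : 4 * n + 10 ≤ W) (hkW : k + 4 ≤ W) (haW : a ≤ W) (hbW : b ≤ W) (hpW : p ≤ W) :
    Ok W distributeProg σ ((e - c) * 249 + 220) fun τ =>
      Parted R (σ aPerm) z c e k a b p (τ aTmp) (τ xCnt 0) 3 (splitView τ) ∧
      ∀ i < k, τ aSA i = σ aSA i ∧ τ aSB i = σ aSB i ∧ τ aSC i = σ aSC i ∧ τ aSE i = σ aSE i ∧
        τ aSP i = σ aSP i := by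
  refine Ok.time (T := 4 + ((e - c) * 249 + 210)) ?_ (by omega)
  refine Ok.seq (Q := fun τ => τ = σ.write xCnt 0 c) (Ok.of_wp ?_ (by decide)) ?_
  · simp only [Prog.wp, Expr.eval_cell, Expr.eval_ofNat, hc]
    exact ⟨by omega, by omega, trivial⟩
  rintro σ' - rfl
  refine Ok.for_const 0 3 (4 + (((e - c) * 83 + 10) + 40))
    (fun r τ => Parted R (σ aPerm) z c e k a b p (τ aTmp) (τ xCnt 0) r (splitView τ) ∧
      ∀ i < k, τ aSA i = σ aSA i ∧ τ aSB i = σ aSB i ∧ τ aSC i = σ aSC i ∧ τ aSE i = σ aSE i ∧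
        τ aSP i = σ aSP i) rfl (Nat.zero_le _) (by omega) (by decide) ?_ ?_ ?_ ?_ ?_
  · intro τ _
    rfl
  · simp only [ne_eq, Nat.reduceEqDiff, not_false_eq_true, Store.write_ne, Store.write_same,
      Function.update_self, splitView, hk]
    refine ⟨⟨le_rfl, ?_, ?_, ?_, ?_, ?_, ?_, ?_⟩, fun i _ => by simp⟩
    · intro x
      simp [mem_tset]
      omega
    · omega
    · exact ⟨le_rfl, le_rfl⟩
    · intro i h1 h2; dsimp only at h2; omega
    · intro i j h1 h2 h3; dsimp only at h3; omega
    · omega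
    · simp
  · rintro r τ - hr hτr hτ ⟨hP, hold⟩
    have f : ∀ x, x ≠ xCnt → x ∉ (forLoop xRv 0 3 (setv xSt (sv xCnt) ;; filterProg ;;
        .cond (sv xCnt - sv xSt) pushProg .skip)).writes → τ x = σ x := by
      intro x h1 h2
      rw [hτ x h2, Store.write_ne _ _ _ h1]
    have e0 := f 0 (by decide) (by decide)
    have eM := f aMtx (by decide) (by decide)
    have eP := f aPerm (by decide) (by decide)
    have eV := f xPiv (by decide) (by decide)
    have eC := f xCl (by decide) (by decide)
    have eH := f xCh (by decide) (by decide)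
    have eA := f xLo (by decide) (by decide)
    have eB := f xHi (by decide) (by decide)
    have eQ := f xPr (by decide) (by decide)
    have hcnt := hP.cnt_le
    have hspk := hP.sp
    have hspk' : k ≤ τ xSp 0 ∧ τ xSp 0 ≤ k + r := hspk
    refine Ok.seq (Q := fun υ => υ = τ.write xSt 0 (τ xCnt 0)) (Ok.of_wp ?_ (by decide)) ?_
    · simp only [Prog.wp, Expr.eval_cell, Expr.eval_ofNat]
      exact ⟨by omega, by omega, trivial⟩
    rintro τ' - rfl
    refine Ok.seq (filterProg_ok (n := n) (R := R) (z := z) (c := c) (e := e) (r := r) (s := τ xCnt 0)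
      ?_ ?_ ?_ ?_ ?_ ?_ ?_ hzn hce hen ?_ ?_ ?_ ?_ hW) ?_
    · rw [Store.write_ne _ _ _ (by decide), e0, hn]
    · rw [Store.write_ne _ _ _ (by decide), eM]; exact hM
    · rw [Store.write_ne _ _ _ (by decide), eV, hz]
    · rw [Store.write_ne _ _ _ (by decide), eC, hc]
    · rw [Store.write_ne _ _ _ (by decide), eH, he]
    · rw [Store.write_ne _ _ _ (by decide), hτr]
    · rw [Store.write_ne _ _ _ (by decide)]
    · omega
    · rw [Store.write_ne _ _ _ (by decide), eP]; exact hlt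
    · rw [Store.write_ne _ _ _ (by decide), eP]; exact hinj
    · rw [Store.write_ne _ _ _ (by decide), eP]; exact hsort
    rintro υ hυ ⟨hF, htmp⟩
    rw [Store.write_ne _ _ _ (by decide), eP] at hF
    have g : ∀ x, x ≠ xSt → x ∉ filterProg.writes → υ x = τ x := by
      intro x h1 h2
      rw [hυ x h2, Store.write_ne _ _ _ h1]
    have gS : υ xSt 0 = τ xCnt 0 := by
      rw [hυ xSt (by decide), Store.write_same, Function.update_self]
    have g1 := g xLo (by decide) (by decide)
    have g2 := g xHi (by decide) (by decide)
    have g3 := g xPr (by decide) (by decide)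
    have g4 := g xSp (by decide) (by decide)
    have g5 := g aSA (by decide) (by decide)
    have g6 := g aSB (by decide) (by decide)
    have g7 := g aSC (by decide) (by decide)
    have g8 := g aSE (by decide) (by decide)
    have g9 := g aSP (by decide) (by decide)
    have hFle := hF.le
    refine Ok.of_wp ?_ (by decide)
    simp only [Prog.wp, pushProg, Expr.eval_cell, Expr.eval_ofNat, Expr.eval_add, Expr.eval_sub,
      ne_eq, Nat.reduceEqDiff, not_false_eq_true, Store.write_ne, Store.write_same,
      gS, g1, g2, g3, g4, eA, eB, eQ, ha, hb, hp]
    refine ⟨fun h => ⟨by omega, by omega, by omega, by omega, by omega, by omega, by omega, by omega,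
      by omega, by omega, by omega, by omega, ?_, ?_⟩, fun h => ⟨?_, ?_⟩⟩
    · refine hP.step hF (fun t ht => ?_) ?_ (Or.inr ?_)
      · rw [htmp t ht, Store.write_ne _ _ _ (by decide)]
      · intro i hi
        have hi' : i < τ xSp 0 := hi
        simp only [splitView, ne_eq, Nat.reduceEqDiff, not_false_eq_true, Store.write_ne,
          Store.write_same, g5, g6, g7, g8, g9]
        simp only [Function.update_of_ne (show i ≠ τ xSp 0 by omega)]
        simp
      · simp only [splitView, ne_eq, Nat.reduceEqDiff, not_false_eq_true, Store.write_ne,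
          Store.write_same, Function.update_self, and_true]
        omega
    · intro i hi
      obtain ⟨o1, o2, o3, o4, o5⟩ := hold i hi
      simp only [g5, g6, g7, g8, g9, Function.update_of_ne (show i ≠ τ xSp 0 by omega)]
      exact ⟨o1, o2, o3, o4, o5⟩
    · refine hP.step hF (fun t ht => ?_) ?_ (Or.inl ?_)
      · rw [htmp t ht, Store.write_ne _ _ _ (by decide)]
      · intro i _
        simp only [splitView, ne_eq, Nat.reduceEqDiff, not_false_eq_true, Store.write_ne,
          g5, g6, g7, g8, g9]
        exact ⟨trivial, trivial, trivial, trivial, trivial⟩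
      · simp only [splitView, ne_eq, Nat.reduceEqDiff, not_false_eq_true, Store.write_ne, g4,
          and_true]
        omega
    · intro i hi
      simp only [g5, g6, g7, g8, g9]
      exact hold i hi
  · show (3 - 0) * (4 + ((e - c) * 83 + 10 + 40) + 1 + 11) + (1 + 1 + 6) ≤ _
    omega
  · intro τ _ _ h
    exact h

theorem pivotProg_ok {k : ℕ} {τ : Store} {cs : ℕ → Finset ℕ} (inv : SplitInv n R (splitView σ) cs)
    (hsp : σ xSp 0 = k + 1) (hn : τ 0 0 = n) (hM : IsMatrix n R (τ aMtx))
    (has : ∀ x y, R x y → ¬ R y x)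
    (hs : Same popProg σ τ) (h1 : τ xSp 0 = k) (h2 : τ xLo 0 = σ aSA k) (h3 : τ xHi 0 = σ aSB k)
    (h4 : τ xCl 0 = σ aSC k) (h5 : τ xCh 0 = σ aSE k) (h6 : τ xPr 0 = σ aSP k)
    (hpiv : σ aSA k < σ aSC k ∨ σ aSE k < σ aSB k) (hW : 4 * n + 10 ≤ W) :
    Ok W pivotProg τ ((σ aSE k - σ aSC k) * 268 + 270) fun υ =>
      ∃ z a b, PivotStep n R (splitView σ) (splitView υ) k z a b := by
  have hk : k < (splitView σ).sp := by show k < σ xSp 0; omega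
  have ht : σ aSA k ≤ σ aSC k ∧ σ aSC k < σ aSE k ∧ σ aSE k ≤ σ aSB k ∧ σ aSB k ≤ n := inv.task k hk
  have hpar : σ aSP k < σ xNc 0 := (inv.parent k hk).1
  have hcount : (splitView σ).N + (splitView σ).rest ≤ 2 * n + 1 := inv.count
  have hNc : σ xNc 0 ≤ 2 * n + 1 := le_trans (Nat.le_add_right _ _) hcount
  -- Each task on the stack contributes at least 1 to `rest`, which bounds the height of the stack
  -- and hence the word size that is needed for it.
  have hkn : k + 1 ≤ 2 * n + 1 := by
    have h7 : (splitView σ).sp ≤ (splitView σ).rest := by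
      unfold SplitState.rest
      conv_lhs => rw [← Finset.card_range (splitView σ).sp, Finset.card_eq_sum_ones]
      refine Finset.sum_le_sum fun i hi => ?_
      have := inv.task i (Finset.mem_range.1 hi)
      omega
    have h8 : (splitView σ).sp = σ xSp 0 := rfl
    omega
  have hlt : ∀ i < n, σ aPerm i < n := inv.lt
  have hinj : ∀ i < n, ∀ j < n, σ aPerm i = σ aPerm j → i = j := inv.inj
  have eP : τ aPerm = σ aPerm := hs aPerm (by decide)
  obtain ⟨z, a, b, hzab⟩ : ∃ z a b, (σ aSA k < σ aSC k ∧ z = σ aPerm (σ aSA k) ∧ a = σ aSA k + 1 ∧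
      b = σ aSB k) ∨ (¬ σ aSA k < σ aSC k ∧ σ aSE k < σ aSB k ∧ z = σ aPerm (σ aSB k - 1) ∧
        a = σ aSA k ∧ b = σ aSB k - 1) := by
    by_cases hc : σ aSA k < σ aSC k
    · exact ⟨_, _, _, Or.inl ⟨hc, rfl, rfl, rfl⟩⟩
    · exact ⟨_, _, _, Or.inr ⟨hc, by omega, rfl, rfl, rfl⟩⟩
  have hzn : z < n := by
    rcases hzab with ⟨k1, rfl, k2, k3⟩ | ⟨k1, k2, rfl, k4, k5⟩ <;> exact hlt _ (by omega)
  have hP1 := hlt (σ aSA k)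
  have hP2 := hlt (σ aSB k - 1)
  refine Ok.time (T := 30 + (((σ aSE k - σ aSC k) * 249 + 220) +
    ((σ aSE k - σ aSC k) * 19 + 10))) ?_ (by omega)
  refine Ok.seq (Q := fun υ => υ xPiv 0 = z ∧ υ xLo 0 = a ∧ υ xHi 0 = b) (Ok.of_wp ?_ (by decide)) ?_
  · simp only [choosePivotProg, Prog.wp, Expr.eval_cell, Expr.eval_ofNat, Expr.eval_add,
      Expr.eval_sub, ne_eq, Nat.reduceEqDiff, not_false_eq_true, Store.write_ne, Store.write_same,
      Function.update_self, h2, h3, h4, eP]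
    refine ⟨fun hc => ?_, fun hc => ?_⟩
    · rcases hzab with ⟨k1, rfl, k2, k3⟩ | ⟨k1, k2, rfl, k4, k5⟩ <;> omega
    · rcases hzab with ⟨k1, rfl, k2, k3⟩ | ⟨k1, k2, rfl, k4, k5⟩ <;> omega
  rintro υ hυ ⟨v1, v2, v3⟩
  have f : ∀ x, x ∉ choosePivotProg.writes → x ∉ popProg.writes → υ x = σ x := fun x hx hx' => by
    rw [hυ x hx, hs x hx']
  have u0 : υ 0 0 = n := by rw [hυ 0 (by decide), hn]
  have uM : υ aMtx = τ aMtx := hυ aMtx (by decide)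
  have uP : υ aPerm = σ aPerm := f aPerm (by decide) (by decide)
  have u4 : υ xCl 0 = σ aSC k := by rw [hυ xCl (by decide), h4]
  have u5 : υ xCh 0 = σ aSE k := by rw [hυ xCh (by decide), h5]
  have u6 : υ xPr 0 = σ aSP k := by rw [hυ xPr (by decide), h6]
  have u1 : υ xSp 0 = k := by rw [hυ xSp (by decide), h1]
  refine Ok.seq (distributeProg_ok (n := n) (R := R) u0 (uM ▸ hM) v1 u4 u5 u1 v2 v3 u6 hzn ht.2.1.le
    (by omega) (uP ▸ hlt) (uP ▸ hinj) (by rw [uP]; exact inv.sorted k hk) hW (by omega) (by omega)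
    (by omega) (by omega)) ?_
  rintro ω hω ⟨hP, hold⟩
  rw [uP] at hP
  have wP : ω aPerm = σ aPerm := (hω aPerm (by decide)).trans uP
  have w4 : ω xCl 0 = σ aSC k := by rw [hω xCl (by decide), u4]
  have w5 : ω xCh 0 = σ aSE k := by rw [hω xCh (by decide), u5]
  have hcl := hP.cnt_le
  refine Ok.for_const (σ aSC k) (σ aSE k) 6
    (fun i π => (∀ t, σ aSC k ≤ t → t < i → π aPerm t = ω aTmp t) ∧
      ∀ t, ¬ (σ aSC k ≤ t ∧ t < i) → π aPerm t = σ aPerm t)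
    w4 ht.2.1.le (by omega) (by decide) ?_ ?_ ?_ ?_ ?_
  · intro π hπ
    simp only [Expr.eval_cell, Expr.eval_ofNat, hπ xCh (by decide), w5]
  · simp only [ne_eq, Nat.reduceEqDiff, not_false_eq_true, Store.write_ne, wP]
    exact ⟨by omega, fun _ _ => trivial⟩
  · rintro i π hci hie hπi hπ ⟨hin, hout⟩
    have eT : π aTmp = ω aTmp := hπ aTmp (by decide)
    have hcard : ω xCnt 0 = σ aSE k := by
      have k1 := card_tset_of_injOn hP.inj
      have k2 : tset (ω aTmp) (σ aSC k) (ω xCnt 0) = tset (σ aPerm) (σ aSC k) (σ aSE k) := by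
        ext x
        rw [hP.mem]
        exact ⟨fun hx => hx.1, fun hx => ⟨hx, rl_lt has z x⟩⟩
      rw [k2, card_tset fun i hi j hj => hinj i (by omega) j (by omega)] at k1
      have := hP.le
      omega
    have hTi : ω aTmp i < n := by
      have : ω aTmp i ∈ tset (σ aPerm) (σ aSC k) (σ aSE k) :=
        ((hP.mem _).1 (mem_tset.2 ⟨i, hci, by omega, rfl⟩)).1
      obtain ⟨t, m1, m2, m3⟩ := mem_tset.1 this
      rw [← m3]
      exact hlt t (by omega)
    refine Ok.of_wp ?_ (by decide)
    simp only [Prog.wp, Expr.eval_cell, Expr.eval_ofNat, ne_eq, Nat.reduceEqDiff,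
      not_false_eq_true, Store.write_ne, Store.write_same, hπi, eT]
    refine ⟨by omega, by omega, fun t m1 m2 => ?_, fun t m1 => ?_⟩
    · by_cases hti : t = i
      · rw [hti, Function.update_self]
      · rw [Function.update_of_ne hti]
        exact hin t m1 (by omega)
    · rw [Function.update_of_ne (by omega)]
      exact hout t (by omega)
  · exact le_rfl
  · rintro π hπ - ⟨hin, hout⟩
    refine ⟨z, a, b, Parted.pivotStep (tmp := ω aTmp) (cnt := ω xCnt 0) inv hsp ?_ has ?_ hin hout
      ?_ ?_ ?_ ?_ ?_⟩
    -- `Parted` refers to the stack only, so overwriting the list of vertices does not disturb it.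
    · have : ∀ s s' : SplitState, s.sp = s'.sp → s.A = s'.A → s.B = s'.B → s.C = s'.C →
          s.E = s'.E → s.P = s'.P → ∀ {perm z c e k a b p tmp cnt r},
          Parted R perm z c e k a b p tmp cnt r s → Parted R perm z c e k a b p tmp cnt r s' := by
        rintro ⟨⟩ ⟨⟩ h1 h2 h3 h4 h5 h6
        dsimp only at h1 h2 h3 h4 h5 h6
        subst h1 h2 h3 h4 h5 h6
        rintro _ _ _ _ _ _ _ _ _ _ _ ⟨q1, q2, q3, q4, q5, q6, q7, q8⟩
        exact ⟨q1, q2, q3, q4, q5, q6, q7, q8⟩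
      refine this _ _ ?_ ?_ ?_ ?_ ?_ ?_ hP
      · exact (congrFun (hπ xSp (by decide)) 0).symm
      · exact (hπ aSA (by decide)).symm
      · exact (hπ aSB (by decide)).symm
      · exact (hπ aSC (by decide)).symm
      · exact (hπ aSE (by decide)).symm
      · exact (hπ aSP (by decide)).symm
    · rcases hzab with hc | hc
      · exact Or.inl hc
      · exact Or.inr hc.2
    · intro i hi
      obtain ⟨o1, o2, o3, o4, o5⟩ := hold i hi
      simp only [splitView, hπ aSA (by decide), hπ aSB (by decide), hπ aSC (by decide),
        hπ aSE (by decide), hπ aSP (by decide), o1, o2, o3, o4, o5, f aSA (by decide) (by decide),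
        f aSB (by decide) (by decide), f aSC (by decide) (by decide), f aSE (by decide) (by decide),
        f aSP (by decide) (by decide), and_self]
    · simp only [splitView, hπ xNc (by decide), hω xNc (by decide), f xNc (by decide) (by decide)]
    · simp only [splitView, hπ aRp (by decide), hω aRp (by decide), f aRp (by decide) (by decide)]
    · simp only [splitView, hπ aPa (by decide), hω aPa (by decide), f aPa (by decide) (by decide)]
    · simp only [splitView, hπ aSz (by decide), hω aSz (by decide), f aSz (by decide) (by decide)]

theorem newClassProg_ok {k : ℕ} {τ : Store} {cs : ℕ → Finset ℕ} (inv : SplitInv n R (splitView σ) cs)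
    (hsp : σ xSp 0 = k + 1)
    (hs : Same popProg σ τ) (h1 : τ xSp 0 = k) (h4 : τ xCl 0 = σ aSC k) (h5 : τ xCh 0 = σ aSE k)
    (h6 : τ xPr 0 = σ aSP k) (hpiv : σ aSA k = σ aSC k ∧ σ aSE k = σ aSB k)
    (hW : 4 * n + 10 ≤ W) :
    Ok W newClassProg τ 100 fun υ => ClassStep (splitView σ) (splitView υ) k := by
  have hk : k < (splitView σ).sp := by show k < σ xSp 0; omega
  have ht : σ aSA k ≤ σ aSC k ∧ σ aSC k < σ aSE k ∧ σ aSE k ≤ σ aSB k ∧ σ aSB k ≤ n := inv.task k hk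
  have hpar : σ aSP k < σ xNc 0 := (inv.parent k hk).1
  have hcount : (splitView σ).N + (splitView σ).rest ≤ 2 * n + 1 := inv.count
  have hNc : σ xNc 0 ≤ 2 * n + 1 := le_trans (Nat.le_add_right _ _) hcount
  have hkn : k + 1 ≤ 2 * n + 1 := by
    have h7 : (splitView σ).sp ≤ (splitView σ).rest := by
      unfold SplitState.rest
      conv_lhs => rw [← Finset.card_range (splitView σ).sp, Finset.card_eq_sum_ones]
      refine Finset.sum_le_sum fun i hi => ?_
      have := inv.task i (Finset.mem_range.1 hi)
      omega
    have h8 : (splitView σ).sp = σ xSp 0 := rfl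
    omega
  have hlt : σ aPerm (σ aSC k) < n := inv.lt _ (by show σ aSC k < n; omega)
  have eP : τ aPerm = σ aPerm := hs aPerm (by decide)
  have eN : τ xNc = σ xNc := hs xNc (by decide)
  have eR : τ aRp = σ aRp := hs aRp (by decide)
  have eQ : τ aPa = σ aPa := hs aPa (by decide)
  have eS : τ aSz = σ aSz := hs aSz (by decide)
  have eA : τ aSA = σ aSA := hs aSA (by decide)
  have eB : τ aSB = σ aSB := hs aSB (by decide)
  have eC : τ aSC = σ aSC := hs aSC (by decide)
  have eE : τ aSE = σ aSE := hs aSE (by decide)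
  have eF : τ aSP = σ aSP := hs aSP (by decide)
  refine Ok.of_wp ?_ (by decide)
  simp only [newClassProg, Prog.wp, Expr.eval_cell, Expr.eval_ofNat, Expr.eval_add, Expr.eval_sub,
    ne_eq, Nat.reduceEqDiff, not_false_eq_true, Store.write_ne, Store.write_same,
    Function.update_self, h1, h4, h5, h6, eP, eN, Nat.add_sub_cancel]
  refine ⟨by omega, by omega, by omega, by omega, by omega, by omega, by omega, by omega,
    fun hc => ⟨by omega, by omega, by omega, by omega, by omega, by omega, by omega, by omega,
      by omega, by omega, by omega, by omega, by omega, by omega, by omega, by omega, by omega,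
      by omega, by omega, by omega, ?_⟩, fun hc => ?_⟩
  · refine ⟨hsp, hpiv, ?_, ?_, ?_, ?_, Or.inr ?_⟩
    · simp only [splitView, ne_eq, Nat.reduceEqDiff, not_false_eq_true, Store.write_ne, eP]
    · intro i hi
      have : i ≠ k := by omega
      simp [splitView, eA, eB, eC, eE, eF, this]
    · intro j hj
      have hj' : j < σ xNc 0 := hj
      have h7 : j ≠ σ xNc 0 := by omega
      have h8 : j ≠ σ xNc 0 + 1 := by omega
      simp [splitView, eR, eQ, eS, h7, h8]
    · simp [splitView]
    · simp [splitView]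
      omega
  · refine ⟨hsp, hpiv, ?_, ?_, ?_, ?_, Or.inl ?_⟩
    · simp only [splitView, ne_eq, Nat.reduceEqDiff, not_false_eq_true, Store.write_ne, eP]
    · intro i hi
      simp [splitView, eA, eB, eC, eE, eF]
    · intro j hj
      have hj' : j < σ xNc 0 := hj
      have h7 : j ≠ σ xNc 0 := by omega
      simp [splitView, eR, eQ, eS, h7]
    · simp [splitView]
    · simp [splitView, h1]
      omega

theorem Ok.assign_seq {a : ℕ} {i e : Expr} {q : Prog} {T T' : ℕ} {Q : Store → Prop}
    (h1 : i.eval σ ≤ W) (h2 : e.eval σ ≤ W) (h3 : i.cost + e.cost + 1 ≤ T)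
    (h4 : Ok W q (σ.write a (i.eval σ) (e.eval σ)) T' Q) :
    Ok W (.assign a i e ;; q) σ (T + T') Q := by
  refine Ok.seq (Q := fun υ => υ = σ.write a (i.eval σ) (e.eval σ))
    ((Ok.assign (Q := fun υ => υ = σ.write a (i.eval σ) (e.eval σ)) h1 h2 rfl).time h3) ?_
  rintro υ - rfl
  exact h4

/-- A pivot round on a task of length l costs O(l) and lowers `pot` by at least l ≥ 1 without
raising `rest`. A class round costs O(1) and lowers `rest` without raising `pot`. Initially `pot` is
n(n - 1) and `rest` is 2n - 1, whence the quadratic bound. -/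
theorem splitProg_ok (hn : σ 0 0 = n) (hn1 : 1 ≤ n) (hM : IsMatrix n R (σ aMtx))
    (has : ∀ x y, R x y → ¬ R y x) (hR : ∀ x y, R x y → x < n ∧ y < n)
    (hp : TopoList n R (σ aPerm)) (hW : 4 * n + 10 ≤ W) :
    Ok W splitProg σ (1000 * (n * n) + 500 * n + 100) fun τ =>
      ∃ cs, ClassTree n R (τ xNc 0) (τ aRp) (τ aPa) (τ aSz) cs := by
  refine Ok.time (T := 4 + (3 + (3 + (3 + (4 + (3 + (4 + (3 + (3 +
    (1000 * (n * n) + 500 * n + 50)))))))))) ?_ (by omega)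
  iterate 9
    refine Ok.assign_seq (by simp) (by simp [hn] <;> omega) (by decide) ?_
  generalize hσ' : Store.write _ aSz _ _ = σ'
  have hf : ∀ x, x ∉ [aRp, xNc, xSp, aSA, aSB, aSC, aSE, aSP, aSz] → σ' x = σ x := by
    intro x hx
    simp only [List.mem_cons, List.not_mem_nil, or_false, not_or] at hx
    rw [← hσ']
    simp [hx]
  have hinit : SplitInit n (splitView σ') := by
    rw [← hσ']
    refine ⟨?_, ?_, ?_, ?_, ?_⟩ <;> simp [splitView, hn]
  clear hσ'
  have hp' : TopoList n R (splitView σ').perm := by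
    show TopoList n R (σ' aPerm)
    rw [hf aPerm (by decide)]; exact hp
  refine Ok.loop (fun τ => ∃ cs, SplitInv n R (splitView τ) cs)
    (fun τ => 800 * (splitView τ).pot + 200 * (splitView τ).rest) ?_ ?_ ?_ ?_
  · rintro τ hτ ⟨cs, inv⟩ hne
    simp only [Expr.eval_cell, Expr.eval_ofNat] at hne
    obtain ⟨k, hk⟩ : ∃ k, τ xSp 0 = k + 1 := ⟨τ xSp 0 - 1, by omega⟩
    have hk' : k < (splitView τ).sp := by show k < τ xSp 0; omega
    have ht : τ aSA k ≤ τ aSC k ∧ τ aSC k < τ aSE k ∧ τ aSE k ≤ τ aSB k ∧ τ aSB k ≤ n :=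
      inv.task k hk'
    have hpar : τ aSP k < τ xNc 0 := (inv.parent k hk').1
    have hcount : (splitView τ).N + (splitView τ).rest ≤ 2 * n + 1 := inv.count
    have hNc : τ xNc 0 ≤ 2 * n + 1 := le_trans (Nat.le_add_right _ _) hcount
    have hkn : k + 1 ≤ 2 * n + 1 := by
      have h7 : (splitView τ).sp ≤ (splitView τ).rest := by
        unfold SplitState.rest
        conv_lhs => rw [← Finset.card_range (splitView τ).sp, Finset.card_eq_sum_ones]
        refine Finset.sum_le_sum fun i hi => ?_
        have := inv.task i (Finset.mem_range.1 hi)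
        omega
      have h8 : (splitView τ).sp = τ xSp 0 := rfl
      omega
    have t0 : τ 0 = σ 0 := (hτ 0 (by decide)).trans (hf 0 (by decide))
    have tM : τ aMtx = σ aMtx := (hτ aMtx (by decide)).trans (hf aMtx (by decide))
    have hpop : Ok W popProg τ 40 fun υ => υ xSp 0 = k ∧ υ xLo 0 = τ aSA k ∧ υ xHi 0 = τ aSB k ∧
        υ xCl 0 = τ aSC k ∧ υ xCh 0 = τ aSE k ∧ υ xPr 0 = τ aSP k := by
      refine Ok.of_wp ?_ (by decide)
      simp only [popProg, Prog.wp, Expr.eval_cell, Expr.eval_ofNat, Expr.eval_sub,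
        ne_eq, Nat.reduceEqDiff, not_false_eq_true, Store.write_ne, Store.write_same,
        Function.update_self, hk, Nat.add_sub_cancel]
      repeat' apply And.intro
      all_goals first | omega | trivial
    by_cases hpiv : τ aSA k < τ aSC k ∨ τ aSE k < τ aSB k
    · refine ⟨40 + (12 + ((τ aSE k - τ aSC k) * 268 + 270)), Ok.seq hpop ?_⟩
      rintro υ hυ ⟨h1, h2, h3, h4, h5, h6⟩
      refine Ok.cond (T := (τ aSE k - τ aSC k) * 268 + 270) (fun _ => ?_) (fun h => ?_) ?_
      · refine (pivotProg_ok inv hk (by rw [hυ 0 (by decide), t0, hn])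
          (by rw [hυ aMtx (by decide), tM]; exact hM) has hυ h1 h2 h3 h4 h5 h6 hpiv hW).mono le_rfl ?_
        rintro ω - ⟨z, a, b, hstep⟩
        refine ⟨⟨cs, hstep.inv inv⟩, ?_⟩
        have k1 := hstep.rest_le inv
        have k2 : (splitView ω).pot + (τ aSE k - τ aSC k) ≤ (splitView τ).pot := hstep.pot_le inv
        have k3 : (sv xSp).cost = 2 := rfl
        omega
      · exfalso
        simp only [Expr.eval_cell, Expr.eval_ofNat, Expr.eval_add, Expr.eval_sub, h2, h3, h4, h5] at h
        omega
      · exact le_of_eq (Nat.add_comm _ _ |>.trans (by rw [Nat.add_comm]; rfl))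
    · refine ⟨40 + (12 + 100), Ok.seq hpop ?_⟩
      rintro υ hυ ⟨h1, h2, h3, h4, h5, h6⟩
      refine Ok.cond (T := 100) (fun h => ?_) (fun _ => ?_) (by decide)
      · exfalso
        simp only [Expr.eval_cell, Expr.eval_ofNat, Expr.eval_add, Expr.eval_sub, h2, h3, h4, h5] at h
        omega
      · refine (newClassProg_ok inv hk hυ h1 h4 h5 h6 (by omega) hW).mono le_rfl ?_
        rintro ω - hstep
        refine ⟨⟨_, hstep.inv inv⟩, ?_⟩
        have k1 := hstep.rest_lt inv
        have k2 := hstep.pot_le inv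
        have k3 : (sv xSp).cost = 2 := rfl
        omega
  · exact ⟨_, hinit.inv hn1 hp' hR⟩
  · have h1 : (splitView σ').pot = n * (n - 1) := by
      unfold SplitState.pot
      obtain ⟨h2, h3, h4, h5, h6⟩ := hinit.task
      rw [hinit.sp, Finset.sum_range_one, h2, h3, h4, h5, Nat.sub_zero]
    have h2 : (splitView σ').rest = 2 * n - 1 := by
      unfold SplitState.rest
      obtain ⟨_, h3, h4, h5, h6⟩ := hinit.task
      rw [hinit.sp, Finset.sum_range_one, h4, h5, Nat.sub_zero]
    have h3 : n * (n - 1) ≤ n * n := Nat.mul_le_mul_left _ (by omega)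
    have h4 : (sv xSp).cost = 2 := rfl
    rw [h1, h2]
    omega
  · rintro τ - ⟨cs, inv⟩ h0
    exact ⟨cs, inv.classTree h0 hR⟩

end

/-! ### The modules which contain the representative of a class -/

theorem rl_self {R : ℕ → ℕ → Prop} (h : ∀ x, ¬ R x x) (x : ℕ) : rl R x x = 0 := by
  simp [rl, h]

theorem rl_eq_zero {R : ℕ → ℕ → Prop} {u x : ℕ} : rl R u x = 0 ↔ ¬ R u x ∧ ¬ R x u := by
  unfold rl
  by_cases h1 : R u x <;> by_cases h2 : R x u <;> simp [h1, h2]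

theorem rl_symm {R : ℕ → ℕ → Prop} {u w x y : ℕ} :
    rl R u x = rl R w y ↔ rl R x u = rl R y w := by
  unfold rl
  by_cases h1 : R u x <;> by_cases h2 : R w y <;> by_cases h3 : R x u <;> by_cases h4 : R y w <;>
    simp [h1, h2, h3, h4]

/-- The set `S` is a module with minimal element `v`; the sets `K 0 = {v}, …, K (q - 1)` partition
it into modules; every module in `S` which avoids `v` is contained in one of them. -/
structure Kids (R : ℕ → ℕ → Prop) (S : Finset ℕ) (v q : ℕ) (K : ℕ → Finset ℕ) (r : ℕ → ℕ) :
    Prop where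
  two : 2 ≤ q
  zero : K 0 = {v}
  mem : ∀ i < q, r i ∈ K i
  mod : ∀ i < q, IsMod R (K i)
  disj : ∀ i < q, ∀ j < q, i ≠ j → Disjoint (K i) (K j)
  cover : ∀ x, x ∈ S ↔ ∃ i < q, x ∈ K i
  modS : IsMod R S
  min : ∀ x ∈ S, ¬ R x v
  maxi : ∀ M : Finset ℕ, M.Nonempty → IsMod R M → M ⊆ S → v ∉ M → ∃ i < q, M ⊆ K i
  irrefl : ∀ x, ¬ R x x

/-- The part with number `y` distinguishes the part with number `z` from `v`. -/
def Forces (R : ℕ → ℕ → Prop) (v : ℕ) (r : ℕ → ℕ) (z y : ℕ) : Prop :=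
  rl R (r y) v ≠ rl R (r y) (r z)

/-- A set of numbers of parts whose union is a module which contains `v`. -/
structure Closed (R : ℕ → ℕ → Prop) (v q : ℕ) (r : ℕ → ℕ) (I : Finset ℕ) : Prop where
  sub : I ⊆ Finset.range q
  zero : 0 ∈ I
  step : ∀ z ∈ I, ∀ y < q, Forces R v r z y → y ∈ I

/-- Every closed set which lies strictly between `A` and the smallest closed set containing `A` and
`x` contains `x`. -/
structure Pick (R : ℕ → ℕ → Prop) (v q : ℕ) (r : ℕ → ℕ) (A : Finset ℕ) (x : ℕ) : Prop where
  lt : x < q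
  notMem : x ∉ A
  mem : ∀ I, Closed R v q r I → A ⊂ I →
    (∀ I', Closed R v q r I' → A ⊆ I' → x ∈ I' → I ⊆ I') → x ∈ I

section
open Classical
variable {R : ℕ → ℕ → Prop} {S : Finset ℕ} {v q : ℕ} {K : ℕ → Finset ℕ} {r : ℕ → ℕ}
  {A I N : Finset ℕ} {x : ℕ}

theorem Kids.rep_zero (h : Kids R S v q K r) : r 0 = v := by
  have := h.mem 0 (by have := h.two; omega)
  rwa [h.zero, Finset.mem_singleton] at this

theorem Kids.idx_eq (h : Kids R S v q K r) {i j : ℕ} (hi : i < q) (hj : j < q) (h1 : x ∈ K i)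
    (h2 : x ∈ K j) : i = j := by
  by_contra hij
  exact Finset.disjoint_left.1 (h.disj i hi j hj hij) h1 h2

theorem Kids.notMem_of_ne (h : Kids R S v q K r) {i j : ℕ} (hi : i < q) (hj : j < q) (hij : i ≠ j) :
    r i ∉ K j := fun h1 => hij (h.idx_eq hi hj (h.mem i hi) h1)

theorem Kids.rep_mem (h : Kids R S v q K r) {i : ℕ} (hi : i < q) : r i ∈ S :=
  (h.cover _).2 ⟨i, hi, h.mem i hi⟩

theorem Kids.mem_biUnion (h : Kids R S v q K r) (hA : A ⊆ Finset.range q) {i : ℕ} (hi : i < q)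
    (hx : x ∈ K i) : x ∈ A.biUnion K ↔ i ∈ A := by
  rw [Finset.mem_biUnion]
  constructor
  · rintro ⟨j, hj, hxj⟩
    rwa [h.idx_eq hi (Finset.mem_range.1 (hA hj)) hx hxj]
  · exact fun hi => ⟨i, hi, hx⟩

/-- A vertex of `S` outside the union lies in a part `l` which, by closedness, forces no `z` in `A`;
so it sees the representative of `z` as it sees `v`. As parts are modules, representatives may be
exchanged for arbitrary members on both sides. -/
theorem Kids.isMod_biUnion (h : Kids R S v q K r) (hA : Closed R v q r A) :
    IsMod R (A.biUnion K) := by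
  have hsub : ∀ y ∈ A.biUnion K, y ∈ S := by
    intro y hy
    obtain ⟨i, hi, hyi⟩ := Finset.mem_biUnion.1 hy
    exact (h.cover y).2 ⟨i, Finset.mem_range.1 (hA.sub hi), hyi⟩
  intro u hu x hx y hy
  by_cases huS : u ∈ S
  · obtain ⟨l, hl, hul⟩ := (h.cover u).1 huS
    have hlA : l ∉ A := fun hlA => hu ((h.mem_biUnion hA.sub hl hul).2 hlA)
    have key : ∀ x ∈ A.biUnion K, rl R u x = rl R (r l) v := by
      intro x hx
      obtain ⟨z, hz, hxz⟩ := Finset.mem_biUnion.1 hx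
      have hzq := Finset.mem_range.1 (hA.sub hz)
      have hzl : z ≠ l := by rintro rfl; exact hlA hz
      have h1 : ¬ Forces R v r z l := fun h1 => hlA (hA.step z hz l hl h1)
      rw [Forces, not_not] at h1
      rw [h1, h.mod z hzq u (fun h2 => hzl (h.idx_eq hzq hl h2 hul)) x hxz (r z) (h.mem z hzq),
        rl_symm]
      exact h.mod l hl (r z) (h.notMem_of_ne hzq hl hzl) u hul (r l) (h.mem l hl)
    rw [key x hx, key y hy]
  · exact h.modS u huS x (hsub x hx) y (hsub y hy)

/-- A part whose representative lies outside the module `N` cannot distinguish two members of `N`,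
in particular not `v` from another representative. -/
theorem Kids.closed_of_isMod (h : Kids R S v q K r) (hN : IsMod R N) (hv : v ∈ N) :
    Closed R v q r ((Finset.range q).filter fun i => r i ∈ N) := by
  refine ⟨Finset.filter_subset _ _, ?_, ?_⟩
  · rw [Finset.mem_filter, Finset.mem_range, h.rep_zero]
    exact ⟨by have := h.two; omega, hv⟩
  · intro z hz y hy hF
    rw [Finset.mem_filter] at hz ⊢
    refine ⟨Finset.mem_range.2 hy, ?_⟩
    by_contra hyN
    exact hF (hN (r y) hyN v hv (r z) hz.2)

/-- The union of `A` is a module, so `r x` is related to `r y` as to `v`, that is, not at all. Hence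
`y` distinguishes `x` from `v` exactly if `y` is comparable with `v`, and then it is above `v` by
minimality of `v`. -/
theorem Kids.forces_of_mem (h : Kids R S v q K r) (hA : Closed R v q r A) (hx : x < q) (hxA : x ∉ A)
    (hxv : rl R v (r x) = 0) {y : ℕ} (hy : y ∈ A) : Forces R v r x y ↔ R v (r y) := by
  have hyq := Finset.mem_range.1 (hA.sub hy)
  have h0q : 0 < q := by have := h.two; omega
  have h1 : rl R (r x) (r y) = rl R (r x) v := by
    refine h.isMod_biUnion hA (r x) ?_ _ ?_ _ ?_
    · rwa [h.mem_biUnion hA.sub hx (h.mem x hx)]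
    · rwa [h.mem_biUnion hA.sub hyq (h.mem y hyq)]
    · rw [h.mem_biUnion hA.sub h0q (by rw [h.zero]; exact Finset.mem_singleton_self v)]
      exact hA.zero
  have h2 : rl R (r y) (r x) = 0 := by
    have h3 : rl R (r y) (r x) = rl R v (r x) := rl_symm.1 h1
    rw [h3, hxv]
  rw [Forces, h2, Ne, rl_eq_zero]
  have := h.min (r y) (h.rep_mem hyq)
  tauto

/-- The members of `A` above `v` force `x` in any case. Equal numbers mean that nothing else does,
so adding `x` forces nothing new. With counts computed in advance, this is a test in constant time.
-/
theorem Kids.closed_insert (h : Kids R S v q K r) (hA : Closed R v q r A) (hx : x < q) (hxA : x ∉ A)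
    (hxv : rl R v (r x) = 0)
    (hc : ((Finset.range q).filter (Forces R v r x)).card = (A.filter fun y => R v (r y)).card) :
    Closed R v q r (insert x A) := by
  have hsub : (A.filter fun y => R v (r y)) ⊆ (Finset.range q).filter (Forces R v r x) := by
    intro y hy
    rw [Finset.mem_filter] at hy ⊢
    exact ⟨hA.sub hy.1, (h.forces_of_mem hA hx hxA hxv hy.1).2 hy.2⟩
  have heq := Finset.eq_of_subset_of_card_le hsub hc.le
  refine ⟨?_, Finset.mem_insert_of_mem hA.zero, ?_⟩
  · intro y hy
    rcases Finset.mem_insert.1 hy with rfl | hy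
    · exact Finset.mem_range.2 hx
    · exact hA.sub hy
  · intro z hz y hy hF
    refine Finset.mem_insert_of_mem ?_
    rcases Finset.mem_insert.1 hz with rfl | hz
    · have : y ∈ (Finset.range q).filter (Forces R v r z) :=
        Finset.mem_filter.2 ⟨Finset.mem_range.2 hy, hF⟩
      rw [← heq] at this
      exact (Finset.mem_filter.1 this).1
    · exact hA.step z hz y hy hF

theorem Kids.pick_of_twin (h : Kids R S v q K r) (hA : Closed R v q r A) (hx : x < q) (hxA : x ∉ A)
    (hxv : rl R v (r x) = 0)
    (hc : ((Finset.range q).filter (Forces R v r x)).card = (A.filter fun y => R v (r y)).card) :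
    Pick R v q r A x := by
  refine ⟨hx, hxA, fun I _ hAI hmin => ?_⟩
  have h1 := hmin _ (h.closed_insert hA hx hxA hxv hc) (Finset.subset_insert _ _)
    (Finset.mem_insert_self _ _)
  obtain ⟨y, hy, hyA⟩ := Finset.exists_of_ssubset hAI
  rcases Finset.mem_insert.1 (h1 hy) with rfl | h2
  · exact hy
  · exact absurd h2 hyA

/-- Let `T` be the union of `I` without that of `A`. All of `T` is incomparable with `v`, hence with
the whole module formed by `A`. A connected component of the comparability graph on `T` is therefore
a module avoiding `v`, so by `maxi` it lies in a single part. This part is incomparable with the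
rest of `T`, so outside `A` nothing forces it. -/
theorem Kids.exists_twin (h : Kids R S v q K r) (hA : Closed R v q r A) (hI : Closed R v q r I)
    (hAI : A ⊂ I) (hU : ∀ y ∈ I, R v (r y) → y ∈ A) :
    ∃ x < q, x ∉ A ∧ rl R v (r x) = 0 ∧
      ((Finset.range q).filter (Forces R v r x)).card = (A.filter fun y => R v (r y)).card := by
  obtain ⟨z, hzI, hzA⟩ := Finset.exists_of_ssubset hAI
  have hzq := Finset.mem_range.1 (hI.sub hzI)
  have h0q : 0 < q := by have := h.two; omega
  have hv0 : v ∈ K 0 := by rw [h.zero]; exact Finset.mem_singleton_self v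
  have hvA : v ∈ A.biUnion K := (h.mem_biUnion hA.sub h0q hv0).2 hA.zero
  have hinc : ∀ i ∈ I, i ∉ A → rl R v (r i) = 0 := fun i hi hiA => by
    rw [rl_eq_zero]
    exact ⟨fun h1 => hiA (hU i hi h1), h.min _ (h.rep_mem (Finset.mem_range.1 (hI.sub hi)))⟩
  let T := I.biUnion K \ A.biUnion K
  have hT : ∀ w, w ∈ T ↔ ∃ i ∈ I, i ∉ A ∧ w ∈ K i := by
    intro w
    rw [Finset.mem_sdiff, Finset.mem_biUnion]
    constructor
    · rintro ⟨⟨i, hi, hw⟩, hwA⟩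
      refine ⟨i, hi, fun hiA => hwA ?_, hw⟩
      exact Finset.mem_biUnion.2 ⟨i, hiA, hw⟩
    · rintro ⟨i, hi, hiA, hw⟩
      refine ⟨⟨i, hi, hw⟩, fun hwA => hiA ?_⟩
      rwa [h.mem_biUnion hA.sub (Finset.mem_range.1 (hI.sub hi)) hw] at hwA
  have hTA : ∀ w ∈ T, ∀ u ∈ A.biUnion K, rl R u w = 0 := by
    intro w hw u hu
    have hw' := (Finset.mem_sdiff.1 hw).2
    obtain ⟨i, hi, hiA, hwi⟩ := (hT w).1 hw
    have hiq := Finset.mem_range.1 (hI.sub hi)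
    have h1 : rl R u w = rl R v w := rl_symm.1 (h.isMod_biUnion hA w hw' u hu v hvA)
    rw [h1, h.mod i hiq v (fun hvi => ?_) w hwi (r i) (h.mem i hiq), hinc i hi hiA]
    have := h.idx_eq hiq h0q hvi hv0
    exact hiA (this ▸ hA.zero)
  -- The connected component of `r z` in the comparability graph on `T`.
  let M := T.filter fun w => Relation.ReflTransGen (fun a b => b ∈ T ∧ rl R a b ≠ 0) (r z) w
  have hMT : M ⊆ T := Finset.filter_subset _ _
  have hMmod : IsMod R M := by
    intro u hu x hx y hy
    have hxT := hMT hx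
    have hyT := hMT hy
    by_cases huI : u ∈ I.biUnion K
    · by_cases huA : u ∈ A.biUnion K
      · rw [hTA x hxT u huA, hTA y hyT u huA]
      · have huT : u ∈ T := Finset.mem_sdiff.2 ⟨huI, huA⟩
        have key : ∀ x ∈ M, rl R u x = 0 := by
          intro x hx
          by_contra hne
          refine hu (Finset.mem_filter.2 ⟨huT, (Finset.mem_filter.1 hx).2.tail ⟨huT, fun h0 => hne ?_⟩⟩)
          rw [rl_eq_zero] at h0 ⊢
          exact h0.symm
        rw [key x hx, key y hy]
    · exact h.isMod_biUnion hI u huI x (Finset.mem_sdiff.1 hxT).1 y (Finset.mem_sdiff.1 hyT).1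
  have hzT : r z ∈ T := (hT _).2 ⟨z, hzI, hzA, h.mem z hzq⟩
  have hzM : r z ∈ M := Finset.mem_filter.2 ⟨hzT, .refl⟩
  have hMS : M ⊆ S := by
    intro w hw
    obtain ⟨i, hi, _, hwi⟩ := (hT w).1 (hMT hw)
    exact (h.cover w).2 ⟨i, Finset.mem_range.1 (hI.sub hi), hwi⟩
  have hMv : v ∉ M := fun hv => (Finset.mem_sdiff.1 (hMT hv)).2 hvA
  obtain ⟨l, hl, hMl⟩ := h.maxi M ⟨_, hzM⟩ hMmod hMS hMv
  have hlz : l = z := h.idx_eq hl hzq (hMl hzM) (h.mem z hzq)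
  subst hlz
  refine ⟨l, hl, hzA, hinc l hzI hzA, congrArg Finset.card ?_⟩
  ext y
  rw [Finset.mem_filter, Finset.mem_filter, Finset.mem_range]
  constructor
  · rintro ⟨hy, hF⟩
    by_cases hyA : y ∈ A
    · exact ⟨hyA, (h.forces_of_mem hA hl hzA (hinc l hzI hzA) hyA).1 hF⟩
    · exfalso
      have hyI := hI.step l hzI y hy hF
      have h0 : rl R (r y) v = 0 := by
        have := hinc y hyI hyA
        rw [rl_eq_zero] at this ⊢
        exact this.symm
      have hyT : r y ∈ T := (hT _).2 ⟨y, hyI, hyA, h.mem y hy⟩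
      have hne : rl R (r l) (r y) ≠ 0 := by
        intro h1
        refine hF (h0.trans ?_)
        rw [eq_comm, rl_eq_zero]
        exact (rl_eq_zero.1 h1).symm
      have hyM : r y ∈ M := Finset.mem_filter.2 ⟨hyT, .single ⟨hyT, hne⟩⟩
      have := h.idx_eq hl hy (hMl hyM) (h.mem y hy)
      rw [this] at hne
      exact hne (rl_self h.irrefl _)
  · rintro ⟨hyA, hyv⟩
    exact ⟨Finset.mem_range.1 (hA.sub hyA), (h.forces_of_mem hA hl hzA (hinc l hzI hzA) hyA).2 hyv⟩

theorem Kids.closed_range (h : Kids R S v q K r) : Closed R v q r (Finset.range q) :=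
  ⟨subset_rfl, Finset.mem_range.2 (by have := h.two; omega), fun _ _ y hy _ => Finset.mem_range.2 hy⟩

/-- Since no part can be added alone, a larger closed set contains some new `y` above `v`. If `y`
did not force `x`, then `x`, being above `v`, would be above `y`, against minimality. -/
theorem Kids.pick_of_minimal (h : Kids R S v q K r) (hA : Closed R v q r A)
    (hno : ∀ x < q, x ∉ A → rl R v (r x) = 0 →
      ((Finset.range q).filter (Forces R v r x)).card ≠ (A.filter fun y => R v (r y)).card)
    (hx : x < q) (hxA : x ∉ A) (hxv : R v (r x))
    (hmin : ∀ y < q, y ∉ A → R v (r y) → ¬ R (r y) (r x)) : Pick R v q r A x := by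
  refine ⟨hx, hxA, fun I hI hAI _ => ?_⟩
  have h1 : ∃ y ∈ I, R v (r y) ∧ y ∉ A := by
    by_contra hc
    push Not at hc
    obtain ⟨y, k1, k2, k3, k4⟩ := h.exists_twin hA hI hAI hc
    exact hno y k1 k2 k3 k4
  obtain ⟨y, hyI, hyv, hyA⟩ := h1
  refine hI.step y hyI x hx fun heq => ?_
  have := (rl_eq_iff.1 heq).2.1 hxv
  exact hmin y (Finset.mem_range.1 (hI.sub hyI)) hyA hyv this

theorem Kids.exists_above (h : Kids R S v q K r) (hA : Closed R v q r A) (hne : A ≠ Finset.range q)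
    (hno : ∀ x < q, x ∉ A → rl R v (r x) = 0 →
      ((Finset.range q).filter (Forces R v r x)).card ≠ (A.filter fun y => R v (r y)).card) :
    ∃ x < q, x ∉ A ∧ R v (r x) := by
  by_contra hc
  push Not at hc
  obtain ⟨y, k1, k2, k3, k4⟩ := h.exists_twin hA h.closed_range (hA.sub.ssubset_of_ne hne)
    fun y hy hyv => by
      by_contra hyA
      exact hc y (Finset.mem_range.1 hy) hyA hyv
  exact hno y k1 k2 k3 k4

/-- The state of the enumeration of the closed sets.  The list `o` has `len` entries; those before
number `h` have been processed; the closed sets found so far consist of the first `bd i` entries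
of `o`, for `i < nb`. -/
structure ChainInv (R : ℕ → ℕ → Prop) (v q : ℕ) (r o bd : ℕ → ℕ) (h len nb : ℕ) : Prop where
  lt : ∀ t < len, o t < q
  inj : ∀ t < len, ∀ u < len, o t = o u → t = u
  zero : o 0 = 0
  le : 1 ≤ h ∧ h ≤ len
  done : ∀ t < h, ∀ y < q, Forces R v r (o t) y → y ∈ tset o 0 len
  start : nb = 0 → h = 1 ∧ len = 1
  first : 1 ≤ nb → bd 0 = 1
  bd_lt : ∀ i < nb, 1 ≤ bd i ∧ bd i < len
  mono : ∀ i, i + 1 < nb → bd i < bd (i + 1)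
  pick : ∀ i < nb, Closed R v q r (tset o 0 (bd i)) ∧ Pick R v q r (tset o 0 (bd i)) (o (bd i))
  gen : ∀ i < nb, ∀ I, Closed R v q r I → tset o 0 (bd i) ⊆ I → o (bd i) ∈ I →
    tset o 0 (if i + 1 < nb then bd (i + 1) else len) ⊆ I

/-! ### Building the chain of closed sets with a queue -/

variable {o bd : ℕ → ℕ} {c len nb y : ℕ}

theorem tset_update_of_le {o : ℕ → ℕ} {len y e : ℕ} (he : e ≤ len) :
    tset (Function.update o len y) 0 e = tset o 0 e :=
  tset_congr fun t _ ht => Function.update_of_ne (by omega) _ _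

theorem ChainInv.init (h : Kids R S v q K r) (h0 : o 0 = 0) : ChainInv R v q r o bd 1 1 0 := by
  refine ⟨?_, ?_, h0, ⟨le_rfl, le_rfl⟩, ?_, fun _ => ⟨rfl, rfl⟩, ?_, ?_, ?_, ?_, ?_⟩
  · intro t ht
    have : t = 0 := by omega
    rw [this, h0]
    have := h.two; omega
  · omega
  · intro t ht y _ hF
    have : t = 0 := by omega
    rw [this, h0, Forces, h.rep_zero] at hF
    exact absurd rfl hF
  all_goals omega

theorem ChainInv.closed (h : ChainInv R v q r o bd c c nb) : Closed R v q r (tset o 0 c) := by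
  refine ⟨?_, mem_tset.2 ⟨0, le_rfl, h.le.1, h.zero⟩, ?_⟩
  · intro x hx
    obtain ⟨t, _, h1, rfl⟩ := mem_tset.1 hx
    exact Finset.mem_range.2 (h.lt t h1)
  · intro z hz y hy hF
    obtain ⟨t, _, h1, rfl⟩ := mem_tset.1 hz
    exact h.done t h1 y hy hF

theorem ChainInv.len_le (h : ChainInv R v q r o bd c len nb) : len ≤ q := by
  have h1 := card_tset h.inj (c := 0)
  have h2 : tset o 0 len ⊆ Finset.range q := by
    intro x hx
    obtain ⟨t, _, h1, rfl⟩ := mem_tset.1 hx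
    exact Finset.mem_range.2 (h.lt t h1)
  have := Finset.card_le_card h2
  rw [h1, Finset.card_range] at this
  omega

theorem ChainInv.append (h : ChainInv R v q r o bd c len nb) (hy : y < q) (hyo : y ∉ tset o 0 len)
    (hnb : 1 ≤ nb) (hgen : ∀ I, Closed R v q r I → tset o 0 len ⊆ I → y ∈ I) :
    ChainInv R v q r (Function.update o len y) bd c (len + 1) nb := by
  have hle := h.le
  have hne : ∀ t < len, o t ≠ y := fun t ht hty => hyo (mem_tset.2 ⟨t, by omega, ht, hty⟩)
  refine ⟨?_, ?_, ?_, by omega, ?_, by omega, h.first, ?_, h.mono, ?_, ?_⟩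
  · intro t ht
    rcases Nat.lt_succ_iff_lt_or_eq.1 ht with ht | rfl
    · rw [Function.update_of_ne (by omega)]; exact h.lt t ht
    · rwa [Function.update_self]
  · intro t ht u hu htu
    rcases Nat.lt_succ_iff_lt_or_eq.1 ht with ht | rfl <;>
      rcases Nat.lt_succ_iff_lt_or_eq.1 hu with hu | rfl
    · rw [Function.update_of_ne (by omega), Function.update_of_ne (by omega)] at htu
      exact h.inj t ht u hu htu
    · rw [Function.update_of_ne (by omega), Function.update_self] at htu
      exact absurd htu (hne t ht)
    · rw [Function.update_self, Function.update_of_ne (by omega)] at htu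
      exact absurd htu.symm (hne u hu)
    · rfl
  · rw [Function.update_of_ne (by omega), h.zero]
  · intro t ht w hw hF
    rw [Function.update_of_ne (by omega)] at hF
    rw [mem_tset_update (by omega)]
    exact Or.inl (h.done t ht w hw hF)
  · intro i hi
    have := h.bd_lt i hi
    omega
  · intro i hi
    have := h.bd_lt i hi
    rw [tset_update_of_le (by omega), Function.update_of_ne (by omega)]
    exact h.pick i hi
  · intro i hi I hI h1 h2
    have := h.bd_lt i hi
    rw [tset_update_of_le (by omega)] at h1
    rw [Function.update_of_ne (by omega)] at h2
    have h3 := h.gen i hi I hI h1 h2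
    split_ifs at h3 ⊢ with hi'
    · have := h.bd_lt _ hi'
      rwa [tset_update_of_le (by omega)]
    · intro w hw
      rcases (mem_tset_update (by omega)).1 hw with hw | rfl
      · exact h3 hw
      · exact hgen I hI h3

/-- When the queue is exhausted, all consequences of the listed parts are listed, so the list forms
a closed set. Its length is recorded as a boundary, and a picked part starts the next closed set. -/
theorem ChainInv.select (h : ChainInv R v q r o bd c c nb)
    (hp : Pick R v q r (tset o 0 c) x) :
    ChainInv R v q r (Function.update o c x) (Function.update bd nb c) c (c + 1) (nb + 1) := by
  have hle := h.le
  have hne : ∀ t < c, o t ≠ x := fun t ht hty => hp.notMem (mem_tset.2 ⟨t, by omega, ht, hty⟩)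
  have hbd : ∀ i, i < nb + 1 → (i < nb ∧ Function.update bd nb c i = bd i) ∨
      (i = nb ∧ Function.update bd nb c i = c) := by
    intro i hi
    rcases Nat.lt_succ_iff_lt_or_eq.1 hi with hi | rfl
    · exact Or.inl ⟨hi, Function.update_of_ne (by omega) _ _⟩
    · exact Or.inr ⟨rfl, Function.update_self ..⟩
  refine ⟨?_, ?_, ?_, by omega, ?_, by omega, ?_, ?_, ?_, ?_, ?_⟩
  · intro t ht
    rcases Nat.lt_succ_iff_lt_or_eq.1 ht with ht | rfl
    · rw [Function.update_of_ne (by omega)]; exact h.lt t ht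
    · rw [Function.update_self]; exact hp.lt
  · intro t ht u hu htu
    rcases Nat.lt_succ_iff_lt_or_eq.1 ht with ht | rfl <;>
      rcases Nat.lt_succ_iff_lt_or_eq.1 hu with hu | rfl
    · rw [Function.update_of_ne (by omega), Function.update_of_ne (by omega)] at htu
      exact h.inj t ht u hu htu
    · rw [Function.update_of_ne (by omega), Function.update_self] at htu
      exact absurd htu (hne t ht)
    · rw [Function.update_self, Function.update_of_ne (by omega)] at htu
      exact absurd htu.symm (hne u hu)
    · rfl
  · rw [Function.update_of_ne (by omega), h.zero]
  · intro t ht w hw hF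
    rw [Function.update_of_ne (by omega)] at hF
    rw [mem_tset_update (by omega)]
    exact Or.inl (h.done t ht w hw hF)
  · intro _
    rcases hbd 0 (by omega) with ⟨h1, h2⟩ | ⟨h1, h2⟩
    · rw [h2]; exact h.first h1
    · rw [h2]; exact (h.start h1.symm).1
  · intro i hi
    rcases hbd i hi with ⟨h1, h2⟩ | ⟨h1, h2⟩
    · have := h.bd_lt i h1
      omega
    · omega
  · intro i hi
    have h3 := hbd i (by omega)
    rcases hbd (i + 1) hi with ⟨h1, h2⟩ | ⟨h1, h2⟩
    · have := h.mono i h1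
      omega
    · have := h.bd_lt i (by omega)
      omega
  · intro i hi
    rcases hbd i hi with ⟨h1, h2⟩ | ⟨h1, h2⟩
    · have := h.bd_lt i h1
      rw [h2, tset_update_of_le (by omega), Function.update_of_ne (by omega)]
      exact h.pick i h1
    · rw [h2, tset_update_of_le le_rfl, Function.update_self]
      exact ⟨h.closed, hp⟩
  · intro i hi I hI k1 k2
    rcases hbd i hi with ⟨h1, h2⟩ | ⟨h1, h2⟩
    · have := h.bd_lt i h1
      rw [h2, tset_update_of_le (by omega)] at k1
      rw [h2, Function.update_of_ne (by omega)] at k2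
      have h3 := h.gen i h1 I hI k1 k2
      rw [if_pos (by omega)]
      rcases hbd (i + 1) (by omega) with ⟨m1, m2⟩ | ⟨m1, m2⟩
      · rw [if_pos m1] at h3
        have := h.bd_lt _ m1
        rwa [m2, tset_update_of_le (by omega)]
      · rw [if_neg (by omega)] at h3
        rwa [m2, tset_update_of_le le_rfl]
    · rw [h2, tset_update_of_le le_rfl] at k1
      rw [h2, Function.update_self] at k2
      rw [if_neg (by omega)]
      intro w hw
      rcases (mem_tset_update (by omega)).1 hw with hw | rfl
      · exact k1 hw
      · exact k2

theorem ChainInv.advance (h : ChainInv R v q r o bd c len nb) (hc : c < len) (hnb : 1 ≤ nb)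
    (hF : ∀ y < q, Forces R v r (o c) y → y ∈ tset o 0 len) :
    ChainInv R v q r o bd (c + 1) len nb := by
  refine ⟨h.lt, h.inj, h.zero, by omega, ?_, by omega, h.first, h.bd_lt, h.mono, h.pick, h.gen⟩
  intro t ht
  rcases Nat.lt_succ_iff_lt_or_eq.1 ht with ht | rfl
  · exact h.done t ht
  · exact hF

/-- The closed sets which have been found, as initial segments of a list of all parts; `bd nb` is
the number of all parts. -/
structure Chain (R : ℕ → ℕ → Prop) (K : ℕ → Finset ℕ) (q : ℕ) (o bd : ℕ → ℕ) (nb : ℕ) :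
    Prop where
  lt : ∀ t < q, o t < q
  inj : ∀ t < q, ∀ u < q, o t = o u → t = u
  zero : o 0 = 0
  first : bd 0 = 1
  last : bd nb = q
  mono : ∀ i < nb, bd i < bd (i + 1)
  mod : ∀ i ≤ nb, IsMod R ((tset o 0 (bd i)).biUnion K)
  node : ∀ i < nb, ∀ N : Finset ℕ, N.Nonempty → IsMod R N →
    (∀ M : Finset ℕ, M.Nonempty → IsMod R M → M ⊆ (Finset.range q).biUnion K →
      M ⊆ N ∨ N ⊆ M ∨ Disjoint M N) →
    N ⊆ (tset o 0 (bd (i + 1))).biUnion K →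
    N = (tset o 0 (bd (i + 1))).biUnion K ∨ N ⊆ (tset o 0 (bd i)).biUnion K ∨
      ∃ t, bd i ≤ t ∧ t < bd (i + 1) ∧ N ⊆ K (o t)

/-- A strong module containing `v` is a union of parts whose numbers form a closed set `I`, because
it overlaps no part. Comparison with the smaller closed set `A` leaves `N` inside its union or `A`
properly inside `I`, and in the latter case `I` is the whole next set. A module without `v` lies in
one part by `maxi`. -/
theorem ChainInv.chain (h : ChainInv R v q r o bd q q nb) (hK : Kids R S v q K r) :
    Chain R K q o (Function.update bd nb q) nb := by
  have hq := hK.two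
  have hnb : 1 ≤ nb := by
    by_contra hc
    have := h.start (by omega)
    omega
  have hbd : ∀ i < nb, Function.update bd nb q i = bd i := fun i hi =>
    Function.update_of_ne (by omega) _ _
  have hbd' : ∀ i < nb, Function.update bd nb q (i + 1) =
      if i + 1 < nb then bd (i + 1) else q := by
    intro i hi
    split_ifs with h1
    · exact hbd _ h1
    · have : i + 1 = nb := by omega
      rw [this, Function.update_self]
  have hcl : ∀ i ≤ nb, Closed R v q r (tset o 0 (Function.update bd nb q i)) := by
    intro i hi
    rcases hi.lt_or_eq with hi | rfl
    · rw [hbd i hi]; exact (h.pick i hi).1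
    · rw [Function.update_self]; exact h.closed
  refine ⟨h.lt, h.inj, h.zero, ?_, Function.update_self .., ?_, ?_, ?_⟩
  · rw [hbd 0 hnb]; exact h.first hnb
  · intro i hi
    rw [hbd i hi, hbd' i hi]
    split_ifs with h1
    · exact h.mono i h1
    · exact (h.bd_lt i hi).2
  · exact fun i hi => hK.isMod_biUnion (hcl i hi)
  · intro i hi N hN1 hN2 hN3 hN4
    have hcA := hcl i hi.le
    have hcB := hcl (i + 1) hi
    have hgen := h.gen i hi
    rw [← hbd' i hi, ← hbd i hi] at hgen
    have hpick := (h.pick i hi).2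
    rw [← hbd i hi] at hpick
    set A := tset o 0 (Function.update bd nb q i) with hA
    set B := tset o 0 (Function.update bd nb q (i + 1)) with hB
    have h0q : 0 < q := by omega
    have hv0 : v ∈ K 0 := by rw [hK.zero]; exact Finset.mem_singleton_self v
    have hSub : ∀ A ⊆ Finset.range q, A.biUnion K ⊆ (Finset.range q).biUnion K :=
      fun A hA => Finset.biUnion_subset_biUnion_of_subset_left _ hA
    by_cases hv : v ∈ N
    · have hcN := hK.closed_of_isMod hN2 hv
      set I := (Finset.range q).filter fun i => r i ∈ N with hI
      have hKN : ∀ i ∈ I, K i ⊆ N := by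
        intro i hi
        rw [hI, Finset.mem_filter, Finset.mem_range] at hi
        rcases hN3 (K i) ⟨_, hK.mem i hi.1⟩ (hK.mod i hi.1)
          (Finset.subset_biUnion_of_mem K (Finset.mem_range.2 hi.1)) with h1 | h1 | h1
        · exact h1
        · have : i = 0 := hK.idx_eq hi.1 h0q (h1 hv) hv0
          rw [this, hK.zero]
          exact Finset.singleton_subset_iff.2 hv
        · exact absurd hi.2 (Finset.disjoint_left.1 h1 (hK.mem i hi.1))
      have hNI : N = I.biUnion K := by
        refine Finset.Subset.antisymm (fun x hx => ?_) (Finset.biUnion_subset.2 hKN)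
        obtain ⟨j, hj, hxj⟩ := Finset.mem_biUnion.1 (hN4 hx)
        have hjq := Finset.mem_range.1 (hcB.sub hj)
        refine Finset.mem_biUnion.2 ⟨j, Finset.mem_filter.2 ⟨Finset.mem_range.2 hjq, ?_⟩, hxj⟩
        rcases hN3 (K j) ⟨_, hK.mem j hjq⟩ (hK.mod j hjq)
          (Finset.subset_biUnion_of_mem K (Finset.mem_range.2 hjq)) with h1 | h1 | h1
        · exact h1 (hK.mem j hjq)
        · have : j = 0 := hK.idx_eq hjq h0q (h1 hv) hv0
          rw [this, hK.rep_zero]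
          exact hv
        · exact absurd hx (Finset.disjoint_left.1 h1 hxj)
      have hIB : I ⊆ B := by
        intro j hj
        have hjq := Finset.mem_range.1 (hcN.sub hj)
        rw [← hK.mem_biUnion hcB.sub hjq (hK.mem j hjq)]
        exact hN4 (hKN j hj (hK.mem j hjq))
      have hvA : v ∈ A.biUnion K := (hK.mem_biUnion hcA.sub h0q hv0).2 hcA.zero
      rcases hN3 (A.biUnion K) ⟨v, hvA⟩ (hK.isMod_biUnion hcA) (hSub A hcA.sub) with h1 | h1 | h1
      · have hAI : A ⊆ I := by
          intro j hj
          have hjq := Finset.mem_range.1 (hcA.sub hj)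
          refine Finset.mem_filter.2 ⟨Finset.mem_range.2 hjq, h1 ?_⟩
          exact Finset.mem_biUnion.2 ⟨j, hj, hK.mem j hjq⟩
        by_cases hEq : A = I
        · exact Or.inr (Or.inl (by rw [hNI, hEq]))
        -- `I` lies in the set generated by `A` and the picked part, so `Pick` puts that part into
        -- `I`, and then everything generated by it.
        · have hx := hpick.mem I hcN (hAI.ssubset_of_ne hEq) fun I' hI' m1 m2 =>
            hIB.trans (hgen I' hI' m1 (by rw [hbd i hi] at m2; rwa [hbd i hi]))
          have := hgen I hcN hAI (by rw [hbd i hi] at hx; rwa [hbd i hi])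
          left
          rw [hNI, hIB.antisymm this]
      · exact Or.inr (Or.inl h1)
      · exact absurd hv (Finset.disjoint_left.1 h1 hvA)
    · have hNS : N ⊆ S := by
        intro x hx
        obtain ⟨j, hj, hxj⟩ := Finset.mem_biUnion.1 (hN4 hx)
        exact (hK.cover x).2 ⟨j, Finset.mem_range.1 (hcB.sub hj), hxj⟩
      obtain ⟨j, hj, hNj⟩ := hK.maxi N hN1 hN2 hNS hv
      obtain ⟨x, hx⟩ := hN1
      have hjB : j ∈ B := (hK.mem_biUnion hcB.sub hj (hNj hx)).1 (hN4 hx)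
      obtain ⟨t, _, ht, rfl⟩ := mem_tset.1 hjB
      right
      rcases Nat.lt_or_ge t (Function.update bd nb q i) with h1 | h1
      · exact Or.inl (hNj.trans (Finset.subset_biUnion_of_mem K (mem_tset.2 ⟨t, by omega, h1, rfl⟩)))
      · exact Or.inr ⟨t, h1, ht, hNj⟩

end

/-! ### Enumeration of the closed sets of a class -/

notation "xCj" => (130 : ℕ)
notation "aKr" => (131 : ℕ)
notation "aCh" => (132 : ℕ)
notation "xKq" => (133 : ℕ)
notation "aDc" => (134 : ℕ)
notation "aInA" => (135 : ℕ)
notation "aOr" => (136 : ℕ)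
notation "xLen" => (137 : ℕ)
notation "aBd" => (138 : ℕ)
notation "xNb" => (139 : ℕ)
notation "xCu" => (140 : ℕ)
notation "xSel" => (141 : ℕ)
notation "xH" => (142 : ℕ)
notation "xY" => (143 : ℕ)
notation "xZ" => (144 : ℕ)

/-- Lists the children of class `xCj`. -/
def kidsProg : Prog :=
  setv xKq 0 ;;
  forLoop xY 1 (sv xNc)
    (.cond (eqE (.cell aPa (sv xY)) (sv xCj))
      (.assign aCh (sv xKq) (sv xY) ;; .assign aKr (sv xKq) (.cell aRp (sv xY)) ;;
        setv xKq (sv xKq + 1)) .skip)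

/-- The representative of the class. -/
def vE : Expr := .cell aRp (sv xCj)

/-- Tests whether part `y` distinguishes part `z` from the representative of the class. -/
def forcesE (z y : Expr) : Expr :=
  (relE (.cell aKr y) vE - relE (.cell aKr y) (.cell aKr z)) +
  (relE (.cell aKr y) (.cell aKr z) - relE (.cell aKr y) vE)

/-- Tests whether part `y` is above the representative of the class. -/
def aboveE (y : Expr) : Expr := .cell aMtx (vE * vN + .cell aKr y)

/-- Counts the parts which distinguish a part from the representative of the class. -/
def countProg : Prog :=
  forLoop xZ 0 (sv xKq)
    (.assign aInA (sv xZ) 0 ;; .assign aDc (sv xZ) 0 ;;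
     forLoop xY 0 (sv xKq)
      (.cond (forcesE (sv xZ) (sv xY)) (.assign aDc (sv xZ) (.cell aDc (sv xZ) + 1)) .skip))

/-- Tests whether part `xY` can not be added alone to the current closed set. -/
def twinE : Expr :=
  (.cell aInA (sv xY) + relE vE (.cell aKr (sv xY))) +
  ((.cell aDc (sv xY) - sv xCu) + (sv xCu - .cell aDc (sv xY)))

/-- Selects a part which can be added alone to the current closed set, if there is one. -/
def twinProg : Prog :=
  setv xSel (sv xKq) ;; forLoop xY 0 (sv xKq) (.cond twinE .skip (setv xSel (sv xY)))

/-- Selects a minimal part among those above the representative and outside the current closed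
set. -/
def minimalProg : Prog :=
  forLoop xY 0 (sv xKq) (.cond (.cell aInA (sv xY)) .skip
    (.cond (aboveE (sv xY))
      (.cond (eqE (sv xSel) (sv xKq)) (setv xSel (sv xY))
        (.cond (.cell aMtx (.cell aKr (sv xY) * vN + .cell aKr (sv xSel)))
          (setv xSel (sv xY)) .skip)) .skip))

/-- Selects a part from which the next closed set is generated. -/
def selectProg : Prog := twinProg ;; .cond (sv xKq - sv xSel) .skip minimalProg

/-- Adds a part to the current set. -/
def enqueueProg (e : Expr) : Prog :=
  .assign aOr (sv xLen) e ;; .assign aInA e 1 ;; setv xCu (sv xCu + aboveE e) ;;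
  setv xLen (sv xLen + 1)

/-- Enumerates the closed sets. -/
def chainProg : Prog :=
  countProg ;;
  .assign aOr 0 0 ;; .assign aInA 0 1 ;; setv xLen 1 ;; setv xNb 0 ;; setv xCu 0 ;;
  forLoop xH 1 (sv xKq)
    (.cond (eqE (sv xLen) (sv xH))
      (selectProg ;; .assign aBd (sv xNb) (sv xH) ;; setv xNb (sv xNb + 1) ;;
        enqueueProg (sv xSel)) .skip ;;
     forLoop xY 0 (sv xKq)
      (.cond (.cell aInA (sv xY)) .skip
        (.cond (forcesE (.cell aOr (sv xH)) (sv xY)) (enqueueProg (sv xY)) .skip))) ;;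
  .assign aBd (sv xNb) (sv xKq)

/-- The data of a class in the memory. -/
structure KidsStore (n W : ℕ) (R : ℕ → ℕ → Prop) (S : Finset ℕ) (v q : ℕ) (K : ℕ → Finset ℕ)
    (r : ℕ → ℕ) (σ : Store) : Prop where
  n_eq : σ 0 0 = n
  mtx : IsMatrix n R (σ aMtx)
  q_eq : σ xKq 0 = q
  v_eq : σ aRp (σ xCj 0) = v
  rep : ∀ i < q, σ aKr i = r i
  rep_lt : ∀ i < q, r i < n
  q_le : q ≤ n
  trans : ∀ x y z, R x y → R y z → R x z
  le : 4 * n + 10 ≤ W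
  kids : Kids R S v q K r

section
open Classical
variable {n W : ℕ} {R : ℕ → ℕ → Prop} {S : Finset ℕ} {v q : ℕ} {K : ℕ → Finset ℕ} {r : ℕ → ℕ}
  {σ τ : Store} {A : Finset ℕ}

theorem KidsStore.congr (h : KidsStore n W R S v q K r σ) (h0 : τ 0 = σ 0) (h1 : τ aMtx = σ aMtx)
    (h2 : τ xKq = σ xKq) (h3 : τ aRp = σ aRp) (h4 : τ xCj = σ xCj) (h5 : τ aKr = σ aKr) :
    KidsStore n W R S v q K r τ := by
  obtain ⟨k1, k2, k3, k4, k5, k6, k7, k8, k9, k10⟩ := h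
  refine ⟨h0 ▸ k1, h1 ▸ k2, h2 ▸ k3, ?_, h5 ▸ k5, k6, k7, k8, k9, k10⟩
  rw [h3, h4, k4]

theorem KidsStore.v_lt (h : KidsStore n W R S v q K r σ) : v < n := by
  rw [← h.kids.rep_zero]
  exact h.rep_lt 0 (by have := h.kids.two; omega)

theorem KidsStore.forcesE_ne (h : KidsStore n W R S v q K r σ) {z y : Expr}
    (hz : z.eval σ < q) (hy : y.eval σ < q) :
    (forcesE z y).eval σ ≠ 0 ↔ Forces R v r (z.eval σ) (y.eval σ) := by
  simp only [forcesE, vE, Expr.eval_cell, Expr.eval_ofNat, Expr.eval_add, Expr.eval_mul,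
    Expr.eval_sub, h.rep _ hz, h.rep _ hy, h.v_eq, h.n_eq,
    h.mtx.rl_eq (h.rep_lt _ hy) (h.rep_lt _ hz), h.mtx.rl_eq (h.rep_lt _ hy) h.v_lt, Forces]
  omega

theorem KidsStore.aboveE_eval (h : KidsStore n W R S v q K r σ) {y : Expr} (hy : y.eval σ < q) :
    (aboveE y).eval σ = if R v (r (y.eval σ)) then 1 else 0 := by
  simp only [aboveE, vE, Expr.eval_cell, Expr.eval_ofNat, Expr.eval_add, Expr.eval_mul,
    h.rep _ hy, h.v_eq, h.n_eq, h.mtx _ h.v_lt _ (h.rep_lt _ hy)]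

theorem card_filter_range_succ (P : ℕ → Prop) (k : ℕ) :
    ((Finset.range (k + 1)).filter P).card =
      ((Finset.range k).filter P).card + if P k then 1 else 0 := by
  rw [Finset.range_add_one, Finset.filter_insert]
  split_ifs
  · rw [Finset.card_insert_of_notMem (by simp)]
  · rfl

theorem countProg_ok (h : KidsStore n W R S v q K r σ) :
    Ok W countProg σ (q * (q * 140 + 40) + 10) fun τ =>
      ∀ x < q, τ aInA x = 0 ∧ τ aDc x = ((Finset.range q).filter (Forces R v r x)).card := by
  have hW := h.le
  have hqn := h.q_le
  refine Ok.for_const 0 q (3 + 2 + 5 + (q * 140 + 10))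
    (fun k τ => ∀ x < k, τ aInA x = 0 ∧ τ aDc x = ((Finset.range q).filter (Forces R v r x)).card)
    rfl (Nat.zero_le _) (by omega) (by decide) ?_ ?_ ?_ ?_ ?_
  · intro τ hτ
    simp only [Expr.eval_cell, Expr.eval_ofNat, hτ xKq (by decide), h.q_eq]
  · omega
  · intro z τ _ hz hτz hτ hI
    refine Ok.time (T := 4 + (4 + (q * 140 + 10))) ?_ (by omega)
    refine Ok.seq (Q := fun υ => υ = τ.write aInA z 0) (Ok.of_wp ?_ (by decide)) ?_
    · simp only [Prog.wp, Expr.eval_cell, Expr.eval_ofNat, hτz]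
      exact ⟨by omega, by omega, trivial⟩
    rintro τ' - rfl
    refine Ok.seq (Q := fun υ => υ = (τ.write aInA z 0).write aDc z 0) (Ok.of_wp ?_ (by decide)) ?_
    · simp only [Prog.wp, Expr.eval_cell, Expr.eval_ofNat, ne_eq, Nat.reduceEqDiff,
        not_false_eq_true, Store.write_ne, hτz]
      exact ⟨by omega, by omega, trivial⟩
    rintro τ' - rfl
    have hf : ∀ x, x ≠ aInA → x ≠ aDc → ((τ.write aInA z 0).write aDc z 0) x = τ x := by
      intro x h1 h2
      rw [Store.write_ne _ _ _ h2, Store.write_ne _ _ _ h1]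
    refine Ok.for_const 0 q 127 (fun k υ => (∀ x < z, υ aDc x = τ aDc x) ∧
      υ aDc z = ((Finset.range k).filter (Forces R v r z)).card)
      rfl (Nat.zero_le _) (by omega) (by decide) ?_ ?_ ?_ ?_ ?_
    · intro υ hυ
      simp only [Expr.eval_cell, Expr.eval_ofNat, hυ xKq (by decide), hf xKq (by decide) (by decide),
        hτ xKq (by decide), h.q_eq]
    · simp only [ne_eq, Nat.reduceEqDiff, not_false_eq_true, Store.write_ne, Store.write_same,
        Function.update_self, Finset.range_zero, Finset.filter_empty, Finset.card_empty, and_true]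
      intro x hx
      exact Function.update_of_ne (by omega) _ _
    · rintro y υ - hy hυy hυ ⟨hI1, hI2⟩
      have hg : ∀ x, x ≠ aInA → x ≠ aDc → x ∉ (forLoop xY 0 (sv xKq)
          (.cond (forcesE (sv xZ) (sv xY)) (.assign aDc (sv xZ) (.cell aDc (sv xZ) + 1))
          .skip)).writes → x ∉ countProg.writes → υ x = σ x := by
        intro x h1 h2 h3 h4
        rw [hυ x h3, hf x h1 h2, hτ x h4]
      have hE : KidsStore n W R S v q K r υ := h.congr (hg _ (by decide) (by decide) (by decide)
        (by decide)) (hg _ (by decide) (by decide) (by decide) (by decide))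
        (hg _ (by decide) (by decide) (by decide) (by decide))
        (hg _ (by decide) (by decide) (by decide) (by decide))
        (hg _ (by decide) (by decide) (by decide) (by decide))
        (hg _ (by decide) (by decide) (by decide) (by decide))
      have hυz : υ xZ 0 = z := by
        rw [hυ xZ (by decide), hf xZ (by decide) (by decide), hτz]
      have hF : (forcesE (sv xZ) (sv xY)).eval υ ≠ 0 ↔ Forces R v r z y := by
        have := hE.forcesE_ne (z := sv xZ) (y := sv xY) (by simpa [hυz]) (by simpa [hυy])
        simpa only [Expr.eval_cell, Expr.eval_ofNat, hυz, hυy] using this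
      have hc : ((Finset.range y).filter (Forces R v r z)).card ≤ y := by
        refine (Finset.card_filter_le _ _).trans ?_
        rw [Finset.card_range]
      refine Ok.of_wp ?_ (by decide)
      simp only [Prog.wp, Expr.eval_cell, Expr.eval_ofNat, Expr.eval_add, ne_eq, Nat.reduceEqDiff,
        not_false_eq_true, Store.write_ne, Store.write_same, hυz, hI2, card_filter_range_succ]
      refine ⟨fun h1 => ⟨by omega, by omega, fun x hx => ?_, ?_⟩, fun h1 => ⟨hI1, ?_⟩⟩
      · rw [Function.update_of_ne (by omega)]; exact hI1 x hx
      · rw [Function.update_self, if_pos (hF.1 h1)]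
      · rw [if_neg fun h2 => hF.2 h2 h1, add_zero]
    · show (q - 0) * (127 + 2 + 11) + (1 + 2 + 6) ≤ _
      rw [Nat.sub_zero]; omega
    · rintro υ hυ - ⟨hI1, hI2⟩ x hx
      rw [Store.write_ne _ _ _ (by decide), Store.write_ne _ _ _ (by decide)]
      have : υ aInA = Function.update (τ aInA) z 0 := by
        rw [hυ aInA (by decide), Store.write_ne _ _ _ (by decide), Store.write_same]
      rw [this]
      by_cases hxz : x = z
      · subst hxz
        rw [Function.update_self]
        exact ⟨rfl, hI2⟩
      · rw [Function.update_of_ne hxz, hI1 x (by omega)]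
        exact hI x (by omega)
  · show (q - 0) * (3 + 2 + 5 + (q * 140 + 10) + 2 + 11) + (1 + 2 + 6) ≤ _
    rw [Nat.sub_zero]; nlinarith
  · intro τ _ _ hI
    exact hI

/-- The current closed set and its description in the memory. -/
structure InStore (R : ℕ → ℕ → Prop) (v q : ℕ) (r : ℕ → ℕ) (A : Finset ℕ) (σ : Store) : Prop where
  mem : ∀ x < q, σ aInA x ≠ 0 ↔ x ∈ A
  dc : ∀ x < q, σ aDc x = ((Finset.range q).filter (Forces R v r x)).card
  cu : σ xCu 0 = (A.filter fun y => R v (r y)).card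

theorem twinProg_ok (h : KidsStore n W R S v q K r σ) (hI : InStore R v q r A σ)  :
    Ok W twinProg σ (q * 90 + 20) fun τ => τ xSel 0 ≤ q ∧
      (τ xSel 0 < q → τ xSel 0 ∉ A ∧ rl R v (r (τ xSel 0)) = 0 ∧
        ((Finset.range q).filter (Forces R v r (τ xSel 0))).card =
          (A.filter fun y => R v (r y)).card) ∧
      (τ xSel 0 = q → ∀ x < q, x ∉ A → rl R v (r x) = 0 →
        ((Finset.range q).filter (Forces R v r x)).card ≠
          (A.filter fun y => R v (r y)).card) := by
  have hW := h.le
  have hqn := h.q_le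
  refine Ok.time (T := 4 + (q * 90 + 10)) ?_ (by omega)
  refine Ok.seq (Q := fun υ => υ = σ.write xSel 0 q) (Ok.of_wp ?_ (by decide)) ?_
  · simp only [Prog.wp, Expr.eval_cell, Expr.eval_ofNat, h.q_eq]
    exact ⟨by omega, by omega, trivial⟩
  rintro σ' - rfl
  refine Ok.for_const 0 q 77 (fun k τ => τ xSel 0 ≤ q ∧
      (τ xSel 0 < q → τ xSel 0 ∉ A ∧ rl R v (r (τ xSel 0)) = 0 ∧
        ((Finset.range q).filter (Forces R v r (τ xSel 0))).card =
          (A.filter fun y => R v (r y)).card) ∧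
      (τ xSel 0 = q → ∀ x < k, x ∉ A → rl R v (r x) = 0 →
        ((Finset.range q).filter (Forces R v r x)).card ≠
          (A.filter fun y => R v (r y)).card))
    rfl (Nat.zero_le _) (by omega) (by decide) ?_ ?_ ?_ ?_ ?_
  · intro τ hτ
    simp only [Expr.eval_cell, Expr.eval_ofNat, hτ xKq (by decide), ne_eq, Nat.reduceEqDiff,
      not_false_eq_true, Store.write_ne, h.q_eq]
  · simp only [ne_eq, Nat.reduceEqDiff, not_false_eq_true, Store.write_ne, Store.write_same,
      Function.update_self]
    exact ⟨le_rfl, fun h => by omega, fun _ => by omega⟩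
  · rintro y τ - hy hτy hτ ⟨h1, h2, h3⟩
    have f : ∀ x, x ≠ xSel → x ≠ xY → τ x = σ x := by
      intro x hx hx'
      rw [hτ x, Store.write_ne _ _ _ hx]
      simp [forLoop, Prog.writes, hx, hx']
    have hE : KidsStore n W R S v q K r τ := h.congr (f _ (by decide) (by decide))
      (f _ (by decide) (by decide)) (f _ (by decide) (by decide)) (f _ (by decide) (by decide))
      (f _ (by decide) (by decide)) (f _ (by decide) (by decide))
    -- A sum of natural numbers vanishes exactly if every summand does, so one expression tests all
    -- the conditions; the two truncated differences together test equality of the counts.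
    have htw : twinE.eval τ = 0 ↔ y ∉ A ∧ rl R v (r y) = 0 ∧
        ((Finset.range q).filter (Forces R v r y)).card =
          (A.filter fun y => R v (r y)).card := by
      simp only [twinE, vE, Expr.eval_cell, Expr.eval_ofNat, Expr.eval_add, Expr.eval_mul,
        Expr.eval_sub, hτy, hE.rep y hy, hE.v_eq, hE.n_eq, hE.mtx.rl_eq h.v_lt (h.rep_lt y hy),
        f aInA (by decide) (by decide), f aDc (by decide) (by decide),
        f xCu (by decide) (by decide), hI.dc y hy, hI.cu]
      rw [← hI.mem y hy]
      omega
    refine Ok.of_wp ?_ (by decide)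
    simp only [Prog.wp, Expr.eval_cell, Expr.eval_ofNat, ne_eq, Nat.reduceEqDiff,
      not_false_eq_true, Store.write_ne, Store.write_same, Function.update_self, hτy]
    refine ⟨fun h4 => ⟨h1, h2, fun h5 x hx hxA hxv hxc => ?_⟩, fun h4 => ⟨by omega, by omega, by omega,
      fun _ => htw.1 h4, by omega⟩⟩
    rcases Nat.lt_succ_iff_lt_or_eq.1 hx with hx | rfl
    · exact h3 h5 x hx hxA hxv hxc
    · exact h4 (htw.2 ⟨hxA, hxv, hxc⟩)
  · show (q - 0) * (77 + 2 + 11) + (1 + 2 + 6) ≤ _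
    rw [Nat.sub_zero]; omega
  · intro τ _ _ h
    exact h

/-- A running minimum over the parts above `v` outside `A`. Transitivity of `R` keeps the earlier
comparisons valid when the candidate is replaced by a smaller one. -/
theorem minimalProg_ok (h : KidsStore n W R S v q K r σ) (hI : InStore R v q r A σ)
    (hs : σ xSel 0 = q) (hex : ∃ x < q, x ∉ A ∧ R v (r x)) :
    Ok W minimalProg σ (q * 90 + 10) fun τ => τ xSel 0 < q ∧ τ xSel 0 ∉ A ∧ R v (r (τ xSel 0)) ∧
      ∀ y < q, y ∉ A → R v (r y) → ¬ R (r y) (r (τ xSel 0)) := by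
  have hW := h.le
  have hqn := h.q_le
  refine Ok.for_const 0 q 77 (fun k τ => (τ xSel 0 = q ∧ ∀ y < k, y ∉ A → ¬ R v (r y)) ∨
      (τ xSel 0 < q ∧ τ xSel 0 ∉ A ∧ R v (r (τ xSel 0)) ∧
      ∀ y < k, y ∉ A → R v (r y) → ¬ R (r y) (r (τ xSel 0))))
    rfl (Nat.zero_le _) (by omega) (by decide) ?_ ?_ ?_ ?_ ?_
  · intro τ hτ
    simp only [Expr.eval_cell, Expr.eval_ofNat, hτ xKq (by decide), h.q_eq]
  · simp only [ne_eq, Nat.reduceEqDiff, not_false_eq_true, Store.write_ne, hs]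
    exact Or.inl ⟨trivial, by omega⟩
  · rintro y τ - hy hτy hτ hinv
    have f : ∀ x, x ≠ xSel → x ≠ xY → τ x = σ x := by
      intro x hx hx'
      rw [hτ x]
      simp [forLoop, Prog.writes, hx, hx']
    have hE : KidsStore n W R S v q K r τ := h.congr (f _ (by decide) (by decide))
      (f _ (by decide) (by decide)) (f _ (by decide) (by decide)) (f _ (by decide) (by decide))
      (f _ (by decide) (by decide)) (f _ (by decide) (by decide))
    have hab : (aboveE (sv xY)).eval τ = if R v (r y) then 1 else 0 := by
      have := hE.aboveE_eval (y := sv xY) (by simpa [hτy])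
      simpa only [Expr.eval_cell, Expr.eval_ofNat, hτy] using this
    have hmem := hI.mem y hy
    refine Ok.of_wp ?_ (by decide)
    simp only [Prog.wp, eqE_eval, Expr.eval_cell, Expr.eval_ofNat, Expr.eval_add, Expr.eval_mul,
      ne_eq, Nat.reduceEqDiff, not_false_eq_true, Store.write_ne, Store.write_same,
      Function.update_self, hτy, hab, f aInA (by decide) (by decide), hE.q_eq, hE.rep y hy, hE.n_eq]
    refine ⟨fun h1 => ?_, fun h1 => ⟨fun h2 => ⟨fun h3 => ⟨by omega, by omega, Or.inr ?_⟩,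
      fun h3 => ⟨fun h4 => ⟨by omega, by omega, Or.inr ?_⟩, fun h4 => ?_⟩⟩, fun h2 => ?_⟩⟩
    · have hyA := hmem.1 h1
      refine hinv.imp (fun k => ⟨k.1, fun x hx hxA => ?_⟩) (fun k => ⟨k.1, k.2.1, k.2.2.1,
        fun x hx hxA => ?_⟩)
      · exact k.2 x (by have : x ≠ y := fun e => hxA (e ▸ hyA); omega) hxA
      · exact k.2.2.2 x (by have : x ≠ y := fun e => hxA (e ▸ hyA); omega) hxA
    · have hyA : y ∉ A := fun h5 => hmem.2 h5 h1
      have hyv : R v (r y) := by by_contra hc; exact h2 (if_neg hc)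
      have hsq : τ xSel 0 = q := by by_contra hc; exact h3 (if_neg hc)
      have hnone : ∀ x < y, x ∉ A → ¬ R v (r x) := by
        rcases hinv with k | k
        · exact k.2
        · omega
      refine ⟨hy, hyA, hyv, fun x hx hxA hxv => ?_⟩
      rcases Nat.lt_succ_iff_lt_or_eq.1 hx with hx | rfl
      · exact absurd hxv (hnone x hx hxA)
      · exact h.kids.irrefl _
    · have hyA : y ∉ A := fun h5 => hmem.2 h5 h1
      have hyv : R v (r y) := by by_contra hc; exact h2 (if_neg hc)
      have hsq : τ xSel 0 ≠ q := by intro hc; rw [if_pos hc] at h3; omega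
      rcases hinv with k | ⟨k1, k2, k3, k4⟩
      · exact absurd k.1 hsq
      · rw [hE.rep _ k1, hE.mtx _ (h.rep_lt y hy) _ (h.rep_lt _ k1)] at h4
        have hlt : R (r y) (r (τ xSel 0)) := by by_contra hc; exact h4 (if_neg hc)
        refine ⟨hy, hyA, hyv, fun x hx hxA hxv hxy => ?_⟩
        rcases Nat.lt_succ_iff_lt_or_eq.1 hx with hx | rfl
        · exact k4 x hx hxA hxv (h.trans _ _ _ hxy hlt)
        · exact h.kids.irrefl _ hxy
    · have hsq : τ xSel 0 ≠ q := by intro hc; rw [if_pos hc] at h3; omega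
      rcases hinv with k | ⟨k1, k2, k3, k4⟩
      · exact absurd k.1 hsq
      · rw [hE.rep _ k1, hE.mtx _ (h.rep_lt y hy) _ (h.rep_lt _ k1)] at h4
        have hlt : ¬ R (r y) (r (τ xSel 0)) := by intro hc; rw [if_pos hc] at h4; omega
        refine Or.inr ⟨k1, k2, k3, fun x hx hxA hxv => ?_⟩
        rcases Nat.lt_succ_iff_lt_or_eq.1 hx with hx | rfl
        · exact k4 x hx hxA hxv
        · exact hlt
    · have hyv : ¬ R v (r y) := by intro hc; rw [if_pos hc] at h2; omega
      refine hinv.imp (fun k => ⟨k.1, fun x hx hxA hxv => ?_⟩) (fun k => ⟨k.1, k.2.1, k.2.2.1,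
        fun x hx hxA hxv => ?_⟩)
      · exact k.2 x (by have : x ≠ y := fun e => hyv (e ▸ hxv); omega) hxA hxv
      · exact k.2.2.2 x (by have : x ≠ y := fun e => hyv (e ▸ hxv); omega) hxA hxv
  · show (q - 0) * (77 + 2 + 11) + (1 + 2 + 6) ≤ _
    rw [Nat.sub_zero]; omega
  · rintro τ - - (⟨-, h1⟩ | h1)
    · obtain ⟨x, hx, hxA, hxv⟩ := hex
      exact absurd hxv (h1 x hx hxA)
    · exact h1

theorem selectProg_ok (h : KidsStore n W R S v q K r σ) (hI : InStore R v q r A σ)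
    (hA : Closed R v q r A) (hne : A ≠ Finset.range q) :
    Ok W selectProg σ (q * 180 + 40) fun τ => Pick R v q r A (τ xSel 0) := by
  refine Ok.time (T := q * 90 + 20 + (q * 90 + 20)) ?_ (by omega)
  refine Ok.seq (twinProg_ok h hI) ?_
  rintro τ hτ ⟨h1, h2, h3⟩
  have hq : τ xKq 0 = q := by rw [hτ xKq (by decide), h.q_eq]
  refine Ok.cond (T := q * 90 + 10) (fun h4 => ?_) (fun h4 => ?_) (by
    show 5 + 1 + (q * 90 + 10) ≤ _; omega)
  · simp only [Expr.eval_cell, Expr.eval_ofNat, Expr.eval_sub, hq] at h4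
    have hlt : τ xSel 0 < q := by omega
    obtain ⟨k1, k2, k3⟩ := h2 hlt
    exact Ok.of_wp (h.kids.pick_of_twin hA hlt k1 k2 k3) (by
      show 1 ≤ _; omega)
  · simp only [Expr.eval_cell, Expr.eval_ofNat, Expr.eval_sub, hq] at h4
    have hsel : τ xSel 0 = q := by omega
    have hno := h3 hsel
    refine (minimalProg_ok (h.congr (hτ _ (by decide)) (hτ _ (by decide)) (hτ _ (by decide))
      (hτ _ (by decide)) (hτ _ (by decide)) (hτ _ (by decide))) ⟨?_, ?_, ?_⟩ hsel
      (h.kids.exists_above hA hne hno)).mono le_rfl ?_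
    · rw [hτ aInA (by decide)]; exact hI.mem
    · rw [hτ aDc (by decide)]; exact hI.dc
    · rw [hτ xCu (by decide)]; exact hI.cu
    · rintro υ - ⟨m1, m2, m3, m4⟩
      exact h.kids.pick_of_minimal hA hno m1 m2 m3 m4

end

section
open Classical
variable {n W : ℕ} {R : ℕ → ℕ → Prop} {S : Finset ℕ} {v q : ℕ} {K : ℕ → Finset ℕ} {r : ℕ → ℕ}
  {σ τ : Store} {A : Finset ℕ}

theorem tset_update_insert {o : ℕ → ℕ} {len y : ℕ} :
    tset (Function.update o len y) 0 (len + 1) = insert y (tset o 0 len) := by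
  ext x
  rw [mem_tset_update (Nat.zero_le _), Finset.mem_insert, or_comm]

theorem enqueueProg_ok {a len y : ℕ} (h : KidsStore n W R S v q K r σ)
    (hI : InStore R v q r (tset (σ aOr) 0 len) σ) (hlen : σ xLen 0 = len) (hlq : len ≤ q)
    (hsub : tset (σ aOr) 0 len ⊆ Finset.range q)
    (hy : σ a 0 = y) (hyq : y < q) (hyA : y ∉ tset (σ aOr) 0 len)
    (ha : a ≠ aOr ∧ a ≠ aInA) :
    Ok W (enqueueProg (sv a)) σ 40 fun τ => τ aOr = Function.update (σ aOr) len y ∧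
      τ xLen 0 = len + 1 ∧ InStore R v q r (tset (τ aOr) 0 (len + 1)) τ := by
  have hW := h.le
  have hqn := h.q_le
  have hcu : σ xCu 0 ≤ q := by
    rw [hI.cu]
    refine (Finset.card_filter_le _ _).trans ((Finset.card_le_card hsub).trans ?_)
    rw [Finset.card_range]
  let σ' := (σ.write aOr len y).write aInA y 1
  have hσ' : KidsStore n W R S v q K r σ' := by
    refine h.congr ?_ ?_ ?_ ?_ ?_ ?_ <;> simp [σ']
  have hab := hσ'.aboveE_eval (y := sv a) (by simpa [σ', ha.1, ha.2, hy])
  refine Ok.of_wp ?_ ?_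
  · simp only [enqueueProg, Prog.wp, Expr.eval_cell, Expr.eval_ofNat, Expr.eval_add, ne_eq,
      Nat.reduceEqDiff, not_false_eq_true, Store.write_ne, ha.1, hlen, hy] at hab ⊢
    have hv : (aboveE (sv a)).eval ((σ.write aOr len y).write aInA y 1) =
        if R v (r y) then 1 else 0 := by
      rw [hab]
      simp only [σ', Store.write_ne _ _ _ ha.1, Store.write_ne _ _ _ ha.2, hy]
    simp only [hv]
    have hle1 : (if R v (r y) then 1 else 0) ≤ 1 := by split_ifs <;> omega
    refine ⟨by omega, by omega, by omega, by omega, by omega, by omega, by omega, by omega, ?_, ?_,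
      ?_, ?_, ?_⟩
    · simp
    · simp
    · intro x hx
      have h1 := hI.mem x hx
      simp only [ne_eq, Nat.reduceEqDiff, not_false_eq_true, Store.write_ne, Store.write_same,
        tset_update_insert, Finset.mem_insert]
      by_cases hxy : x = y
      · subst hxy; simp
      · rw [Function.update_of_ne hxy]
        simpa [hxy] using h1
    · intro x hx
      simp only [ne_eq, Nat.reduceEqDiff, not_false_eq_true, Store.write_ne]
      exact hI.dc x hx
    · simp only [ne_eq, Nat.reduceEqDiff, not_false_eq_true, Store.write_ne, Store.write_same,
        Function.update_self, tset_update_insert, hI.cu]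
      rw [Finset.filter_insert]
      split_ifs with h1
      · rw [Finset.card_insert_of_notMem fun h2 => hyA (Finset.mem_filter.1 h2).1]
      · rfl
  · show (2 + 2 + 1) + ((2 + 1 + 1) + ((1 + (2 + 11 + 1) + 1) + (1 + 4 + 1))) ≤ 40
    omega

/-- The state of the enumeration of the closed sets in the memory. -/
structure ChainStore (n W : ℕ) (R : ℕ → ℕ → Prop) (S : Finset ℕ) (v q : ℕ) (K : ℕ → Finset ℕ)
    (r : ℕ → ℕ) (c : ℕ) (τ : Store) : Prop where
  kids : KidsStore n W R S v q K r τ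
  inv : ChainInv R v q r (τ aOr) (τ aBd) c (τ xLen 0) (τ xNb 0)
  ins : InStore R v q r (tset (τ aOr) 0 (τ xLen 0)) τ

theorem ChainStore.congr {c : ℕ} (h : ChainStore n W R S v q K r c σ) (h0 : τ 0 = σ 0)
    (h1 : τ aMtx = σ aMtx) (h2 : τ xKq = σ xKq) (h3 : τ aRp = σ aRp) (h4 : τ xCj = σ xCj)
    (h5 : τ aKr = σ aKr) (h6 : τ aOr = σ aOr) (h7 : τ aBd = σ aBd) (h8 : τ xLen = σ xLen)
    (h9 : τ xNb = σ xNb) (hh1 : τ aInA = σ aInA) (hh2 : τ aDc = σ aDc) (hh3 : τ xCu = σ xCu) :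
    ChainStore n W R S v q K r c τ := by
  obtain ⟨k1, k2, ⟨k3, k4, k5⟩⟩ := h
  refine ⟨k1.congr h0 h1 h2 h3 h4 h5, ?_, ?_, ?_, ?_⟩
  · rw [h6, h7, h8, h9]; exact k2
  · rw [h6, h8, hh1]; exact k3
  · rw [hh2]; exact k4
  · rw [h6, h8, hh3]; exact k5

theorem ChainInv.tset_sub {o bd : ℕ → ℕ} {c len nb : ℕ} (h : ChainInv R v q r o bd c len nb) :
    tset o 0 len ⊆ Finset.range q := by
  intro x hx
  obtain ⟨t, _, h1, rfl⟩ := mem_tset.1 hx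
  exact Finset.mem_range.2 (h.lt t h1)

theorem ChainInv.nb_le {o bd : ℕ → ℕ} {c len nb : ℕ} (h : ChainInv R v q r o bd c len nb) :
    nb ≤ q := by
  have h1 : ∀ i < nb, i < bd i := by
    intro i
    induction i with
    | zero => intro h0; exact (h.bd_lt 0 h0).1
    | succ i ih => intro hi; have := ih (by omega); have := h.mono i hi; omega
  have h2 := h.len_le
  rcases Nat.eq_zero_or_pos nb with h0 | h0
  · omega
  · have := h1 (nb - 1) (by omega)
    have := h.bd_lt (nb - 1) (by omega)
    omega

theorem enqueue_forced_ok {c : ℕ} (h : ChainStore n W R S v q K r c σ)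
    (hcl : c < σ xLen 0) (hnb : 1 ≤ σ xNb 0) :
    Ok W (forLoop xY 0 (sv xKq)
      (.cond (.cell aInA (sv xY)) .skip
        (.cond (forcesE (.cell aOr (sv xH)) (sv xY)) (enqueueProg (sv xY)) .skip)))
      (σ.write xH 0 c) (q * 180 + 10) fun τ => ChainStore n W R S v q K r c τ ∧
        c < τ xLen 0 ∧ 1 ≤ τ xNb 0 ∧
        ∀ y < q, Forces R v r (τ aOr c) y → y ∈ tset (τ aOr) 0 (τ xLen 0) := by
  have hW := h.kids.le
  have hqn := h.kids.q_le
  refine Ok.for_const 0 q 167 (fun k τ => ChainStore n W R S v q K r c τ ∧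
        c < τ xLen 0 ∧ 1 ≤ τ xNb 0 ∧
        ∀ y < k, Forces R v r (τ aOr c) y → y ∈ tset (τ aOr) 0 (τ xLen 0))
    rfl (Nat.zero_le _) (by omega) (by decide) ?_ ?_ ?_ ?_ ?_
  · intro τ hτ
    simp only [Expr.eval_cell, Expr.eval_ofNat, hτ xKq (by decide), ne_eq, Nat.reduceEqDiff,
      not_false_eq_true, Store.write_ne, h.kids.q_eq]
  · refine ⟨h.congr ?_ ?_ ?_ ?_ ?_ ?_ ?_ ?_ ?_ ?_ ?_ ?_ ?_, ?_, ?_, by omega⟩ <;>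
      simp only [ne_eq, Nat.reduceEqDiff, not_false_eq_true, Store.write_ne, hcl, hnb]
  · rintro y τ - hy hτy hτ ⟨hS, hcl', hnb', hF⟩
    have hH : τ xH 0 = c := by
      rw [hτ xH (by decide), Store.write_same, Function.update_self]
    have hlenq := hS.inv.len_le
    have hadv : ∀ υ, υ = τ.write xY 0 (y + 1) → (y ∈ tset (τ aOr) 0 (τ xLen 0) ∨
        ¬ Forces R v r (τ aOr c) y) → ChainStore n W R S v q K r c υ ∧
        c < υ xLen 0 ∧ 1 ≤ υ xNb 0 ∧
        ∀ w < y + 1, Forces R v r (υ aOr c) w → w ∈ tset (υ aOr) 0 (υ xLen 0) := by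
      rintro υ rfl hor
      refine ⟨hS.congr ?_ ?_ ?_ ?_ ?_ ?_ ?_ ?_ ?_ ?_ ?_ ?_ ?_, ?_, ?_, ?_⟩
      on_goal 16 =>
        simp only [ne_eq, Nat.reduceEqDiff, not_false_eq_true, Store.write_ne]
        intro w hw hFw
        rcases Nat.lt_succ_iff_lt_or_eq.1 hw with hw | rfl
        · exact hF w hw hFw
        · exact hor.resolve_right (not_not.2 hFw)
      all_goals simp only [ne_eq, Nat.reduceEqDiff, not_false_eq_true, Store.write_ne, hcl', hnb']
    refine Ok.cond (T := 160) (fun h1 => ?_) (fun h1 => ?_) (by show 3 + 1 + 160 ≤ _; omega)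
    · simp only [Expr.eval_cell, Expr.eval_ofNat, hτy] at h1
      exact Ok.of_wp (hadv _ rfl (Or.inl ((hS.ins.mem y hy).1 h1))) (by show 1 ≤ _; omega)
    · simp only [Expr.eval_cell, Expr.eval_ofNat, hτy] at h1
      have hyA : y ∉ tset (τ aOr) 0 (τ xLen 0) := fun h2 => (hS.ins.mem y hy).2 h2 h1
      have hoc : τ aOr c < q := hS.inv.lt c hcl'
      have hFe : (forcesE (.cell aOr (sv xH)) (sv xY)).eval τ ≠ 0 ↔ Forces R v r (τ aOr c) y := by
        have := hS.kids.forcesE_ne (z := .cell aOr (sv xH)) (y := sv xY) (by simpa [hH])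
          (by simpa [hτy])
        simpa only [Expr.eval_cell, Expr.eval_ofNat, hH, hτy] using this
      refine Ok.cond (T := 40) (fun h2 => ?_) (fun h2 => ?_) (by decide)
      · have hFy := hFe.1 h2
        refine (enqueueProg_ok hS.kids hS.ins rfl hlenq hS.inv.tset_sub hτy hy hyA (by decide)).mono
          le_rfl ?_
        rintro υ hυ ⟨k1, k2, k3⟩
        have hinv := hS.inv.append hy hyA hnb' fun I hI hsub =>
          hI.step (τ aOr c) (hsub (mem_tset.2 ⟨c, Nat.zero_le _, hcl', rfl⟩)) y hy hFy
        have hSυ : ChainStore n W R S v q K r c υ := by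
          refine ⟨hS.kids.congr (hυ _ (by decide)) (hυ _ (by decide)) (hυ _ (by decide))
            (hυ _ (by decide)) (hυ _ (by decide)) (hυ _ (by decide)), ?_, ?_⟩
          · rw [k1, k2, hυ aBd (by decide), hυ xNb (by decide)]
            exact hinv
          · rw [k2]; exact k3
        refine ⟨hSυ.congr ?_ ?_ ?_ ?_ ?_ ?_ ?_ ?_ ?_ ?_ ?_ ?_ ?_, ?_, ?_, ?_⟩
        on_goal 16 =>
          simp only [ne_eq, Nat.reduceEqDiff, not_false_eq_true, Store.write_ne]
          intro w hw hFw
          rw [k2, k1, mem_tset_update (Nat.zero_le _)]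
          rw [k1, Function.update_of_ne (by omega)] at hFw
          rcases Nat.lt_succ_iff_lt_or_eq.1 hw with hw | rfl
          · exact Or.inl (hF w hw hFw)
          · exact Or.inr rfl
        on_goal 15 =>
          rw [Store.write_ne _ _ _ (by decide), hυ xNb (by decide)]
          exact hnb'
        on_goal 14 =>
          rw [Store.write_ne _ _ _ (by decide), k2]
          omega
        all_goals simp only [ne_eq, Nat.reduceEqDiff, not_false_eq_true, Store.write_ne]
      · exact Ok.of_wp (hadv _ rfl (Or.inr fun h3 => hFe.2 h3 h2)) (by show 1 ≤ _; omega)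
  · show (q - 0) * (167 + 2 + 11) + (1 + 2 + 6) ≤ _
    rw [Nat.sub_zero]; omega
  · intro τ _ _ h
    exact h

theorem openGroup_ok {c : ℕ} (h : ChainStore n W R S v q K r c σ) (hc : c < q)
    (hcl : σ xLen 0 = c) (hH : σ xH 0 = c) :
    Ok W (selectProg ;; .assign aBd (sv xNb) (sv xH) ;; setv xNb (sv xNb + 1) ;;
        enqueueProg (sv xSel)) σ (q * 180 + 100) fun τ => ChainStore n W R S v q K r c τ ∧
          c < τ xLen 0 ∧ 1 ≤ τ xNb 0 := by
  have hW := h.kids.le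
  have hqn := h.kids.q_le
  have hnbq := h.inv.nb_le
  have hinv := h.inv
  rw [hcl] at hinv
  have hne : tset (σ aOr) 0 c ≠ Finset.range q := by
    intro heq
    have := card_tset hinv.inj (c := 0)
    rw [heq, Finset.card_range] at this
    omega
  have hins := h.ins
  rw [hcl] at hins
  refine Ok.time (T := q * 180 + 40 + (5 + (6 + 40))) ?_ (by omega)
  refine Ok.seq (selectProg_ok h.kids hins hinv.closed hne) ?_
  rintro τ hτ hpick
  have eB : τ aBd = σ aBd := hτ aBd (by decide)
  have eN : τ xNb = σ xNb := hτ xNb (by decide)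
  have eH : τ xH = σ xH := hτ xH (by decide)
  refine Ok.seq (Q := fun υ => υ = τ.write aBd (σ xNb 0) c) (Ok.of_wp ?_ (by decide)) ?_
  · simp only [Prog.wp, Expr.eval_cell, Expr.eval_ofNat, eN, eH, hH]
    exact ⟨by omega, by omega, trivial⟩
  rintro τ' - rfl
  refine Ok.seq (Q := fun υ => υ = (τ.write aBd (σ xNb 0) c).write xNb 0 (σ xNb 0 + 1))
    (Ok.of_wp ?_ (by decide)) ?_
  · simp only [Prog.wp, Expr.eval_cell, Expr.eval_ofNat, Expr.eval_add, ne_eq, Nat.reduceEqDiff,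
      not_false_eq_true, Store.write_ne, eN]
    exact ⟨by omega, by omega, trivial⟩
  rintro τ' - rfl
  generalize hυ : (τ.write aBd (σ xNb 0) c).write xNb 0 (σ xNb 0 + 1) = υ
  have f : ∀ x, x ≠ aBd → x ≠ xNb → x ∉ selectProg.writes → υ x = σ x := by
    intro x h1 h2 h3
    rw [← hυ, Store.write_ne _ _ _ h2, Store.write_ne _ _ _ h1, hτ x h3]
  have f' : ∀ x, x ≠ aBd → x ≠ xNb → υ x = τ x := by
    intro x h1 h2
    rw [← hυ, Store.write_ne _ _ _ h2, Store.write_ne _ _ _ h1]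
  have gB : υ aBd = Function.update (σ aBd) (σ xNb 0) c := by
    rw [← hυ, Store.write_ne _ _ _ (by decide), Store.write_same, eB]
  have gN : υ xNb 0 = σ xNb 0 + 1 := by
    rw [← hυ, Store.write_same, Function.update_self]
  have gO : υ aOr = σ aOr := f _ (by decide) (by decide) (by decide)
  have gL : υ xLen 0 = c := by rw [f _ (by decide) (by decide) (by decide), hcl]
  have hk : KidsStore n W R S v q K r υ := h.kids.congr (f _ (by decide) (by decide) (by decide))
    (f _ (by decide) (by decide) (by decide)) (f _ (by decide) (by decide) (by decide))
    (f _ (by decide) (by decide) (by decide)) (f _ (by decide) (by decide) (by decide))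
    (f _ (by decide) (by decide) (by decide))
  have hins' : InStore R v q r (tset (υ aOr) 0 c) υ := by
    rw [gO]
    refine ⟨?_, ?_, ?_⟩
    · rw [f aInA (by decide) (by decide) (by decide)]; exact hins.mem
    · rw [f aDc (by decide) (by decide) (by decide)]; exact hins.dc
    · rw [f xCu (by decide) (by decide) (by decide)]; exact hins.cu
  have gS : υ xSel 0 = τ xSel 0 := by rw [f' xSel (by decide) (by decide)]
  refine (enqueueProg_ok hk hins' gL hc.le (by rw [gO]; exact hinv.tset_sub) gS hpick.lt
    (by rw [gO]; exact hpick.notMem) (by decide)).mono le_rfl ?_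
  rintro ω hω ⟨k1, k2, k3⟩
  have wN : ω xNb 0 = σ xNb 0 + 1 := by rw [hω xNb (by decide), gN]
  refine ⟨⟨hk.congr (hω _ (by decide)) (hω _ (by decide)) (hω _ (by decide))
    (hω _ (by decide)) (hω _ (by decide)) (hω _ (by decide)), ?_, ?_⟩, by omega, by omega⟩
  · rw [k1, k2, wN, hω aBd (by decide), gB, gO]
    exact hinv.select hpick
  · rw [k2]; exact k3

/-- Each position of the queue is treated once, with one scan over the `q` parts and at most one
selection, also linear in `q`. The loop starts at position 1 because part 0 is the representative
itself and forces nothing. -/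
theorem chainProg_ok (h : KidsStore n W R S v q K r σ) :
    Ok W chainProg σ (600 * (q * q) + 300 * q + 100) fun τ =>
      Chain R K q (τ aOr) (τ aBd) (τ xNb 0) ∧ τ xNb 0 ≤ q := by
  have hW := h.le
  have hqn := h.q_le
  have hq2 := h.kids.two
  refine Ok.time (T := q * (q * 140 + 40) + 10 + (3 + (3 + (3 + (3 + (3 +
    ((q * (q * 360 + 150) + 20) + 5))))))) ?_ (by nlinarith)
  refine Ok.seq (countProg_ok h) ?_
  intro σ₁ hσ₁ hcount
  iterate 5
    refine Ok.assign_seq (by simp) (by simp <;> omega) (by decide) ?_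
  generalize hσ' : Store.write _ xCu _ _ = σ'
  have f : ∀ x, x ∉ [aOr, aInA, xLen, xNb, xCu] → x ∉ countProg.writes → σ' x = σ x := by
    intro x hx hx'
    simp only [List.mem_cons, List.not_mem_nil, or_false, not_or] at hx
    rw [← hσ₁ x hx', ← hσ']
    simp [hx]
  have hk' : KidsStore n W R S v q K r σ' := h.congr (f _ (by decide) (by decide))
    (f _ (by decide) (by decide)) (f _ (by decide) (by decide)) (f _ (by decide) (by decide))
    (f _ (by decide) (by decide)) (f _ (by decide) (by decide))
  have g1 : σ' xLen 0 = 1 := by rw [← hσ']; simp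
  have g2 : σ' xNb 0 = 0 := by rw [← hσ']; simp
  have g3 : σ' xCu 0 = 0 := by rw [← hσ']; simp
  have g4 : σ' aOr 0 = 0 := by rw [← hσ']; simp
  have g5 : σ' aInA = Function.update (σ₁ aInA) 0 1 := by rw [← hσ']; simp
  have g6 : σ' aDc = σ₁ aDc := by rw [← hσ']; simp
  clear hσ'
  have hstart : ChainStore n W R S v q K r 1 σ' := by
    have hset : tset (σ' aOr) 0 1 = {0} := by
      ext x
      rw [mem_tset, Finset.mem_singleton]
      constructor
      · rintro ⟨t, h1, h2, h3⟩
        rw [← h3, show t = 0 by omega, g4]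
      · rintro rfl
        exact ⟨0, le_rfl, by omega, g4⟩
    refine ⟨hk', ?_, ?_, ?_, ?_⟩
    · rw [g1, g2]
      exact ChainInv.init h.kids g4
    · intro x hx
      rw [g1, hset, Finset.mem_singleton, g5]
      by_cases hx0 : x = 0
      · subst hx0; simp
      · rw [Function.update_of_ne hx0, (hcount x hx).1]
        simp [hx0]
    · intro x hx
      rw [g6, (hcount x hx).2]
    · rw [g1, hset, g3, eq_comm, Finset.card_eq_zero, Finset.filter_singleton, if_neg]
      rw [h.kids.rep_zero]
      exact h.kids.irrefl v
  refine Ok.seq (T := q * (q * 360 + 150) + 20) (Q := fun τ => ChainStore n W R S v q K r q τ) ?_ ?_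
  · refine Ok.for_const 1 q (13 + 1 + (q * 180 + 100) + (q * 180 + 10)) (fun c τ =>
      ∃ υ, ChainStore n W R S v q K r c υ ∧ τ = υ.write xH 0 c) rfl (by omega) (by omega) (by decide)
      ?_ ?_ ?_ ?_ ?_
    · intro τ hτ
      simp only [Expr.eval_cell, Expr.eval_ofNat, hτ xKq (by decide), hk'.q_eq]
    · exact ⟨σ', hstart, rfl⟩
    · rintro c τ h1c hcq hτc hτ ⟨υ, hυ, hτυ⟩
      have hS : ChainStore n W R S v q K r c τ := by
        subst hτυ
        refine hυ.congr ?_ ?_ ?_ ?_ ?_ ?_ ?_ ?_ ?_ ?_ ?_ ?_ ?_ <;>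
          simp only [ne_eq, Nat.reduceEqDiff, not_false_eq_true, Store.write_ne]
      have hcle := hS.inv.le
      refine Ok.seq (Q := fun τ => ChainStore n W R S v q K r c τ ∧ c < τ xLen 0 ∧ 1 ≤ τ xNb 0)
        (T := 13 + 1 + (q * 180 + 100)) ?_ ?_
      · refine Ok.cond (T := q * 180 + 100) (fun h1 => ?_) (fun h1 => ?_) le_rfl
        · rw [eqE_eval] at h1
          simp only [Expr.eval_cell, Expr.eval_ofNat, hτc] at h1
          exact openGroup_ok hS hcq (by by_contra hc; exact h1 (if_neg hc)) hτc
        · rw [eqE_eval] at h1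
          simp only [Expr.eval_cell, Expr.eval_ofNat, hτc] at h1
          have h2 : τ xLen 0 ≠ c := by intro hc; rw [if_pos hc] at h1; omega
          have h3 : 1 ≤ τ xNb 0 := by
            by_contra hc
            have := hS.inv.start (by omega)
            omega
          exact Ok.of_wp ⟨hS, by omega, h3⟩ (by show 1 ≤ _; omega)
      · rintro ω hω ⟨k1, k2, k3⟩
        -- The loop variable already holds `c`, so this write changes nothing; it only brings the
        -- store into the form in which the `for` rule presents invariants.
        have hωH : ω = ω.write xH 0 c := by
          have : ω xH 0 = c := by rw [hω xH (by decide), hτc]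
          rw [Store.write, ← this, Function.update_eq_self, Function.update_eq_self]
        rw [hωH]
        refine (enqueue_forced_ok k1 k2 k3).mono le_rfl ?_
        rintro π - ⟨m1, m2, m3, m4⟩
        exact ⟨π, ⟨m1.kids, m1.inv.advance m2 m3 m4, m1.ins⟩, rfl⟩
    · show (q - 1) * (13 + 1 + (q * 180 + 100) + (q * 180 + 10) + 2 + 11) + (1 + 2 + 6) ≤ _
      have : (q - 1) * (13 + 1 + (q * 180 + 100) + (q * 180 + 10) + 2 + 11) ≤
        q * (13 + 1 + (q * 180 + 100) + (q * 180 + 10) + 2 + 11) := Nat.mul_le_mul_right _ (by omega)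
      nlinarith
    · rintro τ - - ⟨υ, hυ, rfl⟩
      refine hυ.congr ?_ ?_ ?_ ?_ ?_ ?_ ?_ ?_ ?_ ?_ ?_ ?_ ?_ <;>
          simp only [ne_eq, Nat.reduceEqDiff, not_false_eq_true, Store.write_ne]
  · intro τ _ hS
    have hinv := hS.inv
    have hlen : τ xLen 0 = q := le_antisymm hinv.len_le hinv.le.2
    rw [hlen] at hinv
    have hnb := hinv.nb_le
    refine Ok.of_wp ?_ (by decide)
    simp only [Prog.wp, Expr.eval_cell, Expr.eval_ofNat, ne_eq, Nat.reduceEqDiff,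
      not_false_eq_true, Store.write_ne, Store.write_same, hS.kids.q_eq]
    exact ⟨by omega, by omega, hinv.chain hS.kids.kids, hnb⟩

/-- The children of a class. -/
structure KidsList (N p : ℕ) (par rep : ℕ → ℕ) (q : ℕ) (ch kr : ℕ → ℕ) : Prop where
  mem : ∀ i < q, 1 ≤ ch i ∧ ch i < N ∧ par (ch i) = p ∧ kr i = rep (ch i)
  mono : ∀ i j, i < j → j < q → ch i < ch j
  surj : ∀ c, 1 ≤ c → c < N → par c = p → ∃ i < q, ch i = c
  card : q = ((Finset.Ico 1 N).filter fun c => par c = p).card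

theorem kidsProg_ok {N p : ℕ} (hN : σ xNc 0 = N) (hp : σ xCj 0 = p) (h1N : 1 ≤ N)
    (hW : N ≤ W) (hrep : ∀ j, 1 ≤ j → j < N → σ aRp j ≤ W) :
    Ok W kidsProg σ (N * 60 + 20) fun τ =>
      KidsList N p (σ aPa) (σ aRp) (τ xKq 0) (τ aCh) (τ aKr) := by
  refine Ok.time (T := 3 + (N * 60 + 10)) ?_ (by omega)
  refine Ok.seq (Q := fun υ => υ = σ.write xKq 0 0) (Ok.of_wp ?_ (by decide)) ?_
  · simp only [Prog.wp, Expr.eval_ofNat]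
    exact ⟨by omega, by omega, trivial⟩
  rintro σ' - rfl
  refine Ok.for_const 1 N 40 (fun k τ => τ xKq 0 < k ∧
    (∀ i < τ xKq 0, τ aCh i < k) ∧
    KidsList k p (σ aPa) (σ aRp) (τ xKq 0) (τ aCh) (τ aKr)) rfl h1N hW (by decide) ?_ ?_ ?_ ?_ ?_
  · intro τ hτ
    simp only [Expr.eval_cell, Expr.eval_ofNat, hτ xNc (by decide), ne_eq, Nat.reduceEqDiff,
      not_false_eq_true, Store.write_ne, hN]
  · simp only [ne_eq, Nat.reduceEqDiff, not_false_eq_true, Store.write_ne, Store.write_same,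
      Function.update_self]
    exact ⟨by omega, by omega, by omega, by omega, by omega, by simp⟩
  · rintro c τ h1c hcN hτc hτ ⟨hq, hlt, hI⟩
    have e1 : τ aPa = σ aPa := by rw [hτ aPa (by decide), Store.write_ne _ _ _ (by decide)]
    have e2 : τ aRp = σ aRp := by rw [hτ aRp (by decide), Store.write_ne _ _ _ (by decide)]
    have e3 : τ xCj 0 = p := by rw [hτ xCj (by decide), Store.write_ne _ _ _ (by decide), hp]
    have hrc := hrep c h1c hcN
    have hset : (Finset.Ico 1 (c + 1)).filter (fun x => σ aPa x = p) =
        if σ aPa c = p then insert c ((Finset.Ico 1 c).filter fun x => σ aPa x = p)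
        else (Finset.Ico 1 c).filter fun x => σ aPa x = p := by
      rw [← Finset.insert_Ico_right_eq_Ico_add_one h1c, Finset.filter_insert]
    refine Ok.of_wp ?_ (by decide)
    simp only [Prog.wp, eqE_eval, Expr.eval_cell, Expr.eval_ofNat, Expr.eval_add, ne_eq,
      Nat.reduceEqDiff, not_false_eq_true, Store.write_ne, Store.write_same, Function.update_self,
      hτc, e1, e2, e3]
    refine ⟨fun h1 => ?_, fun h1 => ?_⟩
    · have hpc : σ aPa c = p := by by_contra hc; exact h1 (if_neg hc)
      have hup : ∀ i, i < τ xKq 0 + 1 → (i < τ xKq 0 ∧ ∀ (g : ℕ → ℕ) x,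
          Function.update g (τ xKq 0) x i = g i) ∨ i = τ xKq 0 := by
        intro i hi
        rcases Nat.lt_succ_iff_lt_or_eq.1 hi with hi | rfl
        · exact Or.inl ⟨hi, fun g x => Function.update_of_ne (by omega) _ _⟩
        · exact Or.inr rfl
      refine ⟨by omega, by omega, by omega, by omega, by omega, by omega, by omega, ?_, ?_, ?_, ?_, ?_⟩
      · intro i hi
        rcases hup i hi with ⟨h2, h3⟩ | rfl
        · rw [h3]; have := hlt i h2; omega
        · rw [Function.update_self]; omega
      · intro i hi
        rcases hup i hi with ⟨h2, h3⟩ | rfl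
        · rw [h3, h3]
          obtain ⟨m1, m2, m3, m4⟩ := hI.mem i h2
          exact ⟨m1, by omega, m3, m4⟩
        · rw [Function.update_self, Function.update_self]
          exact ⟨h1c, by omega, hpc, rfl⟩
      · intro i j hij hj
        rw [Function.update_of_ne (show i ≠ τ xKq 0 by omega)]
        rcases hup j hj with ⟨h2, h3⟩ | rfl
        · rw [h3]; exact hI.mono i j hij h2
        · rw [Function.update_self]; exact hlt i hij
      · intro x hx1 hx2 hxp
        rcases Nat.lt_succ_iff_lt_or_eq.1 hx2 with hx2 | rfl
        · obtain ⟨i, h2, h3⟩ := hI.surj x hx1 hx2 hxp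
          exact ⟨i, by omega, by rw [Function.update_of_ne (by omega), h3]⟩
        · exact ⟨_, Nat.lt_succ_self _, Function.update_self ..⟩
      · rw [hset, if_pos hpc, Finset.card_insert_of_notMem (by simp), ← hI.card]
    · have hpc : σ aPa c ≠ p := by intro hc; rw [if_pos hc] at h1; omega
      refine ⟨by omega, fun i hi => by have := hlt i hi; omega, fun i hi => ?_, hI.mono,
        fun x hx1 hx2 hxp => ?_, ?_⟩
      · obtain ⟨m1, m2, m3, m4⟩ := hI.mem i hi
        exact ⟨m1, by omega, m3, m4⟩
      · rcases Nat.lt_succ_iff_lt_or_eq.1 hx2 with hx2 | rfl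
        · exact hI.surj x hx1 hx2 hxp
        · exact absurd hxp hpc
      · rw [hset, if_neg hpc, ← hI.card]
  · show (N - 1) * (40 + 2 + 11) + (1 + 2 + 6) ≤ _
    omega
  · rintro τ - - ⟨-, -, h⟩
    exact h

/-- Children are listed by increasing number and all have numbers above `p`. The class of the
representative has number `p + 1`, so it comes first and becomes part 0. A single child would force
the class to have one vertex only, which the size excludes. -/
theorem ClassTree.kids {N p : ℕ} {rep par siz : ℕ → ℕ} {cs : ℕ → Finset ℕ} {ch kr : ℕ → ℕ}
    (h : ClassTree n R N rep par siz cs) (hp1 : 1 ≤ p) (hpN : p < N) (hs : siz p ≠ 1)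
    (hR : ∀ x, ¬ R x x) (hk : KidsList N p par rep q ch kr) :
    Kids R (cs p) (rep p) q (fun i => cs (ch i)) kr ∧ ch 0 = p + 1 := by
  obtain ⟨hv1, hv2, hv3⟩ := h.vclass p hp1 hpN hs
  obtain ⟨c1, c2, c3, c4, c5⟩ := h.cls p hp1 hpN
  have hc0 : ch 0 = p + 1 := by
    obtain ⟨i, hi, hi'⟩ := hk.surj (p + 1) (by omega) hv1 hv2
    rcases Nat.eq_zero_or_pos i with h0 | h0
    · rw [← h0, hi']
    · have h1 := hk.mono 0 i h0 hi
      obtain ⟨k1, k2, k3, _⟩ := hk.mem 0 (by omega)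
      have := (h.par_lt _ k1 k2).1
      omega
  have hinj : ∀ i < q, ∀ j < q, ch i = ch j → i = j := by
    intro i hi j hj hij
    rcases Nat.lt_trichotomy i j with h1 | h1 | h1
    · have := hk.mono i j h1 hj; omega
    · exact h1
    · have := hk.mono j i h1 hi; omega
  have hcover : ∀ x, x ∈ cs p ↔ ∃ i < q, x ∈ cs (ch i) := by
    intro x
    constructor
    · intro hx
      obtain ⟨j, h1, h2, h3, h4⟩ := h.cover p hp1 hpN hs x hx
      obtain ⟨i, hi, hij⟩ := hk.surj j h1 h2 h3
      exact ⟨i, hi, hij ▸ h4⟩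
    · rintro ⟨i, hi, hx⟩
      obtain ⟨k1, k2, k3, _⟩ := hk.mem i hi
      have := (h.par_lt _ k1 k2).2.2
      rw [k3] at this
      exact this hx
  refine ⟨⟨?_, ?_, ?_, ?_, ?_, hcover, c2, c5, ?_, hR⟩, hc0⟩
  · by_contra hq
    have hsub : cs p ⊆ {rep p} := by
      intro x hx
      obtain ⟨i, hi, hxi⟩ := (hcover x).1 hx
      have : i = 0 := by omega
      rwa [this, hc0, hv3] at hxi
    have h1 := Finset.card_le_card hsub
    have h2 : 0 < (cs p).card := Finset.card_pos.2 ⟨_, c4⟩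
    rw [Finset.card_singleton] at h1
    omega
  · show cs (ch 0) = _
    rw [hc0, hv3]
  · intro i hi
    obtain ⟨k1, k2, k3, k4⟩ := hk.mem i hi
    rw [k4]
    exact (h.cls _ k1 k2).2.2.2.1
  · intro i hi
    obtain ⟨k1, k2, k3, k4⟩ := hk.mem i hi
    exact (h.cls _ k1 k2).2.1
  · intro i hi j hj hij
    obtain ⟨k1, k2, k3, k4⟩ := hk.mem i hi
    obtain ⟨m1, m2, m3, m4⟩ := hk.mem j hj
    exact h.disj _ _ k1 k2 m1 m2 (fun h1 => hij (hinj i hi j hj h1)) (k3.trans m3.symm)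
  · intro M h1 h2 h3 h4
    obtain ⟨j, m1, m2, m3, m4⟩ := h.maxi p hp1 hpN hs M h1 h2 h3 h4
    obtain ⟨i, hi, hij⟩ := hk.surj j m1 m2 m3
    exact ⟨i, hi, by show M ⊆ cs (ch i); rw [hij]; exact m4⟩

end

/-! ### Placing the parts of a class -/

notation "aSt" => (150 : ℕ)
notation "xDm" => (151 : ℕ)
notation "xBs" => (152 : ℕ)
notation "xOf" => (153 : ℕ)
notation "aSl" => (154 : ℕ)
notation "aCum" => (155 : ℕ)
notation "xGi" => (156 : ℕ)
notation "xHb" => (157 : ℕ)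
notation "xG" => (158 : ℕ)

/-- Computes the first coordinates of the parts of a node from the best drawing of its quotient. -/
def placeProg : Prog :=
  forLoop xDm 0 vD
    (setv xBs (.cell aSt (sv xDm)) ;;
     forLoop xZ 0 (sv xT)
      (setv xOf (sv xBs) ;;
       forLoop xY 0 (sv xT)
        (.cond (.cell aBest (sv xDm * sv xT + sv xZ) - .cell aBest (sv xDm * sv xT + sv xY))
          (setv xOf (sv xOf + .cell aWgt (sv xY))) .skip) ;;
       .assign aSt (.cell aSl (sv xZ) * vD + sv xDm) (sv xOf)))

/-- Sets up the quotient of a node. -/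
def quotientProg : Prog :=
  setv xHb (.cell aBd (sv xGi)) ;; setv xT (.cell aBd (sv xGi + 1) - sv xHb + 1) ;;
  .assign aRep 0 vE ;; .assign aWgt 0 (.cell aCum (sv xHb)) ;; .assign aSl 0 0 ;;
  forLoop xZ 1 (sv xT)
    (setv xY (.cell aOr (sv xHb + sv xZ - 1)) ;; .assign aRep (sv xZ) (.cell aKr (sv xY)) ;;
     .assign aWgt (sv xZ) (.cell aSz (.cell aCh (sv xY))) ;;
     .assign aSl (sv xZ) (.cell aCh (sv xY)))

/-- Processes a node. -/
def groupProg : Prog := quotientProg ;; searchProg ;; placeProg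

section
variable {n d W : ℕ} {R : ℕ → ℕ → Prop} {S : Finset ℕ} {v q : ℕ} {K : ℕ → Finset ℕ} {r : ℕ → ℕ}
  {σ τ : Store}

/-- The start of a part is the start of the node plus the sizes of the parts before it. Row 0 is
both the start of the node and, when its slot is used, the slot of part 0; therefore the entry of
each dimension is saved before any row is written in that dimension. -/
theorem placeProg_ok {t : ℕ} (hd : σ 0 2 = d) (ht : σ xT 0 = t) (h1t : 1 ≤ t)
    (hsl : ∀ i < t, ∀ j < t, σ aSl i = σ aSl j → i = j) (hslW : ∀ i < t, σ aSl i * d + d ≤ W)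
    (hb : ∀ D < d, σ aSt D + ∑ l ∈ Finset.range t, σ aWgt l ≤ W) (htW : t ≤ W) (hdW : d ≤ W) :
    Ok W placeProg σ (d * (t * (t * 50 + 50) + 40) + 10) fun τ =>
      (∀ D < d, ∀ i < t, τ aSt (σ aSl i * d + D) = σ aSt D + ∑ l ∈ Finset.range t,
        if σ aBest (D * t + l) < σ aBest (D * t + i) then σ aWgt l else 0) ∧
      ∀ j, (∀ i < t, j ≠ σ aSl i) → ∀ D < d, τ aSt (j * d + D) = σ aSt (j * d + D) := by
  set off : ℕ → ℕ → ℕ → ℕ := fun D i m => ∑ l ∈ Finset.range m,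
    if σ aBest (D * t + l) < σ aBest (D * t + i) then σ aWgt l else 0 with hoff
  have hoffle : ∀ D i m, m ≤ t → off D i m ≤ ∑ l ∈ Finset.range t, σ aWgt l := by
    intro D i m hm
    refine (Finset.sum_le_sum (g := σ aWgt) fun l _ => ?_).trans
      (Finset.sum_le_sum_of_subset (Finset.range_mono hm))
    split_ifs <;> omega
  refine Ok.for_const 0 d (5 + (t * (t * 50 + 50) + 10)) (fun k τ =>
    (∀ D < k, ∀ i < t, τ aSt (σ aSl i * d + D) = σ aSt D + off D i t) ∧
    (∀ j, ∀ D, k ≤ D → D < d → τ aSt (j * d + D) = σ aSt (j * d + D)) ∧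
    ∀ j, (∀ i < t, j ≠ σ aSl i) → ∀ D < d, τ aSt (j * d + D) = σ aSt (j * d + D))
    rfl (Nat.zero_le _) hdW (by decide) ?_ ?_ ?_ ?_ ?_
  · intro τ hτ
    simp only [Expr.eval_cell, Expr.eval_ofNat, hτ 0 (by decide), hd]
  · simp only [ne_eq, Nat.reduceEqDiff, not_false_eq_true, Store.write_ne]
    exact ⟨by omega, fun _ _ _ _ => trivial, fun _ _ _ _ => trivial⟩
  · rintro D τ - hD hτD hτ ⟨hI1, hI2, hI3⟩
    have eb : τ aSt D = σ aSt D := by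
      have := hI2 0 D le_rfl hD
      simpa using this
    have hbD := hb D hD
    refine Ok.seq (Q := fun υ => υ = τ.write xBs 0 (σ aSt D)) (Ok.of_wp ?_ (by decide)) ?_
    · simp only [Prog.wp, Expr.eval_cell, Expr.eval_ofNat, hτD, eb]
      exact ⟨by omega, by omega, trivial⟩
    rintro υ - rfl
    refine Ok.for_const 0 t (4 + ((t * 50 + 10) + 12)) (fun i υ =>
      (∀ D' < D, ∀ i < t, υ aSt (σ aSl i * d + D') = σ aSt D' + off D' i t) ∧
      (∀ i' < i, υ aSt (σ aSl i' * d + D) = σ aSt D + off D i' t) ∧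
      (∀ j, ∀ D', D < D' → D' < d → υ aSt (j * d + D') = σ aSt (j * d + D')) ∧
      ∀ j, (∀ i < t, j ≠ σ aSl i) → ∀ D < d, υ aSt (j * d + D) = σ aSt (j * d + D))
      rfl (Nat.zero_le _) htW (by decide) ?_ ?_ ?_ ?_ ?_
    · intro υ hυ
      simp only [Expr.eval_cell, Expr.eval_ofNat, hυ xT (by decide), ne_eq, Nat.reduceEqDiff,
        not_false_eq_true, Store.write_ne, hτ xT (by decide), ht]
    · simp only [ne_eq, Nat.reduceEqDiff, not_false_eq_true, Store.write_ne]
      exact ⟨hI1, by omega, fun j D' h1 h2 => hI2 j D' h1.le h2, hI3⟩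
    · rintro i υ - hi hυi hυ ⟨hJ1, hJ2, hJ3, hJ4⟩
      have f : ∀ x, x ≠ xBs → x ∉ placeProg.writes → υ x = σ x := by
        intro x h1 h2
        rw [hυ x, Store.write_ne _ _ _ h1, hτ x h2]
        simp only [placeProg, forLoop, Prog.writes, List.mem_append, List.mem_singleton,
          List.not_mem_nil, not_or, or_false] at h2 ⊢
        tauto
      have f0 := f 0 (by decide) (by decide)
      have fT := f xT (by decide) (by decide)
      have fB := f aBest (by decide) (by decide)
      have fW := f aWgt (by decide) (by decide)
      have fS := f aSl (by decide) (by decide)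
      have fD : υ xDm 0 = D := by
        rw [hυ xDm (by decide), Store.write_ne _ _ _ (by decide), hτD]
      have fb : υ xBs 0 = σ aSt D := by
        rw [hυ xBs (by decide), Store.write_same, Function.update_self]
      refine Ok.seq (Q := fun ω => ω = υ.write xOf 0 (σ aSt D)) (Ok.of_wp ?_ (by decide)) ?_
      · simp only [Prog.wp, Expr.eval_cell, Expr.eval_ofNat, fb]
        exact ⟨by omega, by omega, trivial⟩
      rintro ω - rfl
      refine Ok.seq (Q := fun ω => ω xOf 0 = σ aSt D + off D i t) (T := t * 50 + 10) ?_ ?_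
      · refine Ok.for_const 0 t 35 (fun m ω => ω xOf 0 = σ aSt D + off D i m)
          rfl (Nat.zero_le _) htW (by decide) ?_ ?_ ?_ ?_ ?_
        · intro ω hω
          simp only [Expr.eval_cell, Expr.eval_ofNat, hω xT (by decide), ne_eq, Nat.reduceEqDiff,
            not_false_eq_true, Store.write_ne, fT, ht]
        · simp [hoff]
        · intro m ω _ hm hωm hω hI
          have g : ∀ x, x ≠ xOf → x ≠ xY → ω x = υ x := by
            intro x h1 h2
            rw [hω x (by simp [forLoop, Prog.writes, h1, h2]), Store.write_ne _ _ _ h1]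
          have g1 := g xDm (by decide) (by decide)
          have g2 := g xT (by decide) (by decide)
          have g3 := g xZ (by decide) (by decide)
          have g4 := g aBest (by decide) (by decide)
          have g5 := g aWgt (by decide) (by decide)
          have hle := hoffle D i (m + 1) hm
          have hsucc : off D i (m + 1) = off D i m + if σ aBest (D * t + m) < σ aBest (D * t + i)
              then σ aWgt m else 0 := Finset.sum_range_succ _ _
          refine Ok.of_wp ?_ (by decide)
          simp only [Prog.wp, Expr.eval_cell, Expr.eval_ofNat, Expr.eval_add, Expr.eval_sub,
            Expr.eval_mul, g1, g2, g3, g4, g5, fD, fT, ht, hυi, hωm, fB, fW, hI]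
          refine ⟨fun h => ?_, fun h => ?_⟩
          · rw [if_pos (by omega)] at hsucc
            refine ⟨by omega, by omega, ?_⟩
            simp only [ne_eq, Nat.reduceEqDiff, not_false_eq_true, Store.write_ne, Store.write_same,
              Function.update_self]
            omega
          · rw [if_neg (by omega)] at hsucc
            rw [Store.write_ne _ _ _ (by decide), hI]
            omega
        · show (t - 0) * (35 + 2 + 11) + (1 + 2 + 6) ≤ _
          omega
        · intro ω _ _ h
          exact h
      · intro ω hω hωo
        have g : ∀ x, x ≠ xOf → x ≠ xY → ω x = υ x := by
          intro x h1 h2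
          rw [hω x (by simp [forLoop, Prog.writes, h1, h2]), Store.write_ne _ _ _ h1]
        have g1 := g xDm (by decide) (by decide)
        have g3 := g xZ (by decide) (by decide)
        have g4 := g aSl (by decide) (by decide)
        have g5 := g 0 (by decide) (by decide)
        have g6 := g aSt (by decide) (by decide)
        have hle := hoffle D i t le_rfl
        have hsi := hslW i hi
        refine Ok.of_wp ?_ (by decide)
        simp only [Prog.wp, Expr.eval_cell, Expr.eval_ofNat, Expr.eval_add,
          Expr.eval_mul, g1, g3, g4, g5, g6, fD, fS, f0, hd, hυi, hωo, ne_eq, Nat.reduceEqDiff,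
          not_false_eq_true, Store.write_ne, Store.write_same]
        refine ⟨by omega, by omega, ?_, ?_, ?_, ?_⟩
        · intro D' hD' i' hi'
          rw [Function.update_of_ne]
          · exact hJ1 D' hD' i' hi'
          · intro h
            have := (idx_inj (by omega) hD h).2
            omega
        · intro i' hi'
          by_cases hii : i' = i
          · rw [hii, Function.update_self]
          · rw [Function.update_of_ne]
            · exact hJ2 i' (by omega)
            · intro h
              exact hii (hsl i' (by omega) i hi (idx_inj hD hD h).1)
        · intro j D' h1 h2
          rw [Function.update_of_ne]
          · exact hJ3 j D' h1 h2
          · intro h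
            have := (idx_inj h2 hD h).2
            omega
        · intro j hj D' hD'
          rw [Function.update_of_ne]
          · exact hJ4 j hj D' hD'
          · intro h
            exact hj i hi (idx_inj hD' hD h).1
    · show (t - 0) * (4 + (t * 50 + 10 + 12) + 2 + 11) + (1 + 2 + 6) ≤ _
      rw [Nat.sub_zero]; nlinarith
    · rintro υ - - ⟨hJ1, hJ2, hJ3, hJ4⟩
      rw [Store.write_ne _ _ _ (by decide)]
      refine ⟨fun D' hD' i hi => ?_, hJ3, hJ4⟩
      rcases Nat.lt_succ_iff_lt_or_eq.1 hD' with hD' | rfl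
      · exact hJ1 D' hD' i hi
      · exact hJ2 i hi
  · show (d - 0) * (5 + (t * (t * 50 + 50) + 10) + 2 + 11) + (1 + 2 + 6) ≤ _
    rw [Nat.sub_zero]; nlinarith
  · rintro τ - - ⟨hI1, _, hI3⟩
    exact ⟨hI1, hI3⟩

/-- The data needed for processing the nodes of a class. -/
structure GroupStore (n d W : ℕ) (R : ℕ → ℕ → Prop) (S : Finset ℕ) (v q : ℕ) (K : ℕ → Finset ℕ)
    (r : ℕ → ℕ) (o bd ch : ℕ → ℕ) (nb : ℕ) (σ : Store) : Prop where
  kids : KidsStore n W R S v q K r σ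
  dim : σ 0 2 = d
  chain : Chain R K q o bd nb
  ord : ∀ t < q, σ aOr t = o t
  bnd : ∀ i ≤ nb, σ aBd i = bd i
  num : σ xNb 0 = nb
  chd : ∀ i < q, σ aCh i = ch i
  wt : ∀ i < q, σ aSz (ch i) = (K i).card
  inj : ∀ i < q, ∀ j < q, ch i = ch j → i = j
  pos : ∀ i < q, 1 ≤ ch i ∧ ch i * d + d ≤ W
  cum : ∀ x ≤ q, σ aCum x = ((tset o 0 x).biUnion K).card
  sub : ∀ x ∈ S, x < n
  one_le : 1 ≤ d
  big : n * n * (n * n + 1) + d * n + d + n + 2 ≤ W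
  ex : ∃ g, IsDraw d R n g

variable {o bd ch : ℕ → ℕ} {nb : ℕ}

theorem GroupStore.congr (h : GroupStore n d W R S v q K r o bd ch nb σ)
    (hs : ∀ x ∈ [0, aMtx, xKq, aRp, xCj, aKr, aOr, aBd, xNb, aCh, aSz, aCum], τ x = σ x) :
    GroupStore n d W R S v q K r o bd ch nb τ := by
  obtain ⟨k1, k2, k3, k4, k5, k6, k7, k8, k9, hh1, hh2, hh3, hh4, hh5, hh6⟩ := h
  simp only [List.mem_cons, List.not_mem_nil, or_false, forall_eq_or_imp, forall_eq] at hs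
  obtain ⟨m1, m2, m3, m4, m5, m6, m7, m8, m9, n1, n2, n3⟩ := hs
  refine ⟨k1.congr m1 m2 m3 m4 m5 m6, ?_, k3, ?_, ?_, ?_, ?_, ?_, k9, hh1, ?_, hh3, hh4, hh5, hh6⟩
  · rw [m1, k2]
  · rw [m7]; exact k4
  · rw [m8]; exact k5
  · rw [m9, k6]
  · rw [n1]; exact k7
  · rw [n2]; exact k8
  · rw [n3]; exact hh2

theorem Good.congr {n : ℕ} {f : ℕ → ℕ → ℕ} {S : Finset ℕ} {b c : ℕ → ℕ} (h : Good d R n f S b)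
    (hbc : ∀ D < d, b D = c D) : Good d R n f S c := by
  refine ⟨fun D hD x hx => ?_, h.inj, h.mono, h.min⟩
  rw [← hbc D hD]
  exact h.range D hD x hx

theorem quotCost_congr_data {d B t : ℕ} {R : ℕ → ℕ → Prop} {r w r' w' : ℕ → ℕ} {p : ℕ → ℕ → ℕ}
    (hr : ∀ i < t, r i = r' i) (hw : ∀ i < t, w i = w' i) :
    quotCost d R B t r w p = quotCost d R B t r' w' p := by
  unfold quotCost
  refine Finset.sum_congr rfl fun i hi => Finset.sum_congr rfl fun j hj => ?_
  rw [Finset.mem_range] at hi hj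
  rw [pairCost, pairCost, hr i hi, hr j hj, hw i hi, hw j hj]

/-- The parts of a node: a closed set, and the parts which are added to it. -/
def nodePart (K : ℕ → Finset ℕ) (o : ℕ → ℕ) (h l : ℕ) : Finset ℕ :=
  if l = 0 then (tset o 0 h).biUnion K else K (o (h + l - 1))

/-- The representatives of the parts of a node. -/
def nodeRep (r o : ℕ → ℕ) (h l : ℕ) : ℕ := if l = 0 then r 0 else r (o (h + l - 1))

theorem Chain.bd_mono (h : Chain R K q o bd nb) {i j : ℕ} (hij : i ≤ j) (hj : j ≤ nb) :
    bd i ≤ bd j := by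
  induction j with
  | zero => rw [show i = 0 by omega]
  | succ j ih =>
    rcases hij.lt_or_eq with h1 | h1
    · exact (ih (by omega) (by omega)).trans (h.mono j (by omega)).le
    · rw [h1]

theorem Chain.bd_bounds (h : Chain R K q o bd nb) {i : ℕ} (hi : i < nb) :
    1 ≤ bd i ∧ bd i < bd (i + 1) ∧ bd (i + 1) ≤ q := by
  have h1 := h.bd_mono (Nat.zero_le i) hi.le
  have h2 := h.bd_mono (show i + 1 ≤ nb from hi) le_rfl
  rw [h.first] at h1
  rw [h.last] at h2
  exact ⟨h1, h.mono i hi, h2⟩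

/-- The parts of a node partition it into modules with the given representatives. -/
structure NodeParts (R : ℕ → ℕ → Prop) (K : ℕ → Finset ℕ) (r o : ℕ → ℕ) (h e t : ℕ) : Prop where
  mod : ∀ i < t, IsMod R (nodePart K o h i)
  rep : ∀ i < t, nodeRep r o h i ∈ nodePart K o h i
  disj : ∀ i < t, ∀ j < t, i ≠ j → Disjoint (nodePart K o h i) (nodePart K o h j)
  cover : ∀ x, x ∈ (tset o 0 e).biUnion K ↔ ∃ i < t, x ∈ nodePart K o h i

theorem Chain.nodeParts (h : Chain R K q o bd nb) (hK : Kids R S v q K r) {i : ℕ} (hi : i < nb) :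
    NodeParts R K r o (bd i) (bd (i + 1)) (bd (i + 1) - bd i + 1) := by
  obtain ⟨h1, h2, h3⟩ := h.bd_bounds hi
  have hsub : tset o 0 (bd i) ⊆ Finset.range q := by
    intro x hx
    obtain ⟨t, _, ht, rfl⟩ := mem_tset.1 hx
    exact Finset.mem_range.2 (h.lt t (by omega))
  have hq := hK.two
  have hlt : ∀ l, 0 < l → l < bd (i + 1) - bd i + 1 → o (bd i + l - 1) < q := fun l _ _ =>
    h.lt _ (by omega)
  refine ⟨?_, ?_, ?_, ?_⟩
  · intro l hl
    unfold nodePart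
    split_ifs with hl0
    · exact h.mod i hi.le
    · exact hK.mod _ (hlt l (by omega) hl)
  · intro l hl
    unfold nodePart nodeRep
    split_ifs with hl0
    · rw [hK.mem_biUnion hsub (by omega) (hK.mem 0 (by omega))]
      exact mem_tset.2 ⟨0, le_rfl, by omega, h.zero⟩
    · exact hK.mem _ (hlt l (by omega) hl)
  · have key : ∀ l m, l < m → m < bd (i + 1) - bd i + 1 →
        Disjoint (nodePart K o (bd i) l) (nodePart K o (bd i) m) := by
      intro l m hlm hm
      have hmq := hlt m (by omega) hm
      unfold nodePart
      rw [if_neg (show ¬ m = 0 by omega)]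
      split_ifs with hl0
      · rw [Finset.disjoint_right]
        intro x hx
        rw [hK.mem_biUnion hsub hmq hx]
        intro hmem
        obtain ⟨t, _, ht, ht'⟩ := mem_tset.1 hmem
        have := h.inj t (by omega) _ (by omega) ht'
        omega
      · refine hK.disj _ (hlt l (by omega) (by omega)) _ hmq fun heq => ?_
        have := h.inj _ (by omega) _ (by omega) heq
        omega
    intro l hl m hm hlm
    rcases Nat.lt_or_gt_of_ne hlm with h4 | h4
    · exact key l m h4 hm
    · exact (key m l h4 hl).symm
  · intro x
    rw [Finset.mem_biUnion]
    constructor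
    · rintro ⟨j, hj, hx⟩
      obtain ⟨t, _, ht, rfl⟩ := mem_tset.1 hj
      rcases Nat.lt_or_ge t (bd i) with h4 | h4
      · refine ⟨0, by omega, ?_⟩
        rw [nodePart, if_pos rfl]
        exact Finset.mem_biUnion.2 ⟨o t, mem_tset.2 ⟨t, by omega, h4, rfl⟩, hx⟩
      · refine ⟨t - bd i + 1, by omega, ?_⟩
        rw [nodePart, if_neg (by omega), show bd i + (t - bd i + 1) - 1 = t by omega]
        exact hx
    · rintro ⟨l, hl, hx⟩
      unfold nodePart at hx
      split_ifs at hx with hl0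
      · obtain ⟨j, hj, hx⟩ := Finset.mem_biUnion.1 hx
        exact ⟨j, tset_mono le_rfl h2.le hj, hx⟩
      · exact ⟨_, mem_tset.2 ⟨_, Nat.zero_le _, by omega, rfl⟩, hx⟩

theorem quotientProg_ok (h : GroupStore n d W R S v q K r o bd ch nb σ) {i : ℕ} (hi : i < nb)
    (hg : σ xGi 0 = i) (htn : bd (i + 1) - bd i + 1 ≤ n) :
    Ok W quotientProg σ ((bd (i + 1) - bd i + 1) * 50 + 60) fun τ =>
      τ xT 0 = bd (i + 1) - bd i + 1 ∧ ∀ l < bd (i + 1) - bd i + 1,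
        τ aRep l = nodeRep r o (bd i) l ∧ τ aWgt l = (nodePart K o (bd i) l).card ∧
        τ aSl l = if l = 0 then 0 else ch (o (bd i + l - 1)) := by
  obtain ⟨h1, h2, h3⟩ := h.chain.bd_bounds hi
  have hW := h.kids.le
  have hqn := h.kids.q_le
  have hq2 := h.kids.kids.two
  have hcardW : ∀ A ⊆ Finset.range q, (A.biUnion K).card ≤ n := by
    intro A hA
    have : A.biUnion K ⊆ Finset.range n := by
      intro x hx
      obtain ⟨j, hj, hx⟩ := Finset.mem_biUnion.1 hx
      exact Finset.mem_range.2 (h.sub x ((h.kids.kids.cover x).2 ⟨j, Finset.mem_range.1 (hA hj), hx⟩))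
    have := Finset.card_le_card this
    rwa [Finset.card_range] at this
  have hsub : tset o 0 (bd i) ⊆ Finset.range q := by
    intro x hx
    obtain ⟨t, _, ht, rfl⟩ := mem_tset.1 hx
    exact Finset.mem_range.2 (h.chain.lt t (by omega))
  have hc0 := hcardW _ hsub
  have hv := h.kids.v_lt
  have e1 := h.bnd i hi.le
  have e2 := h.bnd (i + 1) hi
  have e3 := h.cum (bd i) (by omega)
  have e4 := h.kids.v_eq
  have hnbW : nb ≤ n := by
    have : ∀ j ≤ nb, j ≤ bd j := by
      intro j
      induction j with
      | zero => omega
      | succ j ih => intro hj; have := ih (by omega); have := h.chain.mono j (by omega); omega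
    have := this nb le_rfl
    rw [h.chain.last] at this
    omega
  refine Ok.time (T := 5 + (12 + (6 + (6 + (4 + ((bd (i + 1) - bd i + 1) * 50 + 10)))))) ?_ (by omega)
  refine Ok.assign_seq (by simp)
    (by simp only [Expr.eval_cell, Expr.eval_ofNat, hg, e1]; omega) (by decide) ?_
  simp only [Expr.eval_cell, Expr.eval_ofNat, hg, e1]
  refine Ok.assign_seq (by simp) ?_ (by decide) ?_
  · simp only [Expr.eval_cell, Expr.eval_ofNat, Expr.eval_add, Expr.eval_sub, ne_eq,
      Nat.reduceEqDiff, not_false_eq_true, Store.write_ne, Store.write_same, Function.update_self,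
      hg, e2]
    omega
  simp only [Expr.eval_cell, Expr.eval_ofNat, Expr.eval_add, Expr.eval_sub, ne_eq,
    Nat.reduceEqDiff, not_false_eq_true, Store.write_ne, Store.write_same, Function.update_self,
    hg, e2]
  refine Ok.assign_seq (by simp) ?_ (by decide) ?_
  · simp only [vE, Expr.eval_cell, Expr.eval_ofNat, ne_eq,
      Nat.reduceEqDiff, not_false_eq_true, Store.write_ne, e4]
    omega
  simp only [vE, Expr.eval_cell, Expr.eval_ofNat, ne_eq,
    Nat.reduceEqDiff, not_false_eq_true, Store.write_ne, e4]
  refine Ok.assign_seq (by simp) ?_ (by decide) ?_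
  · simp only [Expr.eval_cell, Expr.eval_ofNat, ne_eq, Nat.reduceEqDiff, not_false_eq_true,
      Store.write_ne, Store.write_same, Function.update_self, e3]
    omega
  simp only [Expr.eval_cell, Expr.eval_ofNat, ne_eq, Nat.reduceEqDiff, not_false_eq_true,
    Store.write_ne, Store.write_same, Function.update_self, e3]
  refine Ok.assign_seq (by simp) (by simp) (by decide) ?_
  simp only [Expr.eval_ofNat]
  generalize hσ' : Store.write _ aSl _ _ = σ'
  have f : ∀ x, x ∉ [xHb, xT, aRep, aWgt, aSl] → σ' x = σ x := by
    intro x hx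
    simp only [List.mem_cons, List.not_mem_nil, or_false, not_or] at hx
    rw [← hσ']
    simp [hx]
  have g1 : σ' xHb 0 = bd i := by rw [← hσ']; simp
  have g2 : σ' xT 0 = bd (i + 1) - bd i + 1 := by rw [← hσ']; simp
  have g3 : σ' aRep 0 = v := by rw [← hσ']; simp
  have g4 : σ' aWgt 0 = ((tset o 0 (bd i)).biUnion K).card := by rw [← hσ']; simp
  have g5 : σ' aSl 0 = 0 := by rw [← hσ']; simp
  clear hσ'
  refine Ok.for_const 1 (bd (i + 1) - bd i + 1) 35 (fun m τ => ∀ l < m,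
        τ aRep l = nodeRep r o (bd i) l ∧ τ aWgt l = (nodePart K o (bd i) l).card ∧
        τ aSl l = if l = 0 then 0 else ch (o (bd i + l - 1)))
    rfl (by omega) (by omega) (by decide) ?_ ?_ ?_ ?_ ?_
  · intro τ hτ
    simp only [Expr.eval_cell, Expr.eval_ofNat, hτ xT (by decide), g2]
  · intro l hl
    rw [show l = 0 by omega]
    simp only [ne_eq, Nat.reduceEqDiff, not_false_eq_true, Store.write_ne, g3, g4, g5, nodeRep,
      nodePart, if_true, h.kids.kids.rep_zero, and_self]
  · intro m τ hm1 hm hτm hτ hI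
    have e : ∀ x, x ∉ [xHb, xT, aRep, aWgt, aSl, xY, xZ] → τ x = σ x := by
      intro x hx
      simp only [List.mem_cons, List.not_mem_nil, or_false, not_or] at hx
      rw [hτ x (by simp [forLoop, Prog.writes, hx]), f x (by simp [hx])]
    have w1 := e aOr (by decide)
    have w2 := e aKr (by decide)
    have w3 := e aSz (by decide)
    have w4 := e aCh (by decide)
    have w5 : τ xHb 0 = bd i := by rw [hτ xHb (by decide), g1]
    have k1 := h.ord (bd i + m - 1) (by omega)
    have k2 := h.chain.lt (bd i + m - 1) (by omega)
    have k3 := h.kids.rep _ k2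
    have k4 := h.kids.rep_lt _ k2
    have k5 := h.chd _ k2
    have k6 := h.wt _ k2
    have k7 := h.pos _ k2
    have k8 : (K (o (bd i + m - 1))).card ≤ n := by
      have := hcardW {o (bd i + m - 1)} (by simpa using k2)
      simpa using this
    have k9 : ch (o (bd i + m - 1)) ≤ W := by
      have := Nat.le_mul_of_pos_right (ch (o (bd i + m - 1))) h.one_le
      omega
    refine Ok.of_wp ?_ (by decide)
    simp only [Prog.wp, Expr.eval_cell, Expr.eval_ofNat, Expr.eval_add, Expr.eval_sub, ne_eq,
      Nat.reduceEqDiff, not_false_eq_true, Store.write_ne, Store.write_same, Function.update_self,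
      hτm, w1, w2, w3, w4, w5, k1, k3, k5, k6]
    refine ⟨by omega, by omega, by omega, by omega, by omega, by omega, by omega, by omega, ?_⟩
    intro l hl
    by_cases hlm : l = m
    · subst hlm
      simp only [Function.update_self, nodeRep, nodePart, if_neg (show ¬ l = 0 by omega), and_self]
    · simp only [Function.update_of_ne hlm]
      exact hI l (by omega)
  · show (bd (i + 1) - bd i + 1 - 1) * (35 + 2 + 11) + (1 + 2 + 6) ≤ _
    omega
  · intro τ hτ _ hI
    exact ⟨by rw [hτ xT (by decide), g2], hI⟩

/-- The bound for the time spent on a node. -/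
def nodeTime (d k : ℕ) : ℕ := d * k ^ 2 * k.factorial ^ d

theorem nodeTime_mono {d k t : ℕ} (h : t ≤ k) : nodeTime d t ≤ nodeTime d k :=
  Nat.mul_le_mul (Nat.mul_le_mul_left _ (Nat.pow_le_pow_left h 2))
    (Nat.pow_le_pow_left (Nat.factorial_le h) d)

/-- The coordinates of single vertices are not known yet, only starts of parts. Hence the claim is
an implication about every `f`: optimality of `f` on the parts at the computed starts yields
optimality on the node. The implications are chained once the leaves are known. -/
theorem groupProg_ok (h : GroupStore n d W R S v q K r o bd ch nb σ) {i k : ℕ} (hi : i < nb)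
    (hg : σ xGi 0 = i) (htk : bd (i + 1) - bd i + 1 ≤ k)
    (hb : ∀ D < d, σ aSt D + ((tset o 0 (bd (i + 1))).biUnion K).card ≤ n) :
    Ok W groupProg σ (1000 * nodeTime d k) fun τ =>
      (∀ f, Good d R n f ((tset o 0 (bd i)).biUnion K) (fun D => τ aSt D) →
        (∀ t, bd i ≤ t → t < bd (i + 1) → Good d R n f (K (o t)) fun D => τ aSt (ch (o t) * d + D)) →
        Good d R n f ((tset o 0 (bd (i + 1))).biUnion K) fun D => σ aSt D) ∧
      (∀ D < d, τ aSt D + ((tset o 0 (bd i)).biUnion K).card ≤ n) ∧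
      (∀ t, bd i ≤ t → t < bd (i + 1) → ∀ D < d,
        τ aSt (ch (o t) * d + D) + (K (o t)).card ≤ n) ∧
      ∀ j, j ≠ 0 → (∀ t, bd i ≤ t → t < bd (i + 1) → j ≠ ch (o t)) → ∀ D < d,
        τ aSt (j * d + D) = σ aSt (j * d + D) := by
  obtain ⟨h1, h2, h3⟩ := h.chain.bd_bounds hi
  have hparts := h.chain.nodeParts h.kids.kids hi
  have hW := h.kids.le
  have hqn := h.kids.q_le
  have h1d := h.one_le
  set t := bd (i + 1) - bd i + 1 with ht
  set C := nodePart K o (bd i) with hC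
  have htn : t ≤ n := by omega
  have hbig := h.big
  have hdt : d * t ≤ d * n := Nat.mul_le_mul_left _ htn
  have hfac : 1 ≤ t.factorial ^ d := Nat.pow_pos (Nat.factorial_pos t)
  have hX : d * t ^ 2 ≤ nodeTime d t := Nat.le_mul_of_pos_right _ hfac
  have hXk := nodeTime_mono (d := d) htk
  have ht2 : t * t ≤ d * t ^ 2 := by rw [pow_two]; exact Nat.le_mul_of_pos_left _ h1d
  have hd2 : d * t ^ 2 = d * (t * t) := by rw [pow_two]
  have ht4 : 2 ≤ t := by omega
  have hCS : ∀ l < t, ∀ x ∈ C l, x < n := by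
    intro l hl x hx
    have h4 := (hparts.cover x).2 ⟨l, hl, hx⟩
    obtain ⟨j, hj, hxj⟩ := Finset.mem_biUnion.1 h4
    obtain ⟨u, _, hu, rfl⟩ := mem_tset.1 hj
    exact h.sub x ((h.kids.kids.cover x).2 ⟨_, h.chain.lt u (by omega), hxj⟩)
  have hCn : ∀ l < t, (C l).card ≤ n := by
    intro l hl
    have : C l ⊆ Finset.range n := fun x hx => Finset.mem_range.2 (hCS l hl x hx)
    have := Finset.card_le_card this
    rwa [Finset.card_range] at this
  have hsum : ((tset o 0 (bd (i + 1))).biUnion K).card = ∑ l ∈ Finset.range t, (C l).card := by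
    rw [← Finset.card_biUnion]
    · congr 1
      ext x
      rw [hparts.cover, Finset.mem_biUnion]
      simp only [Finset.mem_range]
      exact Iff.rfl
    · intro l hl m hm hlm
      exact hparts.disj l (by simpa using hl) m (by simpa using hm) hlm
  refine Ok.time (T := t * 50 + 60 + (700 * nodeTime d t +
    (d * (t * (t * 50 + 50) + 40) + 10))) ?_ (by nlinarith)
  refine Ok.seq (quotientProg_ok h hi hg htn) ?_
  rintro τ hτ ⟨q1, q2⟩
  refine Ok.seq (T := 700 * nodeTime d t)
    (searchProg_ok (n := n) (d := d) (t := t) (R := R) ?_ ?_ q1 ?_ ?_ ?_ h1d (by omega) htn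
    (by omega)) ?_
  · rw [hτ 0 (by decide), h.kids.n_eq]
  · rw [hτ 0 (by decide), h.dim]
  · intro x hx y hy
    rw [hτ aMtx (by decide), h.kids.mtx x hx y hy]
    split_ifs with hxy <;> simp [hxy]
  · intro l hl
    rw [(q2 l hl).1]
    exact hCS l hl _ (hparts.rep l hl)
  · intro l hl
    rw [(q2 l hl).2.1]
    exact hCn l hl
  rintro υ hυ ⟨hrank, hmin⟩
  have uT : υ xT 0 = t := by rw [hυ xT (by decide), q1]
  have uW : υ aWgt = τ aWgt := hυ aWgt (by decide)
  have uL : υ aSl = τ aSl := hυ aSl (by decide)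
  have uS : υ aSt = σ aSt := (hυ aSt (by decide)).trans (hτ aSt (by decide))
  have uD : υ 0 2 = d := by rw [hυ 0 (by decide), hτ 0 (by decide), h.dim]
  have hsl0 : τ aSl 0 = 0 := by rw [(q2 0 (by omega)).2.2, if_pos rfl]
  have hslp : ∀ l, 0 < l → l < t → τ aSl l = ch (o (bd i + l - 1)) := fun l h4 h5 => by
    rw [(q2 l h5).2.2, if_neg (by omega)]
  have hwsum : ∑ l ∈ Finset.range t, υ aWgt l = ((tset o 0 (bd (i + 1))).biUnion K).card := by
    rw [hsum, uW]
    exact Finset.sum_congr rfl fun l hl => (q2 l (Finset.mem_range.1 hl)).2.1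
  refine (placeProg_ok (t := t) uD uT (by omega) ?_ ?_ ?_ (by omega)
    (by omega)).mono le_rfl ?_
  · have key : ∀ l m, l < m → m < t → τ aSl l ≠ τ aSl m := by
      intro l m hlm hm heq
      rw [hslp m (by omega) hm] at heq
      have hm' := h.chain.lt (bd i + m - 1) (by omega)
      rcases Nat.eq_zero_or_pos l with h0 | h0
      · rw [h0, hsl0] at heq
        have := (h.pos _ hm').1
        omega
      · rw [hslp l h0 (by omega)] at heq
        have := h.chain.inj _ (by omega) _ (by omega)
          (h.inj _ (h.chain.lt (bd i + l - 1) (by omega)) _ hm' heq)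
        omega
    rw [uL]
    intro l hl m hm heq
    rcases Nat.lt_trichotomy l m with h4 | h4 | h4
    · exact absurd heq (key l m h4 hm)
    · exact h4
    · exact absurd heq.symm (key m l h4 hl)
  · rw [uL]
    intro l hl
    rcases Nat.eq_zero_or_pos l with h0 | h0
    · rw [h0, hsl0]; omega
    · rw [hslp l h0 hl]
      exact (h.pos _ (h.chain.lt (bd i + l - 1) (by omega))).2
  · intro D hD
    rw [uS, hwsum]
    have := hb D hD
    omega
  rintro ω hω ⟨hp1, hp2⟩
  rw [uL, uS, uW] at hp1
  rw [uL, uS] at hp2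
  set p : ℕ → ℕ → ℕ := fun D l => υ aBest (D * t + l) with hp
  have hoffs : ∀ D < d, ∀ l < t, ω aSt (τ aSl l * d + D) = σ aSt D +
      ∑ m ∈ Finset.range t, if p D m < p D l then (C m).card else 0 := by
    intro D hD l hl
    rw [hp1 D hD l hl]
    congr 1
    refine Finset.sum_congr rfl fun m hm => ?_
    rw [(q2 m (Finset.mem_range.1 hm)).2.1]
  have hbound : ∀ D < d, ∀ l < t, ω aSt (τ aSl l * d + D) + (C l).card ≤ n := by
    intro D hD l hl
    have h4 : (∑ m ∈ Finset.range t, if p D m < p D l then (C m).card else 0) + (C l).card ≤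
        ∑ m ∈ Finset.range t, (C m).card := by
      rw [← Finset.add_sum_erase (Finset.range t) (fun m => (C m).card) (Finset.mem_range.2 hl),
        ← Finset.add_sum_erase (Finset.range t) (fun m => if p D m < p D l then (C m).card else 0)
          (Finset.mem_range.2 hl), if_neg (lt_irrefl _), zero_add, add_comm]
      refine Nat.add_le_add_left (Finset.sum_le_sum fun m _ => ?_) _
      split_ifs <;> omega
    have h5 := hb D hD
    rw [hoffs D hD l hl]
    omega
  have hslot0 : ∀ D, ω aSt (τ aSl 0 * d + D) = ω aSt D := by
    intro D
    rw [hsl0, Nat.zero_mul, Nat.zero_add]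
  have hC0 : C 0 = (tset o 0 (bd i)).biUnion K := if_pos rfl
  have hCt : ∀ u, bd i ≤ u → u < bd (i + 1) → C (u - bd i + 1) = K (o u) := by
    intro u hu1 hu2
    rw [hC, nodePart, if_neg (by omega), show bd i + (u - bd i + 1) - 1 = u by omega]
  have hslt : ∀ u, bd i ≤ u → u < bd (i + 1) → τ aSl (u - bd i + 1) = ch (o u) := by
    intro u hu1 hu2
    rw [hslp _ (by omega) (by omega), show bd i + (u - bd i + 1) - 1 = u by omega]
  refine ⟨?_, ?_, ?_, ?_⟩
  · intro f hf0 hf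
    refine good_union (C := C) (r := nodeRep r o (bd i)) (p := p) (t := t) h1d
      (fun l hl => ⟨_, hparts.rep l hl⟩) hCS hparts.cover hparts.disj ?_ h.kids.kids.irrefl h.ex
      hrank ?_ ?_
    · intro l hl m hm hlm x hx y hy
      have hd := hparts.disj l hl m hm hlm
      -- Replace `y` by the representative of its part, as seen from `x`, and then `x` by the
      -- representative of its part, as seen from that one; both parts are modules.
      have k1 := hparts.mod m hm x (Finset.disjoint_left.1 hd hx) y hy _ (hparts.rep m hm)
      have k2 := hparts.mod l hl (nodeRep r o (bd i) m)
        (Finset.disjoint_right.1 hd (hparts.rep m hm)) x hx _ (hparts.rep l hl)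
      exact (rl_eq_iff.1 k1).1.trans (rl_eq_iff.1 k2).2
    · intro q' hq'
      have k1 : ∀ p', quotCost d R (n * n + 1) t (τ aRep) (τ aWgt) p' =
          quotCost d R (n * n + 1) t (nodeRep r o (bd i)) (fun l => (C l).card) p' := fun p' =>
        quotCost_congr_data (fun l hl => (q2 l hl).1) fun l hl => (q2 l hl).2.1
      have := hmin q' hq'
      rw [k1, k1] at this
      exact this
    · intro l hl
      rcases Nat.eq_zero_or_pos l with h0 | h0
      · subst h0
        rw [hC0]
        refine hf0.congr fun D hD => ?_
        rw [← hslot0, hoffs D hD 0 hl]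
      · have h4 := hf (bd i + l - 1) (by omega) (by omega)
        have h5 : bd i + l - 1 - bd i + 1 = l := by omega
        rw [← hCt _ (by omega) (by omega), ← hslt _ (by omega) (by omega), h5] at h4
        exact h4.congr fun D hD => hoffs D hD l hl
  · intro D hD
    have := hbound D hD 0 (by omega)
    rwa [hslot0, hC0] at this
  · intro u hu1 hu2 D hD
    have := hbound D hD (u - bd i + 1) (by omega)
    rwa [hslt u hu1 hu2, hCt u hu1 hu2] at this
  · intro j hj0 hj D hD
    refine hp2 j (fun l hl => ?_) D hD
    rcases Nat.eq_zero_or_pos l with h0 | h0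
    · rwa [h0, hsl0]
    · rw [hslp l h0 hl]
      exact hj _ (by omega) (by omega)

end

/-! ### Processing a class -/

/-- Computes the numbers of vertices in the initial segments of the list of children. -/
def cumProg : Prog :=
  .assign aCum 0 0 ;;
  forLoop xZ 0 (sv xKq)
    (.assign aCum (sv xZ + 1) (.cell aCum (sv xZ) + .cell aSz (.cell aCh (.cell aOr (sv xZ)))))

/-- Copies a row of start coordinates. -/
def copyProg (e f : Expr) : Prog :=
  forLoop xDm 0 vD (.assign aSt (e + sv xDm) (.cell aSt (f + sv xDm)))

/-- Processes the nodes of a class from the largest to the smallest. -/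
def groupsProg : Prog := forLoop xG 0 (sv xNb) (setv xGi (sv xNb - 1 - sv xG) ;; groupProg)

/-- Processes a class. -/
def classProg : Prog :=
  kidsProg ;; chainProg ;; cumProg ;; copyProg 0 (sv xCj * vD) ;; groupsProg ;;
    copyProg (.cell aCh 0 * vD) 0

section
variable {n d W : ℕ} {R : ℕ → ℕ → Prop} {S : Finset ℕ} {v q : ℕ} {K : ℕ → Finset ℕ} {r : ℕ → ℕ}
  {o bd ch : ℕ → ℕ} {nb : ℕ} {σ τ : Store}

theorem Chain.card_prefix (h : Chain R K q o bd nb) (hK : Kids R S v q K r) {x : ℕ} (hx : x ≤ q) :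
    ((tset o 0 x).biUnion K).card = ∑ t ∈ Finset.range x, (K (o t)).card := by
  rw [Finset.card_biUnion, tset, Finset.sum_image, Nat.Ico_zero_eq_range]
  · intro t ht u hu
    simp only [Finset.coe_Ico, Set.mem_Ico] at ht hu
    exact h.inj t (by omega) u (by omega)
  · intro i hi j hj hij
    obtain ⟨t, _, ht, rfl⟩ := mem_tset.1 hi
    obtain ⟨u, _, hu, rfl⟩ := mem_tset.1 hj
    exact hK.disj _ (h.lt t (by omega)) _ (h.lt u (by omega)) hij

theorem Chain.exists_eq (h : Chain R K q o bd nb) {i : ℕ} (hi : i < q) : ∃ t < q, o t = i :=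
  surj_of_inj h.lt h.inj i hi

theorem Chain.prefix_all (h : Chain R K q o bd nb) (hK : Kids R S v q K r) :
    (tset o 0 q).biUnion K = S := by
  ext x
  rw [hK.cover, Finset.mem_biUnion]
  constructor
  · rintro ⟨i, hi, hx⟩
    obtain ⟨t, _, ht, rfl⟩ := mem_tset.1 hi
    exact ⟨_, h.lt t ht, hx⟩
  · rintro ⟨i, hi, hx⟩
    obtain ⟨t, ht, rfl⟩ := h.exists_eq hi
    exact ⟨_, mem_tset.2 ⟨t, Nat.zero_le _, ht, rfl⟩, hx⟩

theorem Chain.prefix_one (h : Chain R K q o bd nb) : (tset o 0 1).biUnion K = K 0 := by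
  simp [tset, h.zero]

theorem cumProg_ok (h : Chain R K q o bd nb) (hK : Kids R S v q K r) (hS : S ⊆ Finset.range n)
    (hq : σ xKq 0 = q) (ho : σ aOr = o) (hc : σ aCh = ch) (hw : ∀ i < q, σ aSz (ch i) = (K i).card)
    (hqn : q ≤ n) (hW : n + 1 ≤ W) :
    Ok W cumProg σ (q * 40 + 20) fun τ => ∀ x ≤ q, τ aCum x = ((tset o 0 x).biUnion K).card := by
  refine Ok.time (T := 3 + (q * 40 + 10)) ?_ (by omega)
  refine Ok.assign_seq (by simp) (by simp) (by decide) ?_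
  simp only [Expr.eval_ofNat]
  refine Ok.for_const 0 q 20 (fun k τ => ∀ x ≤ k, τ aCum x = ∑ t ∈ Finset.range x, (K (o t)).card)
    rfl (Nat.zero_le _) (by omega) (by decide) ?_ ?_ ?_ ?_ ?_
  · intro τ hτ
    simp only [Expr.eval_cell, Expr.eval_ofNat, hτ xKq (by decide), ne_eq, Nat.reduceEqDiff,
      not_false_eq_true, Store.write_ne, hq]
  · intro x hx
    rw [Nat.le_zero.1 hx]
    simp
  · intro x τ _ hx hτx hτ hI
    have e : ∀ a ∈ [aOr, aCh, aSz], τ a = σ a := by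
      intro a ha
      simp only [List.mem_cons, List.not_mem_nil, or_false] at ha
      rw [hτ a (by rcases ha with rfl | rfl | rfl <;> decide),
        Store.write_ne _ _ _ (by rcases ha with rfl | rfl | rfl <;> decide)]
    have e1 := e aOr (by decide)
    have e2 := e aCh (by decide)
    have e3 := e aSz (by decide)
    have h1 := h.card_prefix hK (x := x + 1) hx
    have h2 : ((tset o 0 (x + 1)).biUnion K).card ≤ n := by
      rw [← Finset.card_range n]
      refine Finset.card_le_card fun y hy => hS ?_
      rw [← h.prefix_all hK]
      exact Finset.biUnion_subset_biUnion_of_subset_left _ (tset_mono le_rfl hx) hy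
    rw [Finset.sum_range_succ] at h1
    refine Ok.of_wp ?_ (by decide)
    simp only [Prog.wp, Expr.eval_cell, Expr.eval_ofNat, Expr.eval_add, ne_eq, Nat.reduceEqDiff,
      not_false_eq_true, Store.write_ne, Store.write_same, hτx, e1, e2, e3, ho, hc, hI x le_rfl,
      hw _ (h.lt x hx)]
    refine ⟨by omega, by omega, fun y hy => ?_⟩
    rcases hy.lt_or_eq with hy | rfl
    · rw [Function.update_of_ne (by omega), hI y (by omega)]
    · rw [Function.update_self, Finset.sum_range_succ]
  · show (q - 0) * (20 + 2 + 11) + (1 + 2 + 6) ≤ _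
    omega
  · intro τ _ _ hI x hx
    rw [hI x hx, h.card_prefix hK hx]

theorem copyProg_ok {e f : Expr} {j i : ℕ} (hd : σ 0 2 = d)
    (he : ∀ τ, Same (copyProg e f) σ τ → e.eval τ = j * d)
    (hf : ∀ τ, Same (copyProg e f) σ τ → f.eval τ = i * d) (hij : i ≠ j) (hW : j * d + d ≤ W)
    (hcost : e.cost + f.cost ≤ 20) (hst : ∀ D < d, σ aSt (i * d + D) ≤ W) :
    Ok W (copyProg e f) σ (d * 50 + 10) fun τ =>
      (∀ D < d, τ aSt (j * d + D) = σ aSt (i * d + D)) ∧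
      ∀ l, l ≠ j → ∀ D < d, τ aSt (l * d + D) = σ aSt (l * d + D) := by
  refine Ok.for_const 0 d (e.cost + f.cost + 10) (fun k τ =>
      (∀ D < k, τ aSt (j * d + D) = σ aSt (i * d + D)) ∧
      ∀ l, l ≠ j → ∀ D < d, τ aSt (l * d + D) = σ aSt (l * d + D)) rfl (Nat.zero_le _) (by omega)
    (by simp [Prog.writes]) ?_ ?_ ?_ ?_ ?_
  · intro τ hτ
    simp only [Expr.eval_cell, Expr.eval_ofNat, hτ 0 (by simp [forLoop, Prog.writes]), hd]
  · simp only [ne_eq, Nat.reduceEqDiff, not_false_eq_true, Store.write_ne]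
    exact ⟨by omega, fun _ _ _ _ => trivial⟩
  · rintro D τ - hD hτD hτ ⟨hI1, hI2⟩
    have h1 := he τ hτ
    have h2 := hf τ hτ
    have h3 := hst D hD
    refine Ok.of_wp ?_ ?_
    · simp only [Prog.wp, Expr.eval_cell, Expr.eval_ofNat, Expr.eval_add, h1, h2, hτD, ne_eq,
        Nat.reduceEqDiff, not_false_eq_true, Store.write_ne, Store.write_same, hI2 i hij D hD]
      refine ⟨by omega, by omega, fun D' hD' => ?_, fun l hl D' hD' => ?_⟩
      · by_cases h : D' = D
        · rw [h, Function.update_self]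
        · rw [Function.update_of_ne (by omega), hI1 D' (by omega)]
      · rw [Function.update_of_ne fun h => hl (idx_inj hD' hD h).1, hI2 l hl D' hD']
    · show e.cost + 2 + 1 + (f.cost + 2 + 1 + 1) + 1 ≤ _
      omega
  · show (d - 0) * (e.cost + f.cost + 10 + 2 + 11) + (1 + 2 + 6) ≤ _
    rw [Nat.sub_zero]; nlinarith
  · rintro τ - - hI
    exact hI

/-- From the largest closed set to the smallest, row 0 always holds the start of the current closed
set. Each round replaces it by the start of the preceding closed set, which is part 0 of the node,
and fixes the starts of the children added in this step of the chain. -/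
theorem groupsProg_ok (h : GroupStore n d W R S v q K r o bd ch nb σ) {k : ℕ}
    (hk : ∀ i < nb, bd (i + 1) - bd i + 1 ≤ k) (hnb : nb ≤ n)
    (hb : ∀ D < d, σ aSt D + S.card ≤ n) :
    Ok W groupsProg σ (nb * (1000 * nodeTime d k + 30) + 10) fun τ =>
      (∀ f, Good d R n f (K 0) (fun D => τ aSt D) →
        (∀ i, 1 ≤ i → i < q → Good d R n f (K i) fun D => τ aSt (ch i * d + D)) →
        Good d R n f S fun D => σ aSt D) ∧
      (∀ D < d, τ aSt D + (K 0).card ≤ n) ∧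
      (∀ i, 1 ≤ i → i < q → ∀ D < d, τ aSt (ch i * d + D) + (K i).card ≤ n) ∧
      ∀ j, j ≠ 0 → (∀ i < q, j ≠ ch i) → ∀ D < d, τ aSt (j * d + D) = σ aSt (j * d + D) := by
  have hW := h.kids.le
  have hch := h.chain
  refine Ok.for_const 0 nb (9 + 1000 * nodeTime d k) (fun s τ =>
    (∀ f, Good d R n f ((tset o 0 (bd (nb - s))).biUnion K) (fun D => τ aSt D) →
      (∀ t, bd (nb - s) ≤ t → t < q → Good d R n f (K (o t)) fun D => τ aSt (ch (o t) * d + D)) →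
      Good d R n f S fun D => σ aSt D) ∧
    (∀ D < d, τ aSt D + ((tset o 0 (bd (nb - s))).biUnion K).card ≤ n) ∧
    (∀ t, bd (nb - s) ≤ t → t < q → ∀ D < d, τ aSt (ch (o t) * d + D) + (K (o t)).card ≤ n) ∧
    ∀ j, j ≠ 0 → (∀ i < q, j ≠ ch i) → ∀ D < d, τ aSt (j * d + D) = σ aSt (j * d + D))
    rfl (Nat.zero_le _) (by omega) (by decide) ?_ ?_ ?_ ?_ ?_
  · intro τ hτ
    simp only [Expr.eval_cell, Expr.eval_ofNat, hτ xNb (by decide), h.num]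
  · simp only [ne_eq, Nat.reduceEqDiff, not_false_eq_true, Store.write_ne, Nat.sub_zero, hch.last,
      hch.prefix_all h.kids.kids]
    exact ⟨fun f hf _ => hf, hb, fun t h1 h2 => absurd h2 (by omega), fun _ _ _ _ _ => trivial⟩
  · rintro s τ - hs hτs hτ ⟨hI1, hI2, hI3, hI4⟩
    set i := nb - 1 - s with hi
    have hi1 : i + 1 = nb - s := by omega
    have hin : i < nb := by omega
    rw [← hi1] at hI1 hI2 hI3
    obtain ⟨b1, b2, b3⟩ := hch.bd_bounds hin
    have hτn : τ xNb 0 = nb := by rw [hτ xNb (by decide), h.num]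
    refine Ok.assign_seq (by simp) 
      (by simp only [Expr.eval_cell, Expr.eval_ofNat, Expr.eval_sub, hτn]; omega) (by decide) ?_
    simp only [Expr.eval_cell, Expr.eval_ofNat, Expr.eval_sub, hτn, hτs, ← hi]
    have hG : GroupStore n d W R S v q K r o bd ch nb (τ.write xGi 0 i) := by
      refine h.congr fun x hx => ?_
      have h1 : x ≠ xGi := by rintro rfl; exact absurd hx (by decide)
      have h2 : x ∉ groupsProg.writes :=
        (by decide : ∀ x ∈ [0, aMtx, xKq, aRp, xCj, aKr, aOr, aBd, xNb, aCh, aSz, aCum],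
          x ∉ groupsProg.writes) x hx
      rw [Store.write_ne _ _ _ h1, hτ x h2]
    refine (groupProg_ok hG hin (by simp) (hk i hin) ?_).mono le_rfl ?_
    · simpa only [ne_eq, Nat.reduceEqDiff, not_false_eq_true, Store.write_ne] using hI2
    · rintro υ hυ ⟨hp1, hp2, hp3, hp4⟩
      simp only [ne_eq, Nat.reduceEqDiff, not_false_eq_true, Store.write_ne] at hp1 hp4 ⊢
      rw [show nb - (s + 1) = i by omega]
      have hne : ∀ t, bd (i + 1) ≤ t → t < q → ∀ D < d,
          υ aSt (ch (o t) * d + D) = τ aSt (ch (o t) * d + D) := by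
        intro t ht htq D hD
        have h1 := hch.lt t htq
        refine hp4 _ (by have := (h.pos _ h1).1; omega) (fun u hu1 hu2 heq => ?_) D hD
        have := hch.inj _ htq _ (by omega) (h.inj _ h1 _ (hch.lt u (by omega)) heq)
        omega
      refine ⟨fun f hf0 hf => ?_, hp2, fun t h1 h2 D hD => ?_, fun j hj0 hj D hD => ?_⟩
      · refine hI1 f (hp1 f hf0 fun t h1 h2 => hf t h1 (by omega)) fun t h1 h2 => ?_
        exact (hf t (by omega) h2).congr (hne t h1 h2)
      · rcases Nat.lt_or_ge t (bd (i + 1)) with h3 | h3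
        · exact hp3 t h1 h3 D hD
        · rw [hne t h3 h2 D hD]
          exact hI3 t h3 h2 D hD
      · rw [hp4 j hj0 (fun t _ h2 => hj _ (hch.lt t (by omega))) D hD]
        exact hI4 j hj0 hj D hD
  · show (nb - 0) * (9 + 1000 * nodeTime d k + 2 + 11) + (1 + 2 + 6) ≤ _
    rw [Nat.sub_zero]; nlinarith
  · rintro τ - - ⟨hI1, hI2, hI3, hI4⟩
    rw [Nat.sub_self, hch.first] at hI1 hI2 hI3
    rw [hch.prefix_one] at hI1 hI2
    have key : ∀ t, 1 ≤ t → t < q → 1 ≤ o t := by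
      intro t h1 h2
      by_contra h3
      have := hch.inj t h2 0 (by omega) (by rw [hch.zero]; omega)
      omega
    refine ⟨fun f hf0 hf => hI1 f hf0 fun t h1 h2 => hf _ (key t h1 h2) (hch.lt t h2), hI2,
      fun i h1 h2 => ?_, hI4⟩
    obtain ⟨t, ht, rfl⟩ := hch.exists_eq h2
    refine hI3 t ?_ ht
    by_contra h3
    rw [show t = 0 by omega, hch.zero] at h1
    omega

/-- The number of parts of a node of the decomposition tree is at most `k`. -/
def PartsBound (n : ℕ) (R : ℕ → ℕ → Prop) (k : ℕ) : Prop :=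
  ∀ (M : Finset ℕ) (t : ℕ) (C : ℕ → Finset ℕ), IsMod R M → M ⊆ Finset.range n → 2 ≤ t →
    (∀ i < t, (C i).Nonempty) → (∀ i < t, ∀ j < t, i ≠ j → Disjoint (C i) (C j)) →
    (∀ i < t, C i ⊆ M) →
    (∀ N : Finset ℕ, N.Nonempty → IsMod R N →
      (∀ L : Finset ℕ, L.Nonempty → IsMod R L → L ⊆ Finset.range n →
        L ⊆ N ∨ N ⊆ L ∨ Disjoint L N) → N ⊆ M → N = M ∨ ∃ i < t, N ⊆ C i) → t ≤ k

/-- `node` is precisely the criterion of `PartsBound`: part 0 is the preceding closed set, and the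
others are the children added to it. -/
theorem Chain.parts_le {k : ℕ} (h : Chain R K q o bd nb) (hK : Kids R S v q K r)
    (hS : S ⊆ Finset.range n) (hk : PartsBound n R k) {i : ℕ} (hi : i < nb) :
    bd (i + 1) - bd i + 1 ≤ k := by
  obtain ⟨h1, h2, h3⟩ := h.bd_bounds hi
  have hp := h.nodeParts hK hi
  have hall := h.prefix_all hK
  have hsub : (tset o 0 (bd (i + 1))).biUnion K ⊆ S := by
    rw [← hall]
    exact Finset.biUnion_subset_biUnion_of_subset_left _ (tset_mono le_rfl h3)
  refine hk ((tset o 0 (bd (i + 1))).biUnion K) _ (nodePart K o (bd i)) (h.mod (i + 1) hi)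
    (hsub.trans hS) (by omega) (fun l hl => ⟨_, hp.rep l hl⟩) hp.disj
    (fun l hl x hx => (hp.cover x).2 ⟨l, hl, hx⟩) fun N hN hNm hNs hNM => ?_
  have hrange : (Finset.range q).biUnion K ⊆ Finset.range n := by
    intro x hx
    obtain ⟨j, hj, hx⟩ := Finset.mem_biUnion.1 hx
    exact hS ((hK.cover x).2 ⟨j, Finset.mem_range.1 hj, hx⟩)
  rcases h.node i hi N hN hNm (fun L h4 h5 h6 => hNs L h4 h5 (h6.trans hrange)) hNM with
    h4 | h4 | ⟨t, h4, h5, h6⟩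
  · exact Or.inl h4
  · exact Or.inr ⟨0, by omega, h4⟩
  · refine Or.inr ⟨t - bd i + 1, by omega, ?_⟩
    rwa [nodePart, if_neg (by omega), show bd i + (t - bd i + 1) - 1 = t by omega]

/-- The data of the decomposition into classes. -/
structure TreeStore (n d W k N : ℕ) (R : ℕ → ℕ → Prop) (rep par siz : ℕ → ℕ) (cs : ℕ → Finset ℕ)
    (σ : Store) : Prop where
  n_eq : σ 0 0 = n
  dim : σ 0 2 = d
  mtx : IsMatrix n R (σ aMtx)
  num : σ xNc 0 = N
  rep_eq : σ aRp = rep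
  par_eq : σ aPa = par
  siz_eq : σ aSz = siz
  tree : ClassTree n R N rep par siz cs
  irrefl : ∀ x, ¬ R x x
  trans : ∀ x y z, R x y → R y z → R x z
  one_le : 1 ≤ d
  big : n * n * (n * n + 1) + d * n + d + n + 2 ≤ W
  le : 4 * n + 10 ≤ W
  idx : N * d + d ≤ W
  ex : ∃ g, IsDraw d R n g
  bound : PartsBound n R k

variable {k N p : ℕ} {rep par siz : ℕ → ℕ} {cs : ℕ → Finset ℕ}

theorem TreeStore.congr (h : TreeStore n d W k N R rep par siz cs σ)
    (hs : ∀ x ∈ [0, aMtx, xNc, aRp, aPa, aSz], τ x = σ x) :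
    TreeStore n d W k N R rep par siz cs τ := by
  simp only [List.mem_cons, List.not_mem_nil, or_false, forall_eq_or_imp, forall_eq] at hs
  obtain ⟨m1, m2, m3, m4, m5, m6⟩ := hs
  exact { h with
    n_eq := m1 ▸ h.n_eq, dim := m1 ▸ h.dim, mtx := m2 ▸ h.mtx, num := m3 ▸ h.num
    rep_eq := m4 ▸ h.rep_eq, par_eq := m5 ▸ h.par_eq, siz_eq := m6 ▸ h.siz_eq }

/-- The children of one class are disjoint, so their representatives are different vertices. -/
theorem ClassTree.card_kids_le (h : ClassTree n R N rep par siz cs) (p : ℕ) :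
    ((Finset.Ico 1 N).filter fun c => par c = p).card ≤ n := by
  have h1 : ∀ c ∈ (Finset.Ico 1 N).filter fun c => par c = p,
      1 ≤ c ∧ c < N ∧ par c = p := by
    intro c hc
    rw [Finset.mem_filter, Finset.mem_Ico] at hc
    exact ⟨hc.1.1, hc.1.2, hc.2⟩
  have := Finset.card_le_card_of_injOn (t := Finset.range n) rep
    (fun c hc => by
      obtain ⟨h2, h3, _⟩ := h1 c hc
      exact (h.cls c h2 h3).1 (h.cls c h2 h3).2.2.2.1)
    fun c hc e he hce => by
      obtain ⟨h2, h3, h4⟩ := h1 c hc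
      obtain ⟨k2, k3, k4⟩ := h1 e he
      by_contra hne
      refine Finset.disjoint_left.1 (h.disj c e h2 h3 k2 k3 hne (h4.trans k4.symm))
        (h.cls c h2 h3).2.2.2.1 ?_
      rw [hce]
      exact (h.cls e k2 k3).2.2.2.1
  rwa [Finset.card_range] at this

theorem classProg_ok (h : TreeStore n d W k N R rep par siz cs σ) (hp : σ xCj 0 = p) (hp1 : 1 ≤ p)
    (hpN : p < N) (hs : siz p ≠ 1) (hb : ∀ D < d, σ aSt (p * d + D) + siz p ≤ n) (hk : 1 ≤ k) :
    Ok W classProg σ (N * 60 + (600 * n + 1700 * nodeTime d k) *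
        ((Finset.Ico 1 N).filter fun c => par c = p).card) fun τ =>
      (∀ f, (∀ c, 1 ≤ c → c < N → par c = p → Good d R n f (cs c) fun D => τ aSt (c * d + D)) →
        Good d R n f (cs p) fun D => σ aSt (p * d + D)) ∧
      (∀ c, 1 ≤ c → c < N → par c = p → ∀ D < d, τ aSt (c * d + D) + siz c ≤ n) ∧
      ∀ j, 1 ≤ j → j < N → par j ≠ p → ∀ D < d, τ aSt (j * d + D) = σ aSt (j * d + D) := by
  have hW := h.le
  have hidx := h.idx
  have h1d := h.one_le
  have hT := h.tree
  have hN : N ≤ N * d := Nat.le_mul_of_pos_right _ h1d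
  have hrow : ∀ j < N, j * d + d ≤ N * d := fun j hj => by
    rw [← Nat.succ_mul]; exact Nat.mul_le_mul_right _ hj
  have hrepn : ∀ j, 1 ≤ j → j < N → rep j < n := fun j h1 h2 =>
    Finset.mem_range.1 ((hT.cls j h1 h2).1 (hT.cls j h1 h2).2.2.2.1)
  obtain ⟨c1, c2, c3, c4, c5⟩ := hT.cls p hp1 hpN
  set q := ((Finset.Ico 1 N).filter fun c => par c = p).card with hq
  have hqn : q ≤ n := hT.card_kids_le p
  have hX : d ≤ nodeTime d k := by
    rw [nodeTime, mul_assoc]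
    exact Nat.le_mul_of_pos_right _ (Nat.mul_pos (Nat.pow_pos hk) (Nat.pow_pos (Nat.factorial_pos k)))
  have hq1 : 1 ≤ q := by
    obtain ⟨k1, k2, _⟩ := hT.vclass p hp1 hpN hs
    exact Finset.card_pos.2 ⟨p + 1, by simp [k1, k2]⟩
  refine Ok.time (T := N * 60 + 20 + (600 * (q * q) + 300 * q + 100 + (q * 40 + 20 +
    (d * 50 + 10 + (q * (1000 * nodeTime d k + 30) + 10 + (d * 50 + 10)))))) ?_ ?_
  swap
  -- The quadratic cost of the chain is turned into a bound linear in the number `q` of children, so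
  -- that it can be summed over all classes.
  · have h1 : q * q ≤ n * q := Nat.mul_le_mul_right _ hqn
    have h2 : nodeTime d k ≤ nodeTime d k * q := Nat.le_mul_of_pos_right _ hq1
    have h3 : 1 * q ≤ nodeTime d k * q := Nat.mul_le_mul_right _ (by omega)
    nlinarith
  refine Ok.seq (kidsProg_ok h.num hp (by omega) (by omega) fun j h0 hj => ?_) ?_
  · rw [h.rep_eq]
    have := hrepn j h0 hj
    omega
  intro τ hτ hL
  have h' := h.congr (τ := τ) fun x hx =>
    hτ x ((by decide : ∀ x ∈ [0, aMtx, xNc, aRp, aPa, aSz], x ∉ kidsProg.writes) x hx)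
  rw [h.par_eq, h.rep_eq] at hL
  have hqe : τ xKq 0 = q := hL.card
  rw [hqe] at hL
  obtain ⟨hK, hc0⟩ := hT.kids hp1 hpN hs h.irrefl hL
  have hτp : τ xCj 0 = p := by rw [hτ xCj (by decide), hp]
  generalize hch : τ aCh = ch at hL hK hc0
  generalize hkr : τ aKr = kr at hL hK
  have hKS : KidsStore n W R (cs p) (rep p) q (fun i => cs (ch i)) kr τ :=
    ⟨h'.n_eq, h'.mtx, hqe, by rw [hτp, h'.rep_eq], fun i _ => by rw [hkr],
      fun i hi => by
        obtain ⟨k1, k2, _, k4⟩ := hL.mem i hi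
        rw [k4]; exact hrepn _ k1 k2, hqn, h.trans, hW, hK⟩
  refine Ok.seq (chainProg_ok hKS) ?_
  rintro υ hυ ⟨hC, hnb⟩
  generalize ho : υ aOr = o at hC
  generalize hbd : υ aBd = bd at hC
  generalize hnb' : υ xNb 0 = nb at hC hnb
  have uch : υ aCh = ch := by rw [hυ aCh (by decide), hch]
  have usz : υ aSz = siz := by rw [hυ aSz (by decide), h'.siz_eq]
  refine Ok.seq (cumProg_ok hC hK c1 (by rw [hυ xKq (by decide), hqe]) ho uch (fun i hi => ?_) hqn
    (by omega)) ?_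
  · rw [usz, (hT.cls _ (hL.mem i hi).1 (hL.mem i hi).2.1).2.2.1]
  intro ω hω hcum
  have wst : ω aSt = σ aSt := by
    rw [hω aSt (by decide), hυ aSt (by decide), hτ aSt (by decide)]
  have wd : ω 0 2 = d := by rw [hω 0 (by decide), hυ 0 (by decide), h'.dim]
  have wp : ω xCj 0 = p := by rw [hω xCj (by decide), hυ xCj (by decide), hτp]
  -- Row 0 is scratch space. It receives the start of class `p`; the nodes leave in it the start of
  -- part 0, which is copied to class `p + 1`, the class of the representative, at the end.
  refine Ok.seq (copyProg_ok (j := 0) (i := p) wd (fun π _ => by simp)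
    (fun π hπ => ?_) (by omega) (by omega) (by decide) fun D hD => ?_) ?_
  · simp only [Expr.eval_mul, Expr.eval_cell, Expr.eval_ofNat, hπ xCj (by decide),
      hπ 0 (by decide), wd, wp]
  · rw [wst]; have := hb D hD; omega
  rintro π hπ ⟨hp1', hp2'⟩
  simp only [Nat.zero_mul, Nat.zero_add, wst] at hp1' hp2'
  have hG : GroupStore n d W R (cs p) (rep p) q (fun i => cs (ch i)) kr o bd ch nb ω :=
    ⟨hKS.congr (by rw [hω 0 (by decide), hυ 0 (by decide)])
        (by rw [hω aMtx (by decide), hυ aMtx (by decide)])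
        (by rw [hω xKq (by decide), hυ xKq (by decide)])
        (by rw [hω aRp (by decide), hυ aRp (by decide)])
        (by rw [hω xCj (by decide), hυ xCj (by decide)])
        (by rw [hω aKr (by decide), hυ aKr (by decide)]), wd, hC,
      fun t _ => by rw [hω aOr (by decide), ho], fun i _ => by rw [hω aBd (by decide), hbd],
      by rw [hω xNb (by decide), hnb'], fun i _ => by rw [hω aCh (by decide), uch],
      fun i hi => by
        rw [hω aSz (by decide), usz, (hT.cls _ (hL.mem i hi).1 (hL.mem i hi).2.1).2.2.1],
      fun i hi j hj hij => by
        rcases Nat.lt_trichotomy i j with h1 | h1 | h1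
        · exact absurd hij (hL.mono i j h1 hj).ne
        · exact h1
        · exact absurd hij (hL.mono j i h1 hi).ne',
      fun i hi => ⟨(hL.mem i hi).1, by have := hrow _ (hL.mem i hi).2.1; omega⟩, hcum,
      fun x hx => Finset.mem_range.1 (c1 hx), h1d, h.big, h.ex⟩
  have hG' := hG.congr (τ := π) fun x hx => hπ x
    ((by decide : ∀ x ∈ [0, aMtx, xKq, aRp, xCj, aKr, aOr, aBd, xNb, aCh, aSz, aCum],
      x ∉ (copyProg 0 (sv xCj * vD)).writes) x hx)
  refine Ok.seq ((groupsProg_ok hG' (fun i hi => hC.parts_le hK c1 h.bound hi) (by omega)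
    fun D hD => ?_).time (Nat.add_le_add_right (Nat.mul_le_mul_right _ hnb) _)) ?_
  · rw [hp1' D hD, c3]; exact hb D hD
  rintro ρ hρ ⟨r1, r2, r3, r4⟩
  have rch : ρ aCh 0 = p + 1 := by
    rw [hρ aCh (by decide), hπ aCh (by decide), hω aCh (by decide), uch, hc0]
  have rd : ρ 0 2 = d := by rw [hρ 0 (by decide), hG'.dim]
  have hp1N : p + 1 < N := (hT.vclass p hp1 hpN hs).1
  refine (copyProg_ok (j := p + 1) (i := 0) rd (fun ξ hξ => ?_) (fun ξ _ => by simp) (by omega)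
    (by have := hrow _ hp1N; omega) (by decide) fun D hD => ?_).mono le_rfl ?_
  · simp only [Expr.eval_mul, Expr.eval_cell, Expr.eval_ofNat, hξ aCh (by decide),
      hξ 0 (by decide), rd, rch]
  · have := r2 D hD
    simp only [Nat.zero_mul, Nat.zero_add]
    omega
  rintro ξ - ⟨x1, x2⟩
  simp only [Nat.zero_mul, Nat.zero_add] at x1
  have hpos : ∀ i, 1 ≤ i → i < q → ch i ≠ p + 1 := fun i h1 h2 => by
    rw [← hc0]; exact (hL.mono 0 i h1 h2).ne'
  refine ⟨fun f hf => ?_, fun c hc1 hcN hcp => ?_, fun j hj1 hjN hjp D hD => ?_⟩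
  · refine (r1 f ?_ fun i h1 h2 => ?_).congr fun D hD => hp1' D hD
    · have := hf (ch 0) (hL.mem 0 (by omega)).1 (hL.mem 0 (by omega)).2.1 (hL.mem 0 (by omega)).2.2.1
      exact this.congr fun D hD => by rw [hc0, x1 D hD]
    · obtain ⟨k1, k2, k3, _⟩ := hL.mem i h2
      exact (hf _ k1 k2 k3).congr fun D hD => x2 _ (hpos i h1 h2) D hD
  · obtain ⟨i, hi, rfl⟩ := hL.surj c hc1 hcN hcp
    intro D hD
    rw [← (hT.cls _ hc1 hcN).2.2.1]
    rcases Nat.eq_zero_or_pos i with rfl | h0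
    · rw [hc0, x1 D hD, ← hc0]; exact r2 D hD
    · rw [x2 _ (hpos i h0 hi) D hD]; exact r3 i h0 hi D hD
  · have hne : ∀ i < q, j ≠ ch i := by
      rintro i hi rfl
      exact hjp (hL.mem i hi).2.2.1
    rw [x2 j (hc0 ▸ hne 0 (by omega)) D hD, r4 j (by omega) hne D hD, hp2' j (by omega) D hD]

end

/-! ### The whole program -/

/-- Processes all classes. -/
def classesProg : Prog := forLoop xCj 1 (sv xNc) (.cond (.cell aSz (sv xCj) - 1) classProg .skip)

/-- Writes the coordinates of the vertices. -/
def outProg : Prog :=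
  forLoop xCj 1 (sv xNc) (.cond (.cell aSz (sv xCj) - 1) .skip
    (forLoop xDm 0 vD
      (.assign 3 (sv xDm * vN + vE) (.cell aSt (sv xCj * vD + sv xDm)))))

section
variable {n d W k N : ℕ} {R : ℕ → ℕ → Prop} {rep par siz : ℕ → ℕ} {cs : ℕ → Finset ℕ}
  {σ : Store}

theorem ClassTree.one_le_siz (h : ClassTree n R N rep par siz cs) {j : ℕ} (h1 : 1 ≤ j)
    (hN : j < N) : 1 ≤ siz j ∧ siz j ≤ n := by
  obtain ⟨c1, _, c3, c4, _⟩ := h.cls j h1 hN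
  rw [← c3]
  have := Finset.card_le_card c1
  rw [Finset.card_range] at this
  exact ⟨Finset.card_pos.2 ⟨_, c4⟩, this⟩

/-- The classes form a laminar tree. Climbing from `j` along parents, either `i` is met, or it is
passed; in the latter case the induction hypothesis yields a sibling of `j` that also contains `x`,
against disjointness. It follows that a leaf, having no children, shares its vertex with no later
class. -/
theorem ClassTree.exists_child (h : ClassTree n R N rep par siz cs) {x : ℕ} (hx : x < n) (j : ℕ) :
    ∀ i < j, 1 ≤ i → j < N → x ∈ cs i → x ∈ cs j →
      ∃ c, 1 ≤ c ∧ c ≤ j ∧ par c = i ∧ x ∈ cs c := by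
  induction j using Nat.strong_induction_on with
  | _ j ih =>
    intro i hij hi hjN hxi hxj
    obtain ⟨h1, h2, h3⟩ := h.par_lt j (by omega) hjN
    obtain ⟨h4, h5⟩ := h.root (by omega)
    rcases Nat.eq_zero_or_pos (par j) with h0 | h0
    · have h6 := (h.par_lt 1 le_rfl h4).1
      refine absurd hxj (Finset.disjoint_left.1 (h.disj 1 j le_rfl h4 (by omega) hjN (by omega)
        (by omega)) ?_)
      rw [h5]
      exact Finset.mem_range.2 hx
    rcases Nat.lt_trichotomy i (par j) with h6 | h6 | h6
    · obtain ⟨c, c1, c2, c3⟩ := ih _ h1 i h6 hi (by omega) hxi (h3 hxj)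
      exact ⟨c, c1, by omega, c3⟩
    · exact ⟨j, by omega, le_rfl, h6.symm, hxj⟩
    · obtain ⟨c, c1, c2, c3, c4⟩ := ih i hij (par j) h6 h0 (by omega) (h3 hxj) hxi
      exact absurd hxj (Finset.disjoint_left.1 (h.disj c j c1 (by omega) (by omega) hjN (by omega)
        c3) c4)

theorem ClassTree.leaf_inj (h : ClassTree n R N rep par siz cs) {i j : ℕ} (hi : 1 ≤ i) (hiN : i < N)
    (hj : 1 ≤ j) (hjN : j < N) (hsi : siz i = 1) (hsj : siz j = 1) (heq : rep i = rep j) :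
    i = j := by
  have key : ∀ i j, 1 ≤ i → i < j → j < N → siz i = 1 → rep i ≠ rep j := by
    intro i j hi hij hjN hsi heq
    obtain ⟨c1, _, _, c4, _⟩ := h.cls j (by omega) hjN
    obtain ⟨c, k1, k2, k3, _⟩ := h.exists_child (Finset.mem_range.1 (c1 c4)) j i hij hi hjN
      (heq ▸ (h.cls i hi (by omega)).2.2.2.1) c4
    exact (h.par_lt c k1 (by omega)).2.1 (k3 ▸ hsi)
  rcases Nat.lt_trichotomy i j with h1 | h1 | h1
  · exact absurd heq (key i j hi h1 hjN hsi)
  · exact h1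
  · exact absurd heq.symm (key j i hj h1 hiN hsj)

theorem Good.leaf {f : ℕ → ℕ → ℕ} {x : ℕ} {b : ℕ → ℕ} (hd : 1 ≤ d) (hR : ¬ R x x)
    (h : ∀ D < d, f D x = b D) : Good d R n f {x} b := by
  refine ⟨?_, by simp, by simp [hR], fun g _ => ?_⟩
  · intro D hD y hy
    rw [Finset.mem_singleton.1 hy, h D hD]
    simp
  · have : crossFips d R f {x} {x} = 0 := by
      simp only [crossFips, Finset.card_eq_zero, Finset.filter_eq_empty_iff]
      rintro ⟨a, b⟩ hab ⟨hF, _⟩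
      simp only [Finset.mem_product, Finset.mem_singleton] at hab
      have := hF 0 hd
      rw [hab.1, hab.2] at this
      exact lt_irrefl _ this
    omega

/-- Parents have smaller numbers than their children, so increasing order fixes the start of a class
before the class is processed. The bound start plus size ≤ n, handed down alongside, keeps all
coordinates within a word. -/
theorem classesProg_ok (h : TreeStore n d W k N R rep par siz cs σ) (h0 : ∀ i, σ aSt i = 0)
    (hn : 1 ≤ n) (hk : 1 ≤ k) :
    Ok W classesProg σ (N * (N * 60 + 40) + (600 * n + 1700 * nodeTime d k) * N) fun τ =>
      (∀ f, (∀ j, 1 ≤ j → j < N → siz j = 1 → Good d R n f (cs j) fun D => τ aSt (j * d + D)) →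
        Good d R n f (Finset.range n) fun _ => 0) ∧
      ∀ j, 1 ≤ j → j < N → ∀ D < d, τ aSt (j * d + D) ≤ n := by
  have hT := h.tree
  obtain ⟨hN, hroot⟩ := hT.root hn
  have hNW : N ≤ W := (Nat.le_mul_of_pos_right _ h.one_le).trans (by have := h.idx; omega)
  have hp1 : par 1 = 0 := by have := (hT.par_lt 1 le_rfl hN).1; omega
  have hstatic : ∀ τ, Same classesProg σ τ → TreeStore n d W k N R rep par siz cs τ := fun τ hτ =>
    h.congr fun x hx => hτ x
      ((by decide : ∀ x ∈ [0, aMtx, xNc, aRp, aPa, aSz], x ∉ classesProg.writes) x hx)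
  refine Ok.for 1 N (fun p => N * 60 + (600 * n + 1700 * nodeTime d k) *
      ((Finset.Ico 1 N).filter fun c => par c = p).card + 8) (fun p τ =>
    (∀ j, 1 ≤ j → j < p → siz j ≠ 1 → ∀ f,
      (∀ c, 1 ≤ c → c < N → par c = j → Good d R n f (cs c) fun D => τ aSt (c * d + D)) →
      Good d R n f (cs j) fun D => τ aSt (j * d + D)) ∧
    (∀ j, 1 ≤ j → j < N → par j < p → ∀ D < d, τ aSt (j * d + D) + siz j ≤ n) ∧
    ∀ D < d, τ aSt (1 * d + D) = 0) rfl hN.le hNW (by decide) ?_ ?_ ?_ ?_ ?_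
  · intro τ hτ
    simp only [Expr.eval_cell, Expr.eval_ofNat, (hstatic τ hτ).num]
  · simp only [ne_eq, Nat.reduceEqDiff, not_false_eq_true, Store.write_ne, h0]
    refine ⟨by omega, fun j h1 h2 _ D _ => ?_, fun _ _ => trivial⟩
    have := (hT.one_le_siz h1 h2).2
    omega
  · rintro p τ h1p hpN hτp hτ ⟨hI1, hI2, hI3⟩
    have hS := hstatic τ hτ
    obtain ⟨hs1, hs2⟩ := hT.one_le_siz h1p hpN
    have hpp := (hT.par_lt p h1p hpN).1
    refine Ok.cond (fun he => ?_) (fun he => ?_) (T := N * 60 + (600 * n + 1700 * nodeTime d k) *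
      ((Finset.Ico 1 N).filter fun c => par c = p).card + 1) ?_
    · simp only [Expr.eval_cell, Expr.eval_ofNat, Expr.eval_sub, hS.siz_eq, hτp] at he
      refine (classProg_ok hS hτp h1p hpN (by omega) (hI2 p h1p hpN hpp) hk).mono (by omega) ?_
      rintro υ - ⟨g1, g2, g3⟩
      simp only [ne_eq, Nat.reduceEqDiff, not_false_eq_true, Store.write_ne]
      refine ⟨fun j h1 h2 hsj f hf => ?_, fun j h1 h2 h3 D hD => ?_, fun D hD => ?_⟩
      · have hpj := (hT.par_lt j h1 (by omega)).1
        refine Good.congr (b := fun D => τ aSt (j * d + D)) ?_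
          fun D hD => (g3 j h1 (by omega) (by omega) D hD).symm
        rcases Nat.lt_succ_iff_lt_or_eq.1 h2 with h2 | rfl
        · refine hI1 j h1 h2 hsj f fun c c1 c2 c3 => ?_
          exact (hf c c1 c2 c3).congr (g3 c c1 c2 (by omega))
        · exact g1 f hf
      · by_cases hpj : par j = p
        · exact g2 j h1 h2 hpj D hD
        · rw [g3 j h1 h2 hpj D hD]
          exact hI2 j h1 h2 (by omega) D hD
      · rw [g3 1 le_rfl hN (by omega) D hD, hI3 D hD]
    · simp only [Expr.eval_cell, Expr.eval_ofNat, Expr.eval_sub, hS.siz_eq, hτp] at he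
      refine Ok.of_wp ?_ (Nat.le_add_left 1 _)
      simp only [Prog.wp, ne_eq, Nat.reduceEqDiff, not_false_eq_true, Store.write_ne]
      refine ⟨fun j h1 h2 hsj f hf => hI1 j h1 ?_ hsj f hf, fun j h1 h2 h3 => hI2 j h1 h2 ?_, hI3⟩
      · by_contra h3
        exact hsj (by rw [show j = p by omega]; omega)
      · by_contra h4
        exact (hT.par_lt j h1 h2).2.1 (by rw [show par j = p by omega]; omega)
    · show 2 + 1 + 1 + 1 + 1 + _ ≤ _
      omega
  -- Every class is a child of one class only, so the numbers of children add up to at most `N`.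
  · have h1 : ∑ p ∈ Finset.Ico 1 N, ((Finset.Ico 1 N).filter fun c => par c = p).card ≤ N := by
      rw [Finset.sum_card_fiberwise_eq_card_filter]
      exact (Finset.card_filter_le _ _).trans (by simp)
    have h2 := Nat.mul_le_mul_left (600 * n + 1700 * nodeTime d k) h1
    show ∑ p ∈ Finset.Ico 1 N, (_ + 8 + 2 + 11) + (1 + 2 + 6) ≤ _
    simp only [Finset.sum_add_distrib, Finset.sum_const, Nat.card_Ico, smul_eq_mul,
      ← Finset.mul_sum]
    obtain ⟨M, rfl⟩ : ∃ M, N = M + 1 := ⟨N - 1, by omega⟩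
    rw [Nat.add_sub_cancel]
    nlinarith
  · rintro τ - - ⟨hI1, hI2, hI3⟩
    refine ⟨fun f hf => ?_, fun j h1 h2 D hD => ?_⟩
    -- Optimality travels upwards: induction from the last class to the first, since children have
    -- larger numbers than their parents.
    · have key : ∀ m j, N - j ≤ m → 1 ≤ j → j < N →
          Good d R n f (cs j) fun D => τ aSt (j * d + D) := by
        intro m
        induction m with
        | zero => intro j h1 _ h2; omega
        | succ m ih =>
          intro j h1 h2 h3
          by_cases hs : siz j = 1
          · exact hf j h2 h3 hs
          · refine hI1 j h2 h3 hs f fun c c1 c2 c3 => ih c ?_ c1 c2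
            have := (hT.par_lt c c1 c2).1
            omega
      rw [← hroot]
      exact (key N 1 (by omega) le_rfl hN).congr hI3
    · have := hI2 j h1 h2 ((hT.par_lt j h1 h2).1.trans h2) D hD
      omega

theorem outProg_ok (h : TreeStore n d W k N R rep par siz cs σ)
    (hb : ∀ j, 1 ≤ j → j < N → ∀ D < d, σ aSt (j * d + D) ≤ n) (hN : 1 < N) :
    Ok W outProg σ (N * (d * 50 + 40)) fun τ => ∀ j, 1 ≤ j → j < N → siz j = 1 → ∀ D < d,
      τ 3 (D * n + rep j) = σ aSt (j * d + D) := by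
  have hT := h.tree
  have hbig := h.big
  have hNW : N ≤ W := (Nat.le_mul_of_pos_right _ h.one_le).trans (by have := h.idx; omega)
  have hrepn : ∀ j, 1 ≤ j → j < N → rep j < n := fun j h1 h2 =>
    Finset.mem_range.1 ((hT.cls j h1 h2).1 (hT.cls j h1 h2).2.2.2.1)
  refine Ok.for_const 1 N (d * 50 + 20) (fun p τ => ∀ j, 1 ≤ j → j < p → siz j = 1 → ∀ D < d,
      τ 3 (D * n + rep j) = σ aSt (j * d + D)) rfl hN.le hNW (by decide) ?_ ?_ ?_ ?_ ?_
  · intro τ hτ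
    simp only [Expr.eval_cell, Expr.eval_ofNat, hτ xNc (by decide), h.num]
  · omega
  · rintro p τ h1p hpN hτp hτ hI
    have e1 : τ aSz = siz := by rw [hτ aSz (by decide), h.siz_eq]
    have hs1 := (hT.one_le_siz h1p hpN).1
    refine Ok.cond (fun he => ?_) (fun he => ?_) (T := d * 50 + 10) ?_
    · simp only [Expr.eval_cell, Expr.eval_ofNat, Expr.eval_sub, e1, hτp] at he
      refine Ok.of_wp ?_ (by show 1 ≤ _; omega)
      simp only [Prog.wp, ne_eq, Nat.reduceEqDiff, not_false_eq_true, Store.write_ne]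
      intro j h1 h2 hsj
      refine hI j h1 ?_ hsj
      by_contra h3
      rw [show j = p by omega] at hsj
      omega
    · simp only [Expr.eval_cell, Expr.eval_ofNat, Expr.eval_sub, e1, hτp] at he
      refine Ok.for_const 0 d 20 (fun D υ =>
        (∀ j, 1 ≤ j → j < p → siz j = 1 → ∀ D < d, υ 3 (D * n + rep j) = σ aSt (j * d + D)) ∧
        ∀ D' < D, υ 3 (D' * n + rep p) = σ aSt (p * d + D')) rfl (Nat.zero_le _) (by omega)
        (by decide) ?_ ?_ ?_ ?_ ?_
      · intro υ hυ
        simp only [Expr.eval_cell, Expr.eval_ofNat, hυ 0 (by decide), hτ 0 (by decide), h.dim]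
      · simp only [ne_eq, Nat.reduceEqDiff, not_false_eq_true, Store.write_ne]
        exact ⟨hI, by omega⟩
      · rintro D υ - hD hυD hυ ⟨hJ1, hJ2⟩
        have e0 : υ 0 = σ 0 := by rw [hυ 0 (by decide), hτ 0 (by decide)]
        have e2 : υ aRp = rep := by rw [hυ aRp (by decide), hτ aRp (by decide), h.rep_eq]
        have e3 : υ aSt = σ aSt := by rw [hυ aSt (by decide), hτ aSt (by decide)]
        have e4 : υ xCj 0 = p := by rw [hυ xCj (by decide), hτp]
        have h1 := hb p h1p hpN D hD
        have h2 := idx_lt hD (hrepn p h1p hpN)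
        refine Ok.of_wp ?_ (by decide)
        simp only [Prog.wp, vE, Expr.eval_cell, Expr.eval_ofNat, Expr.eval_add, Expr.eval_mul, e0,
          e2, e3, e4, hυD, h.n_eq, h.dim, ne_eq, Nat.reduceEqDiff, not_false_eq_true,
          Store.write_ne, Store.write_same]
        refine ⟨by omega, by omega, fun j j1 j2 j3 D' hD' => ?_, fun D' hD' => ?_⟩
        · rw [Function.update_of_ne, hJ1 j j1 j2 j3 D' hD']
          intro heq
          have := hT.leaf_inj j1 (by omega) h1p hpN j3 (by omega)
            (idx_inj (hrepn j j1 (by omega)) (hrepn p h1p hpN) heq).2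
          omega
        · by_cases hDD : D' = D
          · rw [hDD, Function.update_self]
          · rw [Function.update_of_ne, hJ2 D' (by omega)]
            exact fun heq => hDD (idx_inj (hrepn p h1p hpN) (hrepn p h1p hpN) heq).1
      · show (d - 0) * (20 + 2 + 11) + (1 + 2 + 6) ≤ _
        omega
      · rintro υ - - ⟨hJ1, hJ2⟩ j h1 h2 hsj
        rw [Store.write_ne _ _ _ (by decide)]
        rcases Nat.lt_succ_iff_lt_or_eq.1 h2 with h2 | rfl
        · exact hJ1 j h1 h2 hsj
        · exact hJ2
    · show 2 + 1 + 1 + 1 + 1 + _ ≤ _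
      omega
  · show (N - 1) * (d * 50 + 20 + 2 + 11) + (1 + 2 + 6) ≤ _
    obtain ⟨M, rfl⟩ : ∃ M, N = M + 1 := ⟨N - 1, by omega⟩
    rw [Nat.add_sub_cancel]
    nlinarith
  · rintro τ - - hI
    exact hI

end

/-- Computes an optimal drawing. -/
def mainProg : Prog := topoProg ;; closureProg ;; splitProg ;; classesProg ;; outProg

section
variable {n m d W k : ℕ} {R : ℕ → ℕ → Prop} {σ : Store}

/-- The same topological order is used in every dimension. Existence of some drawing is what rules
out penalties in an optimal quotient drawing. -/
theorem TopoList.exists_isDraw {f : ℕ → ℕ} (h : TopoList n R f) : ∃ g, IsDraw d R n g := by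
  choose! g hg using h.surj
  refine ⟨fun _ => g, fun D _ => ⟨fun x hx y hy hxy => ?_, fun x hx y hy hxy => ?_⟩⟩
  · rw [← (hg x hx).2, ← (hg y hy).2]
    exact congrArg f hxy
  · show g x < g y
    by_contra hlt
    refine h.sorted (g y) (g x) (by omega) (hg x hx).1 ?_
    rwa [(hg x hx).2, (hg y hy).2]

theorem mainProg_ok (hn : σ 0 0 = n) (hm : σ 0 1 = m) (hd : σ 0 2 = d)
    (hE : ∀ e < m, σ 1 e < n ∧ σ 2 e < n) (hR : R = Relation.TransGen (EdgeRel m (σ 1) (σ 2)))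
    (hac : ∀ x, ¬ R x x) (h0 : ∀ a, 3 ≤ a → ∀ i, σ a i = 0) (hn1 : 1 ≤ n) (hd1 : 1 ≤ d)
    (hk : 1 ≤ k) (hb : PartsBound n R k) (hmW : m ≤ W)
    (hW : n * n * (n * n + 1) + (2 * n + 2) * d + 4 * n + 20 ≤ W) :
    Ok W mainProg σ (n * (60 * n + 30 * m + 120) + 10 + (n * (60 * m + 60) + m * (60 * n + 60) + 10 +
      (1000 * (n * n) + 500 * n + 100 + ((2 * n + 1) * ((2 * n + 1) * 60 + 40) +
        (600 * n + 1700 * nodeTime d k) * (2 * n + 1) + (2 * n + 1) * (d * 50 + 40))))) fun τ =>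
      Good d R n (fun D x => τ 3 (D * n + x)) (Finset.range n) fun _ => 0 := by
  subst hR
  have hlt : ∀ x y, Relation.TransGen (EdgeRel m (σ 1) (σ 2)) x y → x < n ∧ y < n := by
    have h1 : ∀ x y, EdgeRel m (σ 1) (σ 2) x y → x < n ∧ y < n := by
      rintro x y ⟨e, he, rfl, rfl⟩
      exact hE e he
    intro x y h
    induction h with
    | single h => exact h1 _ _ h
    | tail _ h ih => exact ⟨ih.1, (h1 _ _ h).2⟩
  have hnn : n * n ≤ n * n * (n * n + 1) := Nat.le_mul_of_pos_right _ (by omega)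
  have hdn : (2 * n + 2) * d = 2 * (d * n) + 2 * d := by ring
  refine Ok.seq (topoProg_ok hn hm hE hac (h0 4 (by omega)) (by omega) hmW) ?_
  intro τ hτ hp
  have t1 : ∀ a ∈ [0, 1, 2, 7, 150], τ a = σ a := fun a ha =>
    hτ a ((by decide : ∀ a ∈ [0, 1, 2, 7, 150], a ∉ topoProg.writes) a ha)
  have t2 := t1 1 (by decide)
  have t3 := t1 2 (by decide)
  refine Ok.seq (closureProg_ok (by rw [t1 0 (by decide), hn]) (by rw [t1 0 (by decide), hm])
    (by rw [t2, t3]; exact hE) (by rw [t2, t3]; exact hp)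
    (by rw [t1 7 (by decide)]; exact h0 7 (by omega)) (by omega) hmW) ?_
  intro υ hυ hM
  rw [t2, t3] at hM
  have hM' : IsMatrix n (Relation.TransGen (EdgeRel m (σ 1) (σ 2))) (υ aMtx) := by
    intro x hx y hy
    rw [hM x hx y hy]
  refine Ok.seq (splitProg_ok (by rw [hυ 0 (by decide), t1 0 (by decide), hn]) hn1 hM'
    (fun x y h1 h2 => hac x (h1.trans h2)) hlt (by rw [hυ aPerm (by decide)]; exact hp)
    (by omega)) ?_
  rintro ω hω ⟨cs, hT⟩
  have hN := hT.count
  have hN1 := (hT.root hn1).1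
  have hNd : ω xNc 0 * d ≤ (2 * n + 1) * d := Nat.mul_le_mul_right _ hN
  have hNd' : (2 * n + 2) * d = (2 * n + 1) * d + d := by ring
  have e0 : ω 0 = σ 0 := by rw [hω 0 (by decide), hυ 0 (by decide), t1 0 (by decide)]
  have hS : TreeStore n d W k (ω xNc 0) (Relation.TransGen (EdgeRel m (σ 1) (σ 2))) (ω aRp) (ω aPa)
      (ω aSz) cs ω :=
    ⟨by rw [e0, hn], by rw [e0, hd], by rw [hω aMtx (by decide)]; exact hM', rfl, rfl, rfl, rfl, hT,
      hac, fun x y z => Relation.TransGen.trans, hd1, by nlinarith, by omega, by omega,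
      hp.exists_isDraw, hb⟩
  refine Ok.seq ((classesProg_ok hS (fun i => ?_) hn1 hk).time (Nat.add_le_add
    (Nat.mul_le_mul hN (Nat.add_le_add_right (Nat.mul_le_mul_right _ hN) _))
    (Nat.mul_le_mul_left _ hN))) ?_
  · rw [hω aSt (by decide), hυ aSt (by decide), t1 aSt (by decide)]
    exact h0 aSt (by omega) i
  rintro ρ hρ ⟨r1, r2⟩
  have hS' := hS.congr (τ := ρ) fun x hx => hρ x
    ((by decide : ∀ x ∈ [0, aMtx, xNc, aRp, aPa, aSz], x ∉ classesProg.writes) x hx)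
  refine (outProg_ok hS' r2 hN1).mono (Nat.mul_le_mul_right _ hN) ?_
  intro ξ _ hx
  refine r1 _ fun j h1 h2 h3 => ?_
  obtain ⟨_, _, c3, c4, _⟩ := hT.cls j h1 h2
  obtain ⟨x, hcs⟩ := Finset.card_eq_one.1 (c3.trans h3)
  rw [hcs, Finset.mem_singleton] at c4
  rw [hcs, ← c4]
  exact Good.leaf hd1 (hac _) fun D hD => hx j h1 h2 h3 D hD

/-! ### Translation between the vertices in `Fin n` and the numbers below n -/

theorem map_filter_val {S : Finset ℕ} (hS : S ⊆ Finset.range n) :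
    (Finset.univ.filter fun x : Fin n => (x : ℕ) ∈ S).map Fin.valEmbedding = S := by
  ext x
  simp only [Finset.mem_map, Finset.mem_filter, Finset.mem_univ, true_and]
  constructor
  · rintro ⟨y, hy, rfl⟩
    exact hy
  · exact fun hx => ⟨⟨x, Finset.mem_range.1 (hS hx)⟩, hx, rfl⟩

variable {G : Digraph (Fin n)}

theorem isModule_iff (hR : ∀ u v : Fin n, HasPath G u v ↔ R u v)
    (hlt : ∀ x y, R x y → x < n ∧ y < n) {M : Finset (Fin n)} :
    IsModule G M ↔ M.Nonempty ∧ IsMod R (M.map Fin.valEmbedding) := by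
  refine and_congr_right fun _ => ?_
  constructor
  · intro h u hu x hx y hy
    obtain ⟨x, hx', rfl⟩ := Finset.mem_map.1 hx
    obtain ⟨y, hy', rfl⟩ := Finset.mem_map.1 hy
    rw [rl_eq_iff]
    by_cases hun : u < n
    · have := h x hx' y hy' ⟨u, hun⟩ fun hu' => hu (Finset.mem_map.2 ⟨_, hu', rfl⟩)
      simp only [hR] at this
      exact ⟨this.2, this.1⟩
    · exact ⟨⟨fun h => absurd (hlt _ _ h).1 hun, fun h => absurd (hlt _ _ h).1 hun⟩,
        ⟨fun h => absurd (hlt _ _ h).2 hun, fun h => absurd (hlt _ _ h).2 hun⟩⟩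
  · intro h x hx y hy u hu
    have := rl_eq_iff.1 (h u (fun h => hu ((Finset.mem_map' Fin.valEmbedding).1 h)) x
      (Finset.mem_map_of_mem Fin.valEmbedding hx) y (Finset.mem_map_of_mem Fin.valEmbedding hy))
    rw [hR, hR, hR, hR]
    exact ⟨this.2, this.1⟩

/-- Numbers from `n` on are unrelated to everything, so modules of `R` below `n` and modules of the
graph correspond, and `card_le_treeDegree` can be transported. -/
theorem partsBound_treeDegree (hR : ∀ u v : Fin n, HasPath G u v ↔ R u v)
    (hlt : ∀ x y, R x y → x < n ∧ y < n) : PartsBound n R (treeDegree G) := by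
  classical
  intro M t C hM hMn ht hne hdis hsub H
  set F : Finset ℕ → Finset (Fin n) := fun S => Finset.univ.filter fun x : Fin n => (x : ℕ) ∈ S
  have hF : ∀ S : Finset ℕ, ∀ x, x ∈ F S ↔ (x : ℕ) ∈ S := fun S x => by simp [F]
  have hFm : ∀ S ⊆ Finset.range n, (F S).map Fin.valEmbedding = S := fun S => map_filter_val
  have hFne : ∀ S ⊆ Finset.range n, S.Nonempty → (F S).Nonempty := by
    rintro S hS ⟨x, hx⟩
    exact ⟨⟨x, Finset.mem_range.1 (hS hx)⟩, (hF _ _).2 hx⟩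
  have hMne : M.Nonempty := (hne 0 (by omega)).mono (hsub 0 (by omega))
  refine card_le_treeDegree (M := F M) ((isModule_iff hR hlt).2 ⟨hFne M hMn hMne, ?_⟩) ht
    (fun i => F (C i)) (fun i hi => hFne _ ((hsub i hi).trans hMn) (hne i hi))
    (fun i hi j hj hij => ?_) (fun i hi x hx => ?_) fun N hN hNM => ?_
  · rwa [hFm M hMn]
  · refine Finset.disjoint_left.2 fun x hx hx' => ?_
    exact Finset.disjoint_left.1 (hdis i hi j hj hij) ((hF _ _).1 hx) ((hF _ _).1 hx')
  · exact (hF _ _).2 (hsub i hi ((hF _ _).1 hx))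
  · obtain ⟨h1, h2⟩ := (isModule_iff hR hlt).1 hN.1
    have h3 := H (N.map Fin.valEmbedding) (by simpa using h1) h2 (fun L l1 l2 l3 => by
      have := hN.2 (F L) ((isModule_iff hR hlt).2 ⟨hFne L l3 l1, by rwa [hFm L l3]⟩)
      rw [← hFm L l3, Finset.map_subset_map, Finset.map_subset_map, Finset.disjoint_map]
      rcases this with h | h | h
      · exact Or.inr (Or.inl h)
      · exact Or.inl h
      · exact Or.inr (Or.inr h.symm)) (by
      rw [← hFm M hMn, Finset.map_subset_map]
      exact hNM)
    refine h3.imp (fun h4 => ?_) fun ⟨i, hi, h4⟩ =>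
      ⟨i, hi, fun x hx => (hF _ _).2 (h4 (Finset.mem_map_of_mem Fin.valEmbedding hx))⟩
    rwa [← hFm M hMn, Finset.map_inj] at h4

theorem crossFips_eq_ncard (hR : ∀ u v : Fin n, HasPath G u v ↔ R u v) {f : ℕ → ℕ → ℕ}
    {Γ : Fin d → Equiv.Perm (Fin n)} (hf : ∀ (D : Fin d) (v : Fin n), f D v = Γ D v) :
    crossFips d R f (Finset.range n) (Finset.range n) = (fips G Γ).ncard := by
  classical
  have hinj : Function.Injective (Prod.map (Fin.val (n := n)) (Fin.val (n := n))) :=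
    Fin.val_injective.prodMap Fin.val_injective
  rw [← Set.ncard_image_of_injective _ hinj, crossFips, ← Set.ncard_coe_finset]
  have hfip : ∀ u v : Fin n, Fip d R f u v ↔ (u, v) ∈ fips G Γ := by
    intro u v
    simp only [Fip, fips, Set.mem_ofPred_eq, hR, Fin.lt_def, ← hf]
    exact and_congr_left fun _ => ⟨fun h D => h D D.2, fun h D hD => h ⟨D, hD⟩⟩
  congr 1
  ext ⟨x, y⟩
  simp only [Finset.coe_filter, Finset.mem_product, Finset.mem_range, Set.mem_ofPred_eq,
    Set.mem_image, Prod.exists, Prod.map_apply, Prod.mk.injEq]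
  constructor
  · rintro ⟨⟨hx, hy⟩, h⟩
    exact ⟨⟨x, hx⟩, ⟨y, hy⟩, (hfip ⟨x, hx⟩ ⟨y, hy⟩).1 h, rfl, rfl⟩
  · rintro ⟨u, v, h, rfl, rfl⟩
    exact ⟨⟨u.2, v.2⟩, (hfip u v).2 h⟩

theorem Good.exists_isMinFipDrawing {f : ℕ → ℕ → ℕ} (hR : ∀ u v : Fin n, HasPath G u v ↔ R u v)
    (h : Good d R n f (Finset.range n) fun _ => 0) :
    ∃ Γ : Fin d → Equiv.Perm (Fin n), (∀ (D : Fin d) (v : Fin n), f D v = Γ D v) ∧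
      IsMinFipDrawing G Γ := by
  have hlt : ∀ (D : Fin d) (v : Fin n), f D v < n := fun D v => by
    have := (h.range D D.2 v (Finset.mem_range.2 v.2)).2
    simpa using this
  have hbij : ∀ D : Fin d, Function.Bijective fun v : Fin n => (⟨f D v, hlt D v⟩ : Fin n) := by
    intro D
    refine Finite.injective_iff_bijective.1 fun u v huv => Fin.ext ?_
    exact h.inj D D.2 u (Finset.mem_range.2 u.2) v (Finset.mem_range.2 v.2) (Fin.ext_iff.1 huv)
  refine ⟨fun D => Equiv.ofBijective _ (hbij D), fun D v => rfl, fun u v huv D => ?_,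
    fun Δ hΔ => ?_⟩
  · exact h.mono D D.2 u (Finset.mem_range.2 u.2) v (Finset.mem_range.2 v.2) ((hR u v).1 huv)
  -- A competitor among the permutations becomes a competitor among the coordinate functions; the
  -- default 0 lies outside the range that is ever inspected.
  · let g : ℕ → ℕ → ℕ := fun D x => if h : D < d ∧ x < n then Δ ⟨D, h.1⟩ ⟨x, h.2⟩ else 0
    have hg : ∀ (D : Fin d) (v : Fin n), g D v = Δ D v := fun D v => dif_pos ⟨D.2, v.2⟩
    rw [← crossFips_eq_ncard hR (f := f) fun D v => rfl, ← crossFips_eq_ncard hR hg]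
    refine h.min g fun D hD => ⟨fun x hx y hy hxy => ?_, fun x hx y hy hxy => ?_⟩
    · rw [hg ⟨D, hD⟩ ⟨x, hx⟩, hg ⟨D, hD⟩ ⟨y, hy⟩, Fin.val_inj, EmbeddingLike.apply_eq_iff_eq] at hxy
      exact Fin.ext_iff.1 hxy
    · rw [hg ⟨D, hD⟩ ⟨x, hx⟩, hg ⟨D, hD⟩ ⟨y, hy⟩, Fin.val_fin_lt]
      exact hΔ _ _ ((hR ⟨x, hx⟩ ⟨y, hy⟩).2 hxy) _

theorem transGen_edgeRel_iff {d : ℕ} {es : List (Fin n × Fin n)}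
    (hes : ∀ u v, (u, v) ∈ es ↔ G.Adj u v) :
    (∀ e < es.length, inputStore n d es 1 e < n ∧ inputStore n d es 2 e < n) ∧
    ∀ x y, Relation.TransGen (EdgeRel es.length (inputStore n d es 1) (inputStore n d es 2)) x y ↔
      ∃ u v : Fin n, (u : ℕ) = x ∧ (v : ℕ) = y ∧ HasPath G u v := by
  have h1 : ∀ e (he : e < es.length), inputStore n d es 1 e = (es[e].1 : ℕ) ∧
      inputStore n d es 2 e = (es[e].2 : ℕ) := by
    intro e he
    simp [inputStore, List.getElem?_eq_getElem he]
  refine ⟨fun e he => by rw [(h1 e he).1, (h1 e he).2]; exact ⟨es[e].1.2, es[e].2.2⟩, ?_⟩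
  have hE : ∀ x y, EdgeRel es.length (inputStore n d es 1) (inputStore n d es 2) x y ↔
      ∃ u v : Fin n, (u : ℕ) = x ∧ (v : ℕ) = y ∧ G.Adj u v := by
    intro x y
    constructor
    · rintro ⟨e, he, rfl, rfl⟩
      exact ⟨es[e].1, es[e].2, (h1 e he).1.symm, (h1 e he).2.symm,
        (hes _ _).1 (List.getElem_mem he)⟩
    · rintro ⟨u, v, rfl, rfl, h⟩
      obtain ⟨e, he, heq⟩ := List.mem_iff_getElem.1 ((hes u v).2 h)
      exact ⟨e, he, by rw [(h1 e he).1, heq], by rw [(h1 e he).2, heq]⟩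
  intro x y
  constructor
  · intro h
    induction h with
    | single h =>
      obtain ⟨u, v, hu, hv, h⟩ := (hE _ _).1 h
      exact ⟨u, v, hu, hv, .single h⟩
    | tail _ h ih =>
      obtain ⟨u, v, hu, hv, h1⟩ := ih
      obtain ⟨v', w, hv', hw, h2⟩ := (hE _ _).1 h
      obtain rfl := Fin.ext (hv.trans hv'.symm)
      exact ⟨u, w, hu, hw, h1.tail h2⟩
  · rintro ⟨u, v, rfl, rfl, h⟩
    exact Relation.TransGen.lift (Fin.val (n := n))
      (fun a b hab => (hE _ _).2 ⟨a, b, rfl, rfl, hab⟩) u v h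

end

/-! ### Final estimates for the word size and the running time -/

theorem PartsBound.mono {n k l : ℕ} {R : ℕ → ℕ → Prop} (h : PartsBound n R k) (hkl : k ≤ l) :
    PartsBound n R l := fun M t C h1 h2 h3 h4 h5 h6 h7 => (h M t C h1 h2 h3 h4 h5 h6 h7).trans hkl

theorem le_word {n d C : ℕ} (hC : 10 ≤ C) (hd : 1 ≤ d) (hn : 1 ≤ n) :
    n * n * (n * n + 1) + (2 * n + 2) * d + 4 * n + 20 ≤ (n + d + 2) ^ C := by
  refine le_trans ?_ (Nat.pow_le_pow_right (by omega) hC)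
  set X := n + d + 2 with hX
  have h1 : n * n ≤ X * X := Nat.mul_le_mul (by omega) (by omega)
  have h2 : n * n * (n * n + 1) ≤ X * X * (X * X + 1) := Nat.mul_le_mul h1 (by omega)
  have h3 : (2 * n + 2) * d ≤ (2 * X) * X := Nat.mul_le_mul (by omega) (by omega)
  have h4 : 4 * X ≤ X * X := Nat.mul_le_mul_right _ (by omega)
  have h5 : 16 * (X * X) ≤ X * X * (X * X) :=
    Nat.mul_le_mul_right _ (by nlinarith)
  have h6 : X ^ 10 = X * X * (X * X) * X ^ 6 := by ring
  have h7 : 4 ≤ X ^ 6 := (show 4 ≤ 4 ^ 6 by norm_num).trans (Nat.pow_le_pow_left (by omega) 6)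
  have h8 : X * X * (X * X) * 4 ≤ X * X * (X * X) * X ^ 6 := Nat.mul_le_mul_left _ h7
  nlinarith

/-- The only terms not bounded directly by `n * m` and `n * Y` are those of order n², and n ≤ m + k
≤ m + Y absorbs them. -/
theorem main_time {n m d k Y : ℕ} (hn : 2 ≤ n) (hY : k ≤ Y) (hdY : d ≤ Y) (hnm : n ≤ m + k) :
    3 + (n * (60 * n + 30 * m + 120) + 10 + (n * (60 * m + 60) + m * (60 * n + 60) + 10 +
      (1000 * (n * n) + 500 * n + 100 + ((2 * n + 1) * ((2 * n + 1) * 60 + 40) +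
        (600 * n + 1700 * Y) * (2 * n + 1) + (2 * n + 1) * (d * 50 + 40))))) ≤
      20000 * (n * m + n * Y) := by
  have h1 : n * n ≤ n * m + n * Y := by
    rw [← Nat.mul_add]
    exact Nat.mul_le_mul_left _ (by omega)
  have h2 : n ≤ n * n := Nat.le_mul_of_pos_left _ (by omega)
  have h3 : m ≤ n * m := Nat.le_mul_of_pos_left _ (by omega)
  have h4 : n * d ≤ n * Y := Nat.mul_le_mul_left _ hdY
  have h5 : Y ≤ n * Y := Nat.le_mul_of_pos_left _ (by omega)
  nlinarith

theorem length_le_of_nodup {n : ℕ} {es : List (Fin n × Fin n)} (h : es.Nodup) :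
    es.length ≤ n * n := by
  simpa using h.length_le_card

end WeakDominance

open WeakDominance
theorem theorem1 :
    ∃ (P : Prog) (C : ℕ), ∀ (d n : ℕ), 1 ≤ d →
      ∀ (G : Digraph (Fin n)), IsDAG G →
      ∀ es : List (Fin n × Fin n), es.Nodup → (∀ u v, (u, v) ∈ es ↔ G.Adj u v) →
      ∃ (σ : Store) (t : ℕ) (Γ : Fin d → Equiv.Perm (Fin n)),
        Exec ((n + d + 2) ^ C) P (inputStore n d es) σ t ∧
        (∀ (D : Fin d) (v : Fin n), σ 3 ((D : ℕ) * n + (v : ℕ)) = (Γ D v : ℕ)) ∧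
        IsMinFipDrawing G Γ ∧
        (2 ≤ n → t ≤ C * (n * es.length +
          n * d * treeDegree G ^ 2 * (treeDegree G).factorial ^ d)) := by
  refine ⟨.cond vN mainProg .skip, 20000, ?_⟩
  intro d n hd G hG es hnd hes
  -- One number serves as the time constant and as the exponent of the word size. It is made opaque
  -- so that the huge power is never evaluated.
  generalize hC : 20000 = C
  rcases Nat.eq_zero_or_pos n with rfl | hn
  · exact ⟨_, _, fun _ => 1, .cond_false rfl (.skip _), fun D v => v.elim0,
      ⟨fun u => u.elim0, fun Δ _ => by simp [fips, Set.eq_empty_of_isEmpty]⟩, by omega⟩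
  obtain ⟨hE, hRiff⟩ := transGen_edgeRel_iff (d := d) hes
  generalize hR : Relation.TransGen (EdgeRel es.length (inputStore n d es 1)
    (inputStore n d es 2)) = R at hRiff
  have hR' : ∀ u v : Fin n, HasPath G u v ↔ R u v := by
    intro u v
    rw [hRiff]
    constructor
    · exact fun h => ⟨u, v, rfl, rfl, h⟩
    · rintro ⟨u', v', hu, hv, h⟩
      rwa [← Fin.ext hu, ← Fin.ext hv]
  have hlt : ∀ x y, R x y → x < n ∧ y < n := by
    intro x y h
    obtain ⟨u, v, rfl, rfl, _⟩ := (hRiff x y).1 h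
    exact ⟨u.2, v.2⟩
  have hW := le_word (n := n) (d := d) (C := C) (by omega) hd hn
  have hm := length_le_of_nodup hnd
  have hnn : n * n ≤ n * n * (n * n + 1) := Nat.le_mul_of_pos_right _ (by omega)
  -- The maximum with 1 is needed for a single vertex, where no node has children and the degree is
  -- 0. From two vertices on it is the degree itself.
  obtain ⟨σ, t, hrun, ht, hgood⟩ := mainProg_ok (W := (n + d + 2) ^ C) (σ := inputStore n d es)
    (n := n) (m := es.length) (d := d) (k := max 1 (treeDegree G)) rfl rfl rfl hE hR.symm
    (fun x hx => by
      have := hlt x x hx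
      exact hG ⟨x, this.1⟩ ((hR' _ _).2 hx))
    (fun a ha i => by
      rw [inputStore, if_neg (by omega), if_neg (by omega), if_neg (by omega)])
    hn hd (le_max_left _ _) ((partsBound_treeDegree hR' hlt).mono (le_max_right _ _)) (by omega) hW
  obtain ⟨Γ, hΓ, hmin⟩ := hgood.exists_isMinFipDrawing hR'
  refine ⟨σ, _, Γ, .cond_true (show n ≠ 0 by omega) hrun, hΓ, hmin, fun hn2 => ?_⟩
  have hk2 := two_le_treeDegree G (by simpa using hn2)
  have hnk := card_le_length_add_treeDegree es (fun u v h => (hes u v).2 h) (by simpa using hn2)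
  rw [Fintype.card_fin] at hnk
  rw [max_eq_right (by omega)] at ht
  generalize treeDegree G = k at *
  have hfac : 1 ≤ k.factorial ^ d := Nat.pow_pos (Nat.factorial_pos k)
  have hk : 1 ≤ k ^ 2 := Nat.pow_pos (by omega)
  have h1 : d ≤ nodeTime d k := by
    rw [nodeTime, mul_assoc]
    exact Nat.le_mul_of_pos_right _ (Nat.mul_pos hk hfac)
  have h2 : k ≤ nodeTime d k :=
    calc k ≤ k ^ 2 := Nat.le_self_pow (by omega) k
      _ ≤ d * k ^ 2 := Nat.le_mul_of_pos_left _ hd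
      _ ≤ nodeTime d k := Nat.le_mul_of_pos_right _ hfac
  have h3 := main_time hn2 h2 h1 hnk
  have h4 : n * nodeTime d k = n * d * k ^ 2 * k.factorial ^ d := by rw [nodeTime]; ring
  have h5 : 2 + 1 + t ≤ C * (n * es.length + n * nodeTime d k) := by
    subst hC
    omega
  rw [← h4]
  exact h5
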